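/- **Setting.** Let $B$ be a $C^*$-algebra. *Partial automorphisms.* A partial automorphism of $B$ is a $*$-isomorphism $\theta:\mathrm{Dom}(\theta)\to\mathrm{Img}(\theta)$ between closed two-sided ideals; they form an inverse semigroup $\mathrm{PAut}(B)$ with $\theta^*=\theta^{-1}$, ordered by $\theta'\le\theta$ iff $\theta$ extends $\theta'$. Write $\rho\perp\sigma$ if $\rho\sigma^*\le\mathrm{Id}$ and $\rho^*\sigma\le\mathrm{Id}$, and $\theta\wedge\theta'$ for the largest partial automorphism extended by both. $[\,\cdot\,]$ denotes the closed linear span. *Bimodules.* A right $C^*$-$B$-$B$-bimodule is a full right Hilbert $C^*$-module $E$ over $B$ with a nondegenerate representation $B\to\mathcal L_B(E)$. Put $E_\theta=\{\xi\in[E\,\mathrm{Dom}(\theta)]:\xi b=\theta(b)\xi\ \ \forall b\in\mathrm{Dom}(\theta)\}$. $E$ is decomposable (resp. $\Theta$-decomposable) if the $E_\theta$ with $\theta\in\mathrm{PAut}(B)$ (resp. $\theta\in\Theta$) span a dense subspace. $B$ is regarded as such a bimodule with $\langle x|y\rangle=x^*y$. An inverse subsemigroup $\Theta\subseteq\mathrm{PAut}(B)$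 is admissible if $\mathrm{Id}_B\in\Theta$, $\Theta$ is closed under $\wedge$, and $B_\theta=[\bigcup_{\theta'\in\Theta,\theta'\le\theta}B_{\theta'}]$ for every $\theta\in\mathrm{PAut}(B)$. *Homogeneous operators and families.* $T:E\to F$ is $(\rho,\sigma)$-homogeneous, $T\in\mathscr L^\rho_\sigma(E,F)$, if $T(E)\subseteq[\mathrm{Img}(\rho)F]$, $Ta\xi=\rho(a)T\xi$ for $a\in\mathrm{Dom}(\rho)$, and there is a map $S=T^*:F\to E$ with $\langle S\eta|\xi\rangle\in\mathrm{Dom}(\sigma)$ and $\langle\eta|T\xi\rangle=\sigma(\langle S\eta|\xi\rangle)$. For families $\mathscr C=(\mathscr C^\rho_\sigma)_{\rho,\sigma\in \mathrm{PAut}(B)}$ of closed subspaces $\mathscr C^\rho_\sigma\subseteq\mathscr L^\rho_\sigma$ put $(\mathscr C^*)^\rho_\sigma=(\mathscr C^{\rho^*}_{\sigma^*})^*$ and $[\mathscr D\mathscr C]^{\rho''}_{\sigma''}=[\{T'T: T'\in\mathscr D^{\rho'}_{\sigma'},T\in\mathscr C^\rho_\sigma,\rho'\rho\le\rho'',\sigma'\sigma\le\sigma''\}]$;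 products with a single operator $T\in\mathscr L^\rho_\sigma$ are defined likewise. A $C^*$-family on $E$ is a family $\mathscr C\subseteq\mathscr L(E)$ with $[\mathscr C^*\mathscr C]=\mathscr C$; it is nondegenerate if $[\mathscr CE]=E$; and $\mathscr M(\mathscr C)^\rho_\sigma=\{T\in\mathscr L^\rho_\sigma(E):[T\mathscr C],[\mathscr CT]\subseteq\mathscr C\}$. Let $\mathscr O(E)^\rho_\sigma$ be the closed span of the operators $\xi\mapsto b\xi c$, $b\in B_\rho$, $c\in B_{\sigma^*}$. Let $l(E)$ and $r(E)$ be the families of operators from $B$ to $E$ with $l(E)^\theta_{\mathrm{Id}}=\{b\mapsto\xi b:\xi\in E_\theta\}$, $r(E)^{\mathrm{Id}}_\theta=\{b\mapsto b\xi:\xi\in E_{\theta^*}\}$ and all other components $0$. *Admissibility.* Let $\Theta$ be admissible. $E$ is $\Theta$-admissible if it is $\Theta$-decomposable, $[l(E)^*l(E)]=l(B)$ and $[r(E)^*r(E)]=r(B)$. A $C^*$-family $\mathscr C$ on $E$ is $\Theta$-admissible if $E$ is $\Theta$-admissible, $\mathscr C$ is nondegenerate, $\mathscr C^\rho_\sigma=[\bigcup\{\mathscr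 C^{\rho'}_{\sigma'}:\rho',\sigma'\in\Theta,\rho'\le\rho,\sigma'\le\sigma\}]$ for all $\rho,\sigma\in\mathrm{PAut}(B)$, $[\mathscr C\mathscr O(E)]\subseteq\mathscr C$, and $[\mathscr C^\rho_\sigma\mathscr O(E)^{\rho^*\rho}_{\sigma^*\sigma}]=\mathscr C^\rho_\sigma$ for $\rho,\sigma\in\Theta$. *Unit and product.* $\mathscr K(B;\Theta)^{\rho'}_{\sigma'}$ is the closed span of the operators $b\mapsto\theta(abcd)$ on $B$ with $\rho,\sigma,\theta\in\Theta$, $\theta\rho\le\rho'$, $\theta\sigma\le\sigma'$, $a\in B_\rho$, $c\in B_{\sigma^*}$, $d\in B_{\theta^*\theta}$. For $\mathscr C$ on $E$ and $\mathscr D$ on $F$, the fiber product $\mathscr C\otimes\mathscr D$ is the family on the internal tensor product $E\otimes F$ (over $B$) with $(\mathscr C\otimes\mathscr D)^\rho_\sigma=[\{c\otimes d:c\in\mathscr C^\rho_{\sigma'},d\in\mathscr D^{\rho'}_\sigma,\sigma'\perp\rho'\}]$, where $(c\otimes d)(\xi\otimes\eta)=c\xi\otimes d\eta$. *Morphisms.*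 A normal morphism $\phi:\mathscr C\to\mathscr D$ is a family of maps $\phi^\rho_\sigma:\mathscr C^\rho_\sigma\to\mathscr D^\rho_\sigma$ such that $[I_\phi E]=F$, where $I_\phi$ is the set of adjointable $B$-bimodule maps $T:E\to F$ with $Tc=\phi^\rho_\sigma(c)T$ and $cT^*=T^*\phi^\rho_\sigma(c)$ for all $\rho,\sigma$ and $c\in\mathscr C^\rho_\sigma$. The objects of $(B,\Theta)\text{-}C^*\text{-family}$ are the $\Theta$-admissible $C^*$-families; the morphisms from $\mathscr C$ to $\mathscr D$ are the normal morphisms $\phi:\mathscr C\to\mathscr M(\mathscr D)$ with $[\phi(\mathscr C)\mathscr D]=\mathscr D$. The identity of $\mathscr C$ is the inclusion $\mathscr C\subseteq\mathscr M(\mathscr C)$, and $\psi\circ\phi$ is the composite of $\phi$ with the extension of $\psi$ to a normal morphism $\mathscr M(\mathscr D)\to\mathscr M(\mathscr G)$. **Theorem.** Let $B$ be a $C^*$-algebra which is decomposable as a right $C^*$-$B$-$B$-bimodule, and let $\Theta\subseteq\mathrm{PAut}(B)$ be an admissible inverse semigroup. Then $(B,\Theta)\text{-}C^*\text{-family}$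 is a category, and it carries the structure of a monoidal category, where $\mathscr K(B;\Theta)$ is the unit and for all $\Theta$-admissible $C^*$-families $\mathscr A,\mathscr C,\mathscr D$ on $E,F,G$ and all morphisms $\phi,\psi$: * the product of $\mathscr C$ and $\mathscr D$ is the fiber product $\mathscr C\otimes\mathscr D$, and the product of $\phi$ and $\psi$ is the morphism $\phi\otimes\psi$ with $(\phi\otimes\psi)^\rho_\sigma(a\otimes c)=\phi^\rho_{\sigma'}(a)\otimes\psi^{\rho'}_\sigma(c)$ for $a$ of degree $(\rho,\sigma')$, $c$ of degree $(\rho',\sigma)$, $\sigma'\perp\rho'$; * the isomorphisms $(\mathscr A\otimes\mathscr C)\otimes\mathscr D\to\mathscr A\otimes(\mathscr C\otimes\mathscr D)$, $\mathscr K(B;\Theta)\otimes\mathscr A\to\mathscr A$ and $\mathscr A\otimes\mathscr K(B;\Theta)\to\mathscr A$ are given by conjugation with the unitary bimodule isomorphisms $(E\otimes F)\otimes G\to E\otimes(F\otimes G)$, $(\xi\otimes\eta)\otimes\zeta\mapsto\xi\otimes(\eta\otimes\zeta)$; $B\otimes E\to E$, $b\otimes\xi\mapsto b\xi$; and $E\otimes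 B\to E$, $\xi\otimes b\mapsto\xi b$. -/

import Mathlib

open CategoryTheory
open scoped SetRel

universe u

noncomputable section

namespace CStarFamily

/-! ### Closed linear spans and partial automorphisms -/

/-- The closed linear span `[S]` of a subset of a normed space. -/
def clspan {V : Type*} [NormedAddCommGroup V] [NormedSpace ℂ V] (S : Set V) : Set V :=
  closure (Submodule.span ℂ S : Set V)

/-- Closed two-sided ideals of a `C⋆`-algebra. -/
structure IsClosedIdeal {B : Type u} [NonUnitalCStarAlgebra B] (I : Set B) : Prop where
  zero_mem : 0 ∈ I
  add_mem : ∀ {a b}, a ∈ I → b ∈ I → a + b ∈ I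
  smul_mem : ∀ (z : ℂ) {a}, a ∈ I → z • a ∈ I
  mul_mem_left : ∀ (b : B) {a}, a ∈ I → b * a ∈ I
  mul_mem_right : ∀ (b : B) {a}, a ∈ I → a * b ∈ I
  isClosed : IsClosed I

/-- A partial automorphism of a `C⋆`-algebra `B`: a `*`-isomorphism `θ : Dom θ → Img θ` between
closed two-sided ideals of `B`, given by its graph, so that `(b, c) ∈ θ.graph` means
`b ∈ Dom θ` and `θ b = c`. -/
@[ext]
structure PAut (B : Type u) [NonUnitalCStarAlgebra B] where
  graph : SetRel B B
  dom_ideal : IsClosedIdeal {b | ∃ c, (b, c) ∈ graph}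
  img_ideal : IsClosedIdeal {c | ∃ b, (b, c) ∈ graph}
  map_unique : ∀ {b c c'}, (b, c) ∈ graph → (b, c') ∈ graph → c = c'
  map_injective : ∀ {b b' c}, (b, c) ∈ graph → (b', c) ∈ graph → b = b'
  map_add : ∀ {b b' c c'}, (b, c) ∈ graph → (b', c') ∈ graph → (b + b', c + c') ∈ graph
  map_smul : ∀ (z : ℂ) {b c}, (b, c) ∈ graph → (z • b, z • c) ∈ graph
  map_mul : ∀ {b b' c c'}, (b, c) ∈ graph → (b', c') ∈ graph → (b * b', c * c') ∈ graph
  map_star : ∀ {b c}, (b, c) ∈ graph → (star b, star c) ∈ graph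

namespace PAut

variable {B : Type u} [NonUnitalCStarAlgebra B]

/-- The domain of a partial automorphism. -/
def dom (θ : PAut B) : Set B := {b | ∃ c, (b, c) ∈ θ.graph}

/-- The image of a partial automorphism. -/
def img (θ : PAut B) : Set B := {c | ∃ b, (b, c) ∈ θ.graph}

/-- `θ ≤ θ'` means that `θ'` extends `θ`. -/
instance : PartialOrder (PAut B) :=
  PartialOrder.lift (fun θ => (θ.graph : Set (B × B))) fun _ _ h => PAut.ext h

/-- The inverse `θ⋆` of `θ`. -/
def inv (θ : PAut B) : PAut B where
  graph := {p | (p.2, p.1) ∈ θ.graph}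
  dom_ideal := θ.img_ideal
  img_ideal := θ.dom_ideal
  map_unique := fun h h' => θ.map_injective h h'
  map_injective := fun h h' => θ.map_unique h h'
  map_add := fun h h' => θ.map_add h h'
  map_smul := fun z _ _ h => θ.map_smul z h
  map_mul := fun h h' => θ.map_mul h h'
  map_star := fun h => θ.map_star h

/-- The identity map of a closed ideal. -/
def idOn (I : Set B) (hI : IsClosedIdeal I) (hstar : ∀ {b}, b ∈ I → star b ∈ I) : PAut B where
  graph := {p | p.1 ∈ I ∧ p.2 = p.1}
  dom_ideal := by simpa using hI
  img_ideal := by simpa using hI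
  map_unique := by
    rintro b c c' ⟨_, h⟩ ⟨_, h'⟩
    exact h.trans h'.symm
  map_injective := by
    rintro b c c' ⟨_, h⟩ ⟨_, h'⟩
    exact h.symm.trans h'
  map_add := by
    rintro b b' c c' ⟨h, h₁⟩ ⟨h', h₂⟩
    exact ⟨hI.add_mem h h', congrArg₂ (· + ·) h₁ h₂⟩
  map_smul := by
    rintro z b c ⟨h, h₁⟩
    exact ⟨hI.smul_mem z h, congrArg (z • ·) h₁⟩
  map_mul := by
    rintro b b' c c' ⟨h, h₁⟩ ⟨h', h₂⟩
    exact ⟨hI.mul_mem_left _ h', congrArg₂ (· * ·) h₁ h₂⟩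
  map_star := by
    rintro b c ⟨h, h₁⟩
    exact ⟨hstar h, congrArg star h₁⟩

/-- The identity `Id` of `B`. -/
def id (B : Type u) [NonUnitalCStarAlgebra B] : PAut B :=
  idOn Set.univ ⟨trivial, fun _ _ => trivial, fun _ _ _ => trivial, fun _ _ _ => trivial,
    fun _ _ _ => trivial, isClosed_univ⟩ fun _ => trivial

/-- The composition `θ⋆θ`, that is, the identity of `Dom θ`. -/
def source (θ : PAut B) : PAut B :=
  idOn θ.dom θ.dom_ideal fun ⟨c, hc⟩ => ⟨star c, θ.map_star hc⟩

/-- The graph of the composition `σθ` (first `θ`, then `σ`) of partial automorphisms. -/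
def comp (σ θ : PAut B) : SetRel B B := θ.graph ○ σ.graph

/-- `σθ ≤ τ`: the partial automorphism `τ` extends the composition `σθ`. -/
def CompLE (σ θ τ : PAut B) : Prop := σ.comp θ ⊆ τ.graph

/-- Compatibility `ρ ⊥ σ`: both `ρσ⋆` and `ρ⋆σ` are restrictions of the identity. -/
def Compatible (ρ σ : PAut B) : Prop := CompLE ρ σ.inv (id B) ∧ CompLE ρ.inv σ (id B)

end PAut

/-! ### Right `C⋆`-bimodules -/

/-- A right `C⋆`-`B`-`B`-bimodule: a full (right) Hilbert `C⋆`-module over `B`, complete in the norm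
`‖⟨x|x⟩‖^(1/2)`, with a nondegenerate representation of `B` by adjointable operators.  The inner
product is linear in the second variable; its positivity is expressed by `⟨x|x⟩ = b⋆b`.  The axioms
not listed (conjugate linearity of the inner product in the first variable, associativity and
bilinearity of the right action, linearity of `x ↦ b x` and `(b x) c = b (x c)`) follow by pairing
with arbitrary elements. -/
structure Bimod (B : Type u) [NonUnitalCStarAlgebra B] where
  carrier : Type u
  [normed : NormedAddCommGroup carrier]
  [space : NormedSpace ℂ carrier]
  [complete : CompleteSpace carrier]
  ip : carrier → carrier → B
  rsmul : carrier → B → carrier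
  lsmul : B → carrier → carrier
  ip_add_right : ∀ x y z, ip x (y + z) = ip x y + ip x z
  ip_smul_right : ∀ (w : ℂ) x y, ip x (w • y) = w • ip x y
  star_ip : ∀ x y, star (ip x y) = ip y x
  ip_self_pos : ∀ x, ∃ b, ip x x = star b * b
  norm_sq : ∀ x, ‖x‖ ^ 2 = ‖ip x x‖
  ip_rsmul : ∀ x y b, ip x (rsmul y b) = ip x y * b
  full : clspan {b | ∃ x y, b = ip x y} = Set.univ
  lsmul_add : ∀ b c x, lsmul (b + c) x = lsmul b x + lsmul c x
  lsmul_smul : ∀ (w : ℂ) b x, lsmul (w • b) x = w • lsmul b x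
  lsmul_mul : ∀ b c x, lsmul (b * c) x = lsmul b (lsmul c x)
  ip_lsmul : ∀ b x y, ip x (lsmul b y) = ip (lsmul (star b) x) y
  nondegenerate : clspan {x | ∃ b y, x = lsmul b y} = Set.univ

attribute [instance] Bimod.normed Bimod.space Bimod.complete

instance {B : Type u} [NonUnitalCStarAlgebra B] : CoeSort (Bimod B) (Type u) := ⟨Bimod.carrier⟩

section Bimodules

variable {B : Type u} [NonUnitalCStarAlgebra B]

lemma clspan_mul_eq_univ :
    clspan {b : B | ∃ x y, b = x * y} = Set.univ := by
  let _ := CStarAlgebra.spectralOrder B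
  have := CStarAlgebra.spectralOrderedRing B
  refine Set.eq_univ_of_forall fun b => ?_
  have h := (CStarAlgebra.increasingApproximateUnit B)
  have := h.neBot
  refine mem_closure_of_tendsto (h.tendsto_mul_left b) (Filter.Eventually.of_forall fun e => ?_)
  exact Submodule.subset_span ⟨_, _, rfl⟩

variable (B) in
/-- The `C⋆`-algebra `B` as a right `C⋆`-`B`-`B`-bimodule, with `⟨x|y⟩ = x⋆y`. -/
abbrev Bimod.self : Bimod B where
  carrier := B
  ip x y := star x * y
  rsmul x b := x * b
  lsmul b x := b * x
  ip_add_right x y z := mul_add _ _ _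
  ip_smul_right w x y := mul_smul_comm _ _ _
  star_ip x y := by simp
  ip_self_pos x := ⟨x, rfl⟩
  norm_sq x := by rw [CStarRing.norm_star_mul_self, sq]
  ip_rsmul x y b := (mul_assoc _ _ _).symm
  full := by
    rw [← clspan_mul_eq_univ (B := B)]
    congr 1
    ext b
    exact ⟨fun ⟨x, y, h⟩ => ⟨star x, y, h⟩, fun ⟨x, y, h⟩ => ⟨star x, y, by simpa using h⟩⟩
  lsmul_add b c x := add_mul _ _ _
  lsmul_smul w b x := smul_mul_assoc _ _ _
  lsmul_mul b c x := mul_assoc _ _ _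
  ip_lsmul b x y := by simp [mul_assoc]
  nondegenerate := clspan_mul_eq_univ

/-- The space of `θ`-homogeneous elements: `ξ ∈ E Dom(θ)` and `ξ b = θ(b) ξ` for `b ∈ Dom θ`. -/
def hmg (E : Bimod B) (θ : PAut B) : Set E :=
  {ξ | ξ ∈ clspan {x : E | ∃ y, ∃ b ∈ θ.dom, x = E.rsmul y b} ∧
    ∀ b c, (b, c) ∈ θ.graph → E.rsmul ξ b = E.lsmul c ξ}

/-- The homogeneous elements are linearly dense. -/
def Decomposable (E : Bimod B) : Prop :=
  clspan {ξ : E | ∃ θ, ξ ∈ hmg E θ} = Set.univ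

/-- The elements that are homogeneous of some degree in `Θ` are linearly dense. -/
def DecomposableIn (Θ : Set (PAut B)) (E : Bimod B) : Prop :=
  clspan {ξ : E | ∃ θ ∈ Θ, ξ ∈ hmg E θ} = Set.univ

/-- Every space of homogeneous elements is determined by the degrees in `Θ`. -/
def SupportedIn (Θ : Set (PAut B)) (E : Bimod B) : Prop :=
  ∀ θ, hmg E θ = clspan {ξ : E | ∃ θ' ∈ Θ, θ' ≤ θ ∧ ξ ∈ hmg E θ'}

/-- Admissible inverse semigroups `Θ ⊆ PAut(B)`. -/
structure AdmissibleSemigroup (Θ : Set (PAut B)) : Prop where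
  comp_mem : ∀ σ ∈ Θ, ∀ θ ∈ Θ, ∃ τ ∈ Θ, τ.graph = σ.comp θ
  inv_mem : ∀ θ ∈ Θ, θ.inv ∈ Θ
  id_mem : PAut.id B ∈ Θ
  meet_mem : ∀ θ ∈ Θ, ∀ θ' ∈ Θ, ∃ τ ∈ Θ, IsGLB {θ, θ'} τ
  supported : SupportedIn Θ (Bimod.self B)

/-! ### Homogeneous operators and families of them -/

/-- `S` is the adjoint of `T` relative to `σ`: `⟨Sη|ξ⟩ ∈ Dom σ` and `⟨η|Tξ⟩ = σ(⟨Sη|ξ⟩)`. -/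
def IsAdjoint {E F : Bimod B} (σ : PAut B) (T : E → F) (S : F → E) : Prop :=
  ∀ ξ η, (E.ip (S η) ξ, F.ip η (T ξ)) ∈ σ.graph

/-- `(ρ, σ)`-homogeneous operators.  (Such maps are automatically linear and bounded.) -/
structure IsHomogeneous {E F : Bimod B} (ρ σ : PAut B) (T : E →L[ℂ] F) : Prop where
  img : ∀ ξ, T ξ ∈ clspan {y : F | ∃ c ∈ ρ.img, ∃ η, y = F.lsmul c η}
  map_lsmul : ∀ a a', (a, a') ∈ ρ.graph → ∀ ξ, T (E.lsmul a ξ) = F.lsmul a' (T ξ)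
  adjointable : ∃ S : F → E, IsAdjoint σ T S

/-- Families `(𝒞^ρ_σ)` of sets of operators from `E` to `F`, ordered by inclusion.  The first
argument is the upper index `ρ`, the second the lower index `σ`. -/
abbrev Fam (E F : Bimod B) := PAut B → PAut B → Set (E →L[ℂ] F)

namespace Fam

variable {E F G : Bimod B}

/-- The family `𝒞⋆` with `(𝒞⋆)^ρ_σ = (𝒞^{ρ⋆}_{σ⋆})⋆`. -/
def adj (C : Fam E F) : Fam F E := fun ρ σ =>
  {S | ∃ T ∈ C ρ.inv σ.inv, IsAdjoint σ.inv T S}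

/-- The product family `[𝒟𝒞]`. -/
def prod (D : Fam F G) (C : Fam E F) : Fam E G := fun ρ'' σ'' =>
  clspan {R | ∃ ρ' ρ σ' σ, PAut.CompLE ρ' ρ ρ'' ∧ PAut.CompLE σ' σ σ'' ∧
    ∃ T' ∈ D ρ' σ', ∃ T ∈ C ρ σ, R = T' ∘L T}

/-- The family that consists of the single operator `T` in degree `(ρ, σ)`. -/
def single (ρ σ : PAut B) (T : E →L[ℂ] F) : Fam E F := fun ρ' σ' =>
  {R | ρ' = ρ ∧ σ' = σ ∧ R = T}

/-- The family is contained in the family of all homogeneous operators. -/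
def Homogeneous (C : Fam E F) : Prop := ∀ ρ σ, ∀ T ∈ C ρ σ, IsHomogeneous ρ σ T

/-- `[𝒞E] = F`. -/
def Nondegenerate (C : Fam E F) : Prop :=
  clspan {y : F | ∃ ρ σ, ∃ T ∈ C ρ σ, ∃ ξ, y = T ξ} = Set.univ

/-- `𝒞` is `Θ`-supported. -/
def Supported (Θ : Set (PAut B)) (C : Fam E F) : Prop :=
  ∀ ρ σ, C ρ σ = clspan {T | ∃ ρ' ∈ Θ, ∃ σ' ∈ Θ, ρ' ≤ ρ ∧ σ' ≤ σ ∧ T ∈ C ρ' σ'}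

/-- `C⋆`-families.  (The components are closed subspaces, since those of a product family are.) -/
def IsCStarFamily (C : Fam E E) : Prop := C.Homogeneous ∧ prod (adj C) C = C

/-- The multiplier family `ℳ(𝒞)`. -/
def multiplier (C : Fam E E) : Fam E E := fun ρ σ =>
  {T | IsHomogeneous ρ σ T ∧ prod (single ρ σ T) C ≤ C ∧ prod C (single ρ σ T) ≤ C}

end Fam

/-- The family `𝒪(E)`, spanned by the operators `ξ ↦ b ξ c` with homogeneous `b, c ∈ B`. -/
def opFam (E : Bimod B) : Fam E E := fun ρ σ =>
  clspan {R | ∃ b ∈ hmg (Bimod.self B) ρ, ∃ c ∈ hmg (Bimod.self B) σ.inv,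
    ∀ ξ, R ξ = E.lsmul b (E.rsmul ξ c)}

/-- The family of the operators `l(ξ) : b ↦ ξ b`, in degree `(θ, Id)` for `ξ` of degree `θ`. -/
def lFam (E : Bimod B) : Fam (Bimod.self B) E := fun ρ σ =>
  clspan {R | σ = PAut.id B ∧ ∃ ξ ∈ hmg E ρ, ∀ b : B, R b = E.rsmul ξ b}

/-- The family of the operators `r(ξ) : b ↦ b ξ`, in degree `(Id, θ⋆)` for `ξ` of degree `θ`. -/
def rFam (E : Bimod B) : Fam (Bimod.self B) E := fun ρ σ =>
  clspan {R | ρ = PAut.id B ∧ ∃ ξ ∈ hmg E σ.inv, ∀ b : B, R b = E.lsmul b ξ}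

/-- `Θ`-admissible right `C⋆`-`B`-`B`-bimodules. -/
structure AdmissibleBimod (Θ : Set (PAut B)) (E : Bimod B) : Prop where
  decomposable : DecomposableIn Θ E
  l_full : Fam.prod (lFam E).adj (lFam E) = lFam (Bimod.self B)
  r_full : Fam.prod (rFam E).adj (rFam E) = rFam (Bimod.self B)

/-- `Θ`-admissible `C⋆`-families. -/
structure AdmissibleFam (Θ : Set (PAut B)) {E : Bimod B} (C : Fam E E) : Prop where
  bimod : AdmissibleBimod Θ E
  isCStarFamily : C.IsCStarFamily
  nondegenerate : C.Nondegenerate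
  supported : C.Supported Θ
  prod_opFam_le : C.prod (opFam E) ≤ C
  mul_opFam : ∀ ρ ∈ Θ, ∀ σ ∈ Θ,
    clspan {R | ∃ T ∈ C ρ σ, ∃ S ∈ opFam E ρ.source σ.source, R = T ∘L S} = C ρ σ

/-- The family `𝒦(B;Θ)` on `B`, spanned by the operators `b ↦ θ(abcd)`. -/
def unitFam (Θ : Set (PAut B)) : Fam (Bimod.self B) (Bimod.self B) := fun ρ' σ' =>
  clspan {k | ∃ ρ ∈ Θ, ∃ σ ∈ Θ, ∃ θ ∈ Θ, PAut.CompLE θ ρ ρ' ∧ PAut.CompLE θ σ σ' ∧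
    ∃ a ∈ hmg (Bimod.self B) ρ, ∃ c ∈ hmg (Bimod.self B) σ.inv,
    ∃ d ∈ hmg (Bimod.self B) θ.source, ∀ b : B, (a * b * c * d, k b) ∈ θ.graph}

/-! ### The internal tensor product and the fiber product -/

/-- An internal tensor product `E ⊗ F` of right `C⋆`-`B`-`B`-bimodules, which is unique up to a
unique unitary that is compatible with the elementary tensors.  (Biadditivity of `tmul` and
`ξb ⊗ η = ξ ⊗ bη` follow from the formula for the inner product.) -/
structure InternalTensor (E F : Bimod B) where
  obj : Bimod B
  tmul : E → F → obj
  ip_tmul : ∀ ξ η ξ' η', obj.ip (tmul ξ η) (tmul ξ' η') = F.ip η (F.lsmul (E.ip ξ ξ') η')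
  rsmul_tmul : ∀ ξ η b, obj.rsmul (tmul ξ η) b = tmul ξ (F.rsmul η b)
  lsmul_tmul : ∀ ξ η b, obj.lsmul b (tmul ξ η) = tmul (E.lsmul b ξ) η
  dense : clspan {x | ∃ ξ η, x = tmul ξ η} = Set.univ

/-- `R = S ⊗ T`. -/
def InternalTensor.IsTensorOp {E F : Bimod B} (t : InternalTensor E F)
    (S : E →L[ℂ] E) (T : F →L[ℂ] F) (R : t.obj →L[ℂ] t.obj) : Prop :=
  ∀ ξ η, R (t.tmul ξ η) = t.tmul (S ξ) (T η)

/-- The fiber product `𝒞 ⊗ 𝒟`. -/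
def fiberProd {E F : Bimod B} (t : InternalTensor E F) (C : Fam E E) (D : Fam F F) :
    Fam t.obj t.obj := fun ρ σ =>
  clspan {R | ∃ σ' ρ', PAut.Compatible σ' ρ' ∧ ∃ c ∈ C ρ σ', ∃ d ∈ D ρ' σ, t.IsTensorOp c d R}

/-- A unitary isomorphism of right `C⋆`-`B`-`B`-bimodules. -/
structure BimodUnitary (E F : Bimod B) where
  equiv : E ≃L[ℂ] F
  ip_map : ∀ x y, F.ip (equiv x) (equiv y) = E.ip x y
  map_lsmul : ∀ b x, equiv (E.lsmul b x) = F.lsmul b (equiv x)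

/-! ### Normal morphisms -/

/-- The adjointable bimodule maps `T : E → F` with `T c = φ(c) T` and `c T⋆ = T⋆ φ(c)`
for all `c` in the family `𝒞`. -/
def intertwiners {E F : Bimod B} {C : Fam E E} {D : Fam F F}
    (φ : ∀ ρ σ, C ρ σ → D ρ σ) : Set (E →L[ℂ] F) :=
  {T | (∀ b ξ, T (E.lsmul b ξ) = F.lsmul b (T ξ)) ∧
    ∃ S : F →L[ℂ] E, (∀ ξ η, E.ip (S η) ξ = F.ip η (T ξ)) ∧
      ∀ ρ σ (c : C ρ σ), T ∘L c.1 = (φ ρ σ c).1 ∘L T ∧ c.1 ∘L S = S ∘L (φ ρ σ c).1}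

/-- Normal morphisms from `𝒞` to `𝒟`. -/
@[ext]
structure NormalMor {E F : Bimod B} (C : Fam E E) (D : Fam F F) where
  map : ∀ ρ σ, C ρ σ → D ρ σ
  dense : clspan {y : F | ∃ T ∈ intertwiners map, ∃ ξ, y = T ξ} = Set.univ

/-- The family `φ(𝒞)`. -/
def NormalMor.range {E F : Bimod B} {C : Fam E E} {D : Fam F F} (φ : NormalMor C D) : Fam F F :=
  fun ρ σ => clspan {R | ∃ c : C ρ σ, R = (φ.map ρ σ c).1}

/-- The objects of the category: `Θ`-admissible `C⋆`-families on right `C⋆`-`B`-`B`-bimodules. -/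
structure AdmFam (Θ : Set (PAut B)) where
  E : Bimod B
  fam : Fam E E
  admissible : AdmissibleFam Θ fam

/-- The morphisms of the category from `𝒞` to `𝒟`: normal morphisms from `𝒞` to `ℳ(𝒟)` that are
nondegenerate, `[φ(𝒞)𝒟] = 𝒟`. -/
@[ext]
structure Mor {Θ : Set (PAut B)} (C D : AdmFam Θ) extends NormalMor C.fam D.fam.multiplier where
  nondegenerate : toNormalMor.range.prod D.fam = D.fam

namespace Mor

variable {Θ : Set (PAut B)}

/-- `φ` is the inclusion of `𝒞` into `ℳ(𝒞)`. -/
def IsId {C : AdmFam Θ} (φ : Mor C C) : Prop :=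
  ∀ ρ σ (c : C.fam ρ σ), (φ.map ρ σ c).1 = c.1

/-- `ψ'` extends `ψ` to the multiplier family. -/
def IsExtension {D G : AdmFam Θ} (ψ : Mor D G)
    (ψ' : NormalMor D.fam.multiplier G.fam.multiplier) : Prop :=
  ∀ ρ σ (d : D.fam ρ σ), ∃ h : d.1 ∈ D.fam.multiplier ρ σ, ψ'.map ρ σ ⟨d.1, h⟩ = ψ.map ρ σ d

/-- `χ` is the composition of `φ` with the extension of `ψ` to a normal morphism from
`ℳ(𝒟)` to `ℳ(𝒢)`. -/
def IsComp {C D G : AdmFam Θ} (φ : Mor C D) (ψ : Mor D G) (χ : Mor C G) : Prop :=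
  ∃ ψ' : NormalMor D.fam.multiplier G.fam.multiplier, ψ.IsExtension ψ' ∧
    ∀ ρ σ (c : C.fam ρ σ), χ.map ρ σ c = ψ'.map ρ σ (φ.map ρ σ c)

/-- `φ` is an isomorphism of `𝒞` onto `𝒟`, given by conjugation with the unitary `U`. -/
def IsConj {C D : AdmFam Θ} (φ : Mor C D) (U : BimodUnitary C.E D.E) : Prop :=
  ∀ ρ σ, (∀ c : C.fam ρ σ, ∀ x, (φ.map ρ σ c).1 x = U.equiv (c.1 (U.equiv.symm x))) ∧
    {R | ∃ c : C.fam ρ σ, R = (φ.map ρ σ c).1} = D.fam ρ σ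

end Mor

/-! ### The category and its monoidal structure -/

/-- The structure of a category on the `Θ`-admissible `C⋆`-families and the nondegenerate normal
morphisms into multiplier families.  The identities and the composition are determined by
`isId` and `isComp`. -/
structure CategoryData (Θ : Set (PAut B)) where
  id : ∀ C : AdmFam Θ, Mor C C
  comp : ∀ {C D G : AdmFam Θ}, Mor C D → Mor D G → Mor C G
  isId : ∀ C, (id C).IsId
  isComp : ∀ {C D G : AdmFam Θ} (φ : Mor C D) (ψ : Mor D G), Mor.IsComp φ ψ (comp φ ψ)
  id_comp : ∀ {C D : AdmFam Θ} (φ : Mor C D), comp (id C) φ = φ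
  comp_id : ∀ {C D : AdmFam Θ} (φ : Mor C D), comp φ (id D) = φ
  assoc : ∀ {C D G K : AdmFam Θ} (φ : Mor C D) (ψ : Mor D G) (χ : Mor G K),
    comp (comp φ ψ) χ = comp φ (comp ψ χ)

/-- The category of `Θ`-admissible `C⋆`-families. -/
abbrev CategoryData.category {Θ : Set (PAut B)} (K : CategoryData Θ) :
    Category.{u} (AdmFam Θ) where
  Hom := Mor
  id := K.id
  comp := K.comp
  id_comp := K.id_comp
  comp_id := K.comp_id
  assoc := K.assoc

/-- Isomorphisms in the category of `Θ`-admissible `C⋆`-families. -/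
abbrev CategoryData.Isom {Θ : Set (PAut B)} (K : CategoryData Θ) (C D : AdmFam Θ) : Type u :=
  letI := K.category
  C ≅ D

/-- The morphism underlying an isomorphism. -/
abbrev CategoryData.Isom.mor {Θ : Set (PAut B)} {K : CategoryData Θ} {C D : AdmFam Θ}
    (e : K.Isom C D) : Mor C D :=
  letI := K.category
  e.hom

/-- The object `𝒦(B;Θ)`. -/
abbrev unitObj (Θ : Set (PAut B)) (hu : AdmissibleFam Θ (unitFam Θ)) : AdmFam Θ :=
  ⟨Bimod.self B, unitFam Θ, hu⟩

/-- The statement that the fiber product of admissible families is admissible. -/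
def FiberProdAdmissible (Θ : Set (PAut B)) (ten : ∀ E F : Bimod B, InternalTensor E F) : Prop :=
  ∀ C D : AdmFam Θ, AdmissibleFam Θ (fiberProd (ten C.E D.E) C.fam D.fam)

/-- The object `𝒞 ⊗ 𝒟`. -/
abbrev prodObj {Θ : Set (PAut B)} {ten : ∀ E F : Bimod B, InternalTensor E F}
    (hp : FiberProdAdmissible Θ ten) (C D : AdmFam Θ) : AdmFam Θ :=
  ⟨(ten C.E D.E).obj, fiberProd (ten C.E D.E) C.fam D.fam, hp C D⟩

/-- The data of the monoidal structure: the product of objects is the fiber product, the unit is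
`𝒦(B;Θ)`, the product of morphisms satisfies `(φ ⊗ ψ)(a ⊗ c) = φ(a) ⊗ ψ(c)`, and the associators
and unitors are given by conjugation with the unitaries `(ξ ⊗ η) ⊗ ζ ↦ ξ ⊗ (η ⊗ ζ)`, `b ⊗ ξ ↦ b ξ`
and `ξ ⊗ b ↦ ξ b`. -/
structure MonoidalData {Θ : Set (PAut B)} (K : CategoryData Θ)
    (ten : ∀ E F : Bimod B, InternalTensor E F) (hu : AdmissibleFam Θ (unitFam Θ))
    (hp : FiberProdAdmissible Θ ten) where
  tensorHom : ∀ {A A' C C' : AdmFam Θ}, Mor A A' → Mor C C' → Mor (prodObj hp A C) (prodObj hp A' C')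
  tensorHom_spec : ∀ {A A' C C' : AdmFam Θ} (φ : Mor A A') (ψ : Mor C C') (ρ σ σ' ρ' : PAut B),
    PAut.Compatible σ' ρ' → ∀ (a : A.fam ρ σ') (c : C.fam ρ' σ),
      ∃ R : (prodObj hp A C).fam ρ σ, (ten A.E C.E).IsTensorOp a.1 c.1 R.1 ∧
        (ten A'.E C'.E).IsTensorOp (φ.map ρ σ' a).1 (ψ.map ρ' σ c).1
          ((tensorHom φ ψ).map ρ σ R).1
  associator : ∀ A C D : AdmFam Θ,
    K.Isom (prodObj hp (prodObj hp A C) D) (prodObj hp A (prodObj hp C D))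
  associator_spec : ∀ A C D : AdmFam Θ,
    ∃ U : BimodUnitary (ten (ten A.E C.E).obj D.E).obj (ten A.E (ten C.E D.E).obj).obj,
      (∀ ξ η ζ, U.equiv ((ten _ D.E).tmul ((ten A.E C.E).tmul ξ η) ζ) =
        (ten A.E _).tmul ξ ((ten C.E D.E).tmul η ζ)) ∧
      Mor.IsConj (CategoryData.Isom.mor (associator A C D)) U
  leftUnitor : ∀ C : AdmFam Θ, K.Isom (prodObj hp (unitObj Θ hu) C) C
  leftUnitor_spec : ∀ C : AdmFam Θ,
    ∃ U : BimodUnitary (ten (Bimod.self B) C.E).obj C.E,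
      (∀ b ξ, U.equiv ((ten (Bimod.self B) C.E).tmul b ξ) = C.E.lsmul b ξ) ∧
      Mor.IsConj (CategoryData.Isom.mor (leftUnitor C)) U
  rightUnitor : ∀ C : AdmFam Θ, K.Isom (prodObj hp C (unitObj Θ hu)) C
  rightUnitor_spec : ∀ C : AdmFam Θ,
    ∃ U : BimodUnitary (ten C.E (Bimod.self B)).obj C.E,
      (∀ ξ b, U.equiv ((ten C.E (Bimod.self B)).tmul ξ b) = C.E.rsmul ξ b) ∧
      Mor.IsConj (CategoryData.Isom.mor (rightUnitor C)) U

/-- The data above in the form used by the class of monoidal categories. -/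
abbrev MonoidalData.toStruct {Θ : Set (PAut B)} {K : CategoryData Θ}
    {ten : ∀ E F : Bimod B, InternalTensor E F} {hu : AdmissibleFam Θ (unitFam Θ)}
    {hp : FiberProdAdmissible Θ ten} (S : MonoidalData K ten hu hp) :
    letI := K.category
    MonoidalCategoryStruct (AdmFam Θ) :=
  letI := K.category
  { tensorObj := prodObj hp
    whiskerLeft := fun X _ _ f => S.tensorHom (K.id X) f
    whiskerRight := fun f Y => S.tensorHom f (K.id Y)
    tensorHom := fun f g => S.tensorHom f g
    tensorUnit := unitObj Θ hu
    associator := S.associator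
    leftUnitor := S.leftUnitor
    rightUnitor := S.rightUnitor }

end Bimodules

end CStarFamily

end

/-!
The category and its monoidal structure rest on three principles.

*Intertwiners determine morphisms.* A normal morphism `φ` satisfies `φ(c) T ξ = T c ξ` for its
intertwiners `T`, whose ranges span a dense subspace. Hence two morphisms that have a common
jointly dense set of intertwiners agree (`Mor.ext_of_intertwiners`), and an operator `c` that
commutes with all `S' T`, where `T`, `T'` are intertwiners and `S'` is the adjoint of `T'`, has a
unique counterpart on the target (`exists_conj`). The counterparts of multipliers give the
extension `Mor.extend` and thereby the composition of morphisms; the counterparts of the operators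
of a fiber product, for the intertwiners `T ⊗ T'`, give the morphism `φ ⊗ ψ` (`tensorMor`). The
axioms of a category and of a monoidal category become identities between bimodule maps, and these
are checked on elementary tensors.

*Densely defined operators are bounded by growth estimates.* An operator given on a linearly dense
set, with an adjoint given on a linearly dense set, is bounded if the iterates of `T⋆T` grow at
most geometrically on each vector (`exists_extension`): by the Cauchy–Schwarz inequality the
numbers `a_k = ‖(T⋆T)ᵏ x‖` satisfy `a_k² ≤ a_{2k} a₀`. The operators `c ⊗ d` on internal tensor
products, the counterparts above and the unitaries between iterated tensor products all arise in
this way. Internal tensor products exist because the Gram matrix of a finite family in a Hilbert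
module is of the form `P⋆P` (`exists_gram_eq`).

*Homogeneous elements of `B` are almost central.* An element `c` of degree `θ` satisfies
`c x = θ(x c)` (`hmg_self_mul_mem_graph`), so elements of degree `Id` are central, and `x⋆x` is central for
homogeneous `x`. If `B` is decomposable, it therefore has an approximate unit of central elements
(`Decomposable.exists_approximateUnit`), and similarly for the domains of the partial automorphisms
that occur (`exists_central_approximateUnit`). Inserting such elements proves that `𝒦(B;Θ)` and the
fiber products are admissible (`AdmissibleSemigroup.unitFam_admissible`, `fiberProd_admissible`),
and that conjugation with `B ⊗ E ≅ E` and `E ⊗ B ≅ E` identifies `𝒦(B;Θ) ⊗ 𝒞` and `𝒞 ⊗ 𝒦(B;Θ)` with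
`𝒞`: an operator of `𝒞` is a limit of sums of operators `T b` with `b` central in the domain of the
degree `ρ` of `T`, and `T b x ξ = ρ(b x) T ξ` exhibits it as the image of a tensor `k ⊗ T`
(`leftUnitor_symm_conj_mem`, `rightUnitor_symm_conj_mem`).

A family `𝒞` is a `C⋆`-family precisely if its components are closed subspaces that increase with
the degree and if it is closed under adjoints and products (`Fam.IsStarAlgFam`). One direction uses
polar approximation: an operator `T` is a limit of operators `T e` with `e` in the `C⋆`-algebra of
the operators of the family of degree `(Id, Id)`, because this algebra contains `T⋆T`.
-/

noncomputable section

namespace CStarFamily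

open Filter Topology

/-! ### Closed linear spans -/

section ClosedSpan

variable {V W : Type*} [NormedAddCommGroup V] [NormedSpace ℂ V] [NormedAddCommGroup W]
  [NormedSpace ℂ W]

lemma subset_clspan (S : Set V) : S ⊆ clspan S :=
  Submodule.subset_span.trans subset_closure

lemma mem_clspan {S : Set V} {x : V} (hx : x ∈ S) : x ∈ clspan S := subset_clspan S hx

lemma clspan_eq_topologicalClosure (S : Set V) :
    clspan S = ((Submodule.span ℂ S).topologicalClosure : Set V) := rfl

lemma isClosed_clspan (S : Set V) : IsClosed (clspan S) := isClosed_closure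

lemma zero_mem_clspan (S : Set V) : (0 : V) ∈ clspan S :=
  (Submodule.span ℂ S).topologicalClosure.zero_mem

lemma add_mem_clspan {S : Set V} {x y : V} (hx : x ∈ clspan S) (hy : y ∈ clspan S) :
    x + y ∈ clspan S :=
  (Submodule.span ℂ S).topologicalClosure.add_mem hx hy

lemma sub_mem_clspan {S : Set V} {x y : V} (hx : x ∈ clspan S) (hy : y ∈ clspan S) :
    x - y ∈ clspan S :=
  (Submodule.span ℂ S).topologicalClosure.sub_mem hx hy

lemma smul_mem_clspan {S : Set V} (z : ℂ) {x : V} (hx : x ∈ clspan S) : z • x ∈ clspan S :=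
  (Submodule.span ℂ S).topologicalClosure.smul_mem z hx

lemma clspan_subset_iff {S T : Set V} : clspan S ⊆ clspan T ↔ S ⊆ clspan T := by
  refine ⟨(subset_clspan S).trans, fun h => ?_⟩
  rw [clspan_eq_topologicalClosure, clspan_eq_topologicalClosure]
  exact Submodule.topologicalClosure_minimal _ (Submodule.span_le.2 h)
    (Submodule.isClosed_topologicalClosure _)

lemma clspan_mono {S T : Set V} (h : S ⊆ T) : clspan S ⊆ clspan T :=
  clspan_subset_iff.2 (h.trans (subset_clspan T))

lemma clspan_clspan (S : Set V) : clspan (clspan S) = clspan S :=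
  Set.Subset.antisymm (clspan_subset_iff.2 subset_rfl) (subset_clspan _)

lemma clspan_induction {S : Set V} {p : V → Prop} (mem : ∀ x ∈ S, p x) (zero : p 0)
    (add : ∀ x y, p x → p y → p (x + y)) (smul : ∀ (z : ℂ) x, p x → p (z • x))
    (closed : IsClosed {x | p x}) {x : V} (hx : x ∈ clspan S) : p x := by
  refine closure_minimal (s := (Submodule.span ℂ S : Set V)) (t := {x | p x}) ?_ closed hx
  intro y hy
  exact Submodule.span_induction (p := fun y _ => p y) mem zero (fun x y _ _ => add x y)
    (fun z x _ => smul z x) hy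

/-- A continuous linear map carries closed spans into closed spans. -/
lemma map_mem_clspan (f : V →L[ℂ] W) {S : Set V} {T : Set W} (h : ∀ s ∈ S, f s ∈ clspan T)
    {x : V} (hx : x ∈ clspan S) : f x ∈ clspan T :=
  clspan_induction (p := fun x => f x ∈ clspan T) h (by simpa using zero_mem_clspan T)
    (fun x y hx hy => by simpa using add_mem_clspan hx hy)
    (fun z x hx => by simpa using smul_mem_clspan z hx)
    ((isClosed_clspan T).preimage f.continuous) hx

lemma eqOn_clspan {f g : V →L[ℂ] W} {S : Set V} (h : ∀ s ∈ S, f s = g s) {x : V}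
    (hx : x ∈ clspan S) : f x = g x :=
  clspan_induction (p := fun x => f x = g x) h (by simp) (fun x y hx hy => by simp [hx, hy])
    (fun z x hx => by simp [hx]) (isClosed_eq f.continuous g.continuous) hx

lemma ext_of_clspan {f g : V →L[ℂ] W} {S : Set V} (hS : clspan S = Set.univ)
    (h : ∀ s ∈ S, f s = g s) : f = g :=
  ContinuousLinearMap.ext fun x => eqOn_clspan h (hS ▸ Set.mem_univ x)

lemma clspan_eq_univ_of_subset {S T : Set V} (hS : clspan S = Set.univ) (h : S ⊆ clspan T) :
    clspan T = Set.univ :=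
  Set.eq_univ_of_univ_subset (hS ▸ clspan_subset_iff.2 h)

lemma denseRange_linearCombination {X : Type*} {u : X → V}
    (hu : clspan (Set.range u) = Set.univ) :
    DenseRange (Finsupp.linearCombination ℂ u) := by
  have := Finsupp.range_linearCombination (M := V) ℂ (v := u)
  rw [DenseRange, ← LinearMap.coe_range, this, dense_iff_closure_eq]
  exact hu

end ClosedSpan

/-! ### The inverse semigroup of partial automorphisms -/

section PartialAutomorphisms

variable {B : Type u} [NonUnitalCStarAlgebra B]

/-- Closed `*`-subalgebras of a `C⋆`-algebra have approximate units. -/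
lemma exists_approximateUnit (S : NonUnitalStarSubalgebra ℂ B) (hS : IsClosed (S : Set B)) :
    ∃ l : Filter B, l.NeBot ∧ (∀ᶠ e in l, e ∈ S ∧ star e = e ∧ ‖e‖ ≤ 1) ∧
      ∀ x ∈ S, Tendsto (fun e => e * x) l (𝓝 x) ∧ Tendsto (fun e => x * e) l (𝓝 x) := by
  have := hS
  let _ := CStarAlgebra.spectralOrder S
  have := CStarAlgebra.spectralOrderedRing S
  have h := CStarAlgebra.increasingApproximateUnit S
  have := h.neBot
  refine ⟨(CStarAlgebra.approximateUnit S).map Subtype.val, inferInstance, ?_, fun x hx => ?_⟩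
  · rw [eventually_map]
    filter_upwards [h.eventually_star_eq, h.eventually_norm] with e h₁ h₂
    exact ⟨e.2, congrArg Subtype.val h₁, h₂⟩
  · have hc := continuous_subtype_val (p := fun b : B => b ∈ S)
    exact ⟨tendsto_map'_iff.2 ((hc.tendsto _).comp (h.tendsto_mul_right ⟨x, hx⟩)),
      tendsto_map'_iff.2 ((hc.tendsto _).comp (h.tendsto_mul_left ⟨x, hx⟩))⟩

namespace PAut

lemma le_iff {θ θ' : PAut B} : θ ≤ θ' ↔ ∀ b c, (b, c) ∈ θ.graph → (b, c) ∈ θ'.graph :=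
  ⟨fun h _ _ hb => h hb, fun h ⟨b, c⟩ hb => h b c hb⟩

lemma map_zero (θ : PAut B) : ((0 : B), (0 : B)) ∈ θ.graph := by
  obtain ⟨c, hc⟩ := θ.dom_ideal.zero_mem
  simpa using θ.map_smul 0 hc

lemma map_sub (θ : PAut B) {b b' c c' : B} (h : (b, c) ∈ θ.graph) (h' : (b', c') ∈ θ.graph) :
    (b - b', c - c') ∈ θ.graph := by
  simpa [sub_eq_add_neg] using θ.map_add h (θ.map_smul (-1) h')

lemma star_mem_dom (θ : PAut B) {b : B} (h : b ∈ θ.dom) : star b ∈ θ.dom :=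
  h.imp' star fun _ => θ.map_star

lemma star_mem_img (θ : PAut B) {b : B} (h : b ∈ θ.img) : star b ∈ θ.img :=
  h.imp' star fun _ => θ.map_star

/-- The domain of a partial automorphism as a `*`-subalgebra. -/
def domAlg (θ : PAut B) : NonUnitalStarSubalgebra ℂ B where
  carrier := θ.dom
  add_mem' := θ.dom_ideal.add_mem
  zero_mem' := θ.dom_ideal.zero_mem
  mul_mem' _ h := θ.dom_ideal.mul_mem_left _ h
  smul_mem' z _ h := θ.dom_ideal.smul_mem z h
  star_mem' := θ.star_mem_dom

lemma norm_le (θ : PAut B) {b c : B} (h : (b, c) ∈ θ.graph) : ‖c‖ ≤ ‖b‖ := by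
  have hcl : IsClosed (θ.domAlg : Set B) := θ.dom_ideal.isClosed
  choose f hf using fun x : θ.domAlg => x.2
  let φ : θ.domAlg →⋆ₙₐ[ℂ] B :=
    { toFun := f
      map_smul' := fun z x => θ.map_unique (hf _) (θ.map_smul z (hf x))
      map_zero' := θ.map_unique (hf _) θ.map_zero
      map_add' := fun x y => θ.map_unique (hf _) (θ.map_add (hf x) (hf y))
      map_mul' := fun x y => θ.map_unique (hf _) (θ.map_mul (hf x) (hf y))
      map_star' := fun x => θ.map_unique (hf _) (θ.map_star (hf x)) }
  have := NonUnitalStarAlgHom.norm_apply_le φ ⟨b, c, h⟩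
  rwa [show φ ⟨b, c, h⟩ = c from θ.map_unique (hf _) h] at this

/-- Partial automorphisms are isometric. -/
lemma norm_eq (θ : PAut B) {b c : B} (h : (b, c) ∈ θ.graph) : ‖c‖ = ‖b‖ :=
  (θ.norm_le h).antisymm (θ.inv.norm_le h)

/-- A limit of elements of the domain has the limit of their images as its image. -/
lemma mem_graph_of_tendsto (θ : PAut B) {ι : Type*} {l : Filter ι} [l.NeBot] {f g : ι → B} {b c : B}
    (hf : Tendsto f l (𝓝 b)) (hg : Tendsto g l (𝓝 c)) (h : ∀ᶠ i in l, (f i, g i) ∈ θ.graph) :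
    (b, c) ∈ θ.graph := by
  obtain ⟨c', hc'⟩ := θ.dom_ideal.isClosed.mem_of_tendsto hf (h.mono fun i hi => ⟨_, hi⟩)
  have : Tendsto g l (𝓝 c') := by
    rw [tendsto_iff_norm_sub_tendsto_zero] at hf ⊢
    refine hf.congr' (h.mono fun i hi => ?_)
    exact (θ.norm_eq (θ.map_sub hi hc')).symm
  rwa [tendsto_nhds_unique hg this]

lemma isClosed_graph (θ : PAut B) : IsClosed (θ.graph : Set (B × B)) := by
  refine isClosed_of_closure_subset fun p hp => ?_
  obtain ⟨f, hf, hp⟩ := mem_closure_iff_seq_limit.1 hp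
  exact θ.mem_graph_of_tendsto (Prod.tendsto_iff _ _ |>.1 hp).1 (Prod.tendsto_iff _ _ |>.1 hp).2
    (Eventually.of_forall hf)

lemma tendsto_of_mem_graph (θ : PAut B) {ι : Type*} {l : Filter ι} {f g : ι → B} {b c : B}
    (hf : Tendsto f l (𝓝 b)) (hb : (b, c) ∈ θ.graph) (h : ∀ᶠ i in l, (f i, g i) ∈ θ.graph) :
    Tendsto g l (𝓝 c) := by
  rw [tendsto_iff_norm_sub_tendsto_zero] at hf ⊢
  exact hf.congr' (h.mono fun i hi => (θ.norm_eq (θ.map_sub hi hb)).symm)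

/-- The domain of a partial automorphism has an approximate unit. -/
lemma exists_approximateUnit (θ : PAut B) :
    ∃ l : Filter B, l.NeBot ∧ (∀ᶠ e in l, e ∈ θ.dom ∧ star e = e ∧ ‖e‖ ≤ 1) ∧
      ∀ x ∈ θ.dom, Tendsto (fun e => e * x) l (𝓝 x) ∧ Tendsto (fun e => x * e) l (𝓝 x) :=
  CStarFamily.exists_approximateUnit θ.domAlg θ.dom_ideal.isClosed

lemma isClosedIdeal_preimage (θ : PAut B) {J : Set B} (hJ : IsClosedIdeal J) :
    IsClosedIdeal {b | ∃ m, (b, m) ∈ θ.graph ∧ m ∈ J} where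
  zero_mem := ⟨0, θ.map_zero, hJ.zero_mem⟩
  add_mem := fun ⟨m, h, hm⟩ ⟨m', h', hm'⟩ => ⟨_, θ.map_add h h', hJ.add_mem hm hm'⟩
  smul_mem := fun z _ ⟨m, h, hm⟩ => ⟨_, θ.map_smul z h, hJ.smul_mem z hm⟩
  mul_mem_left := by
    rintro y x ⟨m, h, hm⟩
    obtain ⟨n, hn⟩ := θ.dom_ideal.mul_mem_left y ⟨m, h⟩
    refine ⟨n, hn, ?_⟩
    obtain ⟨l, _, hl, hl'⟩ := θ.exists_approximateUnit
    -- `θ (y e x) = θ (y e) θ x` belongs to `J`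
    have : ∀ᶠ e in l, ∃ k ∈ J, (y * e * x, k) ∈ θ.graph := hl.mono fun e ⟨he, _⟩ => by
      obtain ⟨k, hk⟩ := θ.dom_ideal.mul_mem_left y he
      exact ⟨_, hJ.mul_mem_left k hm, θ.map_mul hk h⟩
    obtain ⟨g, hg⟩ := this.choice
    have ht : Tendsto (fun e => y * e * x) l (𝓝 (y * x)) := by
      simpa [mul_assoc] using ((hl' x ⟨m, h⟩).1).const_mul y
    exact hJ.isClosed.mem_of_tendsto (θ.tendsto_of_mem_graph ht hn (hg.mono fun _ h => h.2))
      (hg.mono fun _ h => h.1)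
  mul_mem_right := by
    rintro y x ⟨m, h, hm⟩
    obtain ⟨n, hn⟩ := θ.dom_ideal.mul_mem_right y ⟨m, h⟩
    refine ⟨n, hn, ?_⟩
    obtain ⟨l, _, hl, hl'⟩ := θ.exists_approximateUnit
    have : ∀ᶠ e in l, ∃ k ∈ J, (x * (e * y), k) ∈ θ.graph := hl.mono fun e ⟨he, _⟩ => by
      obtain ⟨k, hk⟩ := θ.dom_ideal.mul_mem_right y he
      exact ⟨_, hJ.mul_mem_right k hm, θ.map_mul h hk⟩
    obtain ⟨g, hg⟩ := this.choice
    have ht : Tendsto (fun e => x * (e * y)) l (𝓝 (x * y)) := by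
      simpa [mul_assoc] using ((hl' x ⟨m, h⟩).2).mul_const y
    exact hJ.isClosed.mem_of_tendsto (θ.tendsto_of_mem_graph ht hn (hg.mono fun _ h => h.2))
      (hg.mono fun _ h => h.1)
  isClosed := by
    refine isClosed_of_closure_subset fun b hb => ?_
    obtain ⟨f, hf, hb⟩ := mem_closure_iff_seq_limit.1 hb
    choose g hg using hf
    obtain ⟨m, hm⟩ := θ.dom_ideal.isClosed.mem_of_tendsto hb
      (Eventually.of_forall fun n => ⟨_, (hg n).1⟩)
    exact ⟨m, hm, hJ.isClosed.mem_of_tendsto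
      (θ.tendsto_of_mem_graph hb hm (Eventually.of_forall fun n => (hg n).1))
      (Eventually.of_forall fun n => (hg n).2)⟩

/-- The product of partial automorphisms is their composition on the largest possible domain. -/
instance : Mul (PAut B) where
  mul σ θ :=
    { graph := σ.comp θ
      dom_ideal := by
        convert θ.isClosedIdeal_preimage σ.dom_ideal using 1
        ext b
        exact ⟨fun ⟨c, m, h, h'⟩ => ⟨m, h, c, h'⟩, fun ⟨m, h, c, h'⟩ => ⟨c, m, h, h'⟩⟩
      img_ideal := by
        convert σ.inv.isClosedIdeal_preimage θ.img_ideal using 1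
        ext b
        exact ⟨fun ⟨c, m, h, h'⟩ => ⟨m, h', c, h⟩, fun ⟨m, h, c, h'⟩ => ⟨c, m, h', h⟩⟩
      map_unique := by
        rintro b c c' ⟨m, h₁, h₂⟩ ⟨m', h₁', h₂'⟩
        obtain rfl : m = m' := θ.map_unique h₁ h₁'
        exact σ.map_unique h₂ h₂'
      map_injective := by
        rintro b c c' ⟨m, h₁, h₂⟩ ⟨m', h₁', h₂'⟩
        obtain rfl : m = m' := σ.map_injective h₂ h₂'
        exact θ.map_injective h₁ h₁'
      map_add := fun ⟨_, h₁, h₂⟩ ⟨_, h₁', h₂'⟩ => ⟨_, θ.map_add h₁ h₁', σ.map_add h₂ h₂'⟩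
      map_smul := fun z _ _ ⟨_, h₁, h₂⟩ => ⟨_, θ.map_smul z h₁, σ.map_smul z h₂⟩
      map_mul := fun ⟨_, h₁, h₂⟩ ⟨_, h₁', h₂'⟩ => ⟨_, θ.map_mul h₁ h₁', σ.map_mul h₂ h₂'⟩
      map_star := fun ⟨_, h₁, h₂⟩ => ⟨_, θ.map_star h₁, σ.map_star h₂⟩ }

instance : One (PAut B) := ⟨PAut.id B⟩

instance : Inv (PAut B) := ⟨PAut.inv⟩

lemma inv_eq (θ : PAut B) : θ.inv = θ⁻¹ := rfl

lemma id_eq : PAut.id B = 1 := rfl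

lemma mem_mul {σ θ : PAut B} {b d : B} :
    (b, d) ∈ (σ * θ).graph ↔ ∃ c, (b, c) ∈ θ.graph ∧ (c, d) ∈ σ.graph := Iff.rfl

lemma mem_inv {θ : PAut B} {b c : B} : (b, c) ∈ θ⁻¹.graph ↔ (c, b) ∈ θ.graph := Iff.rfl

lemma mem_one {b c : B} : (b, c) ∈ (1 : PAut B).graph ↔ c = b :=
  ⟨fun h => h.2, fun h => ⟨trivial, h⟩⟩

lemma le_one_iff {θ : PAut B} : θ ≤ 1 ↔ ∀ b c, (b, c) ∈ θ.graph → c = b :=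
  le_iff.trans (by simp only [mem_one])

protected lemma ext' {σ θ : PAut B} (h : ∀ b c, (b, c) ∈ σ.graph ↔ (b, c) ∈ θ.graph) : σ = θ :=
  PAut.ext (Set.ext fun ⟨b, c⟩ => h b c)

instance : Monoid (PAut B) where
  mul_assoc ρ σ θ := PAut.ext' fun b c => by
    simp only [mem_mul]
    exact ⟨fun ⟨x, h, y, h', h''⟩ => ⟨y, ⟨x, h, h'⟩, h''⟩,
      fun ⟨y, ⟨x, h, h'⟩, h''⟩ => ⟨x, h, y, h', h''⟩⟩
  one_mul θ := PAut.ext' fun b c => by simp [mem_mul, mem_one]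
  mul_one θ := PAut.ext' fun b c => by simp [mem_mul, mem_one]

instance : InvolutiveInv (PAut B) where
  inv_inv _ := rfl

protected lemma inv_one : (1 : PAut B)⁻¹ = 1 :=
  PAut.ext' fun b c => by simp [mem_inv, mem_one, eq_comm]

protected lemma mul_inv_rev (σ θ : PAut B) : (σ * θ)⁻¹ = θ⁻¹ * σ⁻¹ :=
  PAut.ext' fun b c => by simp [mem_inv, mem_mul, and_comm]

protected lemma mul_le_mul {σ σ' θ θ' : PAut B} (h : σ ≤ σ') (h' : θ ≤ θ') :
    σ * θ ≤ σ' * θ' :=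
  le_iff.2 fun _ _ ⟨m, h₁, h₂⟩ => ⟨m, h' h₁, h h₂⟩

instance : MulLeftMono (PAut B) := ⟨fun _ _ _ h => PAut.mul_le_mul le_rfl h⟩

instance : MulRightMono (PAut B) := ⟨fun _ _ _ h => PAut.mul_le_mul h le_rfl⟩

protected lemma inv_le_inv {σ θ : PAut B} (h : σ ≤ θ) : σ⁻¹ ≤ θ⁻¹ :=
  le_iff.2 fun b c hb => le_iff.1 h c b hb

lemma mul_inv_mul (θ : PAut B) : θ * θ⁻¹ * θ = θ :=
  PAut.ext' fun b c => by
    refine ⟨?_, fun h => ⟨c, h, b, h, h⟩⟩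
    rintro ⟨x, h, y, h', h''⟩
    obtain rfl : y = b := θ.map_injective h' h
    exact h''

lemma mul_inv_le_one (θ : PAut B) : θ * θ⁻¹ ≤ 1 :=
  le_one_iff.2 fun _ _ ⟨_, h, h'⟩ => θ.map_unique h' h

lemma inv_mul_le_one (θ : PAut B) : θ⁻¹ * θ ≤ 1 := mul_inv_le_one θ⁻¹

lemma inv_of_le_one {e : PAut B} (he : e ≤ 1) : e⁻¹ = e :=
  PAut.ext' fun b c => by
    rw [le_one_iff] at he
    refine ⟨fun h => ?_, fun h => ?_⟩
    · obtain rfl : b = c := he _ _ h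
      exact h
    · obtain rfl : c = b := he _ _ h
      exact h

lemma compLE_iff {σ θ τ : PAut B} : CompLE σ θ τ ↔ σ * θ ≤ τ := Iff.rfl

lemma source_eq (θ : PAut B) : θ.source = θ⁻¹ * θ :=
  PAut.ext' fun b c => by
    refine ⟨?_, ?_⟩
    · rintro ⟨⟨x, hx⟩, rfl : c = b⟩
      exact ⟨x, hx, hx⟩
    · rintro ⟨x, hx, hx'⟩
      exact ⟨⟨x, hx⟩, θ.map_injective hx' hx⟩

lemma compatible_iff {ρ σ : PAut B} : Compatible ρ σ ↔ ρ * σ⁻¹ ≤ 1 ∧ ρ⁻¹ * σ ≤ 1 := Iff.rfl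

lemma Compatible.symm {ρ σ : PAut B} (h : Compatible ρ σ) : Compatible σ ρ := by
  rw [compatible_iff] at *
  refine ⟨?_, ?_⟩
  · have := PAut.inv_le_inv h.1
    rwa [PAut.mul_inv_rev, inv_inv, PAut.inv_one] at this
  · have := PAut.inv_le_inv h.2
    rwa [PAut.mul_inv_rev, inv_inv, PAut.inv_one] at this

lemma Compatible.inv {ρ σ : PAut B} (h : Compatible ρ σ) : Compatible ρ⁻¹ σ⁻¹ :=
  compatible_iff.2 ⟨by simpa using (compatible_iff.1 h).2, by simpa using (compatible_iff.1 h).1⟩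

lemma Compatible.mono {ρ σ ρ' σ' : PAut B} (h : Compatible ρ σ) (hρ : ρ' ≤ ρ) (hσ : σ' ≤ σ) :
    Compatible ρ' σ' :=
  compatible_iff.2 ⟨(PAut.mul_le_mul hρ (PAut.inv_le_inv hσ)).trans h.1,
    (PAut.mul_le_mul (PAut.inv_le_inv hρ) hσ).trans h.2⟩

/-- Compatibility is preserved by composition. -/
lemma Compatible.mul {ρ σ ρ' σ' : PAut B} (h : Compatible ρ σ) (h' : Compatible ρ' σ') :
    Compatible (ρ * ρ') (σ * σ') := by
  rw [compatible_iff] at *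
  constructor
  · calc ρ * ρ' * (σ * σ')⁻¹ = ρ * (ρ' * σ'⁻¹) * σ⁻¹ := by
          rw [PAut.mul_inv_rev]; simp only [mul_assoc]
      _ ≤ ρ * 1 * σ⁻¹ := by gcongr; exact h'.1
      _ ≤ 1 := by simpa using h.1
  · calc (ρ * ρ')⁻¹ * (σ * σ') = ρ'⁻¹ * (ρ⁻¹ * σ) * σ' := by
          rw [PAut.mul_inv_rev]; simp only [mul_assoc]
      _ ≤ ρ'⁻¹ * 1 * σ' := by gcongr; exact h.2
      _ ≤ 1 := by simpa using h'.2

lemma compatible_self (ρ : PAut B) : Compatible ρ ρ :=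
  compatible_iff.2 ⟨mul_inv_le_one ρ, inv_mul_le_one ρ⟩

lemma eq_of_mul_eq_mul {x y : B} {I : Set B}
    (hx : star (x - y) ∈ I) (h : ∀ z ∈ I, z * x = z * y) : x = y := by
  have h0 : star (x - y) * (x - y) = 0 := by rw [mul_sub, h _ hx, sub_self]
  exact sub_eq_zero.1 ((CStarRing.star_mul_self_eq_zero_iff _).1 h0)

/-- Compatible partial automorphisms: `ρ (b y) = σ(b) ρ(y)` for `b ∈ Dom σ` and `y ∈ Dom ρ`.  It
suffices to compare the products with elements of `Dom σ ∩ Dom ρ`, where `ρ` and `σ` agree. -/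
lemma Compatible.map_mul {σ ρ : PAut B} (h : Compatible σ ρ) {b b' y y' : B}
    (hb : (b, b') ∈ σ.graph) (hy : (y, y') ∈ ρ.graph) : (b * y, b' * y') ∈ ρ.graph := by
  have h1 := le_one_iff.1 (compatible_iff.1 h).1
  have h2 := le_one_iff.1 (compatible_iff.1 h).2
  have agree : ∀ {z c c'}, (z, c) ∈ σ.graph → (z, c') ∈ ρ.graph → c = c' :=
    fun hz hz' => h1 _ _ ⟨_, hz', hz⟩
  obtain ⟨x, hx⟩ := σ.img_ideal.mul_mem_right y' ⟨b, hb⟩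
  obtain ⟨x', hx'⟩ := ρ.img_ideal.mul_mem_left b' ⟨y, hy⟩
  obtain rfl : x = x' := (h2 _ _ ⟨_, hx', hx⟩)
  suffices x = b * y by rwa [this] at hx'
  obtain ⟨k, hk⟩ := σ.dom_ideal.mul_mem_right y ⟨b', hb⟩
  obtain ⟨k', hk'⟩ := ρ.dom_ideal.mul_mem_left b ⟨y', hy⟩
  refine eq_of_mul_eq_mul (I := σ.dom ∩ ρ.dom) ⟨σ.star_mem_dom ⟨_, σ.map_sub hx hk⟩,
    ρ.star_mem_dom ⟨_, ρ.map_sub hx' hk'⟩⟩ ?_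
  rintro z ⟨⟨w, hz⟩, hz'⟩
  have e1 : (z * x, w * b' * y') ∈ σ.graph := by simpa [mul_assoc] using σ.map_mul hz hx
  have e2 : (z * b, w * b') ∈ ρ.graph := by
    obtain ⟨c, hc⟩ := ρ.dom_ideal.mul_mem_right b hz'
    rwa [agree (σ.map_mul hz hb) hc]
  have e3 : (z * (b * y), w * b' * y') ∈ σ.graph := by
    have h3 := ρ.map_mul e2 hy
    obtain ⟨c, hc⟩ := σ.dom_ideal.mul_mem_left z ⟨_, hk⟩
    rw [mul_assoc] at h3
    rwa [agree hc h3] at hc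
  exact σ.map_injective e1 e3

end PAut

end PartialAutomorphisms

variable {B : Type u} [NonUnitalCStarAlgebra B]

/-! ### Hilbert modules and bimodules -/

namespace Bimod

variable (E : Bimod B)

lemma ip_sub_right (x y z : E) : E.ip x (y - z) = E.ip x y - E.ip x z := by
  rw [sub_eq_add_neg, ← neg_one_smul ℂ z, E.ip_add_right, E.ip_smul_right, neg_one_smul,
    sub_eq_add_neg]

lemma ip_add_left (x y z : E) : E.ip (x + y) z = E.ip x z + E.ip y z := by
  rw [← E.star_ip, E.ip_add_right, star_add, E.star_ip, E.star_ip]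

lemma ip_smul_left (w : ℂ) (x y : E) : E.ip (w • x) y = star w • E.ip x y := by
  rw [← E.star_ip, E.ip_smul_right, star_smul, E.star_ip]

lemma ip_sub_left (x y z : E) : E.ip (x - y) z = E.ip x z - E.ip y z := by
  rw [← E.star_ip, ip_sub_right, star_sub, E.star_ip, E.star_ip]

lemma ip_rsmul_left (x y : E) (b : B) : E.ip (E.rsmul x b) y = star b * E.ip x y := by
  rw [← E.star_ip, E.ip_rsmul, star_mul, E.star_ip]

variable {E}

lemma ip_self_eq_zero {x : E} (h : E.ip x x = 0) : x = 0 := by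
  have := E.norm_sq x
  rw [h, norm_zero] at this
  exact norm_eq_zero.1 (pow_eq_zero_iff two_ne_zero |>.1 this)

lemma ext_ip {x y : E} (h : ∀ z, E.ip z x = E.ip z y) : x = y :=
  sub_eq_zero.1 (ip_self_eq_zero (by rw [ip_sub_right, h, sub_self]))

variable (E)

/-- The Cauchy–Schwarz inequality. -/
lemma norm_ip_le (x y : E) : ‖E.ip y x‖ ≤ ‖y‖ * ‖x‖ := by
  let _ := CStarAlgebra.spectralOrder B
  have := CStarAlgebra.spectralOrderedRing B
  have pos : ∀ z : E, 0 ≤ E.ip z z := fun z => by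
    obtain ⟨b, hb⟩ := E.ip_self_pos z
    rw [hb]
    exact star_mul_self_nonneg b
  by_cases hy : y = 0
  · have : E.ip y x = 0 := by
      rw [hy, ← zero_smul ℂ (0 : E), ip_smul_left, star_zero, zero_smul]
    rw [this, norm_zero]
    positivity
  have hy' : 0 < ‖y‖ := norm_pos_iff.2 hy
  set b := E.ip y x with hb
  have hb' : E.ip x y = star b := by rw [hb, E.star_ip]
  set t : ℝ := (‖y‖ ^ 2)⁻¹ with ht
  -- expand `0 ≤ ⟨x - y t b | x - y t b⟩` with `t = ‖y‖⁻²`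
  have h0 := pos (x - (t : ℂ) • E.rsmul y b)
  have h1 : E.ip (x - (t : ℂ) • E.rsmul y b) (x - (t : ℂ) • E.rsmul y b)
      = E.ip x x - (2 * t) • (star b * b) + (t * t) • (star b * E.ip y y * b) := by
    simp only [ip_sub_left, ip_sub_right, ip_smul_left, E.ip_smul_right, E.ip_rsmul,
      ip_rsmul_left, hb', ← hb, RCLike.star_def, Complex.conj_ofReal]
    simp only [Complex.coe_smul, ← smul_smul, two_mul, add_smul, mul_assoc, sub_mul,
      smul_mul_assoc, smul_sub]
    abel
  have h2 : star b * E.ip y y * b ≤ ‖y‖ ^ 2 • (star b * b) := by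
    rw [E.norm_sq]
    exact CStarAlgebra.star_left_conjugate_le_norm_smul (IsSelfAdjoint.of_nonneg (pos y))
  have ht0 : 0 ≤ t := by positivity
  have h3 : (t * t) • (star b * E.ip y y * b) ≤ t • (star b * b) := by
    refine (smul_le_smul_of_nonneg_left h2 (mul_nonneg ht0 ht0)).trans_eq ?_
    rw [smul_smul, ht]
    congr 1
    field_simp
  have h4 : t • (star b * b) ≤ E.ip x x := by
    rw [h1] at h0
    have h5 : 0 ≤ E.ip x x - (2 * t) • (star b * b) + t • (star b * b) :=
      h0.trans (add_le_add_right h3 _)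
    rw [two_mul, add_smul] at h5
    rw [← sub_nonneg]
    convert h5 using 1
    abel
  have h6 := CStarAlgebra.norm_le_norm_of_nonneg_of_le
    (smul_nonneg ht0 (star_mul_self_nonneg b)) h4
  rw [norm_smul, CStarRing.norm_star_mul_self, Real.norm_of_nonneg ht0, ← E.norm_sq, ht,
    inv_mul_le_iff₀ (by positivity)] at h6
  nlinarith [norm_nonneg b, norm_nonneg x, abs_le_of_sq_le_sq' (a := ‖b‖) (b := ‖y‖ * ‖x‖)
    (by nlinarith) (by positivity)]

/-- The inner product as a continuous sesquilinear map. -/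
def ipL : E →L⋆[ℂ] E →L[ℂ] B :=
  LinearMap.mkContinuous₂
    (LinearMap.mk₂'ₛₗ (starRingEnd ℂ) (RingHom.id ℂ) E.ip E.ip_add_left
      (fun w x y => E.ip_smul_left w x y) E.ip_add_right E.ip_smul_right) 1
    fun x y => by simpa using E.norm_ip_le y x

lemma ipL_apply (x y : E) : E.ipL x y = E.ip x y := rfl

lemma ip_zero_right (x : E) : E.ip x 0 = 0 := (E.ipL x).map_zero

lemma ip_zero_left (x : E) : E.ip 0 x = 0 := by rw [← E.ipL_apply, map_zero]; rfl

variable {E} in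
lemma tendsto_ip {ι : Type*} {l : Filter ι} {f g : ι → E} {x y : E} (hf : Tendsto f l (𝓝 x))
    (hg : Tendsto g l (𝓝 y)) : Tendsto (fun i => E.ip (f i) (g i)) l (𝓝 (E.ip x y)) :=
  (isBoundedBilinearMap_apply.continuous.tendsto (E.ipL x, _)).comp
    (((E.ipL.continuous.tendsto x).comp hf).prodMk_nhds hg)

lemma continuous_ip : Continuous fun p : E × E => E.ip p.1 p.2 :=
  continuous_iff_continuousAt.2 fun p =>
    tendsto_ip (continuous_fst.tendsto p) (continuous_snd.tendsto p)

lemma rsmul_add (x y : E) (b : B) : E.rsmul (x + y) b = E.rsmul x b + E.rsmul y b :=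
  ext_ip fun z => by simp only [E.ip_rsmul, E.ip_add_right, add_mul]

lemma rsmul_add_right (x : E) (b c : B) : E.rsmul x (b + c) = E.rsmul x b + E.rsmul x c :=
  ext_ip fun z => by simp only [E.ip_rsmul, E.ip_add_right, mul_add]

lemma smul_rsmul (w : ℂ) (x : E) (b : B) : E.rsmul (w • x) b = w • E.rsmul x b :=
  ext_ip fun z => by simp only [E.ip_rsmul, E.ip_smul_right, smul_mul_assoc]

lemma rsmul_smul (w : ℂ) (x : E) (b : B) : E.rsmul x (w • b) = w • E.rsmul x b :=
  ext_ip fun z => by simp only [E.ip_rsmul, E.ip_smul_right, mul_smul_comm]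

lemma rsmul_mul (x : E) (b c : B) : E.rsmul x (b * c) = E.rsmul (E.rsmul x b) c :=
  ext_ip fun z => by simp only [E.ip_rsmul, mul_assoc]

lemma lsmul_add_right (b : B) (x y : E) : E.lsmul b (x + y) = E.lsmul b x + E.lsmul b y :=
  ext_ip fun z => by simp only [E.ip_lsmul, E.ip_add_right]

lemma lsmul_smul_right (w : ℂ) (b : B) (x : E) : E.lsmul b (w • x) = w • E.lsmul b x :=
  ext_ip fun z => by simp only [E.ip_lsmul, E.ip_smul_right]

lemma lsmul_rsmul (b c : B) (x : E) : E.lsmul b (E.rsmul x c) = E.rsmul (E.lsmul b x) c :=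
  ext_ip fun z => by simp only [E.ip_lsmul, E.ip_rsmul]

lemma ip_lsmul_left (b : B) (x y : E) : E.ip (E.lsmul b x) y = E.ip x (E.lsmul (star b) y) := by
  rw [E.ip_lsmul, star_star]

lemma norm_rsmul_le (b : B) (x : E) : ‖E.rsmul x b‖ ≤ ‖b‖ * ‖x‖ := by
  refine le_of_sq_le_sq ?_ (by positivity)
  rw [E.norm_sq, E.ip_rsmul, ip_rsmul_left, mul_pow, E.norm_sq x, sq]
  calc _ ≤ ‖star b‖ * ‖E.ip x x‖ * ‖b‖ :=
        (norm_mul_le _ _).trans (mul_le_mul_of_nonneg_right (norm_mul_le _ _) (norm_nonneg b))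
    _ = _ := by rw [norm_star]; ring

end Bimod

/-- A positive contraction `c` can be written as `2k - k²` with `k` selfadjoint, that is,
`1 - c = (1 - k)²`. -/
lemma exists_two_smul_sub_mul_self [PartialOrder B] [StarOrderedRing B] {c : B} (hc : 0 ≤ c)
    (hc' : ‖c‖ ≤ 1) : ∃ k : B, star k = k ∧ k + k - k * k = c := by
  have hsa : IsSelfAdjoint c := IsSelfAdjoint.of_nonneg hc
  have hf0 : (fun x : ℝ => 1 - √(1 - x)) 0 = 0 := by simp
  have hfc : ContinuousOn (fun x : ℝ => 1 - √(1 - x)) (quasispectrum ℝ c) := by fun_prop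
  refine ⟨cfcₙ (fun x : ℝ => 1 - √(1 - x)) c, cfcₙ_predicate (R := ℝ) _ c, ?_⟩
  rw [← cfcₙ_add .., ← cfcₙ_mul .., ← cfcₙ_sub (R := ℝ) _ _ c]
  conv_rhs => rw [← cfcₙ_id' ℝ c]
  refine cfcₙ_congr fun x hx => ?_
  have hx1 : x ≤ 1 := by
    have := NonUnitalIsometricContinuousFunctionalCalculus.norm_quasispectrum_le (𝕜 := ℝ) c hx
    exact (le_abs_self x).trans (this.trans hc')
  have := Real.mul_self_sqrt (sub_nonneg.2 hx1)
  linarith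

namespace Bimod

variable (E : Bimod B)

/-- The representation of `B` on a bimodule is contractive. -/
lemma norm_lsmul_le (b : B) (x : E) : ‖E.lsmul b x‖ ≤ ‖b‖ * ‖x‖ := by
  let _ := CStarAlgebra.spectralOrder B
  have := CStarAlgebra.spectralOrderedRing B
  have pos : ∀ z : E, 0 ≤ E.ip z z := fun z => by
    obtain ⟨b, hb⟩ := E.ip_self_pos z
    rw [hb]
    exact star_mul_self_nonneg b
  by_cases hb : b = 0
  · have : E.lsmul b x = 0 := by rw [hb, ← zero_smul ℂ (0 : B), E.lsmul_smul, zero_smul]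
    rw [this, norm_zero]
    positivity
  have hb' : 0 < ‖b‖ := norm_pos_iff.2 hb
  set t : ℝ := (‖b‖ ^ 2)⁻¹ with ht
  have ht0 : 0 ≤ t := by positivity
  obtain ⟨k, hk, hk'⟩ := exists_two_smul_sub_mul_self (c := t • (star b * b))
    (smul_nonneg ht0 (star_mul_self_nonneg b)) (by
      rw [norm_smul, CStarRing.norm_star_mul_self, Real.norm_of_nonneg ht0, ht, ← sq]
      exact (inv_mul_cancel₀ (by positivity)).le)
  -- with `b⋆b / ‖b‖² = 2k - k²`, the element `⟨x - k x | x - k x⟩` is positive and equals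
  -- `⟨x|x⟩ - ⟨b x | b x⟩ / ‖b‖²`
  have h1 : E.ip (x - E.lsmul k x) (x - E.lsmul k x) =
      E.ip x x - t • E.ip (E.lsmul b x) (E.lsmul b x) := by
    have h2 : E.ip x (E.lsmul ((t : ℂ) • (star b * b)) x) =
        t • E.ip (E.lsmul b x) (E.lsmul b x) := by
      rw [E.lsmul_smul, E.ip_smul_right, E.lsmul_mul, E.ip_lsmul (star b), star_star,
        Complex.coe_smul]
    rw [← h2, Complex.coe_smul, ← hk']
    have h3 : E.lsmul (k + k - k * k) x = E.lsmul k x + E.lsmul k x - E.lsmul k (E.lsmul k x) := by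
      rw [sub_eq_add_neg, ← neg_one_smul ℂ, E.lsmul_add, E.lsmul_add, E.lsmul_smul, E.lsmul_mul,
        neg_one_smul, ← sub_eq_add_neg]
    have h4 : ∀ y, E.ip (E.lsmul k x) y = E.ip x (E.lsmul k y) := fun y => by
      rw [E.ip_lsmul, hk]
    simp only [h3, ip_sub_left, ip_sub_right, E.ip_add_right, h4]
    abel
  have h5 := pos (x - E.lsmul k x)
  rw [h1, sub_nonneg] at h5
  have h6 := CStarAlgebra.norm_le_norm_of_nonneg_of_le (smul_nonneg ht0 (pos _)) h5
  rw [norm_smul, ← E.norm_sq, ← E.norm_sq, Real.norm_of_nonneg ht0, ht,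
    inv_mul_le_iff₀ (by positivity), ← mul_pow] at h6
  exact le_of_sq_le_sq h6 (by positivity)

/-- The left action of `B`, as a bounded bilinear map. -/
def lm : B →L[ℂ] E →L[ℂ] E :=
  LinearMap.mkContinuous₂
    (LinearMap.mk₂ ℂ E.lsmul E.lsmul_add E.lsmul_smul E.lsmul_add_right
      (fun w b x => E.lsmul_smul_right w b x)) 1
    fun b x => by simpa using E.norm_lsmul_le b x

/-- The right action of `B`, as a bounded bilinear map. -/
def rm : B →L[ℂ] E →L[ℂ] E :=
  LinearMap.mkContinuous₂
    (LinearMap.mk₂ ℂ (fun b x => E.rsmul x b) (fun b c x => E.rsmul_add_right x b c)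
      (fun w b x => E.rsmul_smul w x b) (fun b x y => E.rsmul_add x y b)
      (fun w b x => E.smul_rsmul w x b)) 1
    fun b x => by simpa using E.norm_rsmul_le b x

lemma lm_apply (b : B) (x : E) : E.lm b x = E.lsmul b x := rfl

lemma rm_apply (b : B) (x : E) : E.rm b x = E.rsmul x b := rfl

lemma norm_lm_le (b : B) : ‖E.lm b‖ ≤ ‖b‖ :=
  ContinuousLinearMap.opNorm_le_bound _ (norm_nonneg b) (E.norm_lsmul_le b)

lemma norm_rm_le (b : B) : ‖E.rm b‖ ≤ ‖b‖ :=
  ContinuousLinearMap.opNorm_le_bound _ (norm_nonneg b) (E.norm_rsmul_le b)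

lemma lsmul_sub_right (b : B) (x y : E) : E.lsmul b (x - y) = E.lsmul b x - E.lsmul b y :=
  (E.lm b).map_sub x y

lemma rsmul_sub (x y : E) (b : B) : E.rsmul (x - y) b = E.rsmul x b - E.rsmul y b :=
  (E.rm b).map_sub x y

variable {E} in
lemma tendsto_lsmul {ι : Type*} {l : Filter ι} {f : ι → B} {g : ι → E} {b : B} {x : E}
    (hf : Tendsto f l (𝓝 b)) (hg : Tendsto g l (𝓝 x)) :
    Tendsto (fun i => E.lsmul (f i) (g i)) l (𝓝 (E.lsmul b x)) :=
  (isBoundedBilinearMap_apply.continuous.tendsto (E.lm b, _)).comp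
    (((E.lm.continuous.tendsto b).comp hf).prodMk_nhds hg)

variable {E} in
lemma tendsto_rsmul {ι : Type*} {l : Filter ι} {f : ι → B} {g : ι → E} {b : B} {x : E}
    (hf : Tendsto f l (𝓝 b)) (hg : Tendsto g l (𝓝 x)) :
    Tendsto (fun i => E.rsmul (g i) (f i)) l (𝓝 (E.rsmul x b)) :=
  (isBoundedBilinearMap_apply.continuous.tendsto (E.rm b, _)).comp
    (((E.rm.continuous.tendsto b).comp hf).prodMk_nhds hg)

/-- The closed submodule `[Dom(θ) E]`. -/
def lspan (θ : PAut B) : Set E := clspan {y : E | ∃ c ∈ θ.dom, ∃ η, y = E.lsmul c η}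

/-- The closed submodule `[E Dom(θ)]`. -/
def rspan (θ : PAut B) : Set E := clspan {x : E | ∃ y, ∃ b ∈ θ.dom, x = E.rsmul y b}

end Bimod

lemma isClosed_setOf_tendsto_apply {V ι : Type*} [NormedAddCommGroup V] [NormedSpace ℂ V]
    {l : Filter ι} {A : ι → V →L[ℂ] V} (hA : ∀ᶠ i in l, ‖A i‖ ≤ 1) :
    IsClosed {x | Tendsto (fun i => A i x) l (𝓝 x)} := by
  refine isClosed_of_closure_subset fun x hx => ?_
  rw [Set.mem_ofPred, Metric.tendsto_nhds]
  intro ε hε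
  obtain ⟨y, hy, hxy⟩ := Metric.mem_closure_iff.1 hx (ε / 3) (by positivity)
  filter_upwards [hA, Metric.tendsto_nhds.1 hy (ε / 3) (by positivity)] with i hi hi'
  have h1 : dist (A i x) (A i y) ≤ dist x y := by
    rw [dist_eq_norm, dist_eq_norm, ← map_sub]
    simpa using (A i).le_of_opNorm_le hi (x - y)
  have := dist_triangle4_right (A i x) x (A i y) y
  linarith

namespace Bimod

variable {E : Bimod B} {θ : PAut B}

lemma lsmul_mem_lspan {b : B} (hb : b ∈ θ.dom) (x : E) : E.lsmul b x ∈ E.lspan θ :=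
  mem_clspan ⟨b, hb, x, rfl⟩

lemma rsmul_mem_rspan {b : B} (hb : b ∈ θ.dom) (x : E) : E.rsmul x b ∈ E.rspan θ :=
  mem_clspan ⟨x, b, hb, rfl⟩

/-- Approximate units of `Dom θ` converge strongly to the identity on `[Dom(θ) E]`. -/
lemma tendsto_lsmul_of_mem_lspan {l : Filter B}
    (hl : ∀ᶠ e in l, e ∈ θ.dom ∧ star e = e ∧ ‖e‖ ≤ 1)
    (hl' : ∀ x ∈ θ.dom, Tendsto (fun e => e * x) l (𝓝 x) ∧ Tendsto (fun e => x * e) l (𝓝 x))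
    {x : E} (hx : x ∈ E.lspan θ) : Tendsto (fun e => E.lsmul e x) l (𝓝 x) := by
  refine clspan_induction (p := fun x => Tendsto (fun e => E.lm e x) l (𝓝 x)) ?_
    (by simpa using tendsto_const_nhds)
    (fun x y hx hy => by simpa only [map_add] using hx.add hy)
    (fun z x hx => by simpa only [map_smul] using hx.const_smul z)
    (isClosed_setOf_tendsto_apply (hl.mono fun e he => (E.norm_lm_le e).trans he.2.2)) hx
  rintro _ ⟨c, hc, η, rfl⟩
  simp only [lm_apply, ← E.lsmul_mul]
  exact tendsto_lsmul (hl' c hc).1 tendsto_const_nhds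

lemma tendsto_rsmul_of_mem_rspan {l : Filter B}
    (hl : ∀ᶠ e in l, e ∈ θ.dom ∧ star e = e ∧ ‖e‖ ≤ 1)
    (hl' : ∀ x ∈ θ.dom, Tendsto (fun e => e * x) l (𝓝 x) ∧ Tendsto (fun e => x * e) l (𝓝 x))
    {x : E} (hx : x ∈ E.rspan θ) : Tendsto (fun e => E.rsmul x e) l (𝓝 x) := by
  refine clspan_induction (p := fun x => Tendsto (fun e => E.rm e x) l (𝓝 x)) ?_
    (by simpa using tendsto_const_nhds)
    (fun x y hx hy => by simpa only [map_add] using hx.add hy)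
    (fun z x hx => by simpa only [map_smul] using hx.const_smul z)
    (isClosed_setOf_tendsto_apply (hl.mono fun e he => (E.norm_rm_le e).trans he.2.2)) hx
  rintro _ ⟨η, c, hc, rfl⟩
  simp only [rm_apply, ← E.rsmul_mul]
  exact tendsto_rsmul (hl' c hc).2 tendsto_const_nhds

/-- An element of `[Dom(θ) E]` belongs to a closed set as soon as its multiples by elements of
`Dom θ` do. -/
lemma mem_of_lsmul_mem {x : E} (hx : x ∈ E.lspan θ) {S : Set E} (hS : IsClosed S)
    (h : ∀ e ∈ θ.dom, E.lsmul e x ∈ S) : x ∈ S := by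
  obtain ⟨l, _, hl, hl'⟩ := θ.exists_approximateUnit
  exact hS.mem_of_tendsto (tendsto_lsmul_of_mem_lspan hl hl' hx) (hl.mono fun e he => h e he.1)

lemma mem_of_rsmul_mem {x : E} (hx : x ∈ E.rspan θ) {S : Set E} (hS : IsClosed S)
    (h : ∀ e ∈ θ.dom, E.rsmul x e ∈ S) : x ∈ S := by
  obtain ⟨l, _, hl, hl'⟩ := θ.exists_approximateUnit
  exact hS.mem_of_tendsto (tendsto_rsmul_of_mem_rspan hl hl' hx) (hl.mono fun e he => h e he.1)

/-- Elements of `[Dom(θ) E]` are separated by the left action of `Dom θ`. -/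
lemma eq_of_lsmul_eq {x y : E} (hx : x ∈ E.lspan θ) (hy : y ∈ E.lspan θ)
    (h : ∀ e ∈ θ.dom, E.lsmul e x = E.lsmul e y) : x = y := by
  have := mem_of_lsmul_mem (sub_mem_clspan hx hy) (isClosed_singleton (x := (0 : E))) fun e he => by
    rw [lsmul_sub_right, h e he, sub_self]
    rfl
  exact sub_eq_zero.1 this

lemma eq_of_rsmul_eq {x y : E} (hx : x ∈ E.rspan θ) (hy : y ∈ E.rspan θ)
    (h : ∀ e ∈ θ.dom, E.rsmul x e = E.rsmul y e) : x = y := by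
  have := mem_of_rsmul_mem (sub_mem_clspan hx hy) (isClosed_singleton (x := (0 : E))) fun e he => by
    rw [rsmul_sub, h e he, sub_self]
    rfl
  exact sub_eq_zero.1 this

lemma lsmul_mem_lspan_of_mem (b : B) {x : E} (hx : x ∈ E.lspan θ) : E.lsmul b x ∈ E.lspan θ := by
  refine map_mem_clspan (E.lm b) ?_ hx
  rintro _ ⟨c, hc, η, rfl⟩
  rw [lm_apply, ← E.lsmul_mul]
  exact lsmul_mem_lspan (θ.dom_ideal.mul_mem_left b hc) η

lemma rsmul_mem_lspan_of_mem (b : B) {x : E} (hx : x ∈ E.lspan θ) : E.rsmul x b ∈ E.lspan θ := by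
  refine map_mem_clspan (E.rm b) ?_ hx
  rintro _ ⟨c, hc, η, rfl⟩
  rw [rm_apply, ← E.lsmul_rsmul]
  exact lsmul_mem_lspan hc _

lemma rsmul_mem_rspan_of_mem (b : B) {x : E} (hx : x ∈ E.rspan θ) : E.rsmul x b ∈ E.rspan θ := by
  refine map_mem_clspan (E.rm b) ?_ hx
  rintro _ ⟨η, c, hc, rfl⟩
  rw [rm_apply, ← E.rsmul_mul]
  exact rsmul_mem_rspan (θ.dom_ideal.mul_mem_right b hc) η

lemma lsmul_mem_rspan_of_mem (b : B) {x : E} (hx : x ∈ E.rspan θ) : E.lsmul b x ∈ E.rspan θ := by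
  refine map_mem_clspan (E.lm b) ?_ hx
  rintro _ ⟨η, c, hc, rfl⟩
  rw [lm_apply, E.lsmul_rsmul]
  exact rsmul_mem_rspan hc _

lemma ip_mem_dom {x : E} (hx : x ∈ E.rspan θ) (y : E) : E.ip y x ∈ θ.dom := by
  refine clspan_induction (p := fun x => E.ipL y x ∈ θ.dom) ?_ ?_ ?_ ?_ ?_ hx
  · rintro _ ⟨η, c, hc, rfl⟩
    rw [ipL_apply, E.ip_rsmul]
    exact θ.dom_ideal.mul_mem_left _ hc
  · rw [_root_.map_zero]
    exact θ.dom_ideal.zero_mem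
  · intro x y hx hy
    rw [_root_.map_add]
    exact θ.dom_ideal.add_mem hx hy
  · intro z x hx
    rw [_root_.map_smul]
    exact θ.dom_ideal.smul_mem z hx
  · exact θ.dom_ideal.isClosed.preimage (E.ipL y).continuous

lemma mem_rspan_of_ip_mem {x : E} (hx : E.ip x x ∈ θ.dom) : x ∈ E.rspan θ := by
  obtain ⟨l, _, hl, hl'⟩ := θ.exists_approximateUnit
  have key : Tendsto (fun e => E.rsmul x e) l (𝓝 x) := by
    rw [tendsto_iff_norm_sub_tendsto_zero]
    set a := E.ip x x
    have h1 : Tendsto (fun e => 2 * ‖a * e - a‖) l (𝓝 0) := by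
      simpa using (tendsto_iff_norm_sub_tendsto_zero.1 (hl' a hx).2).const_mul 2
    have h2 : ∀ᶠ e in l, ‖E.rsmul x e - x‖ ^ 2 ≤ 2 * ‖a * e - a‖ := hl.mono fun e he => by
      have : E.ip (E.rsmul x e - x) (E.rsmul x e - x) = e * (a * e - a) - (a * e - a) := by
        simp only [ip_sub_left, ip_sub_right, E.ip_rsmul, ip_rsmul_left, he.2.1, mul_sub, sub_mul,
          mul_assoc, a]
        abel
      rw [E.norm_sq, this, two_mul]
      refine (norm_sub_le _ _).trans (add_le_add_left ((norm_mul_le _ _).trans ?_) _)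
      exact mul_le_of_le_one_left (norm_nonneg _) he.2.2
    have h3 : Tendsto (fun e => ‖E.rsmul x e - x‖ ^ 2) l (𝓝 0) :=
      squeeze_zero' (Eventually.of_forall fun _ => by positivity) h2 h1
    simpa using h3.sqrt
  exact (isClosed_clspan _).mem_of_tendsto key (hl.mono fun e he => rsmul_mem_rspan he.1 x)

lemma mem_lspan_one (x : E) : x ∈ E.lspan 1 := by
  have h : x ∈ clspan {x | ∃ b y, x = E.lsmul b y} := E.nondegenerate ▸ Set.mem_univ x
  refine clspan_mono ?_ h
  rintro _ ⟨b, y, rfl⟩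
  exact ⟨b, ⟨b, PAut.mem_one.2 rfl⟩, y, rfl⟩

lemma mem_rspan_one (x : E) : x ∈ E.rspan 1 :=
  mem_rspan_of_ip_mem ⟨_, PAut.mem_one.2 rfl⟩

lemma mem_lspan_self {x : B} : x ∈ (Bimod.self B).lspan θ ↔ x ∈ θ.dom := by
  refine ⟨fun h => ?_, fun h => ?_⟩
  · refine clspan_induction (p := fun x => x ∈ θ.dom) ?_ θ.dom_ideal.zero_mem
      (fun _ _ => θ.dom_ideal.add_mem) (fun z _ => θ.dom_ideal.smul_mem z)
      θ.dom_ideal.isClosed h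
    rintro _ ⟨c, hc, y, rfl⟩
    exact θ.dom_ideal.mul_mem_right y hc
  · obtain ⟨l, _, hl, hl'⟩ := θ.exists_approximateUnit
    exact (isClosed_clspan _).mem_of_tendsto (hl' x h).1
      (hl.mono fun e he => lsmul_mem_lspan (E := Bimod.self B) he.1 x)

lemma mem_rspan_self {x : B} : x ∈ (Bimod.self B).rspan θ ↔ x ∈ θ.dom := by
  refine ⟨fun h => ?_, fun h => ?_⟩
  · refine clspan_induction (p := fun x => x ∈ θ.dom) ?_ θ.dom_ideal.zero_mem
      (fun _ _ => θ.dom_ideal.add_mem) (fun z _ => θ.dom_ideal.smul_mem z)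
      θ.dom_ideal.isClosed h
    rintro _ ⟨y, c, hc, rfl⟩
    exact θ.dom_ideal.mul_mem_left y hc
  · exact mem_rspan_of_ip_mem (E := Bimod.self B) (θ.dom_ideal.mul_mem_left _ h)

end Bimod

/-! ### Homogeneous elements -/

section HomogeneousElements

variable {E : Bimod B} {θ σ : PAut B}

lemma hmg_rsmul {x : E} (hx : x ∈ hmg E θ) {b c : B} (h : (b, c) ∈ θ.graph) :
    E.rsmul x b = E.lsmul c x := hx.2 b c h

lemma hmg_rspan {x : E} (hx : x ∈ hmg E θ) : x ∈ E.rspan θ := hx.1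

lemma hmg_lspan {x : E} (hx : x ∈ hmg E θ) : x ∈ E.lspan θ⁻¹ :=
  Bimod.mem_of_rsmul_mem (hmg_rspan hx) (isClosed_clspan _) fun e ⟨c, hc⟩ => by
    rw [hmg_rsmul hx hc]
    exact Bimod.lsmul_mem_lspan ⟨e, hc⟩ x

lemma zero_mem_hmg : (0 : E) ∈ hmg E θ :=
  ⟨zero_mem_clspan _, fun b c _ => by rw [← E.rm_apply, ← E.lm_apply, map_zero, map_zero]⟩

lemma add_mem_hmg {x y : E} (hx : x ∈ hmg E θ) (hy : y ∈ hmg E θ) : x + y ∈ hmg E θ :=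
  ⟨add_mem_clspan hx.1 hy.1, fun b c h => by
    rw [E.rsmul_add, E.lsmul_add_right, hx.2 b c h, hy.2 b c h]⟩

lemma smul_mem_hmg (z : ℂ) {x : E} (hx : x ∈ hmg E θ) : z • x ∈ hmg E θ :=
  ⟨smul_mem_clspan z hx.1, fun b c h => by
    rw [E.smul_rsmul, E.lsmul_smul_right, hx.2 b c h]⟩

lemma isClosed_hmg : IsClosed (hmg E θ) := by
  have : hmg E θ = E.rspan θ ∩ ⋂ b, ⋂ c, ⋂ (_ : (b, c) ∈ θ.graph), {x | E.rm b x = E.lm c x} := by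
    ext x
    simp only [Set.mem_inter_iff, Set.mem_iInter]
    rfl
  rw [this]
  exact (isClosed_clspan _).inter (isClosed_iInter fun b => isClosed_iInter fun c =>
    isClosed_iInter fun _ => isClosed_eq (E.rm b).continuous (E.lm c).continuous)

lemma hmg_mono (h : σ ≤ θ) : hmg E σ ⊆ hmg E θ := by
  intro x hx
  refine ⟨clspan_mono ?_ hx.1, fun b c hb => ?_⟩
  · rintro _ ⟨y, b, ⟨c, hc⟩, rfl⟩
    exact ⟨y, b, ⟨c, h hc⟩, rfl⟩
  · refine Bimod.eq_of_lsmul_eq (Bimod.rsmul_mem_lspan_of_mem _ (hmg_lspan hx))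
      (Bimod.lsmul_mem_lspan_of_mem _ (hmg_lspan hx)) ?_
    rintro k ⟨y, hy : (y, k) ∈ σ.graph⟩
    obtain ⟨d, hd⟩ := σ.dom_ideal.mul_mem_right b ⟨k, hy⟩
    have : d = k * c := θ.map_unique (h hd) (θ.map_mul (h hy) hb)
    rw [E.lsmul_rsmul, ← hx.2 y k hy, ← E.rsmul_mul, hx.2 _ _ hd, this, E.lsmul_mul]

lemma mem_hmg_self {b : B} :
    b ∈ hmg (Bimod.self B) θ ↔ b ∈ θ.dom ∧ ∀ x y, (x, y) ∈ θ.graph → b * x = y * b :=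
  and_congr_left' Bimod.mem_rspan_self

lemma hmg_self_mul {b x y : B} (hb : b ∈ hmg (Bimod.self B) θ) (h : (x, y) ∈ θ.graph) :
    b * x = y * b := hb.2 x y h

lemma hmg_self_dom {b : B} (hb : b ∈ hmg (Bimod.self B) θ) : b ∈ θ.dom := (mem_hmg_self.1 hb).1

lemma hmg_self_img {b : B} (hb : b ∈ hmg (Bimod.self B) θ) : b ∈ θ.img :=
  Bimod.mem_lspan_self.1 (hmg_lspan hb)

lemma star_mem_hmg {b : B} (hb : b ∈ hmg (Bimod.self B) θ) :
    star b ∈ hmg (Bimod.self B) θ⁻¹ :=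
  mem_hmg_self.2 ⟨θ.star_mem_img (hmg_self_img hb), fun x y (h : (y, x) ∈ θ.graph) => by
    simpa using congrArg star (hmg_self_mul hb (θ.map_star h)).symm⟩

/-- `B_σ E_θ ⊆ E_{σθ}`. -/
lemma lsmul_mem_hmg {b : B} {x : E} (hb : b ∈ hmg (Bimod.self B) σ) (hx : x ∈ hmg E θ) :
    E.lsmul b x ∈ hmg E (σ * θ) := by
  refine ⟨?_, fun y z ⟨m, h, h'⟩ => ?_⟩
  · -- `b e (c x)` with `e ∈ Dom σ` and `c ∈ Img θ` equals `(b x) g` with `θ(g) = e c`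
    refine Bimod.mem_of_rsmul_mem (E := Bimod.self B) (S := {b | E.lsmul b x ∈ E.rspan (σ * θ)})
      (hmg_rspan hb) ((isClosed_clspan _).preimage (E.lm.flip x).continuous) fun e he => ?_
    refine Bimod.mem_of_lsmul_mem (S := {x | E.lsmul (b * e) x ∈ E.rspan (σ * θ)}) (hmg_lspan hx)
      ((isClosed_clspan _).preimage (E.lm (b * e)).continuous) fun c hc => ?_
    obtain ⟨g, (hg : (g, e * c) ∈ θ.graph)⟩ := θ⁻¹.dom_ideal.mul_mem_left e hc
    obtain ⟨d, hd⟩ := σ.dom_ideal.mul_mem_right c he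
    rw [Set.mem_ofPred, ← E.lsmul_mul, mul_assoc, E.lsmul_mul, ← hmg_rsmul hx hg, E.lsmul_rsmul]
    exact Bimod.rsmul_mem_rspan (θ := σ * θ) ⟨d, PAut.mem_mul.2 ⟨_, hg, hd⟩⟩ _
  · rw [← E.lsmul_rsmul, hmg_rsmul hx h, ← E.lsmul_mul, hmg_self_mul hb h', E.lsmul_mul]

lemma mul_mem_hmg {a b : B} (ha : a ∈ hmg (Bimod.self B) σ) (hb : b ∈ hmg (Bimod.self B) θ) :
    a * b ∈ hmg (Bimod.self B) (σ * θ) := lsmul_mem_hmg (E := Bimod.self B) ha hb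

/-- `⟨E_σ|E_θ⟩ ⊆ B_{σ⋆θ}`. -/
lemma ip_mem_hmg {x y : E} (hx : x ∈ hmg E σ) (hy : y ∈ hmg E θ) :
    E.ip x y ∈ hmg (Bimod.self B) (σ⁻¹ * θ) := by
  refine mem_hmg_self.2 ⟨?_, fun b c ⟨m, h, h'⟩ => ?_⟩
  · refine Bimod.mem_of_lsmul_mem (S := {x | E.ip x y ∈ (σ⁻¹ * θ).dom}) (hmg_lspan hx)
      ((σ⁻¹ * θ).dom_ideal.isClosed.preimage
        (E.continuous_ip.comp (Continuous.prodMk_left y))) fun e he => ?_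
    refine Bimod.mem_of_lsmul_mem (S := {y | E.ip (E.lsmul e x) y ∈ (σ⁻¹ * θ).dom}) (hmg_lspan hy)
      ((σ⁻¹ * θ).dom_ideal.isClosed.preimage (E.ipL _).continuous) fun c hc => ?_
    obtain ⟨g, (hg : (g, star e * c) ∈ θ.graph)⟩ := θ⁻¹.dom_ideal.mul_mem_left (star e) hc
    obtain ⟨d, hd⟩ := σ⁻¹.dom_ideal.mul_mem_right c (σ⁻¹.star_mem_dom he)
    rw [Set.mem_ofPred, Bimod.ip_lsmul_left, ← E.lsmul_mul, ← hmg_rsmul hy hg, E.ip_rsmul]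
    exact (σ⁻¹ * θ).dom_ideal.mul_mem_left _ ⟨d, _, hg, hd⟩
  · rw [← E.ip_rsmul, hmg_rsmul hy h, E.ip_lsmul, ← hmg_rsmul hx (σ.map_star h'),
      Bimod.ip_rsmul_left, star_star]

end HomogeneousElements

/-! ### Homogeneous operators -/

section Adjoints

variable {E F G : Bimod B} {σ τ : PAut B}

lemma PAut.Compatible.map_mul' {σ ρ : PAut B} (h : PAut.Compatible σ ρ) {b b' y y' : B}
    (hb : (b, b') ∈ σ.graph) (hy : (y, y') ∈ ρ.graph) : (y * b, y' * b') ∈ ρ.graph := by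
  simpa using ρ.map_star (h.map_mul (σ.map_star hb) (ρ.map_star hy))

namespace IsAdjoint

lemma unique {T : E → F} {S S' : F → E} (h : IsAdjoint σ T S) (h' : IsAdjoint σ T S') : S = S' :=
  funext fun η => Bimod.ext_ip fun ξ => by
    rw [← E.star_ip, σ.map_injective (h ξ η) (h' ξ η), E.star_ip]

lemma symm {T : E → F} {S : F → E} (h : IsAdjoint σ T S) : IsAdjoint σ⁻¹ S T := fun η ξ => by
  have := σ.map_star (h ξ η)
  rwa [E.star_ip, F.star_ip] at this

lemma mono {T : E → F} {S : F → E} (h : IsAdjoint σ T S) (hσ : σ ≤ τ) : IsAdjoint τ T S :=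
  fun ξ η => hσ (h ξ η)

lemma comp {T : E → F} {S : F → E} {T' : F → G} {S' : G → F} (h' : IsAdjoint τ T' S')
    (h : IsAdjoint σ T S) : IsAdjoint (τ * σ) (T' ∘ T) (S ∘ S') := fun ξ ζ =>
  PAut.mem_mul.2 ⟨_, h ξ (S' ζ), h' (T ξ) ζ⟩

lemma clm_comp {T : E →L[ℂ] F} {S : F →L[ℂ] E} {T' : F →L[ℂ] G} {S' : G →L[ℂ] F}
    (h' : IsAdjoint τ T' S') (h : IsAdjoint σ T S) : IsAdjoint (τ * σ) (T' ∘L T) (S ∘L S') :=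
  h'.comp h

lemma norm_sq_le {T : E → F} {S : F → E} (h : IsAdjoint σ T S) (ξ : E) :
    ‖T ξ‖ ^ 2 ≤ ‖S (T ξ)‖ * ‖ξ‖ := by
  rw [F.norm_sq, σ.norm_eq (h ξ (T ξ))]
  exact E.norm_ip_le _ _

lemma add {T T' : E →L[ℂ] F} {S S' : F →L[ℂ] E} (h : IsAdjoint σ T S) (h' : IsAdjoint σ T' S') :
    IsAdjoint σ (T + T' : E →L[ℂ] F) (S + S' : F →L[ℂ] E) := fun ξ η => by
  simp only [_root_.add_apply, E.ip_add_left, F.ip_add_right]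
  exact σ.map_add (h ξ η) (h' ξ η)

lemma sub {T T' : E →L[ℂ] F} {S S' : F →L[ℂ] E} (h : IsAdjoint σ T S) (h' : IsAdjoint σ T' S') :
    IsAdjoint σ (T - T' : E →L[ℂ] F) (S - S' : F →L[ℂ] E) := fun ξ η => by
  simp only [_root_.sub_apply, E.ip_sub_left, F.ip_sub_right]
  exact σ.map_sub (h ξ η) (h' ξ η)

lemma smul {T : E →L[ℂ] F} {S : F →L[ℂ] E} (h : IsAdjoint σ T S) (z : ℂ) :
    IsAdjoint σ (z • T : E →L[ℂ] F) (star z • S : F →L[ℂ] E) := fun ξ η => by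
  simp only [_root_.smul_apply, E.ip_smul_left, F.ip_smul_right, star_star]
  exact σ.map_smul z (h ξ η)

lemma zero : IsAdjoint σ (0 : E →L[ℂ] F) (0 : F →L[ℂ] E) := fun ξ η => by
  simp only [_root_.zero_apply, E.ip_zero_left, F.ip_zero_right]
  exact σ.map_zero

lemma norm_le {T : E →L[ℂ] F} {S : F → E} (h : IsAdjoint σ T S) (η : F) :
    ‖S η‖ ≤ ‖T‖ * ‖η‖ := by
  have h1 := h.symm.norm_sq_le η
  have h2 := mul_le_mul_of_nonneg_right (T.le_opNorm (S η)) (norm_nonneg η)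
  by_cases h0 : ‖S η‖ = 0
  · rw [h0]
    positivity
  have h3 : 0 < ‖S η‖ := lt_of_le_of_ne (norm_nonneg _) (Ne.symm h0)
  nlinarith

lemma norm_eq {T : E →L[ℂ] F} {S : F →L[ℂ] E} (h : IsAdjoint σ T S) : ‖S‖ = ‖T‖ :=
  le_antisymm (S.opNorm_le_bound (norm_nonneg _) h.norm_le)
    (T.opNorm_le_bound (norm_nonneg _) h.symm.norm_le)

/-- Adjoints are automatically linear and bounded. -/
lemma exists_clm {T : E →L[ℂ] F} {S : F → E} (h : IsAdjoint σ T S) :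
    ∃ S' : F →L[ℂ] E, ⇑S' = S := by
  refine ⟨LinearMap.mkContinuous ⟨⟨S, fun x y => ?_⟩, fun z x => ?_⟩ ‖T‖ h.norm_le, rfl⟩
  · refine Bimod.ext_ip fun ξ => ?_
    rw [← E.star_ip, E.ip_add_right, ← E.star_ip (S x), ← E.star_ip (S y), ← star_add]
    refine congrArg star (σ.map_injective (h ξ (x + y)) ?_)
    rw [F.ip_add_left]
    exact σ.map_add (h ξ x) (h ξ y)
  · refine Bimod.ext_ip fun ξ => ?_
    simp only [RingHom.id_apply]
    rw [← E.star_ip, E.ip_smul_right, ← E.star_ip (S x), ← star_star z, ← star_smul, star_star]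
    refine congrArg star (σ.map_injective (h ξ (z • x)) ?_)
    rw [F.ip_smul_left]
    exact σ.map_smul _ (h ξ x)

/-- Limits of operators with an adjoint in a closed set have an adjoint in this set. -/
lemma of_mem_closure {K : Set (F →L[ℂ] E)} (hK : IsClosed K) {T : E →L[ℂ] F}
    (hT : T ∈ closure {T : E →L[ℂ] F | ∃ S ∈ K, IsAdjoint σ T S}) :
    ∃ S ∈ K, IsAdjoint σ T S := by
  obtain ⟨t, ht, hT⟩ := mem_closure_iff_seq_limit.1 hT
  choose s hK' hs using ht
  have hc : CauchySeq s := by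
    have := hT.cauchySeq
    rw [Metric.cauchySeq_iff] at this ⊢
    simp only [dist_eq_norm, ((hs _).sub (hs _)).norm_eq] at this ⊢
    exact this
  obtain ⟨S, hS⟩ := cauchySeq_tendsto_of_complete hc
  refine ⟨S, hK.mem_of_tendsto hS (Eventually.of_forall hK'), fun ξ η => ?_⟩
  have ev : ∀ (V W : Bimod B) (x : V), Continuous fun A : V →L[ℂ] W => A x := fun V W x =>
    (ContinuousLinearMap.apply ℂ W x).continuous
  exact σ.mem_graph_of_tendsto
    (Bimod.tendsto_ip (((ev _ _ η).tendsto S).comp hS) tendsto_const_nhds)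
    (Bimod.tendsto_ip tendsto_const_nhds (((ev _ _ ξ).tendsto T).comp hT))
    (Eventually.of_forall fun n => hs n ξ η)

end IsAdjoint

end Adjoints

namespace IsHomogeneous

variable {E F G : Bimod B} {ρ σ ρ' σ' : PAut B} {T : E →L[ℂ] F}

lemma mem_lspan (h : IsHomogeneous ρ σ T) (ξ : E) : T ξ ∈ F.lspan ρ⁻¹ := h.img ξ

lemma exists_adjoint (h : IsHomogeneous ρ σ T) : ∃ S : F →L[ℂ] E, IsAdjoint σ T S := by
  obtain ⟨S, hS⟩ := h.adjointable
  obtain ⟨S', rfl⟩ := hS.exists_clm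
  exact ⟨S', hS⟩

lemma mk' (h : ∀ ξ, T ξ ∈ F.lspan ρ⁻¹)
    (h' : ∀ a a', (a, a') ∈ ρ.graph → ∀ ξ, T (E.lsmul a ξ) = F.lsmul a' (T ξ))
    {S : F →L[ℂ] E} (hS : IsAdjoint σ T S) : IsHomogeneous ρ σ T :=
  ⟨h, h', S, hS⟩

lemma mono (h : IsHomogeneous ρ σ T) (hρ : ρ ≤ ρ') (hσ : σ ≤ σ') : IsHomogeneous ρ' σ' T := by
  obtain ⟨S, hS⟩ := h.exists_adjoint
  refine mk' (fun ξ => ?_) (fun a a' ha ξ => ?_) (hS.mono hσ)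
  · refine clspan_mono ?_ (h.mem_lspan ξ)
    rintro _ ⟨c, ⟨d, hd⟩, η, rfl⟩
    exact ⟨c, ⟨d, hρ hd⟩, η, rfl⟩
  · have key : ∀ k ∈ ρ⁻¹.dom, F.lsmul k (T (E.lsmul a ξ)) = F.lsmul k (F.lsmul a' (T ξ)) := by
      rintro k ⟨y, hy : (y, k) ∈ ρ.graph⟩
      obtain ⟨d, hd⟩ := ρ.dom_ideal.mul_mem_right a ⟨k, hy⟩
      have : d = k * a' := ρ'.map_unique (hρ hd) (ρ'.map_mul (hρ hy) ha)
      rw [← h.map_lsmul y k hy, ← E.lsmul_mul, h.map_lsmul _ _ hd, this, F.lsmul_mul]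
    exact Bimod.eq_of_lsmul_eq (h.mem_lspan _) (Bimod.lsmul_mem_lspan_of_mem _ (h.mem_lspan _)) key

lemma map_rsmul (h : IsHomogeneous ρ σ T) {y z : B} (hy : (y, z) ∈ σ.graph) (ξ : E) :
    T (E.rsmul ξ y) = F.rsmul (T ξ) z := by
  obtain ⟨S, hS⟩ := h.exists_adjoint
  refine Bimod.ext_ip fun η => ?_
  refine σ.map_unique (hS _ η) ?_
  rw [E.ip_rsmul, F.ip_rsmul]
  exact σ.map_mul (hS ξ η) hy

lemma mem_rspan (h : IsHomogeneous ρ σ T) (ξ : E) : T ξ ∈ F.rspan σ⁻¹ := by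
  obtain ⟨S, hS⟩ := h.exists_adjoint
  exact Bimod.mem_rspan_of_ip_mem ⟨_, hS ξ (T ξ)⟩

/-- An operator of degree `(ρ, σ)` intertwines the left actions along every partial automorphism
that is compatible with `ρ`. -/
lemma map_lsmul_of_compatible (h : IsHomogeneous ρ σ T) {τ : PAut B} (hτ : PAut.Compatible τ ρ)
    {b b' : B} (hb : (b, b') ∈ τ.graph) (ξ : E) : T (E.lsmul b ξ) = F.lsmul b' (T ξ) := by
  refine Bimod.eq_of_lsmul_eq (h.mem_lspan _) (Bimod.lsmul_mem_lspan_of_mem _ (h.mem_lspan _)) ?_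
  rintro k ⟨y, hy : (y, k) ∈ ρ.graph⟩
  rw [← h.map_lsmul y k hy, ← E.lsmul_mul, h.map_lsmul _ _ (hτ.map_mul' hb hy), F.lsmul_mul]

/-- An operator of degree `(ρ, σ)` intertwines the right actions along every partial automorphism
that is compatible with `σ`. -/
lemma map_rsmul_of_compatible (h : IsHomogeneous ρ σ T) {τ : PAut B} (hτ : PAut.Compatible τ σ)
    {b b' : B} (hb : (b, b') ∈ τ.graph) (ξ : E) : T (E.rsmul ξ b) = F.rsmul (T ξ) b' := by
  refine Bimod.eq_of_rsmul_eq (h.mem_rspan _) (Bimod.rsmul_mem_rspan_of_mem _ (h.mem_rspan _)) ?_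
  rintro k ⟨y, hy : (y, k) ∈ σ.graph⟩
  rw [← h.map_rsmul hy, ← E.rsmul_mul, h.map_rsmul (hτ.map_mul hb hy), F.rsmul_mul]

/-- The adjoint of a homogeneous operator is homogeneous. -/
lemma adjoint (h : IsHomogeneous ρ σ T) {S : F →L[ℂ] E} (hS : IsAdjoint σ T S) :
    IsHomogeneous ρ⁻¹ σ⁻¹ S := by
  have h1 : ∀ a a', (a, a') ∈ ρ.graph → ∀ η, S (F.lsmul a' η) = E.lsmul a (S η) := by
    intro a a' ha η
    refine Bimod.ext_ip fun ξ => ?_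
    rw [← E.star_ip, ← E.star_ip (E.lsmul a (S η))]
    refine congrArg star (σ.map_injective (hS ξ _) ?_)
    rw [Bimod.ip_lsmul_left, Bimod.ip_lsmul_left, ← h.map_lsmul _ _ (ρ.map_star ha)]
    exact hS _ η
  refine mk' (fun η => ?_) (fun a' a ha η => h1 a a' ha η) hS.symm
  -- `S (e η) → S η` for an approximate unit `e` of `Img ρ`, as `‖S ζ‖² ≤ ‖ζ‖ ‖T S ζ‖`
  obtain ⟨l, _, hl, hl'⟩ := ρ⁻¹.exists_approximateUnit
  have key : Tendsto (fun e => S (F.lsmul e η)) l (𝓝 (S η)) := by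
    rw [tendsto_iff_norm_sub_tendsto_zero]
    have h2 := tendsto_iff_norm_sub_tendsto_zero.1
      (Bimod.tendsto_lsmul_of_mem_lspan hl hl' (h.mem_lspan (S η)))
    have h3 : ∀ᶠ e in l, ‖S (F.lsmul e η) - S η‖ ^ 2 ≤
        ‖F.lsmul e (T (S η)) - T (S η)‖ * (2 * ‖η‖) := hl.mono fun e ⟨⟨d, hd⟩, _, he⟩ => by
      have h4 : ‖F.lsmul e η - η‖ ≤ 2 * ‖η‖ := by
        refine (norm_sub_le _ _).trans ?_
        have := (F.norm_lsmul_le e η).trans (mul_le_of_le_one_left (norm_nonneg η) he)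
        linarith
      have h5 := hS.symm.norm_sq_le (F.lsmul e η - η)
      rw [map_sub, map_sub, h1 d e hd, h.map_lsmul d e hd] at h5
      rw [h1 d e hd]
      exact h5.trans (mul_le_mul_of_nonneg_left h4 (norm_nonneg _))
    have h6 : Tendsto (fun e => ‖S (F.lsmul e η) - S η‖ ^ 2) l (𝓝 0) :=
      squeeze_zero' (Eventually.of_forall fun _ => by positivity) h3
        (by simpa using h2.mul_const (2 * ‖η‖))
    simpa using h6.sqrt
  refine (isClosed_clspan _).mem_of_tendsto key (hl.mono fun e ⟨⟨d, hd⟩, _⟩ => ?_)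
  rw [h1 d e hd]
  exact Bimod.lsmul_mem_lspan (θ := ρ) ⟨e, hd⟩ _

lemma comp {T' : F →L[ℂ] G} (h' : IsHomogeneous ρ' σ' T') (h : IsHomogeneous ρ σ T) :
    IsHomogeneous (ρ' * ρ) (σ' * σ) (T' ∘L T) := by
  obtain ⟨S, hS⟩ := h.exists_adjoint
  obtain ⟨S', hS'⟩ := h'.exists_adjoint
  refine mk' (fun ξ => ?_) (fun a a' ⟨m, hm, hm'⟩ ξ => ?_) (hS'.clm_comp hS)
  · -- `T' (a T ξ)` with `a ∈ Img ρ` is approximated by `b T' (a T ξ) = T' (c a T ξ)`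
    refine Bimod.mem_of_lsmul_mem (θ := ρ'⁻¹) (h'.mem_lspan _) (isClosed_clspan _) ?_
    rintro b ⟨c, hc : (c, b) ∈ ρ'.graph⟩
    change G.lsmul b (T' (T ξ)) ∈ _
    rw [← h'.map_lsmul c b hc]
    refine Bimod.mem_of_lsmul_mem (θ := ρ⁻¹) (S := {x | T' (F.lsmul c x) ∈ G.lspan (ρ' * ρ)⁻¹})
      (h.mem_lspan _) ((isClosed_clspan _).preimage
        (T'.continuous.comp (F.lm c).continuous)) fun a ha => ?_
    obtain ⟨y, (hy : (y, c * a) ∈ ρ.graph)⟩ := ρ⁻¹.dom_ideal.mul_mem_left c ha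
    obtain ⟨z, hz⟩ := ρ'.dom_ideal.mul_mem_right a ⟨b, hc⟩
    rw [Set.mem_ofPred, ← F.lsmul_mul, h'.map_lsmul _ _ hz]
    exact Bimod.lsmul_mem_lspan (θ := (ρ' * ρ)⁻¹) ⟨y, PAut.mem_mul.2 ⟨_, hy, hz⟩⟩ _
  · rw [ContinuousLinearMap.comp_apply, h.map_lsmul _ _ hm, h'.map_lsmul _ _ hm']
    rfl

lemma zero : IsHomogeneous ρ σ (0 : E →L[ℂ] F) :=
  mk' (fun _ => zero_mem_clspan _)
    (fun a a' _ ξ => by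
      rw [← F.lm_apply]
      simp)
    IsAdjoint.zero

lemma add {T' : E →L[ℂ] F} (h : IsHomogeneous ρ σ T) (h' : IsHomogeneous ρ σ T') :
    IsHomogeneous ρ σ (T + T') := by
  obtain ⟨S, hS⟩ := h.exists_adjoint
  obtain ⟨S', hS'⟩ := h'.exists_adjoint
  exact mk' (fun ξ => add_mem_clspan (h.mem_lspan ξ) (h'.mem_lspan ξ))
    (fun a a' ha ξ => by
      simp only [_root_.add_apply, F.lsmul_add_right, h.map_lsmul _ _ ha,
        h'.map_lsmul _ _ ha])
    (hS.add hS')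

lemma smul (h : IsHomogeneous ρ σ T) (z : ℂ) : IsHomogeneous ρ σ (z • T) := by
  obtain ⟨S, hS⟩ := h.exists_adjoint
  exact mk' (fun ξ => smul_mem_clspan z (h.mem_lspan ξ))
    (fun a a' ha ξ => by
      simp only [_root_.smul_apply, F.lsmul_smul_right, h.map_lsmul _ _ ha])
    (hS.smul z)

lemma isClosed_setOf (ρ σ : PAut B) : IsClosed {T : E →L[ℂ] F | IsHomogeneous ρ σ T} := by
  refine isClosed_of_closure_subset fun T hT => ?_
  have ev : ∀ (x : E), Continuous fun A : E →L[ℂ] F => A x := fun x =>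
    (ContinuousLinearMap.apply ℂ F x).continuous
  obtain ⟨S, -, hS⟩ := IsAdjoint.of_mem_closure isClosed_univ (closure_mono
    (fun T (hT : IsHomogeneous ρ σ T) => hT.exists_adjoint.imp fun S hS => ⟨trivial, hS⟩) hT)
  refine mk' (fun ξ => ?_) (fun a a' ha ξ => ?_) hS
  · exact closure_minimal (t := {T : E →L[ℂ] F | T ξ ∈ F.lspan ρ⁻¹})
      (fun T (hT : IsHomogeneous ρ σ T) => hT.mem_lspan ξ)
      ((isClosed_clspan _).preimage (ev ξ)) hT
  · exact closure_minimal (t := {T : E →L[ℂ] F | T (E.lsmul a ξ) = F.lm a' (T ξ)})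
      (fun T (hT : IsHomogeneous ρ σ T) => hT.map_lsmul a a' ha ξ)
      (isClosed_eq (ev _) ((F.lm a').continuous.comp (ev ξ))) hT

lemma of_mem_clspan {S : Set (E →L[ℂ] F)} (hS : ∀ T ∈ S, IsHomogeneous ρ σ T)
    (hT : T ∈ clspan S) : IsHomogeneous ρ σ T :=
  clspan_induction (p := fun T => IsHomogeneous ρ σ T) hS zero (fun _ _ h h' => h.add h')
    (fun z _ h => h.smul z) (isClosed_setOf ρ σ) hT

end IsHomogeneous

/-! ### Extension of densely defined homogeneous operators -/

/-- If `a_k² ≤ a_{2k} a₀` and `a_k` grows at most like `r^k`, then `a₁ ≤ r a₀`. -/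
lemma le_mul_of_sq_le {a : ℕ → ℝ} (ha : ∀ k, 0 ≤ a k) (h : ∀ k, a k ^ 2 ≤ a (2 * k) * a 0)
    {C r : ℝ} (hr : 0 ≤ r) (hC : ∀ k, a k ≤ C * r ^ k) : a 1 ≤ r * a 0 := by
  by_contra! hlt
  have ha0 : 0 < a 0 := by
    by_contra! h0
    have h1 := h 1
    rw [le_antisymm h0 (ha 0), mul_zero] at h1
    have h2 : a 1 = 0 := by
      have := sq_nonneg (a 1)
      exact pow_eq_zero_iff two_ne_zero |>.1 (le_antisymm h1 this)
    have h3 := le_antisymm h0 (ha 0)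
    rw [h2, h3, mul_zero] at hlt
    exact lt_irrefl _ hlt
  -- put `q = a 1 / a 0 > r`; then `a (2^n) ≥ a 0 * q ^ (2^n)`
  set q := a 1 / a 0 with hq
  have hqr : r < q := by rwa [hq, lt_div_iff₀ ha0]
  have hq0 : 0 < q := hr.trans_lt hqr
  have h1 : ∀ n : ℕ, a 0 * q ^ (2 ^ n) ≤ a (2 ^ n) := by
    intro n
    induction n with
    | zero => simp [hq, mul_div_cancel₀ _ ha0.ne']
    | succ n ih =>
      have h2 := h (2 ^ n)
      have h3 : (a 0 * q ^ (2 ^ n)) ^ 2 ≤ a (2 ^ n) ^ 2 := by gcongr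
      rw [pow_succ 2 n, mul_comm (2 ^ n) 2]
      have h4 : a 0 * (a 0 * q ^ (2 * 2 ^ n)) ≤ a 0 * a (2 * 2 ^ n) := by
        calc a 0 * (a 0 * q ^ (2 * 2 ^ n)) = (a 0 * q ^ (2 ^ n)) ^ 2 := by ring
          _ ≤ a (2 * 2 ^ n) * a 0 := h3.trans h2
          _ = _ := mul_comm _ _
      exact le_of_mul_le_mul_left h4 ha0
  rcases hr.eq_or_lt with rfl | hr0
  · have h2 := (h1 0).trans (hC (2 ^ 0))
    have h3 : 0 < a 0 * q ^ (2 ^ 0) := by positivity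
    simp at h2 h3
    nlinarith
  · have hs : 1 < q / r := by rwa [one_lt_div hr0]
    obtain ⟨n, hn⟩ := pow_unbounded_of_one_lt (C / a 0) hs
    have h2 := (h1 n).trans (hC (2 ^ n))
    have h3 : (q / r) ^ n ≤ (q / r) ^ (2 ^ n) :=
      pow_le_pow_right₀ hs.le Nat.lt_two_pow_self.le
    have h4 : C / a 0 < (q / r) ^ (2 ^ n) := hn.trans_le h3
    rw [div_lt_iff₀ ha0, div_pow, div_mul_eq_mul_div, lt_div_iff₀ (by positivity)] at h4
    linarith

/-- A densely defined operator that sends `u x` to `u' (m x)` and has a densely defined adjoint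
sending `u' y` to `u (n y)` is bounded, provided that the powers of `n m` grow at most
geometrically: the Cauchy–Schwarz inequality bounds the norm by the growth rate. -/
lemma exists_extension {F G : Bimod B} {σ : PAut B} {X X' : Type*} (u : X → F) (u' : X' → G)
    (hu : clspan (Set.range u) = Set.univ) (m : X → X') (n : X' → X)
    (hadj : ∀ x y, (F.ip (u (n y)) (u x), G.ip (u' y) (u' (m x))) ∈ σ.graph)
    {r : ℝ} (hr : 0 ≤ r) (hbound : ∀ x, ∃ C, ∀ k : ℕ, ‖u ((n ∘ m)^[k] x)‖ ≤ C * r ^ k) :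
    ∃ R : F →L[ℂ] G, (∀ x, R (u x) = u' (m x)) ∧ ‖R‖ ^ 2 ≤ r := by
  -- extend `u`, `u'`, `m` and `n` linearly to finitely supported functions
  set U := Finsupp.linearCombination ℂ u
  set U' := Finsupp.linearCombination ℂ u'
  have hadj' : ∀ (x : X →₀ ℂ) (y : X' →₀ ℂ), (F.ip (U (Finsupp.lmapDomain ℂ ℂ n y)) (U x),
      G.ip (U' y) (U' (Finsupp.lmapDomain ℂ ℂ m x))) ∈ σ.graph := by
    intro x y
    induction x using Finsupp.induction_linear with
    | zero => simpa [F.ip_zero_right, G.ip_zero_right] using σ.map_zero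
    | add x x' hx hx' =>
      simp only [map_add, F.ip_add_right, G.ip_add_right]
      exact σ.map_add hx hx'
    | single x z =>
      simp only [Finsupp.lmapDomain_apply, Finsupp.mapDomain_single, U, U',
        Finsupp.linearCombination_single, F.ip_smul_right, G.ip_smul_right]
      refine σ.map_smul z ?_
      induction y using Finsupp.induction_linear with
      | zero => simpa [F.ip_zero_left, G.ip_zero_left] using σ.map_zero
      | add y y' hy hy' =>
        simp only [Finsupp.mapDomain_add, map_add, F.ip_add_left, G.ip_add_left]
        exact σ.map_add hy hy'
      | single y w =>
        simp only [Finsupp.mapDomain_single, Finsupp.linearCombination_single, F.ip_smul_left,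
          G.ip_smul_left]
        exact σ.map_smul _ (hadj x y)
  set M := Finsupp.lmapDomain ℂ ℂ m
  set N := Finsupp.lmapDomain ℂ ℂ n
  -- the operator `N M` is symmetric, so that `a_k = ‖(N M)ᵏ x‖` satisfies `a_k² ≤ a_{2k} a₀`
  have key : ∀ x, ‖U' (M x)‖ ^ 2 ≤ ‖U (N (M x))‖ * ‖U x‖ := fun x => by
    rw [G.norm_sq, σ.norm_eq (hadj' x (M x))]
    exact F.norm_ip_le _ _
  have sym : ∀ x y, F.ip (U (N (M x))) (U y) = F.ip (U x) (U (N (M y))) := fun x y => by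
    refine σ.map_injective (hadj' y (M x)) ?_
    have := σ.map_star (hadj' x (M y))
    rwa [F.star_ip, G.star_ip] at this
  have iter : ∀ (k : ℕ) x y, F.ip (U ((N ∘ M)^[k] x)) (U y) = F.ip (U x) (U ((N ∘ M)^[k] y)) := by
    intro k
    induction k with
    | zero => simp
    | succ k ih =>
      intro x y
      rw [Function.iterate_succ_apply, ih, Function.iterate_succ_apply']
      exact sym x _
  have hb : ∀ x, ∃ C, ∀ k : ℕ, ‖U ((N ∘ M)^[k] x)‖ ≤ C * r ^ k := by
    intro x
    have add : ∀ k (x y : X →₀ ℂ), (N ∘ M)^[k] (x + y) = (N ∘ M)^[k] x + (N ∘ M)^[k] y := by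
      intro k
      induction k with
      | zero => simp
      | succ k ih => intro x y; simp [Function.iterate_succ_apply, ih]
    induction x using Finsupp.induction_linear with
    | zero =>
      refine ⟨0, fun k => ?_⟩
      have : (N ∘ M)^[k] (0 : X →₀ ℂ) = 0 := Function.iterate_fixed (by simp) k
      rw [this]
      simp
    | add x y hx hy =>
      obtain ⟨C, hC⟩ := hx
      obtain ⟨C', hC'⟩ := hy
      refine ⟨C + C', fun k => ?_⟩
      rw [add, map_add, add_mul]
      exact (norm_add_le _ _).trans (add_le_add (hC k) (hC' k))
    | single x z =>
      obtain ⟨C, hC⟩ := hbound x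
      refine ⟨‖z‖ * C, fun k => ?_⟩
      have : (N ∘ M)^[k] (Finsupp.single x z) = Finsupp.single ((n ∘ m)^[k] x) z := by
        induction k with
        | zero => rfl
        | succ k ih =>
          rw [Function.iterate_succ_apply', ih, Function.iterate_succ_apply']
          simp [M, N, Finsupp.mapDomain_single]
      rw [this, Finsupp.linearCombination_single, norm_smul, mul_assoc]
      exact mul_le_mul_of_nonneg_left (hC k) (norm_nonneg z)
  have bound : ∀ x, ‖U' (M x)‖ ^ 2 ≤ r * ‖U x‖ ^ 2 := by
    intro x
    obtain ⟨C, hC⟩ := hb x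
    have h1 := le_mul_of_sq_le (a := fun k => ‖U ((N ∘ M)^[k] x)‖) (fun _ => norm_nonneg _)
      (fun k => ?_) hr hC
    · refine (key x).trans ?_
      rw [sq, ← mul_assoc]
      exact mul_le_mul_of_nonneg_right h1 (norm_nonneg _)
    · simp only [Function.iterate_zero, id]
      rw [F.norm_sq, ← iter, ← Function.iterate_add_apply, ← two_mul]
      exact F.norm_ip_le _ _
  have bound' : ∀ x, ‖(U' ∘ₗ M) x‖ ≤ √r * ‖U x‖ := fun x => by
    refine le_of_sq_le_sq ?_ (by positivity)
    rw [mul_pow, Real.sq_sqrt hr]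
    exact bound x
  have hd : DenseRange U := denseRange_linearCombination hu
  refine ⟨(U' ∘ₗ M).extendOfNorm U, fun x => ?_, ?_⟩
  · have h1 := LinearMap.extendOfNorm_eq hd ⟨_, bound'⟩ (Finsupp.single x 1)
    simpa [U, U', M, Finsupp.mapDomain_single] using h1
  · have h1 : ‖(U' ∘ₗ M).extendOfNorm U‖ ≤ √r :=
      ContinuousLinearMap.opNorm_le_bound _ (Real.sqrt_nonneg r)
        (LinearMap.norm_extendOfNorm_apply_le hd _ bound')
    calc _ ≤ √r ^ 2 := by gcongr
      _ = r := Real.sq_sqrt hr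

/-- Adjointness can be checked on linearly dense sets. -/
lemma isAdjoint_of_dense {F G : Bimod B} {σ : PAut B} {X X' : Type*} {u : X → F} {u' : X' → G}
    (hu : clspan (Set.range u) = Set.univ) (hu' : clspan (Set.range u') = Set.univ)
    {R : F →L[ℂ] G} {S : G →L[ℂ] F}
    (h : ∀ x y, (F.ip (S (u' y)) (u x), G.ip (u' y) (R (u x))) ∈ σ.graph) : IsAdjoint σ R S := by
  have hc : ∀ y : G, Continuous fun ξ : F => (F.ip (S y) ξ, G.ip y (R ξ)) := fun y =>
    (F.ipL (S y)).continuous.prodMk ((G.ipL y).continuous.comp R.continuous)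
  have hc' : ∀ ξ : F, Continuous fun y : G => (F.ip (S y) ξ, G.ip y (R ξ)) := fun ξ =>
    (F.continuous_ip.comp (S.continuous.prodMk continuous_const)).prodMk
      (G.continuous_ip.comp (continuous_id.prodMk continuous_const))
  intro ξ η
  refine clspan_induction (p := fun η => (F.ip (S η) ξ, G.ip η (R ξ)) ∈ σ.graph) ?_ ?_ ?_ ?_
    (σ.isClosed_graph.preimage (hc' ξ)) (hu' ▸ Set.mem_univ η)
  · rintro _ ⟨y, rfl⟩
    refine clspan_induction (p := fun ξ => (F.ip (S (u' y)) ξ, G.ip (u' y) (R ξ)) ∈ σ.graph)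
      ?_ ?_ ?_ ?_ (σ.isClosed_graph.preimage (hc _)) (hu ▸ Set.mem_univ ξ)
    · rintro _ ⟨x, rfl⟩
      exact h x y
    · simpa [F.ip_zero_right, G.ip_zero_right] using σ.map_zero
    · intro x x' hx hx'
      simp only [map_add, F.ip_add_right, G.ip_add_right]
      exact σ.map_add hx hx'
    · intro z x hx
      simp only [map_smul, F.ip_smul_right, G.ip_smul_right]
      exact σ.map_smul z hx
  · simpa [F.ip_zero_left, G.ip_zero_left] using σ.map_zero
  · intro x x' hx hx'
    simp only [map_add, F.ip_add_left, G.ip_add_left]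
    exact σ.map_add hx hx'
  · intro z x hx
    simp only [map_smul, F.ip_smul_left, G.ip_smul_left]
    exact σ.map_smul _ hx

/-- Homogeneity can be checked on a linearly dense set. -/
lemma isHomogeneous_of_dense {F G : Bimod B} {ρ σ : PAut B} {X : Type*} {u : X → F}
    (hu : clspan (Set.range u) = Set.univ) {R : F →L[ℂ] G} {S : G →L[ℂ] F} (hS : IsAdjoint σ R S)
    (himg : ∀ x, R (u x) ∈ G.lspan ρ⁻¹)
    (hmap : ∀ a a', (a, a') ∈ ρ.graph → ∀ x, R (F.lsmul a (u x)) = G.lsmul a' (R (u x))) :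
    IsHomogeneous ρ σ R := by
  refine .mk' (fun ξ => ?_) (fun a a' ha ξ => ?_) hS
  · refine map_mem_clspan R ?_ (hu ▸ Set.mem_univ ξ)
    rintro _ ⟨x, rfl⟩
    exact himg x
  · refine eqOn_clspan (f := R ∘L F.lm a) (g := G.lm a' ∘L R) ?_ (hu ▸ Set.mem_univ ξ)
    rintro _ ⟨x, rfl⟩
    exact hmap a a' ha x

/-! ### Unitary bimodule isomorphisms -/

namespace BimodUnitary

variable {E F : Bimod B} (U : BimodUnitary E F)

lemma isAdjoint : IsAdjoint 1 (U.equiv : E →L[ℂ] F) (U.equiv.symm : F →L[ℂ] E) := fun ξ η => by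
  rw [PAut.mem_one]
  have := U.ip_map (U.equiv.symm η) ξ
  rwa [ContinuousLinearEquiv.apply_symm_apply] at this

/-- The inverse of a unitary bimodule isomorphism. -/
def symm : BimodUnitary F E where
  equiv := U.equiv.symm
  ip_map x y := by
    have := U.ip_map (U.equiv.symm x) (U.equiv.symm y)
    simpa using this.symm
  map_lsmul b x := by
    apply U.equiv.injective
    rw [U.map_lsmul]
    simp

end BimodUnitary

/-- Two linearly dense maps into bimodules with the same Gram function, on which `B` acts in the
same way, differ by a unitary bimodule isomorphism. -/
lemma exists_bimodUnitary {E F : Bimod B} {X : Type*} (u : X → E) (v : X → F)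
    (hu : clspan (Set.range u) = Set.univ) (hv : clspan (Set.range v) = Set.univ)
    (hip : ∀ x y, F.ip (v x) (v y) = E.ip (u x) (u y)) (act : B → X → X)
    (hu' : ∀ b x, E.lsmul b (u x) = u (act b x)) (hv' : ∀ b x, F.lsmul b (v x) = v (act b x)) :
    ∃ U : BimodUnitary E F, ∀ x, U.equiv (u x) = v x := by
  have it : ∀ (k : ℕ) (x : X), (_root_.id ∘ _root_.id)^[k] x = x := fun k x =>
    Function.iterate_fixed rfl k
  obtain ⟨R, hR, -⟩ := exists_extension (σ := 1) (r := 1) u v hu _root_.id _root_.id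
    (fun x y => PAut.mem_one.2 (hip y x)) zero_le_one
    (fun x => ⟨‖u x‖, fun k => by rw [it, one_pow, mul_one]⟩)
  obtain ⟨S, hS, -⟩ := exists_extension (σ := 1) (r := 1) v u hv _root_.id _root_.id
    (fun x y => PAut.mem_one.2 (hip y x).symm) zero_le_one
    (fun x => ⟨‖v x‖, fun k => by rw [it, one_pow, mul_one]⟩)
  simp only [id_eq] at hR hS
  have h1 : S ∘L R = .id ℂ E := ext_of_clspan hu (by rintro _ ⟨x, rfl⟩; simp [hR, hS])
  have h2 : R ∘L S = .id ℂ F := ext_of_clspan hv (by rintro _ ⟨x, rfl⟩; simp [hR, hS])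
  have hadj : IsAdjoint 1 R S := isAdjoint_of_dense hu hv fun x y => by
    rw [PAut.mem_one, hS, hR, hip]
  refine ⟨⟨.equivOfInverse R S (fun x => congrArg (· x) h1) (fun x => congrArg (· x) h2),
    fun x y => ?_, fun b x => ?_⟩, hR⟩
  · change F.ip (R x) (R y) = E.ip x y
    rw [PAut.mem_one.1 (hadj y (R x))]
    exact congrArg (fun T : E →L[ℂ] E => E.ip (T x) y) h1
  · change R (E.lsmul b x) = F.lsmul b (R x)
    refine eqOn_clspan (f := R ∘L E.lm b) (g := F.lm b ∘L R) ?_ (hu ▸ Set.mem_univ x)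
    rintro _ ⟨x, rfl⟩
    change R (E.lsmul b (u x)) = F.lsmul b (R (u x))
    rw [hu', hR, hR, hv']

/-! ### Operators on internal tensor products -/

namespace InternalTensor

variable {E F : Bimod B} (t : InternalTensor E F)

lemma ext_tmul {x y : t.obj} (h : ∀ ξ η, t.obj.ip (t.tmul ξ η) x = t.obj.ip (t.tmul ξ η) y) :
    x = y := by
  refine Bimod.ext_ip fun z => ?_
  rw [← t.obj.star_ip, ← t.obj.star_ip y]
  refine congrArg star (eqOn_clspan (f := t.obj.ipL x) (g := t.obj.ipL y) ?_
    (t.dense ▸ Set.mem_univ z))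
  rintro _ ⟨ξ, η, rfl⟩
  rw [Bimod.ipL_apply, Bimod.ipL_apply, ← t.obj.star_ip, h, t.obj.star_ip]

lemma add_tmul (ξ ξ' : E) (η : F) : t.tmul (ξ + ξ') η = t.tmul ξ η + t.tmul ξ' η :=
  t.ext_tmul fun x y => by
    simp only [t.obj.ip_add_right, t.ip_tmul, E.ip_add_right, F.lsmul_add, F.ip_add_right]

lemma smul_tmul (z : ℂ) (ξ : E) (η : F) : t.tmul (z • ξ) η = z • t.tmul ξ η :=
  t.ext_tmul fun x y => by
    simp only [t.obj.ip_smul_right, t.ip_tmul, E.ip_smul_right, F.lsmul_smul, F.ip_smul_right]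

lemma tmul_add (ξ : E) (η η' : F) : t.tmul ξ (η + η') = t.tmul ξ η + t.tmul ξ η' :=
  t.ext_tmul fun x y => by
    simp only [t.obj.ip_add_right, t.ip_tmul, F.lsmul_add_right, F.ip_add_right]

lemma tmul_smul (z : ℂ) (ξ : E) (η : F) : t.tmul ξ (z • η) = z • t.tmul ξ η :=
  t.ext_tmul fun x y => by
    simp only [t.obj.ip_smul_right, t.ip_tmul, F.lsmul_smul_right, F.ip_smul_right]

lemma rsmul_tmul_eq (ξ : E) (b : B) (η : F) :
    t.tmul (E.rsmul ξ b) η = t.tmul ξ (F.lsmul b η) :=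
  t.ext_tmul fun x y => by
    simp only [t.ip_tmul, E.ip_rsmul, F.lsmul_mul]

lemma norm_tmul_le (ξ : E) (η : F) : ‖t.tmul ξ η‖ ≤ ‖ξ‖ * ‖η‖ := by
  refine le_of_sq_le_sq ?_ (by positivity)
  rw [t.obj.norm_sq, t.ip_tmul]
  calc _ ≤ ‖η‖ * (‖E.ip ξ ξ‖ * ‖η‖) :=
        (F.norm_ip_le _ _).trans (mul_le_mul_of_nonneg_left (F.norm_lsmul_le _ _) (norm_nonneg _))
    _ = (‖ξ‖ * ‖η‖) ^ 2 := by rw [← E.norm_sq]; ring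

/-- The map `(ξ, η) ↦ ξ ⊗ η`, as a bounded bilinear map. -/
def tmulL : E →L[ℂ] F →L[ℂ] t.obj :=
  LinearMap.mkContinuous₂
    (LinearMap.mk₂ ℂ t.tmul t.add_tmul t.smul_tmul t.tmul_add
      (fun z ξ η => t.tmul_smul z ξ η)) 1
    fun ξ η => by simpa using t.norm_tmul_le ξ η

lemma clspan_range : clspan (Set.range fun p : E × F => t.tmul p.1 p.2) = Set.univ := by
  rw [← t.dense]
  congr 1
  ext x
  exact ⟨fun ⟨p, hp⟩ => ⟨p.1, p.2, hp.symm⟩, fun ⟨ξ, η, h⟩ => ⟨(ξ, η), h.symm⟩⟩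

/-- Elementary tensors of vectors from linearly dense sets are linearly dense. -/
lemma clspan_range_of_dense {X Y : Type*} {u : X → E} {v : Y → F}
    (hu : clspan (Set.range u) = Set.univ) (hv : clspan (Set.range v) = Set.univ) :
    clspan (Set.range fun p : X × Y => t.tmul (u p.1) (v p.2)) = Set.univ := by
  refine clspan_eq_univ_of_subset t.dense ?_
  rintro _ ⟨ξ, η, rfl⟩
  refine map_mem_clspan (t.tmulL.flip η) ?_ (hu ▸ Set.mem_univ ξ)
  rintro _ ⟨x, rfl⟩
  refine map_mem_clspan (t.tmulL (u x)) ?_ (hv ▸ Set.mem_univ η)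
  rintro _ ⟨y, rfl⟩
  exact mem_clspan ⟨(x, y), rfl⟩

end InternalTensor

section TensorOperators

variable {E F E' F' E'' F'' : Bimod B}

/-- `R = S ⊗ T` for operators `S : E → E'` and `T : F → F'`. -/
def IsTensorMap (t : InternalTensor E F) (t' : InternalTensor E' F') (S : E →L[ℂ] E')
    (T : F →L[ℂ] F') (R : t.obj →L[ℂ] t'.obj) : Prop :=
  ∀ ξ η, R (t.tmul ξ η) = t'.tmul (S ξ) (T η)

variable {t : InternalTensor E F} {t' : InternalTensor E' F'} {t'' : InternalTensor E'' F''}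

lemma IsTensorMap.unique {S : E →L[ℂ] E'} {T : F →L[ℂ] F'} {R R' : t.obj →L[ℂ] t'.obj}
    (h : IsTensorMap t t' S T R) (h' : IsTensorMap t t' S T R') : R = R' :=
  ext_of_clspan t.dense (by rintro _ ⟨ξ, η, rfl⟩; rw [h, h'])

lemma IsTensorMap.comp {S : E →L[ℂ] E'} {T : F →L[ℂ] F'} {R : t.obj →L[ℂ] t'.obj}
    {S' : E' →L[ℂ] E''} {T' : F' →L[ℂ] F''} {R' : t'.obj →L[ℂ] t''.obj}
    (h' : IsTensorMap t' t'' S' T' R') (h : IsTensorMap t t' S T R) :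
    IsTensorMap t t'' (S' ∘L S) (T' ∘L T) (R' ∘L R) := fun ξ η => by
  simp only [ContinuousLinearMap.comp_apply]
  rw [h, h']

lemma IsTensorMap.add_left {S S' : E →L[ℂ] E'} {T : F →L[ℂ] F'} {R R' : t.obj →L[ℂ] t'.obj}
    (h : IsTensorMap t t' S T R) (h' : IsTensorMap t t' S' T R') :
    IsTensorMap t t' (S + S') T (R + R') := fun ξ η => by
  simp only [add_apply, h ξ η, h' ξ η, t'.add_tmul]

lemma IsTensorMap.add_right {S : E →L[ℂ] E'} {T T' : F →L[ℂ] F'} {R R' : t.obj →L[ℂ] t'.obj}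
    (h : IsTensorMap t t' S T R) (h' : IsTensorMap t t' S T' R') :
    IsTensorMap t t' S (T + T') (R + R') := fun ξ η => by
  simp only [add_apply, h ξ η, h' ξ η, t'.tmul_add]

lemma IsTensorMap.smul_left {S : E →L[ℂ] E'} {T : F →L[ℂ] F'} {R : t.obj →L[ℂ] t'.obj}
    (h : IsTensorMap t t' S T R) (z : ℂ) : IsTensorMap t t' (z • S) T (z • R) := fun ξ η => by
  simp only [smul_apply, h ξ η, t'.smul_tmul]

lemma IsTensorMap.smul_right {S : E →L[ℂ] E'} {T : F →L[ℂ] F'} {R : t.obj →L[ℂ] t'.obj}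
    (h : IsTensorMap t t' S T R) (z : ℂ) : IsTensorMap t t' S (z • T) (z • R) := fun ξ η => by
  simp only [smul_apply, h ξ η, t'.tmul_smul]

/-- The Gram matrix identity behind `(c ⊗ d)⋆ = c⋆ ⊗ d⋆`; it uses that `d` intertwines the left
actions along `σ'`. -/
lemma ip_tmul_mem_graph (t : InternalTensor E F) (t' : InternalTensor E' F') {ρ' σ σ' : PAut B}
    {c : E →L[ℂ] E'} {d : F →L[ℂ] F'} (hd : IsHomogeneous ρ' σ d) (hσ : PAut.Compatible σ' ρ')
    {c' : E' →L[ℂ] E} {d' : F' →L[ℂ] F} (hc : IsAdjoint σ' c c') (hd' : IsAdjoint σ d d')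
    (ξ : E) (η : F) (ξ' : E') (η' : F') :
    (t.obj.ip (t.tmul (c' ξ') (d' η')) (t.tmul ξ η),
      t'.obj.ip (t'.tmul ξ' η') (t'.tmul (c ξ) (d η))) ∈ σ.graph := by
  rw [t.ip_tmul, t'.ip_tmul, ← hd.map_lsmul_of_compatible hσ (hc ξ ξ')]
  exact hd' _ η'

lemma IsTensorMap.isAdjoint {ρ' σ σ' : PAut B}
    {c : E →L[ℂ] E'} {d : F →L[ℂ] F'} (hd : IsHomogeneous ρ' σ d) (hσ : PAut.Compatible σ' ρ')
    {c' : E' →L[ℂ] E} {d' : F' →L[ℂ] F} (hc : IsAdjoint σ' c c') (hd' : IsAdjoint σ d d')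
    {R : t.obj →L[ℂ] t'.obj} {R' : t'.obj →L[ℂ] t.obj}
    (hR : IsTensorMap t t' c d R) (hR' : IsTensorMap t' t c' d' R') : IsAdjoint σ R R' :=
  isAdjoint_of_dense t.clspan_range t'.clspan_range fun x y => by
    rw [hR, hR']
    exact ip_tmul_mem_graph t t' hd hσ hc hd' x.1 x.2 y.1 y.2

/-- The operator `c ⊗ d` exists and is bounded by `‖c‖ ‖d‖` if the lower degree of `c` is
compatible with the upper degree of `d`. -/
lemma exists_isTensorMap_norm_le (t : InternalTensor E F) (t' : InternalTensor E' F')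
    {ρ ρ' σ σ' : PAut B} {c : E →L[ℂ] E'} {d : F →L[ℂ] F'} (hc : IsHomogeneous ρ σ' c)
    (hd : IsHomogeneous ρ' σ d) (hσ : PAut.Compatible σ' ρ') :
    ∃ R, IsTensorMap t t' c d R ∧ ‖R‖ ≤ ‖c‖ * ‖d‖ := by
  obtain ⟨c', hc'⟩ := hc.exists_adjoint
  obtain ⟨d', hd'⟩ := hd.exists_adjoint
  obtain ⟨R, hR, hn⟩ := exists_extension (σ := σ) (r := (‖c‖ * ‖d‖) ^ 2)
    (fun p : E × F => t.tmul p.1 p.2) (fun p : E' × F' => t'.tmul p.1 p.2) t.clspan_range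
    (fun p => (c p.1, d p.2)) (fun p => (c' p.1, d' p.2))
    (fun x y => ip_tmul_mem_graph t t' hd hσ hc' hd' x.1 x.2 y.1 y.2) (by positivity) (by
      intro x
      refine ⟨‖x.1‖ * ‖x.2‖, fun k => ?_⟩
      have key : ‖((fun p : E' × F' => (c' p.1, d' p.2)) ∘ fun p : E × F => (c p.1, d p.2))^[k] x
          |>.1‖ ≤ (‖c‖ ^ 2) ^ k * ‖x.1‖ ∧ ‖((fun p : E' × F' => (c' p.1, d' p.2)) ∘
            fun p : E × F => (c p.1, d p.2))^[k] x |>.2‖ ≤ (‖d‖ ^ 2) ^ k * ‖x.2‖ := by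
        induction k with
        | zero => simp
        | succ k ih =>
          rw [Function.iterate_succ_apply']
          constructor
          · refine (c'.le_opNorm _).trans ?_
            rw [hc'.norm_eq]
            refine (mul_le_mul_of_nonneg_left (c.le_opNorm _) (norm_nonneg _)).trans ?_
            calc _ = ‖c‖ ^ 2 * _ := by rw [sq, mul_assoc]
              _ ≤ ‖c‖ ^ 2 * _ := mul_le_mul_of_nonneg_left ih.1 (by positivity)
              _ = _ := by ring
          · refine (d'.le_opNorm _).trans ?_
            rw [hd'.norm_eq]
            refine (mul_le_mul_of_nonneg_left (d.le_opNorm _) (norm_nonneg _)).trans ?_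
            calc _ = ‖d‖ ^ 2 * _ := by rw [sq, mul_assoc]
              _ ≤ ‖d‖ ^ 2 * _ := mul_le_mul_of_nonneg_left ih.2 (by positivity)
              _ = _ := by ring
      refine (t.norm_tmul_le _ _).trans ?_
      calc _ ≤ ((‖c‖ ^ 2) ^ k * ‖x.1‖) * ((‖d‖ ^ 2) ^ k * ‖x.2‖) :=
            mul_le_mul key.1 key.2 (norm_nonneg _) (by positivity)
        _ = _ := by rw [mul_pow, mul_pow]; ring)
  exact ⟨R, fun ξ η => hR (ξ, η), le_of_sq_le_sq hn (by positivity)⟩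

lemma IsTensorMap.norm_le {ρ ρ' σ σ' : PAut B} {c : E →L[ℂ] E'} {d : F →L[ℂ] F'}
    (hc : IsHomogeneous ρ σ' c) (hd : IsHomogeneous ρ' σ d) (hσ : PAut.Compatible σ' ρ')
    {R : t.obj →L[ℂ] t'.obj} (hR : IsTensorMap t t' c d R) : ‖R‖ ≤ ‖c‖ * ‖d‖ := by
  obtain ⟨R', hR', hn⟩ := exists_isTensorMap_norm_le t t' hc hd hσ
  rwa [hR.unique hR']

lemma exists_isTensorMap (t : InternalTensor E F) (t' : InternalTensor E' F')
    {ρ ρ' σ σ' : PAut B} {c : E →L[ℂ] E'} {d : F →L[ℂ] F'} (hc : IsHomogeneous ρ σ' c)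
    (hd : IsHomogeneous ρ' σ d) (hσ : PAut.Compatible σ' ρ') : ∃ R, IsTensorMap t t' c d R :=
  let ⟨R, hR, _⟩ := exists_isTensorMap_norm_le t t' hc hd hσ
  ⟨R, hR⟩

lemma IsTensorMap.isHomogeneous {ρ ρ' σ σ' : PAut B} {c : E →L[ℂ] E'} {d : F →L[ℂ] F'}
    (hc : IsHomogeneous ρ σ' c) (hd : IsHomogeneous ρ' σ d) (hσ : PAut.Compatible σ' ρ')
    {R : t.obj →L[ℂ] t'.obj} (hR : IsTensorMap t t' c d R) : IsHomogeneous ρ σ R := by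
  obtain ⟨c', hc'⟩ := hc.exists_adjoint
  obtain ⟨d', hd'⟩ := hd.exists_adjoint
  obtain ⟨R', hR'⟩ := exists_isTensorMap t' t (hc.adjoint hc') (hd.adjoint hd') hσ.inv
  refine isHomogeneous_of_dense t.clspan_range (hR.isAdjoint hd hσ hc' hd' hR') ?_ ?_
  · intro x
    rw [hR]
    refine map_mem_clspan (t'.tmulL.flip (d x.2)) ?_ (hc.mem_lspan x.1)
    rintro _ ⟨k, hk, η, rfl⟩
    change t'.tmul (E'.lsmul k η) (d x.2) ∈ _
    rw [← t'.lsmul_tmul]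
    exact Bimod.lsmul_mem_lspan (θ := ρ⁻¹) hk _
  · intro a a' ha x
    rw [t.lsmul_tmul, hR, hR, hc.map_lsmul a a' ha, t'.lsmul_tmul]

end TensorOperators

/-! ### `C⋆`-algebras of adjointable operators and polar approximation -/

section AdjointableAlgebras

variable {E F : Bimod B}

/-- A closed algebra of operators on a Hilbert module that contains the adjoints of its elements
is a `C⋆`-algebra. -/
abbrev adjointableCStarAlgebra (A : NonUnitalSubalgebra ℂ (E →L[ℂ] E))
    (hA : IsClosed (A : Set (E →L[ℂ] E))) (adj : ∀ T ∈ A, ∃ S ∈ A, IsAdjoint 1 T S) :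
    NonUnitalCStarAlgebra A :=
  let st : A → A := fun T => ⟨(adj T T.2).choose, (adj T T.2).choose_spec.1⟩
  have hst : ∀ T : A, IsAdjoint 1 (T : E →L[ℂ] E) (st T : E →L[ℂ] E) :=
    fun T => (adj T T.2).choose_spec.2
  have uniq : ∀ (T S : A), IsAdjoint 1 (T : E →L[ℂ] E) (S : E →L[ℂ] E) → st T = S := fun T S h =>
    Subtype.ext (DFunLike.coe_injective ((hst T).unique h))
  { (inferInstance : NonUnitalNormedRing A),
    (inferInstance : Module ℂ A) with
    norm_smul_le := fun z T => norm_smul_le z (T : E →L[ℂ] E)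
    star := st
    star_involutive := fun T => uniq _ _ (by simpa [PAut.inv_one] using (hst T).symm)
    star_mul := fun T S => uniq _ _ (by
      have := (hst T).clm_comp (hst S)
      rwa [mul_one] at this)
    star_add := fun T S => uniq _ _ ((hst T).add (hst S))
    star_smul := fun z T => uniq _ _ ((hst T).smul z)
    complete := (completeSpace_coe_iff_isComplete.2 hA.isComplete).complete
    norm_mul_self_le := fun T => by
      have h : ‖(T : E →L[ℂ] E)‖ ≤ √‖(st T : E →L[ℂ] E) ∘L (T : E →L[ℂ] E)‖ := by
        refine ContinuousLinearMap.opNorm_le_bound _ (Real.sqrt_nonneg _) fun ξ => ?_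
        refine le_of_sq_le_sq ?_ (by positivity)
        rw [mul_pow, Real.sq_sqrt (norm_nonneg _), sq ‖ξ‖, ← mul_assoc]
        exact ((hst T).norm_sq_le ξ).trans (mul_le_mul_of_nonneg_right
          (((st T : E →L[ℂ] E) ∘L (T : E →L[ℂ] E)).le_opNorm ξ) (norm_nonneg _))
      have h2 := (Real.le_sqrt (norm_nonneg _) (norm_nonneg _)).1 h
      rw [sq] at h2
      exact h2
    smul_assoc := fun z T S => Subtype.ext (by ext; rfl)
    smul_comm := fun z T S => Subtype.ext (by
      ext x
      exact ((T : E →L[ℂ] E).map_smul z ((S : E →L[ℂ] E) x)).symm) }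

/-- Closed `*`-algebras of operators have approximate units. -/
lemma exists_approximateUnit_adjointable (A : NonUnitalSubalgebra ℂ (E →L[ℂ] E))
    (hA : IsClosed (A : Set (E →L[ℂ] E))) (adj : ∀ T ∈ A, ∃ S ∈ A, IsAdjoint 1 T S) :
    ∃ l : Filter (E →L[ℂ] E), l.NeBot ∧
      (∀ᶠ e in l, e ∈ A ∧ ‖e‖ ≤ 1 ∧ IsAdjoint 1 e e) ∧
      ∀ x ∈ A, Tendsto (fun e => x ∘L e) l (𝓝 x) := by
  let _ := adjointableCStarAlgebra A hA adj
  let _ := CStarAlgebra.spectralOrder A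
  have := CStarAlgebra.spectralOrderedRing A
  have h := CStarAlgebra.increasingApproximateUnit A
  have := h.neBot
  refine ⟨(CStarAlgebra.approximateUnit A).map Subtype.val, inferInstance, ?_, fun x hx => ?_⟩
  · rw [eventually_map]
    filter_upwards [h.eventually_star_eq, h.eventually_norm] with e h₁ h₂
    have h₃ : (adj e e.2).choose = e := congrArg Subtype.val h₁
    have h₄ := (adj e e.2).choose_spec.2
    rw [h₃] at h₄
    exact ⟨e.2, h₂, h₄⟩
  · have hc := continuous_subtype_val (p := fun b : E →L[ℂ] E => b ∈ A)
    exact tendsto_map'_iff.2 ((hc.tendsto _).comp (h.tendsto_mul_left ⟨x, hx⟩))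

/-- If `T⋆T` belongs to a closed `*`-algebra `A` of operators, then `T` is a limit of operators
`T e` with `e ∈ A`, since `‖T - T e‖² ≤ 2 ‖T⋆T - T⋆T e‖` for `‖e‖ ≤ 1`. -/
lemma mem_clspan_comp_of_adjoint_comp_mem (A : NonUnitalSubalgebra ℂ (E →L[ℂ] E))
    (hA : IsClosed (A : Set (E →L[ℂ] E))) (adj : ∀ T ∈ A, ∃ S ∈ A, IsAdjoint 1 T S)
    {σ : PAut B} {T : E →L[ℂ] F} {S : F →L[ℂ] E} (hS : IsAdjoint σ T S) (h : S ∘L T ∈ A) :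
    T ∈ clspan {R | ∃ a ∈ A, R = T ∘L a} ∧ S ∈ clspan {R | ∃ a ∈ A, R = a ∘L S} := by
  obtain ⟨l, _, hl, hl'⟩ := exists_approximateUnit_adjointable A hA adj
  have h1 : ∀ e : E →L[ℂ] E, ‖e‖ ≤ 1 →
      ‖T ∘L e - T‖ ^ 2 ≤ 2 * ‖(S ∘L T) ∘L e - S ∘L T‖ := fun e he => by
    have h2 : ‖T ∘L e - T‖ ≤ √(2 * ‖(S ∘L T) ∘L e - S ∘L T‖) := by
      refine ContinuousLinearMap.opNorm_le_bound _ (Real.sqrt_nonneg _) fun ξ => ?_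
      refine le_of_sq_le_sq ?_ (by positivity)
      rw [mul_pow, Real.sq_sqrt (by positivity)]
      have h3 := hS.norm_sq_le (e ξ - ξ)
      have h4 : ‖e ξ - ξ‖ ≤ 2 * ‖ξ‖ := by
        refine (norm_sub_le _ _).trans ?_
        have := e.le_of_opNorm_le he ξ
        linarith
      have h5 := ((S ∘L T) ∘L e - S ∘L T).le_opNorm ξ
      have h6 : ((S ∘L T) ∘L e - S ∘L T) ξ = S (T (e ξ - ξ)) := by simp
      have h7 : (T ∘L e - T) ξ = T (e ξ - ξ) := by simp
      rw [h6] at h5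
      rw [h7]
      calc _ ≤ ‖S (T (e ξ - ξ))‖ * ‖e ξ - ξ‖ := h3
        _ ≤ (‖(S ∘L T) ∘L e - S ∘L T‖ * ‖ξ‖) * (2 * ‖ξ‖) :=
          mul_le_mul h5 h4 (norm_nonneg _) (by positivity)
        _ = _ := by ring
    exact (Real.le_sqrt (norm_nonneg _) (by positivity)).1 h2
  have key : Tendsto (fun e => T ∘L e) l (𝓝 T) := by
    rw [tendsto_iff_norm_sub_tendsto_zero]
    have h2 : Tendsto (fun e => ‖T ∘L e - T‖ ^ 2) l (𝓝 0) :=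
      squeeze_zero' (Eventually.of_forall fun _ => by positivity) (hl.mono fun e he => h1 e he.2.1)
        (by simpa using (tendsto_iff_norm_sub_tendsto_zero.1 (hl' _ h)).const_mul 2)
    simpa using h2.sqrt
  have key' : Tendsto (fun e => e ∘L S) l (𝓝 S) := by
    rw [tendsto_iff_norm_sub_tendsto_zero] at key ⊢
    refine key.congr' (hl.mono fun e he => ?_)
    have := hS.clm_comp he.2.2
    rw [mul_one] at this
    exact (this.sub hS).norm_eq.symm
  exact ⟨(isClosed_clspan _).mem_of_tendsto key (hl.mono fun e he => mem_clspan ⟨e, he.1, rfl⟩),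
    (isClosed_clspan _).mem_of_tendsto key' (hl.mono fun e he => mem_clspan ⟨e, he.1, rfl⟩)⟩

end AdjointableAlgebras

/-! ### `C⋆`-families -/

namespace Fam

variable {E F G : Bimod B}

lemma mem_prod {D : Fam F G} {C : Fam E F} {ρ' σ' ρ σ ρ'' σ'' : PAut B} {T' : F →L[ℂ] G}
    {T : E →L[ℂ] F} (hT' : T' ∈ D ρ' σ') (hT : T ∈ C ρ σ) (hρ : ρ' * ρ ≤ ρ'') (hσ : σ' * σ ≤ σ'') :
    T' ∘L T ∈ prod D C ρ'' σ'' :=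
  mem_clspan ⟨ρ', ρ, σ', σ, hρ, hσ, T', hT', T, hT, rfl⟩

/-- The description of `C⋆`-families by closure properties: the components are closed subspaces that
grow with the degree, and the family is closed under adjoints and products. -/
structure IsStarAlgFam (C : Fam E E) : Prop where
  homogeneous : C.Homogeneous
  clspan_eq : ∀ ρ σ, clspan (C ρ σ) = C ρ σ
  mono : ∀ {ρ σ ρ' σ'}, ρ ≤ ρ' → σ ≤ σ' → C ρ σ ⊆ C ρ' σ'
  adj_mem : ∀ {ρ σ} {T S : E →L[ℂ] E}, T ∈ C ρ σ → IsAdjoint σ T S → S ∈ C ρ⁻¹ σ⁻¹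
  mul_mem : ∀ {ρ' σ' ρ σ} {T' T : E →L[ℂ] E}, T' ∈ C ρ' σ' → T ∈ C ρ σ →
    T' ∘L T ∈ C (ρ' * ρ) (σ' * σ)

/-- A family of operators that contains the closed span of the products is determined by them. -/
lemma prod_le {D : Fam F G} {C : Fam E F} {K : Fam E G} (hK : ∀ ρ σ, clspan (K ρ σ) = K ρ σ)
    (hK' : ∀ {ρ σ ρ' σ'}, ρ ≤ ρ' → σ ≤ σ' → K ρ σ ⊆ K ρ' σ')
    (h : ∀ {ρ' σ' ρ σ} {T' : F →L[ℂ] G} {T : E →L[ℂ] F}, T' ∈ D ρ' σ' → T ∈ C ρ σ →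
      T' ∘L T ∈ K (ρ' * ρ) (σ' * σ)) : prod D C ≤ K := by
  intro ρ'' σ''
  change prod D C ρ'' σ'' ⊆ K ρ'' σ''
  rw [← hK]
  refine clspan_mono ?_
  rintro _ ⟨ρ', ρ, σ', σ, hρ, hσ, T', hT', T, hT, rfl⟩
  exact hK' hρ hσ (h hT' hT)

lemma prod_mono_degree {D : Fam F G} {C : Fam E F} {ρ σ ρ' σ' : PAut B} (hρ : ρ ≤ ρ')
    (hσ : σ ≤ σ') : prod D C ρ σ ⊆ prod D C ρ' σ' := by
  refine clspan_mono ?_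
  rintro _ ⟨ρ₁, ρ₂, σ₁, σ₂, h, h', H⟩
  exact ⟨ρ₁, ρ₂, σ₁, σ₂, h.trans hρ, h'.trans hσ, H⟩

namespace IsStarAlgFam

variable {C : Fam E E} {ρ σ : PAut B}

lemma exists_adjoint (hC : C.IsStarAlgFam) {T : E →L[ℂ] E} (hT : T ∈ C ρ σ) :
    ∃ S ∈ C ρ⁻¹ σ⁻¹, IsAdjoint σ T S := by
  obtain ⟨S, hS⟩ := (hC.homogeneous ρ σ T hT).exists_adjoint
  exact ⟨S, hC.adj_mem hT hS, hS⟩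

lemma zero_mem (hC : C.IsStarAlgFam) (ρ σ : PAut B) : (0 : E →L[ℂ] E) ∈ C ρ σ :=
  hC.clspan_eq ρ σ ▸ zero_mem_clspan _

lemma add_mem (hC : C.IsStarAlgFam) {T T' : E →L[ℂ] E} (h : T ∈ C ρ σ) (h' : T' ∈ C ρ σ) :
    T + T' ∈ C ρ σ :=
  hC.clspan_eq ρ σ ▸ add_mem_clspan (mem_clspan h) (mem_clspan h')

lemma smul_mem (hC : C.IsStarAlgFam) (z : ℂ) {T : E →L[ℂ] E} (h : T ∈ C ρ σ) : z • T ∈ C ρ σ :=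
  hC.clspan_eq ρ σ ▸ smul_mem_clspan z (mem_clspan h)

lemma isClosed (hC : C.IsStarAlgFam) (ρ σ : PAut B) : IsClosed (C ρ σ) :=
  hC.clspan_eq ρ σ ▸ isClosed_clspan _

/-- A component of degree `(e, f)` with idempotents `e, f ≤ 1` is an algebra. -/
def coreAlg (hC : C.IsStarAlgFam) {e f : PAut B} (he : e ≤ 1) (hf : f ≤ 1) :
    NonUnitalSubalgebra ℂ (E →L[ℂ] E) where
  carrier := C e f
  add_mem' := hC.add_mem
  zero_mem' := hC.zero_mem e f
  mul_mem' h h' := hC.mono ((PAut.mul_le_mul he le_rfl).trans_eq (one_mul e))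
    ((PAut.mul_le_mul hf le_rfl).trans_eq (one_mul f)) (hC.mul_mem h h')
  smul_mem' z _ h := hC.smul_mem z h

lemma coreAlg_adj (hC : C.IsStarAlgFam) {e f : PAut B} (he : e ≤ 1) (hf : f ≤ 1) :
    ∀ T ∈ hC.coreAlg he hf, ∃ S ∈ hC.coreAlg he hf, IsAdjoint 1 T S := fun T hT => by
  obtain ⟨S, hS, hS'⟩ := hC.exists_adjoint hT
  rw [PAut.inv_of_le_one he, PAut.inv_of_le_one hf] at hS
  exact ⟨S, hS, hS'.mono hf⟩

/-- Polar approximation on the right: if `T⋆T ∈ C^e_f` then `T ∈ [T C^e_f]`. -/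
lemma mem_clspan_comp_right (hC : C.IsStarAlgFam) {e f : PAut B} (he : e ≤ 1) (hf : f ≤ 1)
    {T : E →L[ℂ] F} {S : F →L[ℂ] E} (hS : IsAdjoint σ T S) (h : S ∘L T ∈ C e f) :
    T ∈ clspan {R | ∃ a ∈ C e f, R = T ∘L a} :=
  (mem_clspan_comp_of_adjoint_comp_mem (hC.coreAlg he hf) (hC.isClosed e f) (hC.coreAlg_adj he hf)
    hS h).1

/-- Polar approximation on the left: if `T T⋆ ∈ C^e_f` then `T ∈ [C^e_f T]`. -/
lemma mem_clspan_comp_left (hC : C.IsStarAlgFam) {e f : PAut B} (he : e ≤ 1) (hf : f ≤ 1)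
    {T : F →L[ℂ] E} {S : E →L[ℂ] F} (hS : IsAdjoint σ T S) (h : T ∘L S ∈ C e f) :
    T ∈ clspan {R | ∃ a ∈ C e f, R = a ∘L T} :=
  (mem_clspan_comp_of_adjoint_comp_mem (hC.coreAlg he hf) (hC.isClosed e f) (hC.coreAlg_adj he hf)
    hS.symm h).2

lemma mem_clspan_comp_right_of_mem (hC : C.IsStarAlgFam) {T : E →L[ℂ] E} (hT : T ∈ C ρ σ) :
    T ∈ clspan {R | ∃ a ∈ C (ρ⁻¹ * ρ) (σ⁻¹ * σ), R = T ∘L a} := by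
  obtain ⟨S, hS, hS'⟩ := hC.exists_adjoint hT
  exact hC.mem_clspan_comp_right ρ.inv_mul_le_one σ.inv_mul_le_one hS' (hC.mul_mem hS hT)

lemma mem_clspan_comp_left_of_mem (hC : C.IsStarAlgFam) {T : E →L[ℂ] E} (hT : T ∈ C ρ σ) :
    T ∈ clspan {R | ∃ a ∈ C (ρ * ρ⁻¹) (σ * σ⁻¹), R = a ∘L T} := by
  obtain ⟨S, hS, hS'⟩ := hC.exists_adjoint hT
  exact hC.mem_clspan_comp_left ρ.mul_inv_le_one σ.mul_inv_le_one hS' (hC.mul_mem hT hS)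

lemma mem_clspan_one_comp (hC : C.IsStarAlgFam) {T : E →L[ℂ] E} (hT : T ∈ C ρ σ) :
    T ∈ clspan {R | ∃ a ∈ C 1 1, R = a ∘L T} := by
  refine clspan_mono ?_ (hC.mem_clspan_comp_left_of_mem hT)
  rintro _ ⟨a, ha, rfl⟩
  exact ⟨a, hC.mono ρ.mul_inv_le_one σ.mul_inv_le_one ha, rfl⟩

lemma adj_eq (hC : C.IsStarAlgFam) : adj C = C := by
  ext ρ σ S
  constructor
  · rintro ⟨T, hT, h⟩
    exact hC.adj_mem hT h
  · intro hS
    obtain ⟨T, hT, h⟩ := hC.exists_adjoint hS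
    exact ⟨T, hT, h.symm⟩

lemma isCStarFamily (hC : C.IsStarAlgFam) : C.IsCStarFamily := by
  refine ⟨hC.homogeneous, ?_⟩
  rw [hC.adj_eq]
  refine le_antisymm (prod_le hC.clspan_eq hC.mono hC.mul_mem) fun ρ σ T hT => ?_
  refine clspan_mono ?_ (hC.mem_clspan_comp_right_of_mem hT)
  rintro _ ⟨a, ha, rfl⟩
  exact ⟨ρ, ρ⁻¹ * ρ, σ, σ⁻¹ * σ, (by rw [PAut.compLE_iff, ← mul_assoc, ρ.mul_inv_mul]),
    (by rw [PAut.compLE_iff, ← mul_assoc, σ.mul_inv_mul]), T, hT, a, ha, rfl⟩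

end IsStarAlgFam

/-- The components of a `C⋆`-family are closed under adjoints, since those of the products `X⋆ T`
with `X` and `T` in the family, which span it, are again such products. -/
lemma IsCStarFamily.isStarAlgFam {C : Fam E E} (h : C.IsCStarFamily) : C.IsStarAlgFam := by
  obtain ⟨hom, hC⟩ := h
  have closed : ∀ ρ σ, clspan (C ρ σ) = C ρ σ := fun ρ σ => by
    rw [← hC]
    exact clspan_clspan _
  have adj_mem : ∀ {ρ σ} {T S : E →L[ℂ] E}, T ∈ C ρ σ → IsAdjoint σ T S → S ∈ C ρ⁻¹ σ⁻¹ := by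
    intro ρ σ T S hT hS
    have key : ∃ S ∈ C ρ⁻¹ σ⁻¹, IsAdjoint σ T S := by
      have hT' : T ∈ prod (adj C) C ρ σ := by rwa [hC]
      have hcl : IsClosed (C ρ⁻¹ σ⁻¹) := closed ρ⁻¹ σ⁻¹ ▸ isClosed_clspan _
      refine IsAdjoint.of_mem_closure hcl (closure_mono ?_ hT')
      intro T hT
      refine Submodule.span_induction
        (p := fun (T : E →L[ℂ] E) _ => ∃ S ∈ C ρ⁻¹ σ⁻¹, IsAdjoint σ T S) ?_ ?_ ?_ ?_ hT
      · rintro _ ⟨ρ', ρ₁, σ', σ₁, hρ, hσ, X, ⟨Y, hY, hXY⟩, T, hT, rfl⟩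
        obtain ⟨S, hS⟩ := (hom _ _ T hT).exists_adjoint
        refine ⟨S ∘L Y, ?_, (hXY.symm.clm_comp hS).mono hσ⟩
        rw [← hC]
        refine mem_prod (ρ' := ρ₁⁻¹) (σ' := σ₁⁻¹) (ρ := ρ'⁻¹) (σ := σ'⁻¹)
          ⟨T, by simpa [PAut.inv_eq] using hT, by simpa [PAut.inv_eq] using hS⟩ hY ?_ ?_
        · rw [← PAut.mul_inv_rev]
          exact PAut.inv_le_inv hρ
        · rw [← PAut.mul_inv_rev]
          exact PAut.inv_le_inv hσ
      · exact ⟨0, closed ρ⁻¹ σ⁻¹ ▸ zero_mem_clspan _, IsAdjoint.zero⟩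
      · rintro T T' _ _ ⟨S, hS, h⟩ ⟨S', hS', h'⟩
        exact ⟨S + S', closed ρ⁻¹ σ⁻¹ ▸ add_mem_clspan (mem_clspan hS) (mem_clspan hS'), h.add h'⟩
      · rintro z T _ ⟨S, hS, h⟩
        exact ⟨star z • S, closed ρ⁻¹ σ⁻¹ ▸ smul_mem_clspan _ (mem_clspan hS), h.smul z⟩
    obtain ⟨S', hS', h⟩ := key
    rwa [DFunLike.coe_injective (hS.unique h)]
  refine ⟨hom, closed, fun h h' => ?_, adj_mem, fun {ρ' σ' ρ σ T' T} hT' hT => ?_⟩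
  · rw [← hC]
    exact prod_mono_degree h h'
  · rw [← hC]
    obtain ⟨S, hS⟩ := (hom _ _ T' hT').exists_adjoint
    exact mem_prod ⟨S, adj_mem hT' hS, hS.symm⟩ hT le_rfl le_rfl

end Fam

/-! ### Homogeneous elements of the coefficient algebra -/

section HomogeneousCoefficients

variable {θ ρ σ : PAut B}

lemma mem_hmg_one {c : B} : c ∈ hmg (Bimod.self B) 1 ↔ ∀ x, c * x = x * c := by
  refine mem_hmg_self.trans ⟨fun h x => h.2 x x (PAut.mem_one.2 rfl),
    fun h => ⟨⟨c, PAut.mem_one.2 rfl⟩, fun x y hy => ?_⟩⟩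
  rw [PAut.mem_one.1 hy, h]

lemma mem_hmg_of_le_one {e : PAut B} (he : e ≤ 1) {c : B} :
    c ∈ hmg (Bimod.self B) e ↔ c ∈ e.dom ∧ ∀ x, c * x = x * c := by
  refine ⟨fun h => ⟨hmg_self_dom h, mem_hmg_one.1 (hmg_mono he h)⟩,
    fun h => mem_hmg_self.2 ⟨h.1, fun x y hy => ?_⟩⟩
  rw [PAut.le_one_iff.1 he _ _ hy, h.2]

lemma star_mul_self_mem_hmg {b : B} (hb : b ∈ hmg (Bimod.self B) θ) :
    star b * b ∈ hmg (Bimod.self B) (θ⁻¹ * θ) := mul_mem_hmg (star_mem_hmg hb) hb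

lemma eq_zero_of_star_mul_self_add {a b : B} (h : star a * a + star b * b = 0) : a = 0 := by
  let _ := CStarAlgebra.spectralOrder B
  have := CStarAlgebra.spectralOrderedRing B
  refine (CStarRing.star_mul_self_eq_zero_iff a).1 (le_antisymm ?_ (star_mul_self_nonneg a))
  rw [eq_neg_of_add_eq_zero_left h, neg_nonpos]
  exact star_mul_self_nonneg b

lemma star_mul_self_eq_mul_star_self_of_central {u : B}
    (h1 : ∀ x, star u * u * x = x * (star u * u)) (h2 : ∀ x, u * star u * x = x * (u * star u)) :
    star u * u = u * star u := by
  set n := star u * u - u * star u with hn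
  have hs : star n = n := by simp [hn]
  have h3 : u * n = 0 := by rw [hn, mul_sub, ← mul_assoc u, h2, sub_self]
  have h4 : n * n = 0 := by
    have hc : n * star u = star u * n := by rw [hn, sub_mul, mul_sub, h1, h2]
    calc n * n = star u * (u * n) - u * (star u * n) := by
          conv_lhs => lhs; rw [hn]
          rw [sub_mul, mul_assoc, mul_assoc]
      _ = 0 := by rw [← hc, ← mul_assoc u, h3, zero_mul, mul_zero, sub_zero]
  have h5 : n = 0 := (CStarRing.star_mul_self_eq_zero_iff n).1 (by rw [hs, h4])
  exact sub_eq_zero.1 h5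

lemma star_mul_self_eq_mul_star_self {u : B} (hu : u ∈ hmg (Bimod.self B) ρ) :
    star u * u = u * star u := by
  have hu' : star u * u ∈ hmg (Bimod.self B) (ρ⁻¹ * ρ) := star_mul_self_mem_hmg hu
  have hu'' : u * star u ∈ hmg (Bimod.self B) (ρ * ρ⁻¹) := mul_mem_hmg hu (star_mem_hmg hu)
  exact star_mul_self_eq_mul_star_self_of_central
    (mem_hmg_one.1 (hmg_mono ρ.inv_mul_le_one hu')) (mem_hmg_one.1 (hmg_mono ρ.mul_inv_le_one hu''))

/-- If `u` has degree `ρ` and `v = ρ(u)`, then `ρ(u⋆u) - u⋆u = (v - u)⋆(v - u)`. -/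
lemma star_mul_self_sub_of_mem_graph {u v : B} (hu : u ∈ hmg (Bimod.self B) ρ)
    (hv : (u, v) ∈ ρ.graph) : star (v - u) * (v - u) = star v * v - star u * u := by
  have h1 : u * star u = star v * u := hmg_self_mul hu (ρ.map_star hv)
  have h2 : u * star u = star u * v := by simpa using congrArg star h1
  rw [star_sub, mul_sub, sub_mul, sub_mul, ← h1, ← h2, star_mul_self_eq_mul_star_self hu]
  abel

/-- A partial automorphism fixes the elements of its degree: the differences `ρ(u⋆u) - u⋆u` and
`ρ⁻¹(u⋆u) - u⋆u` are both positive, hence they vanish. -/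
lemma hmg_self_mem_graph {u : B} (hu : u ∈ hmg (Bimod.self B) ρ) : (u, u) ∈ ρ.graph := by
  obtain ⟨v, hv⟩ := hmg_self_dom hu
  obtain ⟨v', hv'⟩ := hmg_self_dom (star_mem_hmg hu)
  have h1 := star_mul_self_sub_of_mem_graph hu hv
  have h2 := star_mul_self_sub_of_mem_graph (star_mem_hmg hu) hv'
  rw [star_star, ← star_mul_self_eq_mul_star_self hu] at h2
  -- transport `ρ⁻¹(u⋆u) - u⋆u` along `ρ`
  have hk : (v' - star u, star u - star v) ∈ ρ.graph := ρ.map_sub hv' (ρ.map_star hv)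
  have h3 := ρ.map_mul (ρ.map_star hk) hk
  rw [h2] at h3
  have hw := ρ.map_mul (ρ.map_star hv) hv
  have hw' : (star v' * v', star u * u) ∈ ρ.graph := by
    have := ρ.map_mul (ρ.map_star hv') hv'
    rwa [star_star, ← star_mul_self_eq_mul_star_self hu] at this
  have h4 := ρ.map_unique h3 (ρ.map_sub hw' hw)
  have h5 : v - u = 0 := by
    refine eq_zero_of_star_mul_self_add (b := star u - star v) ?_
    rw [h1, h4]
    abel
  rwa [sub_eq_zero.1 h5] at hv

/-- An element `c` of degree `θ` satisfies `θ(x c) = c x` for all `x ∈ B`. -/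
lemma hmg_self_mul_mem_graph {c : B} (hc : c ∈ hmg (Bimod.self B) θ) (x : B) :
    (x * c, c * x) ∈ θ.graph := by
  obtain ⟨z, hz⟩ := θ.img_ideal.mul_mem_right x (hmg_self_img hc)
  suffices x * c = z by rwa [this]
  obtain ⟨k, hk⟩ := θ.dom_ideal.mul_mem_left x (hmg_self_dom hc)
  refine PAut.eq_of_mul_eq_mul (I := θ.dom) ⟨_, θ.map_star (θ.map_sub hk hz)⟩ ?_
  rintro y ⟨p, hp⟩
  obtain ⟨p', hp'⟩ := θ.dom_ideal.mul_mem_right x ⟨p, hp⟩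
  -- `y z` and `y x c` have the same image `p c x = c y x`
  have e1 := θ.map_mul hp hz
  have e2 := θ.map_mul hp' (hmg_self_mem_graph hc)
  have e3 : c * (y * x) = p' * c := hmg_self_mul hc hp'
  have e4 : c * y = p * c := hmg_self_mul hc hp
  rw [← e3, ← mul_assoc, e4] at e2
  rw [← mul_assoc] at e1
  rw [← mul_assoc]
  exact θ.map_injective e2 e1

/-- Conjugation of homogeneous elements by a partial automorphism. -/
lemma hmg_self_conj {u v : B} (hv : v ∈ hmg (Bimod.self B) ρ) (h : (u, v) ∈ θ.graph) :
    u ∈ hmg (Bimod.self B) (θ⁻¹ * ρ * θ) := by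
  refine mem_hmg_self.2 ⟨⟨u, v, h, v, hmg_self_mem_graph hv, h⟩, ?_⟩
  rintro x y ⟨p, hp, q, hq, (hy : (y, q) ∈ θ.graph)⟩
  have e := hmg_self_mul hv hq
  have e1 := θ.map_mul h hp
  rw [e] at e1
  exact θ.map_injective e1 (θ.map_mul hy h)

/-- The central elements `u` that lie in the domain of a restriction `e` of the identity. -/
def centralAlg (e : PAut B) (he : e ≤ 1) : NonUnitalStarSubalgebra ℂ B where
  carrier := hmg (Bimod.self B) e
  add_mem' := add_mem_hmg
  zero_mem' := zero_mem_hmg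
  smul_mem' z _ h := smul_mem_hmg z h
  mul_mem' {a b} ha hb := by
    have h : a * b ∈ hmg (Bimod.self B) (e * e) := mul_mem_hmg ha hb
    exact hmg_mono (mul_le_of_le_one_right' he) h
  star_mem' {a} ha := by
    have h : star a ∈ hmg (Bimod.self B) e⁻¹ := star_mem_hmg ha
    rwa [PAut.inv_of_le_one he] at h

lemma tendsto_mul_of_star_mul_self {l : Filter B} {x : B}
    (hl : ∀ᶠ u in l, star u = u ∧ ‖u‖ ≤ 1)
    (h : Tendsto (fun u => star x * x * u) l (𝓝 (star x * x))) :
    Tendsto (fun u => x * u) l (𝓝 x) := by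
  rw [tendsto_iff_norm_sub_tendsto_zero] at h ⊢
  have h' : Tendsto (fun u => √(2 * ‖star x * x * u - star x * x‖)) l (𝓝 0) := by
    simpa using (h.const_mul 2).sqrt
  refine squeeze_zero' (Eventually.of_forall fun _ => norm_nonneg _) ?_ h'
  filter_upwards [hl] with u hu
  refine Real.le_sqrt_of_sq_le ?_
  have e : star (x * u - x) * (x * u - x) =
      u * (star x * x * u - star x * x) - (star x * x * u - star x * x) := by
    rw [star_sub, star_mul, hu.1]
    noncomm_ring
  rw [sq, ← CStarRing.norm_star_mul_self, e]
  refine (norm_sub_le _ _).trans ?_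
  have := (norm_mul_le u (star x * x * u - star x * x)).trans
    (mul_le_mul_of_nonneg_right hu.2 (norm_nonneg _))
  linarith

/-- The central elements in the domain of `e ≤ Id` contain an approximate unit for all `x` such
that `x⋆x` is such an element. -/
lemma exists_central_approximateUnit {e : PAut B} (he : e ≤ 1) : ∃ l : Filter B, l.NeBot ∧
    (∀ᶠ u in l, u ∈ hmg (Bimod.self B) e ∧ star u = u ∧ ‖u‖ ≤ 1) ∧
    ∀ x, star x * x ∈ hmg (Bimod.self B) e → Tendsto (fun u => x * u) l (𝓝 x) := by
  obtain ⟨l, hl, hl1, hl2⟩ := CStarFamily.exists_approximateUnit (centralAlg e he)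
    (isClosed_hmg (E := Bimod.self B))
  exact ⟨l, hl, hl1, fun x hx => tendsto_mul_of_star_mul_self (hl1.mono fun u hu => hu.2)
    (hl2 _ hx).2⟩

lemma mem_of_mul_central_mem {e : PAut B} (he : e ≤ 1) {x : B}
    (hx : star x * x ∈ hmg (Bimod.self B) e) {S : Set B} (hS : IsClosed S)
    (h : ∀ u ∈ hmg (Bimod.self B) e, x * u ∈ S) : x ∈ S := by
  obtain ⟨l, hl, hl1, hl2⟩ := exists_central_approximateUnit he
  exact hS.mem_of_tendsto (hl2 x hx) (hl1.mono fun u hu => h u hu.1)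

/-- If `B` is decomposable, then its centre is nondegenerate. -/
lemma Decomposable.exists_approximateUnit (hB : Decomposable (Bimod.self B)) :
    ∃ l : Filter B, l.NeBot ∧
      (∀ᶠ u in l, u ∈ hmg (Bimod.self B) 1 ∧ star u = u ∧ ‖u‖ ≤ 1) ∧
      ∀ E : Bimod B, ∀ x : E, Tendsto (fun u => E.lsmul u x) l (𝓝 x) ∧
        Tendsto (fun u => E.rsmul x u) l (𝓝 x) := by
  obtain ⟨l, hl, hl1, hl2⟩ := exists_central_approximateUnit (B := B) le_rfl
  have h1 : ∀ x : B, Tendsto (fun u => x * u) l (𝓝 x) := fun x => by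
    -- it suffices to consider homogeneous `x`, for which `x⋆x` is central
    have hx : x ∈ clspan {ξ : Bimod.self B | ∃ θ, ξ ∈ hmg (Bimod.self B) θ} := hB ▸ trivial
    refine clspan_induction (p := fun x => Tendsto (fun u => (Bimod.self B).rm u x) l (𝓝 x))
      ?_ ?_ ?_ ?_ ?_ hx
    · rintro x ⟨θ, hx⟩
      exact hl2 x (hmg_mono θ.inv_mul_le_one (star_mul_self_mem_hmg hx))
    · simp
    · intro x y hx hy
      simpa using hx.add hy
    · intro z x hx
      simpa using hx.const_smul z
    · exact isClosed_setOf_tendsto_apply (hl1.mono fun u hu => ((Bimod.self B).norm_rm_le u).trans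
        hu.2.2)
  have h2 : ∀ x : B, Tendsto (fun u => u * x) l (𝓝 x) := fun x =>
    (h1 x).congr' (hl1.mono fun u hu => (mem_hmg_one.1 hu.1 x).symm)
  have h3 : ∀ᶠ u in l, u ∈ (1 : PAut B).dom ∧ star u = u ∧ ‖u‖ ≤ 1 :=
    hl1.mono fun u hu => ⟨⟨u, PAut.mem_one.2 rfl⟩, hu.2⟩
  exact ⟨l, hl, hl1, fun E x => ⟨Bimod.tendsto_lsmul_of_mem_lspan h3
    (fun x _ => ⟨h2 x, h1 x⟩) (Bimod.mem_lspan_one x), Bimod.tendsto_rsmul_of_mem_rspan h3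
    (fun x _ => ⟨h2 x, h1 x⟩) (Bimod.mem_rspan_one x)⟩⟩

lemma Decomposable.mem_of_lsmul_mem (hB : Decomposable (Bimod.self B)) {E : Bimod B} {x : E}
    {S : Set E} (hS : IsClosed S) (h : ∀ u ∈ hmg (Bimod.self B) 1, E.lsmul u x ∈ S) : x ∈ S := by
  obtain ⟨l, hl, hl1, hl2⟩ := hB.exists_approximateUnit
  exact hS.mem_of_tendsto (hl2 E x).1 (hl1.mono fun u hu => h u hu.1)

lemma Decomposable.mem_of_rsmul_mem (hB : Decomposable (Bimod.self B)) {E : Bimod B} {x : E}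
    {S : Set E} (hS : IsClosed S) (h : ∀ u ∈ hmg (Bimod.self B) 1, E.rsmul x u ∈ S) : x ∈ S := by
  obtain ⟨l, hl, hl1, hl2⟩ := hB.exists_approximateUnit
  exact hS.mem_of_tendsto (hl2 E x).2 (hl1.mono fun u hu => h u hu.1)

end HomogeneousCoefficients

/-! ### Multiplication operators -/

section Multiplication

variable {E : Bimod B} {ρ σ τ : PAut B}

lemma isAdjoint_lm (b : B) : IsAdjoint 1 (E.lm b) (E.lm (star b)) := fun ξ η => by
  rw [PAut.mem_one, Bimod.lm_apply, Bimod.lm_apply, Bimod.ip_lsmul_left, star_star]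

lemma isHomogeneous_lm {b : B} (hb : b ∈ hmg (Bimod.self B) ρ) : IsHomogeneous ρ 1 (E.lm b) := by
  refine IsHomogeneous.mk' (fun ξ => Bimod.lsmul_mem_lspan (hmg_self_img hb) ξ)
    (fun a a' h ξ => ?_) (isAdjoint_lm b)
  rw [Bimod.lm_apply, Bimod.lm_apply, ← E.lsmul_mul, ← E.lsmul_mul, hmg_self_mul hb h]

lemma isAdjoint_rm {c : B} (hc : c ∈ hmg (Bimod.self B) σ⁻¹) :
    IsAdjoint σ (E.rm c) (E.rm (star c)) := fun ξ η => by
  rw [Bimod.rm_apply, Bimod.rm_apply, E.ip_rsmul_left, E.ip_rsmul, star_star]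
  exact hmg_self_mul_mem_graph hc _

lemma isHomogeneous_rm {c : B} (hc : c ∈ hmg (Bimod.self B) σ⁻¹) :
    IsHomogeneous 1 σ (E.rm c) := by
  refine IsHomogeneous.mk' (fun ξ => by
    rw [PAut.inv_one]; exact Bimod.mem_lspan_one _) (fun a a' h ξ => ?_) (isAdjoint_rm hc)
  rw [PAut.mem_one.1 h, Bimod.rm_apply, Bimod.rm_apply, E.lsmul_rsmul]

lemma lm_comp_rm_mem_opFam {b c : B} (hb : b ∈ hmg (Bimod.self B) ρ)
    (hc : c ∈ hmg (Bimod.self B) σ⁻¹) : E.lm b ∘L E.rm c ∈ opFam E ρ σ :=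
  mem_clspan ⟨b, hb, c, hc, fun _ => rfl⟩

lemma mem_clspan_lm_comp_rm {S : E →L[ℂ] E} (hS : S ∈ opFam E ρ σ) :
    S ∈ clspan {R | ∃ b ∈ hmg (Bimod.self B) ρ, ∃ c ∈ hmg (Bimod.self B) σ⁻¹,
      R = E.lm b ∘L E.rm c} := by
  refine clspan_mono ?_ hS
  rintro R ⟨b, hb, c, hc, h⟩
  exact ⟨b, hb, c, hc, ContinuousLinearMap.ext h⟩

end Multiplication

section Composition

variable {E F G : Bimod B}

lemma comp_mem_clspan_left (R : F →L[ℂ] G) {S : Set (E →L[ℂ] F)} {S' : Set (E →L[ℂ] G)}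
    (h : ∀ s ∈ S, R ∘L s ∈ clspan S') {T : E →L[ℂ] F} (hT : T ∈ clspan S) :
    R ∘L T ∈ clspan S' :=
  map_mem_clspan (ContinuousLinearMap.compL ℂ E F G R) h hT

lemma comp_mem_clspan_right (R : E →L[ℂ] F) {S : Set (F →L[ℂ] G)} {S' : Set (E →L[ℂ] G)}
    (h : ∀ s ∈ S, s ∘L R ∈ clspan S') {T : F →L[ℂ] G} (hT : T ∈ clspan S) :
    T ∘L R ∈ clspan S' :=
  map_mem_clspan ((ContinuousLinearMap.compL ℂ E F G).flip R) h hT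

end Composition

namespace AdmissibleFam

variable {Θ : Set (PAut B)} {E : Bimod B} {C : Fam E E} {ρ σ τ : PAut B} {T : E →L[ℂ] E}

lemma isStarAlgFam (h : AdmissibleFam Θ C) : C.IsStarAlgFam := h.isCStarFamily.isStarAlgFam

lemma comp_op_mem (h : AdmissibleFam Θ C) (hT : T ∈ C ρ σ) {ρ' σ' : PAut B} {S : E →L[ℂ] E}
    (hS : S ∈ opFam E ρ' σ') : T ∘L S ∈ C (ρ * ρ') (σ * σ') :=
  h.prod_opFam_le _ _ (Fam.mem_prod hT hS le_rfl le_rfl)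

/-- Every operator of an admissible family is a limit of sums of operators `ξ ↦ S(bξc)` with
central `b` and `c`. -/
lemma mem_clspan_comp_op (h : AdmissibleFam Θ C) (hT : T ∈ C ρ σ) :
    T ∈ clspan {R | ∃ ρ' ∈ Θ, ∃ σ' ∈ Θ, ρ' ≤ ρ ∧ σ' ≤ σ ∧ ∃ S ∈ C ρ' σ',
      ∃ b ∈ hmg (Bimod.self B) (ρ'⁻¹ * ρ'), ∃ c ∈ hmg (Bimod.self B) (σ'⁻¹ * σ'),
      R = S ∘L (E.lm b ∘L E.rm c)} := by
  rw [h.supported] at hT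
  refine clspan_subset_iff.2 ?_ hT
  rintro T ⟨ρ', hρ', σ', hσ', hρ, hσ, hT⟩
  rw [← h.mul_opFam ρ' hρ' σ' hσ'] at hT
  refine clspan_subset_iff.2 ?_ hT
  rintro _ ⟨S, hS, O, hO, rfl⟩
  refine comp_mem_clspan_left S ?_ (mem_clspan_lm_comp_rm hO)
  rintro _ ⟨b, hb, c, hc, rfl⟩
  refine mem_clspan ⟨ρ', hρ', σ', hσ', hρ, hσ, S, hS, b, PAut.source_eq ρ' ▸ hb, c, ?_, rfl⟩
  · rwa [PAut.source_eq, PAut.inv_of_le_one σ'.inv_mul_le_one] at hc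

lemma comp_lm_mem (h : AdmissibleFam Θ C) (hT : T ∈ C ρ σ) {b : B}
    (hb : b ∈ hmg (Bimod.self B) τ) : T ∘L E.lm b ∈ C (ρ * τ) σ := by
  rw [← h.isStarAlgFam.clspan_eq]
  refine comp_mem_clspan_right _ ?_ (h.mem_clspan_comp_op hT)
  rintro _ ⟨ρ', hρ', σ', hσ', hρ, hσ, S, hS, b', hb', c, hc, rfl⟩
  have hb2 : b' * b ∈ hmg (Bimod.self B) (ρ'⁻¹ * ρ' * τ) := mul_mem_hmg hb' hb
  have hc2 : c ∈ hmg (Bimod.self B) (σ'⁻¹ * σ')⁻¹ := by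
    rwa [PAut.inv_of_le_one σ'.inv_mul_le_one]
  have e : (S ∘L (E.lm b' ∘L E.rm c)) ∘L E.lm b = S ∘L (E.lm (b' * b) ∘L E.rm c) := by
    ext ξ
    simp [Bimod.lm_apply, Bimod.rm_apply, E.lsmul_mul, E.lsmul_rsmul]
  rw [e]
  refine mem_clspan (h.isStarAlgFam.mono ?_ ?_ (h.comp_op_mem hS (lm_comp_rm_mem_opFam hb2 hc2)))
  · rw [← mul_assoc, ← mul_assoc, PAut.mul_inv_mul]
    exact mul_le_mul_left hρ τ
  · rwa [← mul_assoc, PAut.mul_inv_mul]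

lemma comp_rm_mem (h : AdmissibleFam Θ C) (hT : T ∈ C ρ σ) {c : B}
    (hc : c ∈ hmg (Bimod.self B) τ⁻¹) : T ∘L E.rm c ∈ C ρ (σ * τ) := by
  rw [← h.isStarAlgFam.clspan_eq]
  refine comp_mem_clspan_right _ ?_ (h.mem_clspan_comp_op hT)
  rintro _ ⟨ρ', hρ', σ', hσ', hρ, hσ, S, hS, b, hb, c', hc', rfl⟩
  have hc2 : c * c' ∈ hmg (Bimod.self B) (σ'⁻¹ * σ' * τ)⁻¹ := by
    rw [PAut.mul_inv_rev, PAut.inv_of_le_one σ'.inv_mul_le_one]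
    exact mul_mem_hmg hc hc'
  have e : (S ∘L (E.lm b ∘L E.rm c')) ∘L E.rm c = S ∘L (E.lm b ∘L E.rm (c * c')) := by
    ext ξ
    simp [Bimod.lm_apply, Bimod.rm_apply, E.rsmul_mul]
  rw [e]
  refine mem_clspan (h.isStarAlgFam.mono ?_ ?_ (h.comp_op_mem hS (lm_comp_rm_mem_opFam hb hc2)))
  · rwa [← mul_assoc, PAut.mul_inv_mul]
  · rw [← mul_assoc, ← mul_assoc, PAut.mul_inv_mul]
    exact mul_le_mul_left hσ τ

lemma lm_comp_mem (h : AdmissibleFam Θ C) (hT : T ∈ C ρ σ) {b : B}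
    (hb : b ∈ hmg (Bimod.self B) τ) : E.lm b ∘L T ∈ C (τ * ρ) σ := by
  obtain ⟨S, hS, hTS⟩ := h.isStarAlgFam.exists_adjoint hT
  have h1 := h.comp_lm_mem hS (star_mem_hmg hb)
  have h2 := (isAdjoint_lm (E := E) b).clm_comp hTS
  rw [one_mul] at h2
  have h3 := h.isStarAlgFam.adj_mem h1 h2.symm
  simpa [PAut.mul_inv_rev] using h3

lemma rm_comp_mem (h : AdmissibleFam Θ C) (hT : T ∈ C ρ σ) {c : B}
    (hc : c ∈ hmg (Bimod.self B) τ⁻¹) : E.rm c ∘L T ∈ C ρ (τ * σ) := by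
  obtain ⟨S, hS, hTS⟩ := h.isStarAlgFam.exists_adjoint hT
  have h1 := h.comp_rm_mem hS (star_mem_hmg hc)
  have h2 := (isAdjoint_rm (E := E) hc).clm_comp hTS
  have h3 := h.isStarAlgFam.adj_mem (S := E.rm c ∘L T) h1
    (by simpa [PAut.mul_inv_rev] using h2.symm)
  simpa [PAut.mul_inv_rev] using h3

end AdmissibleFam

/-! ### Admissible bimodules -/

section Transport

lemma mem_clspan_of_isometry {V W : Type*} [NormedAddCommGroup V] [NormedSpace ℂ V]
    [CompleteSpace V] [NormedAddCommGroup W] [NormedSpace ℂ W] (f : V →L[ℂ] W)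
    (hf : ∀ x, ‖f x‖ = ‖x‖) {S : Set V} {x : V} (hx : f x ∈ clspan (f '' S)) : x ∈ clspan S := by
  have hf' : Isometry f := AddMonoidHomClass.isometry_of_norm f hf
  have h : f x ∈ closure (f '' (Submodule.span ℂ S : Set V)) := by
    rw [clspan, ← ContinuousLinearMap.coe_coe f, Submodule.span_image] at hx
    exact hx
  rw [hf'.isClosedEmbedding.closure_image_eq] at h
  obtain ⟨y, hy, hyx⟩ := h
  rwa [← hf'.injective hyx]

lemma IsAdjoint.mem_clspan {E F : Bimod B} {σ : PAut B} {S₀ : Set (E →L[ℂ] F)}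
    {K : Set (F →L[ℂ] E)} (h : ∀ T ∈ S₀, ∃ S ∈ clspan K, IsAdjoint σ T S) {T : E →L[ℂ] F}
    {S : F →L[ℂ] E} (hT : T ∈ clspan S₀) (hS : IsAdjoint σ T S) : S ∈ clspan K := by
  have hsub : (Submodule.span ℂ S₀ : Set (E →L[ℂ] F)) ⊆
      {T : E →L[ℂ] F | ∃ S ∈ clspan K, IsAdjoint σ T S} := fun T hT => by
    refine Submodule.span_induction h ⟨0, zero_mem_clspan _, IsAdjoint.zero⟩ ?_ ?_ hT
    · rintro T T' - - ⟨S, hS, h⟩ ⟨S', hS', h'⟩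
      exact ⟨S + S', add_mem_clspan hS hS', h.add h'⟩
    · rintro z T - ⟨S, hS, h⟩
      exact ⟨star z • S, smul_mem_clspan _ hS, h.smul z⟩
  obtain ⟨S', hS', h'⟩ := IsAdjoint.of_mem_closure (isClosed_clspan K) (closure_mono hsub hT)
  rwa [DFunLike.coe_injective (hS.unique h')]

namespace PAut

lemma mem_graph_of_mul_left {θ : PAut B} {x z : B} (hx : x ∈ θ.dom) (hz : z ∈ θ.img)
    (h : ∀ p y, (p, y) ∈ θ.graph → (p * x, y * z) ∈ θ.graph) : (x, z) ∈ θ.graph := by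
  obtain ⟨z', hz'⟩ := hx
  suffices z' = z by rwa [← this]
  obtain ⟨x', hx'⟩ := hz
  refine eq_of_mul_eq_mul (I := θ.img) ⟨_, θ.map_star (θ.map_sub hz' hx')⟩ ?_
  rintro y ⟨p, hp⟩
  exact θ.map_unique (θ.map_mul hp hz') (h p y hp)

lemma mem_graph_of_mul_right {θ : PAut B} {x z : B} (hx : x ∈ θ.dom) (hz : z ∈ θ.img)
    (h : ∀ p y, (p, y) ∈ θ.graph → (x * p, z * y) ∈ θ.graph) : (x, z) ∈ θ.graph := by
  have := mem_graph_of_mul_left (θ.star_mem_dom hx) (θ.star_mem_img hz) fun p y hp => by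
    simpa using θ.map_star (h _ _ (θ.map_star hp))
  simpa using θ.map_star this

lemma exists_mem_clspan {θ : PAut B} {S X : Set B} {x : B} (hx : x ∈ clspan S)
    (h : ∀ s ∈ S, ∃ w ∈ clspan X, (s, w) ∈ θ.graph) : ∃ w ∈ clspan X, (x, w) ∈ θ.graph := by
  refine clspan_induction (p := fun x => ∃ w ∈ clspan X, (x, w) ∈ θ.graph) h
    ⟨0, zero_mem_clspan _, θ.map_zero⟩ ?_ ?_ ?_ hx
  · rintro x y ⟨w, hw, hxw⟩ ⟨v, hv, hyv⟩
    exact ⟨w + v, add_mem_clspan hw hv, θ.map_add hxw hyv⟩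
  · rintro z x ⟨w, hw, hxw⟩
    exact ⟨z • w, smul_mem_clspan z hw, θ.map_smul z hxw⟩
  · refine isClosed_of_closure_subset fun x hx => ?_
    have hd : x ∈ θ.dom := by
      have hc : IsClosed θ.dom := θ.dom_ideal.isClosed
      refine hc.closure_subset_iff.2 ?_ hx
      rintro x ⟨w, -, h⟩
      exact ⟨w, h⟩
    obtain ⟨w, hw⟩ := hd
    obtain ⟨s, hs, hsx⟩ := mem_closure_iff_seq_limit.1 hx
    choose v hv hsv using hs
    exact ⟨w, (isClosed_clspan X).mem_of_tendsto
      (θ.tendsto_of_mem_graph hsx hw (Eventually.of_forall hsv)) (Eventually.of_forall hv), hw⟩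

lemma eq_one_of_one_le {σ : PAut B} (h : 1 ≤ σ) : σ = 1 := by
  refine le_antisymm (le_one_iff.2 fun b c hc => ?_) h
  exact σ.map_unique hc (le_iff.1 h b b (mem_one.2 rfl))

lemma inv_eq_one {σ : PAut B} : σ⁻¹ = 1 ↔ σ = 1 :=
  ⟨fun h => by rw [← inv_inv σ, h, PAut.inv_one], fun h => by rw [h, PAut.inv_one]⟩

end PAut

end Transport

section LeftRightOperators

variable {E : Bimod B} {θ ρ σ : PAut B}

lemma norm_lm_self (b : B) : ‖(Bimod.self B).lm b‖ = ‖b‖ := by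
  refine le_antisymm (Bimod.norm_lm_le _ b) ?_
  rcases eq_or_ne b 0 with rfl | hb
  · simp
  · have h : ‖b * star b‖ ≤ ‖(Bimod.self B).lm b‖ * ‖star b‖ :=
      ((Bimod.self B).lm b).le_opNorm (star b)
    rw [CStarRing.norm_self_mul_star, norm_star] at h
    exact le_of_mul_le_mul_right h (norm_pos_iff.2 hb)

lemma norm_rm_self (b : B) : ‖(Bimod.self B).rm b‖ = ‖b‖ := by
  refine le_antisymm (Bimod.norm_rm_le _ b) ?_
  rcases eq_or_ne b 0 with rfl | hb
  · simp
  · have h : ‖star b * b‖ ≤ ‖(Bimod.self B).rm b‖ * ‖star b‖ :=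
      ((Bimod.self B).rm b).le_opNorm (star b)
    rw [CStarRing.norm_star_mul_self, norm_star] at h
    exact le_of_mul_le_mul_right h (norm_pos_iff.2 hb)

/-- For `ξ` of degree `θ`, `θ(⟨η|bξ⟩) = θ(⟨η|ξ⟩) b`. -/
lemma ip_lsmul_mem_graph {ξ η : E} (hξ : ξ ∈ hmg E θ) {w : B} (hw : (E.ip η ξ, w) ∈ θ.graph)
    (b : B) : (E.ip η (E.lsmul b ξ), w * b) ∈ θ.graph := by
  have h1 : E.lsmul b ξ ∈ E.rspan θ := Bimod.lsmul_mem_rspan_of_mem b (hmg_rspan hξ)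
  refine PAut.mem_graph_of_mul_right (Bimod.ip_mem_dom h1 η)
    (θ.img_ideal.mul_mem_right b ⟨_, hw⟩) fun p y hp => ?_
  obtain ⟨q, hq⟩ := θ.img_ideal.mul_mem_left b ⟨p, hp⟩
  have := θ.map_mul hw hq
  rwa [← E.ip_rsmul, hmg_rsmul hξ hq, E.lsmul_mul, ← hmg_rsmul hξ hp, E.lsmul_rsmul, E.ip_rsmul,
    ← mul_assoc] at this

/-- For `ξ` of degree `θ`, `θ(⟨ξ|bη⟩) = b θ(⟨ξ|η⟩)`. -/
lemma ip_lsmul_mem_graph' {ξ η : E} (hξ : ξ ∈ hmg E θ) {w : B} (hw : (E.ip ξ η, w) ∈ θ.graph)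
    (b : B) : (E.ip ξ (E.lsmul b η), b * w) ∈ θ.graph := by
  have h := θ.map_star hw
  rw [E.star_ip] at h
  have := θ.map_star (ip_lsmul_mem_graph hξ h (star b))
  rwa [E.star_ip, ← E.ip_lsmul, star_mul, star_star, star_star] at this

lemma ip_mem_dom_left {ξ : E} (hξ : ξ ∈ hmg E θ) (η : E) : E.ip ξ η ∈ θ.dom := by
  have := θ.star_mem_dom (Bimod.ip_mem_dom (hmg_rspan hξ) η)
  rwa [E.star_ip] at this

/-- The adjoint of `r(ξ) : b ↦ bξ` is `η ↦ θ(⟨ξ|η⟩)`, for `ξ` of degree `θ`. -/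
lemma exists_adjoint_lm_flip {ξ : E} (hξ : ξ ∈ hmg E θ) : ∃ S : E →L[ℂ] Bimod.self B,
    (∀ η, (E.ip ξ η, S η) ∈ θ.graph) ∧
      IsAdjoint θ⁻¹ (E.lm.flip ξ : Bimod.self B →L[ℂ] E) S := by
  choose S hS using fun η => ip_mem_dom_left hξ η
  have h : IsAdjoint (E := Bimod.self B) θ⁻¹ (E.lm.flip ξ : Bimod.self B →L[ℂ] E) S :=
    fun b η => by
      have h1 := θ.map_star (hS η)
      rw [E.star_ip] at h1
      exact ip_lsmul_mem_graph hξ h1 b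
  obtain ⟨S', hS'⟩ := h.exists_clm
  exact ⟨S', fun η => by rw [hS']; exact hS η, by rw [hS']; exact h⟩

lemma isAdjoint_rm_flip (ξ : E) :
    IsAdjoint (E := Bimod.self B) (F := E) 1 (E.rm.flip ξ) (E.ipL ξ) :=
  fun b η => by
    rw [PAut.mem_one]
    change E.ip η (E.rsmul ξ b) = star (E.ip ξ η) * b
    rw [E.ip_rsmul, E.star_ip]

/-- The family `[l(E)⋆ l(E)]` consists of left multiplications with inner products of homogeneous
elements. -/
lemma prod_adj_lFam (ρ σ : PAut B) : Fam.prod (lFam E).adj (lFam E) ρ σ =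
    clspan {R | σ = 1 ∧ ∃ ρ₁ ρ₂, ρ₁⁻¹ * ρ₂ ≤ ρ ∧ ∃ ξ ∈ hmg E ρ₁, ∃ η ∈ hmg E ρ₂,
      R = (Bimod.self B).lm (E.ip ξ η)} := by
  refine Set.Subset.antisymm (clspan_subset_iff.2 ?_) (clspan_subset_iff.2 ?_)
  · rintro _ ⟨ρ₁, ρ₂, σ₁, σ₂, hρ, hσ, S, ⟨T', hT', hS⟩, T, hT, rfl⟩
    rw [PAut.compLE_iff] at hρ hσ
    have hS' : S ∈ clspan {R : E →L[ℂ] Bimod.self B | σ₁ = 1 ∧ ∃ ξ ∈ hmg E ρ₁⁻¹,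
        R = E.ipL ξ} := by
      refine IsAdjoint.mem_clspan ?_ hT' hS
      rintro T ⟨h, ξ, hξ, hT⟩
      replace h : σ₁ = 1 := PAut.inv_eq_one.1 h
      refine ⟨E.ipL ξ, mem_clspan ⟨h, ξ, hξ, rfl⟩, ?_⟩
      have : T = E.rm.flip ξ := ContinuousLinearMap.ext hT
      rw [this, PAut.inv_eq, h, PAut.inv_one]
      exact isAdjoint_rm_flip ξ
    refine comp_mem_clspan_right T ?_ hS'
    rintro _ ⟨h1, ξ, hξ, rfl⟩
    refine comp_mem_clspan_left _ ?_ hT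
    rintro R ⟨h2, η, hη, hR⟩
    rw [PAut.id_eq] at h2
    refine mem_clspan ⟨?_, ρ₁⁻¹, ρ₂, by rwa [inv_inv], ξ, hξ, η, hη, ?_⟩
    · rw [h1, h2, one_mul] at hσ
      exact PAut.eq_one_of_one_le hσ
    · ext b
      change E.ip ξ (R b) = E.ip ξ η * b
      rw [hR, E.ip_rsmul]
  · rintro _ ⟨h, ρ₁, ρ₂, hρ, ξ, hξ, η, hη, rfl⟩
    have h1 : (E.ipL ξ : E →L[ℂ] Bimod.self B) ∈ (lFam E).adj ρ₁⁻¹ 1 := by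
      refine ⟨E.rm.flip ξ, mem_clspan ⟨PAut.inv_one, ξ, ?_, fun _ => rfl⟩, ?_⟩
      · rwa [PAut.inv_eq, inv_inv]
      · rw [PAut.inv_eq, PAut.inv_one]
        exact isAdjoint_rm_flip ξ
    have h2 : (E.rm.flip η : Bimod.self B →L[ℂ] E) ∈ lFam E ρ₂ 1 :=
      mem_clspan ⟨rfl, η, hη, fun _ => rfl⟩
    have h3 := Fam.mem_prod h1 h2 hρ (σ'' := σ) (by rw [h, one_mul])
    have e : (Bimod.self B).lm (E.ip ξ η) = (E.ipL ξ : E →L[ℂ] Bimod.self B) ∘L E.rm.flip η :=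
      ContinuousLinearMap.ext fun b => (E.ip_rsmul _ _ _).symm
    rw [e]
    exact h3

/-- The family `[r(E)⋆ r(E)]` consists of right multiplications with the elements `θ(⟨ξ|η⟩)` for `ξ`
of degree `θ`. -/
lemma prod_adj_rFam (ρ σ : PAut B) : Fam.prod (rFam E).adj (rFam E) ρ σ =
    clspan {R | ρ = 1 ∧ ∃ θ₁ θ₂, θ₁ * θ₂⁻¹ ≤ σ ∧ ∃ ξ ∈ hmg E θ₁, ∃ η ∈ hmg E θ₂,
      ∃ w, (E.ip ξ η, w) ∈ θ₁.graph ∧ R = (Bimod.self B).rm w} := by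
  refine Set.Subset.antisymm (clspan_subset_iff.2 ?_) (clspan_subset_iff.2 ?_)
  · rintro _ ⟨ρ₁, ρ₂, σ₁, σ₂, hρ, hσ, S, ⟨T', hT', hS⟩, T, hT, rfl⟩
    rw [PAut.compLE_iff] at hρ hσ
    have hS' : S ∈ clspan {R : E →L[ℂ] Bimod.self B | ρ₁ = 1 ∧ ∃ ξ ∈ hmg E σ₁,
        ∀ η, (E.ip ξ η, R η) ∈ σ₁.graph} := by
      refine IsAdjoint.mem_clspan ?_ hT' hS
      rintro T ⟨h, ξ, hξ, hT⟩
      replace h : ρ₁ = 1 := PAut.inv_eq_one.1 h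
      rw [PAut.inv_eq, PAut.inv_eq, inv_inv] at hξ
      obtain ⟨R, hR, hR'⟩ := exists_adjoint_lm_flip hξ
      refine ⟨R, mem_clspan ⟨h, ξ, hξ, hR⟩, ?_⟩
      have : T = E.lm.flip ξ := ContinuousLinearMap.ext hT
      rw [this]
      exact hR'
    refine comp_mem_clspan_right T ?_ hS'
    rintro S ⟨h1, ξ, hξ, hS⟩
    refine comp_mem_clspan_left _ ?_ hT
    rintro R ⟨h2, η, hη, hR⟩
    rw [PAut.id_eq] at h2
    refine mem_clspan ⟨?_, σ₁, σ₂⁻¹, by rwa [inv_inv], ξ, hξ, η, hη, S η, hS η, ?_⟩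
    · rw [h1, h2, one_mul] at hρ
      exact PAut.eq_one_of_one_le hρ
    · ext b
      have h3 := hS (R b)
      rw [hR] at h3
      have h4 := σ₁.map_unique h3 (ip_lsmul_mem_graph' hξ (hS η) b)
      rw [← hR] at h4
      exact h4
  · rintro _ ⟨h, θ₁, θ₂, hσ, ξ, hξ, η, hη, w, hw, rfl⟩
    obtain ⟨S, hS, hS'⟩ := exists_adjoint_lm_flip hξ
    have h1 : S ∈ (rFam E).adj 1 θ₁ :=
      ⟨E.lm.flip ξ, mem_clspan ⟨PAut.inv_one, ξ, by rwa [PAut.inv_eq, PAut.inv_eq, inv_inv],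
        fun _ => rfl⟩, hS'⟩
    have h2 : (E.lm.flip η : Bimod.self B →L[ℂ] E) ∈ rFam E 1 θ₂⁻¹ :=
      mem_clspan ⟨rfl, η, by rwa [PAut.inv_eq, inv_inv], fun _ => rfl⟩
    have h3 := Fam.mem_prod h1 h2 (ρ'' := ρ) (by rw [h, one_mul]) hσ
    have e : (Bimod.self B).rm w = S ∘L (E.lm.flip η : Bimod.self B →L[ℂ] E) :=
      ContinuousLinearMap.ext fun b => θ₁.map_unique (ip_lsmul_mem_graph' hξ hw b) (hS _)
    rw [e]
    exact h3

lemma lFam_self (ρ σ : PAut B) : lFam (Bimod.self B) ρ σ =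
    clspan {R | σ = 1 ∧ ∃ b ∈ hmg (Bimod.self B) ρ, R = (Bimod.self B).lm b} := by
  refine congrArg clspan (Set.ext fun R => and_congr_right' (exists_congr fun b =>
    and_congr_right' ⟨fun h => ContinuousLinearMap.ext h, fun h x => by rw [h]; rfl⟩))

lemma rFam_self (ρ σ : PAut B) : rFam (Bimod.self B) ρ σ =
    clspan {R | ρ = 1 ∧ ∃ b ∈ hmg (Bimod.self B) σ⁻¹, R = (Bimod.self B).rm b} := by
  refine congrArg clspan (Set.ext fun R => and_congr_right' (exists_congr fun b =>
    and_congr_right' ⟨fun h => ContinuousLinearMap.ext h, fun h x => by rw [h]; rfl⟩))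

/-- The condition `[l(E)⋆ l(E)] = l(B)` in terms of inner products. -/
lemma l_full_iff : Fam.prod (lFam E).adj (lFam E) = lFam (Bimod.self B) ↔
    ∀ θ, hmg (Bimod.self B) θ ⊆ clspan {b : B | ∃ ρ₁ ρ₂, ρ₁⁻¹ * ρ₂ ≤ θ ∧
      ∃ ξ ∈ hmg E ρ₁, ∃ η ∈ hmg E ρ₂, b = E.ip ξ η} := by
  constructor
  · intro h θ b hb
    have hb' : (Bimod.self B).lm b ∈ lFam (Bimod.self B) θ 1 := by
      rw [lFam_self]
      exact mem_clspan ⟨rfl, b, hb, rfl⟩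
    rw [← h, prod_adj_lFam] at hb'
    refine mem_clspan_of_isometry (Bimod.self B).lm norm_lm_self (clspan_mono ?_ hb')
    rintro _ ⟨-, ρ₁, ρ₂, hρ, ξ, hξ, η, hη, rfl⟩
    exact ⟨_, ⟨ρ₁, ρ₂, hρ, ξ, hξ, η, hη, rfl⟩, rfl⟩
  · intro h
    funext ρ σ
    rw [prod_adj_lFam, lFam_self]
    refine Set.Subset.antisymm (clspan_mono ?_) (clspan_subset_iff.2 ?_)
    · rintro _ ⟨h, ρ₁, ρ₂, hρ, ξ, hξ, η, hη, rfl⟩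
      exact ⟨h, _, hmg_mono hρ (ip_mem_hmg hξ hη), rfl⟩
    · rintro _ ⟨h', b, hb, rfl⟩
      refine map_mem_clspan (Bimod.self B).lm ?_ (h ρ hb)
      rintro _ ⟨ρ₁, ρ₂, hρ, ξ, hξ, η, hη, rfl⟩
      exact mem_clspan ⟨h', ρ₁, ρ₂, hρ, ξ, hξ, η, hη, rfl⟩

/-- The condition `[r(E)⋆ r(E)] = r(B)` in terms of inner products. -/
lemma r_full_iff : Fam.prod (rFam E).adj (rFam E) = rFam (Bimod.self B) ↔
    ∀ θ, hmg (Bimod.self B) θ ⊆ clspan {w : B | ∃ θ₁ θ₂, θ₂ * θ₁⁻¹ ≤ θ ∧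
      ∃ ξ ∈ hmg E θ₁, ∃ η ∈ hmg E θ₂, (E.ip ξ η, w) ∈ θ₁.graph} := by
  constructor
  · intro h θ b hb
    have hb' : (Bimod.self B).rm b ∈ rFam (Bimod.self B) 1 θ⁻¹ := by
      rw [rFam_self]
      exact mem_clspan ⟨rfl, b, by rwa [inv_inv], rfl⟩
    rw [← h, prod_adj_rFam] at hb'
    refine mem_clspan_of_isometry (Bimod.self B).rm norm_rm_self (clspan_mono ?_ hb')
    rintro _ ⟨-, θ₁, θ₂, hθ, ξ, hξ, η, hη, w, hw, rfl⟩
    refine ⟨w, ⟨θ₁, θ₂, ?_, ξ, hξ, η, hη, hw⟩, rfl⟩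
    simpa [PAut.mul_inv_rev] using PAut.inv_le_inv hθ
  · intro h
    funext ρ σ
    rw [prod_adj_rFam, rFam_self]
    refine Set.Subset.antisymm (clspan_mono ?_) (clspan_subset_iff.2 ?_)
    · rintro _ ⟨h, θ₁, θ₂, hθ, ξ, hξ, η, hη, w, hw, rfl⟩
      refine ⟨h, w, ?_, rfl⟩
      have h1 := hmg_self_conj (θ := θ₁⁻¹) (ip_mem_hmg hξ hη) hw
      refine hmg_mono ?_ h1
      rw [inv_inv, ← mul_assoc]
      refine (mul_le_mul_left (mul_le_of_le_one_left' θ₁.mul_inv_le_one) _).trans ?_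
      simpa [PAut.mul_inv_rev] using PAut.inv_le_inv hθ
    · rintro _ ⟨h', b, hb, rfl⟩
      refine map_mem_clspan (Bimod.self B).rm ?_ (h _ hb)
      rintro w ⟨θ₁, θ₂, hθ, ξ, hξ, η, hη, hw⟩
      refine mem_clspan ⟨h', θ₁, θ₂, ?_, ξ, hξ, η, hη, w, hw, rfl⟩
      simpa [PAut.mul_inv_rev] using PAut.inv_le_inv hθ

end LeftRightOperators

namespace AdmissibleSemigroup

variable {Θ : Set (PAut B)}

lemma mul_mem (h : AdmissibleSemigroup Θ) {σ θ : PAut B} (hσ : σ ∈ Θ) (hθ : θ ∈ Θ) :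
    σ * θ ∈ Θ := by
  obtain ⟨τ, hτ, e⟩ := h.comp_mem σ hσ θ hθ
  rwa [← show τ = σ * θ from PAut.ext e]

lemma inv_mem' (h : AdmissibleSemigroup Θ) {θ : PAut B} (hθ : θ ∈ Θ) : θ⁻¹ ∈ Θ := h.inv_mem θ hθ

lemma one_mem (h : AdmissibleSemigroup Θ) : 1 ∈ Θ := h.id_mem

/-- The algebra `B` is admissible as a bimodule over itself. -/
lemma admissibleBimod_self (h : AdmissibleSemigroup Θ) (hB : Decomposable (Bimod.self B)) :
    AdmissibleBimod Θ (Bimod.self B) where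
  decomposable := by
    refine clspan_eq_univ_of_subset hB ?_
    rintro ξ ⟨θ, hξ⟩
    rw [h.supported θ] at hξ
    refine clspan_mono ?_ hξ
    rintro ξ ⟨θ', hθ', -, hξ⟩
    exact ⟨θ', hθ', hξ⟩
  l_full := by
    refine l_full_iff.2 fun θ b hb => ?_
    refine hB.mem_of_lsmul_mem (E := Bimod.self B) (isClosed_clspan _) fun u hu => ?_
    have hu' : star u ∈ hmg (Bimod.self B) 1⁻¹ := star_mem_hmg hu
    rw [PAut.inv_one] at hu'
    refine mem_clspan ⟨1, θ, by rw [PAut.inv_one, one_mul], star u, hu', b, hb, ?_⟩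
    change u * b = star (star u) * b
    rw [star_star]
  r_full := by
    refine r_full_iff.2 fun θ b hb => ?_
    refine hB.mem_of_lsmul_mem (E := Bimod.self B) (isClosed_clspan _) fun u hu => ?_
    have hu' : star u ∈ hmg (Bimod.self B) 1⁻¹ := star_mem_hmg hu
    rw [PAut.inv_one] at hu'
    refine mem_clspan ⟨1, θ, by rw [PAut.inv_one, mul_one], star u, hu', b, hb, ?_⟩
    rw [PAut.mem_one]
    change u * b = star (star u) * b
    rw [star_star]

end AdmissibleSemigroup

/-! ### The unit family -/

lemma hmg_self_mono {σ θ : PAut B} (h : σ ≤ θ) {b : B} (hb : b ∈ hmg (Bimod.self B) σ) :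
    b ∈ hmg (Bimod.self B) θ := hmg_mono (E := Bimod.self B) h hb

namespace PAut

variable {θ θ₁ θ₂ : PAut B} {d : B}

lemma exists_shift (hd : d ∈ θ.dom) : ∃ V : B →L[ℂ] B, ∀ b, (b * d, V b) ∈ θ.graph := by
  choose f hf using fun b => θ.dom_ideal.mul_mem_left b hd
  let V : B →ₗ[ℂ] B :=
    { toFun := f
      map_add' := fun x y => θ.map_unique (hf _) (by rw [add_mul]; exact θ.map_add (hf x) (hf y))
      map_smul' := fun z x => θ.map_unique (hf _) (by
        rw [smul_mul_assoc]; exact θ.map_smul z (hf x)) }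
  refine ⟨V.mkContinuous ‖d‖ fun b => ?_, hf⟩
  rw [mul_comm]
  exact (θ.norm_eq (hf b)).trans_le (norm_mul_le b d)

open Classical in
/-- The operator `b ↦ θ(b d)` on `B`, for `d ∈ Dom θ` (and zero otherwise). -/
def shift (θ : PAut B) (d : B) : B →L[ℂ] B := if h : d ∈ θ.dom then (exists_shift h).choose else 0

lemma shift_spec (hd : d ∈ θ.dom) (b : B) : (b * d, θ.shift d b) ∈ θ.graph := by
  rw [shift, dif_pos hd]
  exact (exists_shift hd).choose_spec b

lemma shift_eq {V : B →L[ℂ] B} (hV : ∀ b, (b * d, V b) ∈ θ.graph) (hd : d ∈ θ.dom) :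
    θ.shift d = V :=
  ContinuousLinearMap.ext fun b => θ.map_unique (shift_spec hd b) (hV b)

lemma source_dom (hd : d ∈ hmg (Bimod.self B) (θ⁻¹ * θ)) : d ∈ θ.dom := by
  obtain ⟨_, c, hc, -⟩ := hmg_self_dom hd
  exact ⟨c, hc⟩

lemma central_of_source (hd : d ∈ hmg (Bimod.self B) (θ⁻¹ * θ)) (x : B) : d * x = x * d :=
  mem_hmg_one.1 (hmg_self_mono θ.inv_mul_le_one hd) x

lemma mem_source {x : B} : x ∈ hmg (Bimod.self B) (θ⁻¹ * θ) ↔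
    x ∈ θ.dom ∧ ∀ y, x * y = y * x := by
  refine ⟨fun h => ⟨source_dom h, central_of_source h⟩, fun h =>
    (mem_hmg_of_le_one θ.inv_mul_le_one).2 ⟨?_, h.2⟩⟩
  obtain ⟨c, hc⟩ := h.1
  exact ⟨x, c, hc, hc⟩

/-- The image of a central element is central. -/
lemma map_central {d d' : B} (hd : d ∈ hmg (Bimod.self B) (θ⁻¹ * θ)) (h : (d, d') ∈ θ.graph) :
    d' ∈ hmg (Bimod.self B) (θ * θ⁻¹) := by
  have h1 := hmg_self_conj (θ := θ⁻¹) hd h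
  refine hmg_self_mono ?_ h1
  rw [inv_inv, ← mul_assoc, mul_inv_mul]

/-- `θ(b d) x = θ(b θ⁻¹(θ(d) x))` for central `d`. -/
lemma shift_mul_mem_graph (hd : d ∈ hmg (Bimod.self B) (θ⁻¹ * θ)) {d' x e : B}
    (h : (d, d') ∈ θ.graph) (he : (e, d' * x) ∈ θ.graph) (b : B) :
    (b * e, θ.shift d b * x) ∈ θ.graph := by
  have hV := shift_spec (source_dom hd)
  refine mem_graph_of_mul_left (θ.dom_ideal.mul_mem_left b ⟨_, he⟩)
    (θ.img_ideal.mul_mem_right x ⟨_, hV b⟩) fun p y hp => ?_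
  -- both sides are the image of `p b d`, multiplied by `x`
  have h1 := θ.map_mul hp (hV b)
  obtain ⟨q, hq⟩ := θ.dom_ideal.mul_mem_right b ⟨_, hp⟩
  have h2 := θ.map_mul hq h
  rw [mul_assoc] at h2
  have h3 := θ.map_unique h1 h2
  have h4 := θ.map_mul hq he
  rwa [← mul_assoc q, ← h3, mul_assoc p, mul_assoc y] at h4

/-- `x θ(b d) = θ(θ⁻¹(x θ(d)) b)` for central `d`. -/
lemma mul_shift_mem_graph (hd : d ∈ hmg (Bimod.self B) (θ⁻¹ * θ)) {d' x e : B}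
    (h : (d, d') ∈ θ.graph) (he : (e, x * d') ∈ θ.graph) (b : B) :
    (e * b, x * θ.shift d b) ∈ θ.graph := by
  have hV := shift_spec (source_dom hd)
  have hc := central_of_source hd
  refine mem_graph_of_mul_right (θ.dom_ideal.mul_mem_right b ⟨_, he⟩)
    (θ.img_ideal.mul_mem_left x ⟨_, hV b⟩) fun p y hp => ?_
  have h1 := θ.map_mul (hV b) hp
  obtain ⟨q, hq⟩ := θ.dom_ideal.mul_mem_left b ⟨_, hp⟩
  have h2 := θ.map_mul h hq
  rw [← mul_assoc, hc] at h2
  have h3 := θ.map_unique h1 h2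
  have h4 := θ.map_mul he hq
  rwa [mul_assoc x, ← h3, ← mul_assoc e, ← mul_assoc x] at h4

lemma isAdjoint_shift (hd : d ∈ hmg (Bimod.self B) (θ⁻¹ * θ)) {d' : B}
    (h : (d, d') ∈ θ.graph) : IsAdjoint (E := Bimod.self B) (F := Bimod.self B) θ
      (θ.shift d) (θ⁻¹.shift (star d')) := fun ξ η => by
  have h' : (star d', star d) ∈ θ⁻¹.graph := θ.map_star h
  have h1 : (θ⁻¹.shift (star d') η, η * star d') ∈ θ.graph := shift_spec ⟨_, h'⟩ η
  have h2 := θ.map_star h1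
  have hc := mem_hmg_one.1 (hmg_self_mono θ.mul_inv_le_one (map_central hd h)) (star η)
  rw [star_mul, star_star, hc] at h2
  exact mul_shift_mem_graph hd h h2 ξ

lemma isHomogeneous_shift (hd : d ∈ hmg (Bimod.self B) (θ⁻¹ * θ)) :
    IsHomogeneous (E := Bimod.self B) (F := Bimod.self B) θ θ (θ.shift d) := by
  have hV := shift_spec (source_dom hd)
  obtain ⟨d', hd'⟩ := source_dom hd
  refine IsHomogeneous.mk' (fun ξ => Bimod.mem_lspan_self.2 ⟨_, hV ξ⟩) (fun a a' h ξ => ?_)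
    (isAdjoint_shift hd hd')
  have := θ.map_mul h (hV ξ)
  rw [← mul_assoc] at this
  exact θ.map_unique (hV _) this

lemma exists_shift_comp_shift (hd : d ∈ hmg (Bimod.self B) (θ₁⁻¹ * θ₁)) {d₂ : B}
    (hd₂ : d₂ ∈ hmg (Bimod.self B) (θ₂⁻¹ * θ₂)) :
    ∃ e ∈ hmg (Bimod.self B) ((θ₂ * θ₁)⁻¹ * (θ₂ * θ₁)),
      θ₂.shift d₂ ∘L θ₁.shift d = (θ₂ * θ₁).shift e := by
  obtain ⟨d', hd'⟩ := source_dom hd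
  have hc := hmg_self_mono θ₁.mul_inv_le_one (map_central hd hd')
  obtain ⟨e, he⟩ := θ₁.img_ideal.mul_mem_right d₂ ⟨_, hd'⟩
  have h1 : d' * d₂ ∈ hmg (Bimod.self B) (1 * (θ₂⁻¹ * θ₂)) := mul_mem_hmg hc hd₂
  rw [one_mul] at h1
  have h2 := hmg_self_conj h1 he
  have h3 : e ∈ hmg (Bimod.self B) ((θ₂ * θ₁)⁻¹ * (θ₂ * θ₁)) := by
    rwa [PAut.mul_inv_rev, mul_assoc, ← mul_assoc θ₂⁻¹, ← mul_assoc]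
  refine ⟨e, h3, (shift_eq (fun b => ?_) (source_dom h3)).symm⟩
  exact ⟨_, shift_mul_mem_graph hd hd' he b, shift_spec (source_dom hd₂) _⟩

/-- The closed set principle for the operators `b ↦ θ(b d)` with central `d`. -/
lemma shift_mem (hd : d ∈ hmg (Bimod.self B) (θ⁻¹ * θ)) {P : Set (B →L[ℂ] B)} (hP : IsClosed P)
    (h : ∀ u ∈ hmg (Bimod.self B) (θ⁻¹ * θ), θ.shift (d * u) ∈ P) : θ.shift d ∈ P := by
  obtain ⟨l, hl, hl1, hl2⟩ := exists_central_approximateUnit θ.inv_mul_le_one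
  have hdd : star d * d ∈ hmg (Bimod.self B) (θ⁻¹ * θ) :=
    (centralAlg _ θ.inv_mul_le_one).mul_mem' ((centralAlg _ θ.inv_mul_le_one).star_mem' hd) hd
  have h1 := tendsto_iff_norm_sub_tendsto_zero.1 (hl2 d hdd)
  refine hP.mem_of_tendsto (f := fun u => θ.shift (d * u)) (b := l) ?_
    (hl1.mono fun u hu => h u hu.1)
  refine tendsto_iff_norm_sub_tendsto_zero.2 (squeeze_zero (fun _ => norm_nonneg _)
    (fun u => ?_) h1)
  refine ContinuousLinearMap.opNorm_le_bound _ (norm_nonneg _) fun b => ?_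
  have h2 := θ.map_sub (shift_spec (θ.dom_ideal.mul_mem_right u (source_dom hd)) b)
    (shift_spec (source_dom hd) b)
  rw [← mul_sub] at h2
  rw [mul_comm]
  exact (θ.norm_eq h2).trans_le (norm_mul_le _ _)

end PAut

section UnitFamily

variable {Θ : Set (PAut B)} {ρ σ ρ' σ' ρ₁ σ₁ θ : PAut B}

/-- The family `𝒦(B;Θ)` is spanned by the compositions of the operators `b ↦ θ(b d)` with central
`d` and the operators `b ↦ a b c`. -/
lemma unitFam_eq (ρ' σ' : PAut B) : unitFam Θ ρ' σ' = clspan {k | ∃ ρ ∈ Θ, ∃ σ ∈ Θ, ∃ θ ∈ Θ,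
    θ * ρ ≤ ρ' ∧ θ * σ ≤ σ' ∧ ∃ a ∈ hmg (Bimod.self B) ρ, ∃ c ∈ hmg (Bimod.self B) σ⁻¹,
    ∃ d ∈ hmg (Bimod.self B) (θ⁻¹ * θ),
      k = θ.shift d ∘L ((Bimod.self B).lm a ∘L (Bimod.self B).rm c)} := by
  refine congrArg clspan (Set.ext fun k => ?_)
  refine exists_congr fun ρ => and_congr_right' (exists_congr fun σ => and_congr_right'
    (exists_congr fun θ => and_congr_right' (and_congr_right' (and_congr_right'
    (exists_congr fun a => and_congr_right' (exists_congr fun c => and_congr_right'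
    (exists_congr fun d => ?_)))))))
  rw [PAut.source_eq]
  refine and_congr_right fun hd => ⟨fun h => ContinuousLinearMap.ext fun b => ?_, ?_⟩
  · refine θ.map_unique (h b) ?_
    rw [mul_assoc a]
    exact PAut.shift_spec (PAut.source_dom hd) (a * (b * c))
  · rintro rfl b
    rw [mul_assoc a]
    exact PAut.shift_spec (PAut.source_dom hd) (a * (b * c))

lemma unitFam_mono (hρ : ρ ≤ ρ') (hσ : σ ≤ σ') : unitFam Θ ρ σ ⊆ unitFam Θ ρ' σ' := by
  refine clspan_mono ?_
  rintro k ⟨ρ₁, h1, σ₁, h2, θ, h3, h4, h5, h⟩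
  exact ⟨ρ₁, h1, σ₁, h2, θ, h3, le_trans (PAut.compLE_iff.1 h4) hρ,
    le_trans (PAut.compLE_iff.1 h5) hσ, h⟩

lemma clspan_unitFam (ρ σ : PAut B) : clspan (unitFam Θ ρ σ) = unitFam Θ ρ σ := clspan_clspan _

lemma mem_unitFam {a c d : B} (hρΘ : ρ ∈ Θ) (hσΘ : σ ∈ Θ) (hθΘ : θ ∈ Θ)
    (ha : a ∈ hmg (Bimod.self B) ρ) (hc : c ∈ hmg (Bimod.self B) σ⁻¹)
    (hd : d ∈ hmg (Bimod.self B) (θ⁻¹ * θ)) (hρ : θ * ρ ≤ ρ') (hσ : θ * σ ≤ σ') :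
    θ.shift d ∘L ((Bimod.self B).lm a ∘L (Bimod.self B).rm c) ∈ unitFam Θ ρ' σ' := by
  rw [unitFam_eq]
  exact mem_clspan ⟨ρ, hρΘ, σ, hσΘ, θ, hθΘ, hρ, hσ, a, ha, c, hc, d, hd, rfl⟩

namespace AdmissibleSemigroup

lemma unitFam_homogeneous : (unitFam Θ).Homogeneous := fun ρ' σ' T hT => by
  rw [unitFam_eq] at hT
  refine IsHomogeneous.of_mem_clspan ?_ hT
  rintro k ⟨ρ, hρ, σ, hσ, θ, hθ, h1, h2, a, ha, c, hc, d, hd, rfl⟩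
  have h := (PAut.isHomogeneous_shift hd).comp ((isHomogeneous_lm ha).comp (isHomogeneous_rm hc))
  exact h.mono (by rwa [mul_one]) (by rwa [one_mul])

/-- Products `O V`, where `O b = a b c` and `V b = θ(b d)`, belong to the unit family: if `u` and
`v` are approximate units of central elements, then `a θ(b d u v) c = θ(a' b c' d)` with
`θ(a') = a θ(u)` and `θ(c') = θ(v) c`. -/
lemma op_comp_shift_mem (hΘ : AdmissibleSemigroup Θ) (hρ : ρ ∈ Θ) (hσ : σ ∈ Θ) (hθ : θ ∈ Θ)
    {a c d : B} (ha : a ∈ hmg (Bimod.self B) ρ) (hc : c ∈ hmg (Bimod.self B) σ⁻¹)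
    (hd : d ∈ hmg (Bimod.self B) (θ⁻¹ * θ)) :
    ((Bimod.self B).lm a ∘L (Bimod.self B).rm c) ∘L θ.shift d ∈ unitFam Θ (ρ * θ) (σ * θ) := by
  have hP : IsClosed {V : B →L[ℂ] B | ((Bimod.self B).lm a ∘L (Bimod.self B).rm c) ∘L V ∈
      unitFam Θ (ρ * θ) (σ * θ)} :=
    (isClosed_clspan _).preimage (ContinuousLinearMap.compL ℂ B B B
      ((Bimod.self B).lm a ∘L (Bimod.self B).rm c)).continuous
  have hm {x y : B} (hx : x ∈ hmg (Bimod.self B) (θ⁻¹ * θ))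
      (hy : y ∈ hmg (Bimod.self B) (θ⁻¹ * θ)) : x * y ∈ hmg (Bimod.self B) (θ⁻¹ * θ) :=
    (centralAlg _ θ.inv_mul_le_one).mul_mem' hx hy
  refine PAut.shift_mem hd hP fun u hu => PAut.shift_mem (hm hd hu) hP fun v hv => ?_
  obtain ⟨u', hu'⟩ := PAut.source_dom hu
  obtain ⟨v', hv'⟩ := PAut.source_dom hv
  have hu1 := hmg_self_mono θ.mul_inv_le_one (PAut.map_central hu hu')
  have hv1 := hmg_self_mono θ.mul_inv_le_one (PAut.map_central hv hv')
  obtain ⟨a', ha'⟩ := θ.img_ideal.mul_mem_left a ⟨_, hu'⟩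
  obtain ⟨c', hc'⟩ := θ.img_ideal.mul_mem_right c ⟨_, hv'⟩
  have ha1 : a * u' ∈ hmg (Bimod.self B) (ρ * 1) := mul_mem_hmg ha hu1
  have hc1 : v' * c ∈ hmg (Bimod.self B) (1 * σ⁻¹) := mul_mem_hmg hv1 hc
  have ha2 := hmg_self_conj ha1 ha'
  have hc2 := hmg_self_conj hc1 hc'
  rw [mul_one] at ha2
  have e1 : θ⁻¹ * (1 * σ⁻¹) * θ = (θ⁻¹ * σ * θ)⁻¹ := by
    rw [one_mul, PAut.mul_inv_rev, PAut.mul_inv_rev, inv_inv, mul_assoc]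
  rw [e1] at hc2
  have e : ((Bimod.self B).lm a ∘L (Bimod.self B).rm c) ∘L θ.shift (d * u * v) =
      θ.shift d ∘L ((Bimod.self B).lm a' ∘L (Bimod.self B).rm c') := by
    refine ContinuousLinearMap.ext fun b => ?_
    have hduv := PAut.source_dom (hm (hm hd hu) hv)
    have hcd := PAut.central_of_source hd
    have hcu := PAut.central_of_source hu
    have hcv := PAut.central_of_source hv
    have h1 := PAut.mul_shift_mem_graph hu hu' ha' (b * d * v)
    have h2 := PAut.shift_mul_mem_graph hv hv' hc' (a' * b * d)
    have h3 : θ.shift u (b * d * v) = θ.shift (d * u * v) b := by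
      refine θ.map_unique (PAut.shift_spec (PAut.source_dom hu) _) ?_
      have := PAut.shift_spec hduv b
      have e0 : b * (d * u * v) = b * d * v * u := by
        rw [mul_assoc d, hcu v]
        simp only [mul_assoc]
      rwa [e0] at this
    have h4 : θ.shift v (a' * b * d) = a * θ.shift (d * u * v) b := by
      refine θ.map_unique (PAut.shift_spec (PAut.source_dom hv) _) ?_
      rwa [h3, ← mul_assoc, ← mul_assoc] at h1
    have h5 := PAut.shift_spec (PAut.source_dom hd) (a' * (b * c'))
    have h6 : a' * (b * c') * d = a' * b * d * c' := by
      rw [← mul_assoc, mul_assoc (a' * b), ← hcd, ← mul_assoc]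
    rw [h6] at h5
    rw [h4, mul_assoc a] at h2
    exact θ.map_unique h2 h5
  change ((Bimod.self B).lm a ∘L (Bimod.self B).rm c) ∘L θ.shift (d * u * v) ∈ unitFam Θ _ _
  rw [e]
  refine mem_unitFam (hΘ.mul_mem (hΘ.mul_mem (hΘ.inv_mem' hθ) hρ) hθ)
    (hΘ.mul_mem (hΘ.mul_mem (hΘ.inv_mem' hθ) hσ) hθ) hθ ha2 hc2 hd ?_ ?_
  · rw [← mul_assoc, ← mul_assoc]
    exact mul_le_mul_left (mul_le_of_le_one_left' θ.mul_inv_le_one) _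
  · rw [← mul_assoc, ← mul_assoc]
    exact mul_le_mul_left (mul_le_of_le_one_left' θ.mul_inv_le_one) _

/-- The unit family absorbs the operators `b ↦ a b c` on the right, as such operators compose to
operators of the same kind. -/
lemma unitFam_comp_op_mem (hΘ : AdmissibleSemigroup Θ)
    {T : Bimod.self B →L[ℂ] Bimod.self B} (hT : T ∈ unitFam Θ ρ' σ')
    (hρ : ρ ∈ Θ) (hσ : σ ∈ Θ) {a c : B} (ha : a ∈ hmg (Bimod.self B) ρ)
    (hc : c ∈ hmg (Bimod.self B) σ⁻¹) :
    T ∘L ((Bimod.self B).lm a ∘L (Bimod.self B).rm c) ∈ unitFam Θ (ρ' * ρ) (σ' * σ) := by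
  rw [unitFam_eq] at hT
  rw [← clspan_unitFam]
  refine comp_mem_clspan_right _ ?_ hT
  rintro _ ⟨ρ₁, hρ₁, σ₁, hσ₁, θ, hθ, h1, h2, a₁, ha₁, c₁, hc₁, d, hd, rfl⟩
  have e : (θ.shift d ∘L ((Bimod.self B).lm a₁ ∘L (Bimod.self B).rm c₁)) ∘L
      ((Bimod.self B).lm a ∘L (Bimod.self B).rm c) =
      θ.shift d ∘L ((Bimod.self B).lm (a₁ * a) ∘L (Bimod.self B).rm (c * c₁)) := by
    refine ContinuousLinearMap.ext fun b => congrArg (θ.shift d) ?_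
    change a₁ * (a * (b * c) * c₁) = a₁ * a * (b * (c * c₁))
    simp only [mul_assoc]
  rw [e]
  have hc' : c * c₁ ∈ hmg (Bimod.self B) (σ₁ * σ)⁻¹ := by
    rw [PAut.mul_inv_rev]
    exact mul_mem_hmg hc hc₁
  refine mem_clspan (mem_unitFam (hΘ.mul_mem hρ₁ hρ) (hΘ.mul_mem hσ₁ hσ) hθ
    (mul_mem_hmg ha₁ ha) hc' hd ?_ ?_)
  · rw [← mul_assoc]
    exact mul_le_mul_left h1 _
  · rw [← mul_assoc]
    exact mul_le_mul_left h2 _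

/-- The unit family absorbs the operators `b ↦ θ(b d)` on the left, as such operators compose to
operators of the same kind. -/
lemma shift_comp_unitFam_mem (hΘ : AdmissibleSemigroup Θ)
    {T : Bimod.self B →L[ℂ] Bimod.self B} (hT : T ∈ unitFam Θ ρ σ)
    (hθ : θ ∈ Θ) {d : B} (hd : d ∈ hmg (Bimod.self B) (θ⁻¹ * θ)) :
    (θ.shift d : Bimod.self B →L[ℂ] Bimod.self B) ∘L T ∈ unitFam Θ (θ * ρ) (θ * σ) := by
  rw [unitFam_eq] at hT
  rw [← clspan_unitFam]
  refine comp_mem_clspan_left (E := Bimod.self B) (F := Bimod.self B) (G := Bimod.self B) _ ?_ hT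
  rintro _ ⟨ρ₁, hρ₁, σ₁, hσ₁, θ₁, hθ₁, h1, h2, a, ha, c, hc, d₁, hd₁, rfl⟩
  obtain ⟨e, he, h⟩ := PAut.exists_shift_comp_shift hd₁ hd
  rw [← ContinuousLinearMap.comp_assoc, h]
  refine mem_clspan (mem_unitFam hρ₁ hσ₁ (hΘ.mul_mem hθ hθ₁) ha hc he ?_ ?_)
  · rw [mul_assoc]
    exact mul_le_mul_right h1 _
  · rw [mul_assoc]
    exact mul_le_mul_right h2 _

/-- Adjoints and products of generators `V O` of the unit family, with `V b = θ(b d)` and `O b = a b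
c`, are brought back to this form by exchanging the order of `O` and `V`. -/
lemma unitFam_isStarAlgFam (hΘ : AdmissibleSemigroup Θ) : (unitFam Θ).IsStarAlgFam where
  homogeneous := unitFam_homogeneous
  clspan_eq := clspan_unitFam
  mono := unitFam_mono
  adj_mem := by
    intro ρ σ T S hT hS
    rw [unitFam_eq] at hT
    rw [← clspan_unitFam]
    refine IsAdjoint.mem_clspan ?_ hT hS
    rintro _ ⟨ρ₁, hρ₁, σ₁, hσ₁, θ, hθ, h1, h2, a, ha, c, hc, d, hd, rfl⟩
    obtain ⟨d', hd'⟩ := PAut.source_dom hd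
    have h3 := (PAut.isAdjoint_shift hd hd').clm_comp
      ((isAdjoint_lm (E := Bimod.self B) a).clm_comp (isAdjoint_rm hc))
    refine ⟨_, mem_clspan ?_, h3.mono (by rwa [one_mul])⟩
    have hd'' : star d' ∈ hmg (Bimod.self B) (θ * θ⁻¹)⁻¹ := star_mem_hmg (PAut.map_central hd hd')
    rw [PAut.mul_inv_rev] at hd''
    have h4 := hΘ.op_comp_shift_mem (hΘ.inv_mem' hρ₁) (hΘ.inv_mem' hσ₁) (hΘ.inv_mem' hθ)
      (star_mem_hmg ha) (star_mem_hmg hc) hd''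
    rw [← PAut.mul_inv_rev, ← PAut.mul_inv_rev] at h4
    refine unitFam_mono (PAut.inv_le_inv h1) (PAut.inv_le_inv h2) ?_
    have e : (Bimod.self B).rm (star c) ∘L (Bimod.self B).lm (star a) =
        (Bimod.self B).lm (star a) ∘L (Bimod.self B).rm (star c) :=
      ContinuousLinearMap.ext fun b => mul_assoc (star a) b (star c)
    rw [e]
    exact h4
  mul_mem := by
    intro ρ' σ' ρ σ T' T hT' hT
    rw [unitFam_eq] at hT hT'
    rw [← clspan_unitFam]
    refine comp_mem_clspan_right _ ?_ hT'
    rintro _ ⟨ρ₂, hρ₂, σ₂, hσ₂, θ₂, hθ₂, h1', h2', a₂, ha₂, c₂, hc₂, d₂, hd₂, rfl⟩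
    refine comp_mem_clspan_left _ ?_ hT
    rintro _ ⟨ρ₁, hρ₁, σ₁, hσ₁, θ₁, hθ₁, h1, h2, a₁, ha₁, c₁, hc₁, d₁, hd₁, rfl⟩
    have h3 := hΘ.op_comp_shift_mem hρ₂ hσ₂ hθ₁ ha₂ hc₂ hd₁
    have h4 := hΘ.unitFam_comp_op_mem (hΘ.shift_comp_unitFam_mem h3 hθ₂ hd₂) hρ₁ hσ₁ ha₁ hc₁
    refine mem_clspan (unitFam_mono ?_ ?_ h4)
    · rw [← mul_assoc, mul_assoc]
      exact PAut.mul_le_mul h1' h1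
    · rw [← mul_assoc, mul_assoc]
      exact PAut.mul_le_mul h2' h2

lemma unitFam_comp_opFam_mem (hΘ : AdmissibleSemigroup Θ)
    {T O : Bimod.self B →L[ℂ] Bimod.self B} (hT : T ∈ unitFam Θ ρ' σ')
    (hO : O ∈ opFam (Bimod.self B) ρ σ) : T ∘L O ∈ unitFam Θ (ρ' * ρ) (σ' * σ) := by
  rw [← clspan_unitFam]
  refine comp_mem_clspan_left _ ?_ (mem_clspan_lm_comp_rm hO)
  rintro _ ⟨a, ha, c, hc, rfl⟩
  -- reduce to coefficients whose degrees belong to `Θ`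
  rw [hΘ.supported] at ha hc
  refine map_mem_clspan ((ContinuousLinearMap.compL ℂ B B B T) ∘L
    (ContinuousLinearMap.compL ℂ B B B).flip ((Bimod.self B).rm c) ∘L (Bimod.self B).lm) ?_ ha
  rintro a ⟨ρ₁, hρ₁, h1, ha⟩
  refine map_mem_clspan ((ContinuousLinearMap.compL ℂ B B B T) ∘L
    (ContinuousLinearMap.compL ℂ B B B ((Bimod.self B).lm a)) ∘L (Bimod.self B).rm) ?_ hc
  rintro c ⟨σ₁, hσ₁, h2, hc⟩
  have h3 := hΘ.unitFam_comp_op_mem hT hρ₁ (hΘ.inv_mem' hσ₁) ha (by rwa [inv_inv])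
  refine mem_clspan (unitFam_mono (mul_le_mul_right h1 _) (mul_le_mul_right ?_ _) h3)
  simpa using PAut.inv_le_inv h2

/-- If `θρ₁ ≤ ρ`, then elements of degree `ρ₁` cut down to `Dom θ` are supported on `Dom ρ`. -/
lemma mem_dom_of_mul_le {a e : B} (hθ : θ * ρ₁ ≤ ρ) (ha : a ∈ hmg (Bimod.self B) ρ₁)
    (he : e ∈ hmg (Bimod.self B) (θ⁻¹ * θ)) : star (a * e) * (a * e) ∈
      hmg (Bimod.self B) (ρ⁻¹ * ρ) := by
  have h1 : a * e ∈ hmg (Bimod.self B) (ρ₁ * (θ⁻¹ * θ)) := mul_mem_hmg ha he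
  have h2 : a * e ∈ hmg (Bimod.self B) ρ₁ :=
    hmg_self_mono (mul_le_of_le_one_right' θ.inv_mul_le_one) h1
  obtain ⟨x, hx⟩ := θ.dom_ideal.mul_mem_left a (PAut.source_dom he)
  have h3 : (a * e, x) ∈ ρ.graph := PAut.le_iff.1 hθ _ _ ⟨_, hmg_self_mem_graph h2, hx⟩
  have h4 : star (a * e) * (a * e) ∈ hmg (Bimod.self B) (ρ₁⁻¹ * ρ₁) := star_mul_self_mem_hmg h2
  exact PAut.mem_source.2 ⟨ρ.dom_ideal.mul_mem_left _ ⟨_, h3⟩, PAut.central_of_source h4⟩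

/-- The operators `b ↦ θ(a b c d)` are limits of such operators with `a` and `c` in `Dom θ`. -/
lemma shift_comp_mem {a c d : B} (hd : d ∈ hmg (Bimod.self B) (θ⁻¹ * θ)) {P : Set (B →L[ℂ] B)}
    (hP : IsClosed P)
    (h : ∀ e ∈ hmg (Bimod.self B) (θ⁻¹ * θ), ∀ f ∈ hmg (Bimod.self B) (θ⁻¹ * θ),
      θ.shift d ∘L ((Bimod.self B).lm (a * e) ∘L (Bimod.self B).rm (c * f)) ∈ P) :
    θ.shift d ∘L ((Bimod.self B).lm a ∘L (Bimod.self B).rm c) ∈ P := by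
  have hP' : IsClosed {V : B →L[ℂ] B | V ∘L ((Bimod.self B).lm a ∘L (Bimod.self B).rm c) ∈ P} :=
    hP.preimage ((ContinuousLinearMap.compL ℂ B B B).flip
      ((Bimod.self B).lm a ∘L (Bimod.self B).rm c)).continuous
  have hm {x y : B} (hx : x ∈ hmg (Bimod.self B) (θ⁻¹ * θ))
      (hy : y ∈ hmg (Bimod.self B) (θ⁻¹ * θ)) : x * y ∈ hmg (Bimod.self B) (θ⁻¹ * θ) :=
    (centralAlg _ θ.inv_mul_le_one).mul_mem' hx hy
  refine PAut.shift_mem hd hP' fun e he => PAut.shift_mem (hm hd he) hP' fun f hf => ?_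
  -- `θ(a b c d e f) = θ((a e) b (f c) d)`
  have e1 : θ.shift (d * e * f) ∘L ((Bimod.self B).lm a ∘L (Bimod.self B).rm c) =
      θ.shift d ∘L ((Bimod.self B).lm (a * e) ∘L (Bimod.self B).rm (c * f)) := by
    refine ContinuousLinearMap.ext fun b => ?_
    refine θ.map_unique (PAut.shift_spec (PAut.source_dom (hm (hm hd he) hf)) _) ?_
    have h3 := PAut.shift_spec (PAut.source_dom hd) (a * e * (b * (c * f)))
    have hcd := PAut.central_of_source hd
    have hce := PAut.central_of_source he
    have h4 : a * e * (b * (c * f)) * d = a * (b * c) * (d * e * f) := by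
      rw [mul_assoc a e, hce, mul_assoc d e f, hce, ← mul_assoc d, hcd]
      simp only [mul_assoc]
      rw [hce d]
    rw [h4] at h3
    exact h3
  change θ.shift (d * e * f) ∘L ((Bimod.self B).lm a ∘L (Bimod.self B).rm c) ∈ P
  rw [e1]
  exact h e he f hf

/-- The generators of the unit family of degree `(ρ, σ)` are limits of their products with operators
`b ↦ a' b c'` for central `a' ∈ Dom ρ` and `c' ∈ Dom σ`. -/
lemma comp_op_mem_clspan (hρ₁ : ρ₁ ∈ Θ) (hσ₁ : σ₁ ∈ Θ)
    (hθ : θ ∈ Θ) (h1 : θ * ρ₁ ≤ ρ) (h2 : θ * σ₁ ≤ σ) {a c d : B}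
    (ha : a ∈ hmg (Bimod.self B) ρ₁) (hc : c ∈ hmg (Bimod.self B) σ₁⁻¹)
    (hd : d ∈ hmg (Bimod.self B) (θ⁻¹ * θ)) :
    θ.shift d ∘L ((Bimod.self B).lm a ∘L (Bimod.self B).rm c) ∈
      clspan {R | ∃ T ∈ unitFam Θ ρ σ, ∃ S ∈ opFam (Bimod.self B) ρ.source σ.source,
        R = T ∘L S} := by
  set K := {R | ∃ T ∈ unitFam Θ ρ σ, ∃ S ∈ opFam (Bimod.self B) ρ.source σ.source, R = T ∘L S}
  refine shift_comp_mem hd (isClosed_clspan K) fun e he f hf => ?_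
  have hu : a * e ∈ hmg (Bimod.self B) (ρ₁ * (θ⁻¹ * θ)) := mul_mem_hmg ha he
  have hu : a * e ∈ hmg (Bimod.self B) ρ₁ :=
    hmg_self_mono (mul_le_of_le_one_right' θ.inv_mul_le_one) hu
  have hv : c * f ∈ hmg (Bimod.self B) (σ₁⁻¹ * (θ⁻¹ * θ)) := mul_mem_hmg hc hf
  have hv : c * f ∈ hmg (Bimod.self B) σ₁⁻¹ :=
    hmg_self_mono (mul_le_of_le_one_right' θ.inv_mul_le_one) hv
  have hvv : star (c * f) * (c * f) ∈ hmg (Bimod.self B) (σ⁻¹ * σ) := by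
    have h3 : star c ∈ hmg (Bimod.self B) σ₁⁻¹⁻¹ := star_mem_hmg hc
    have h4 : star f ∈ hmg (Bimod.self B) (θ⁻¹ * θ) := (centralAlg _ θ.inv_mul_le_one).star_mem' hf
    rw [inv_inv] at h3
    have h5 := mem_dom_of_mul_le h2 h3 h4
    have h6 : star (star c * star f) = c * f := by
      rw [star_mul, star_star, star_star, PAut.central_of_source hf]
    rw [h6] at h5
    rw [star_mul_self_eq_mul_star_self hv]
    rwa [← h6, star_star, h6]
  have hPu : IsClosed {u : B | θ.shift d ∘L ((Bimod.self B).lm u ∘L (Bimod.self B).rm (c * f)) ∈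
      clspan K} := (isClosed_clspan _).preimage ((ContinuousLinearMap.compL ℂ B B B (θ.shift d)) ∘L
        (ContinuousLinearMap.compL ℂ B B B).flip ((Bimod.self B).rm (c * f)) ∘L
          (Bimod.self B).lm).continuous
  refine mem_of_mul_central_mem ρ.inv_mul_le_one (mem_dom_of_mul_le h1 ha he) hPu fun a' ha' => ?_
  have hPv : IsClosed {v : B | θ.shift d ∘L ((Bimod.self B).lm (a * e * a') ∘L
      (Bimod.self B).rm v) ∈ clspan K} :=
    (isClosed_clspan _).preimage ((ContinuousLinearMap.compL ℂ B B B (θ.shift d)) ∘L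
        (ContinuousLinearMap.compL ℂ B B B ((Bimod.self B).lm (a * e * a'))) ∘L
          (Bimod.self B).rm).continuous
  refine mem_of_mul_central_mem σ.inv_mul_le_one hvv hPv fun c' hc' => ?_
  refine mem_clspan ⟨θ.shift d ∘L ((Bimod.self B).lm (a * e) ∘L (Bimod.self B).rm (c * f)),
    mem_unitFam hρ₁ hσ₁ hθ hu hv hd h1 h2, (Bimod.self B).lm a' ∘L (Bimod.self B).rm c',
    lm_comp_rm_mem_opFam (by rwa [PAut.source_eq]) ?_, ?_⟩
  · rwa [PAut.source_eq, PAut.inv_of_le_one σ.inv_mul_le_one]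
  · refine ContinuousLinearMap.ext fun b => congrArg (θ.shift d) ?_
    change a * e * a' * (b * (c * f * c')) = a * e * (a' * (b * c') * (c * f))
    rw [← PAut.central_of_source hc' (c * f)]
    simp only [mul_assoc]

/-- The unit family is admissible. -/
lemma unitFam_admissible (hΘ : AdmissibleSemigroup Θ) (hB : Decomposable (Bimod.self B)) :
    AdmissibleFam Θ (unitFam Θ) where
  bimod := hΘ.admissibleBimod_self hB
  isCStarFamily := hΘ.unitFam_isStarAlgFam.isCStarFamily
  nondegenerate := by
    refine Set.eq_univ_of_forall fun b => ?_
    refine hB.mem_of_lsmul_mem (E := Bimod.self B) (isClosed_clspan _) fun u hu => ?_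
    refine hB.mem_of_rsmul_mem (E := Bimod.self B) (isClosed_clspan _) fun v hv => ?_
    refine hB.mem_of_rsmul_mem (E := Bimod.self B) (isClosed_clspan _) fun w hw => ?_
    have hv' : v ∈ hmg (Bimod.self B) 1⁻¹ := by rwa [PAut.inv_one]
    have hw' : w ∈ hmg (Bimod.self B) (1⁻¹ * 1) := by rwa [PAut.inv_one, mul_one]
    refine mem_clspan ⟨_, _, _, mem_unitFam hΘ.one_mem hΘ.one_mem hΘ.one_mem hu hv' hw' le_rfl
      le_rfl, b, ?_⟩
    have h := PAut.mem_one.1 (PAut.shift_spec (PAut.source_dom hw') (u * (b * v)))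
    refine Eq.trans ?_ h.symm
    change u * b * v * w = u * (b * v) * w
    simp only [mul_assoc]
  supported ρ' σ' := by
    refine Set.Subset.antisymm ?_ ?_
    · rw [unitFam_eq]
      refine clspan_mono ?_
      rintro _ ⟨ρ, hρ, σ, hσ, θ, hθ, h1, h2, a, ha, c, hc, d, hd, rfl⟩
      exact ⟨_, hΘ.mul_mem hθ hρ, _, hΘ.mul_mem hθ hσ, h1, h2,
        mem_unitFam hρ hσ hθ ha hc hd le_rfl le_rfl⟩
    · rw [← clspan_unitFam]
      refine clspan_mono ?_
      rintro T ⟨ρ, -, σ, -, h1, h2, hT⟩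
      exact unitFam_mono h1 h2 hT
  prod_opFam_le := by
    refine Fam.prod_le clspan_unitFam unitFam_mono ?_
    intro ρ' σ' ρ σ T O hT hO
    exact hΘ.unitFam_comp_opFam_mem hT hO
  mul_opFam ρ hρΘ σ hσΘ := by
    refine Set.Subset.antisymm ?_ fun T hT => ?_
    · refine (clspan_mono ?_).trans (clspan_unitFam ρ σ).subset
      rintro _ ⟨T, hT, O, hO, rfl⟩
      rw [PAut.source_eq, PAut.source_eq] at hO
      have h : T ∘L O ∈ unitFam Θ (ρ * (ρ⁻¹ * ρ)) (σ * (σ⁻¹ * σ)) :=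
        hΘ.unitFam_comp_opFam_mem (T := T) (O := O) hT hO
      rwa [← mul_assoc, ← mul_assoc, PAut.mul_inv_mul, PAut.mul_inv_mul] at h
    · rw [unitFam_eq] at hT
      refine clspan_subset_iff.2 ?_ hT
      rintro _ ⟨ρ₁, hρ₁, σ₁, hσ₁, θ, hθ, h1, h2, a, ha, c, hc, d, hd, rfl⟩
      exact comp_op_mem_clspan hρ₁ hσ₁ hθ h1 h2 ha hc hd

end AdmissibleSemigroup

end UnitFamily

/-! ### The fiber product of admissible families -/

/-- A bounded linear relation maps the closed span of `S` to the closed span of `G` as soon as it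
maps `S` there. -/
lemma mem_clspan_of_rel {V W : Type*} [NormedAddCommGroup V] [NormedSpace ℂ V]
    [NormedAddCommGroup W] [NormedSpace ℂ W] (r : V → W → Prop) {H : Set V}
    (hH : clspan H = H) (ex : ∀ v ∈ H, ∃ w, r v w)
    (add : ∀ {v v' w w'}, r v w → r v' w' → r (v + v') (w + w'))
    (smul : ∀ (z : ℂ) {v w}, r v w → r (z • v) (z • w)) (K : ℝ)
    (bound : ∀ v ∈ H, ∀ w, r v w → ‖w‖ ≤ K * ‖v‖) {S : Set V} {G : Set W} (hSH : S ⊆ H)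
    (h : ∀ s ∈ S, ∀ w, r s w → w ∈ clspan G) {v : V} {w : W} (hv : v ∈ clspan S) (hw : r v w) :
    w ∈ clspan G := by
  have sub {v v' w w'} (h : r v w) (h' : r v' w') : r (v - v') (w - w') := by
    have := add h (smul (-1) h')
    rwa [neg_one_smul, neg_one_smul, ← sub_eq_add_neg, ← sub_eq_add_neg] at this
  have hsub {v v'} (h : v ∈ H) (h' : v' ∈ H) : v - v' ∈ H := by
    rw [← hH] at *
    exact sub_mem_clspan h h'
  have zero : (0 : V) ∈ H := hH ▸ zero_mem_clspan H
  -- by the bound, the relation is single-valued on `H`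
  have uniq {v w w'} (h : r v w) (h' : r v w') : w = w' := by
    have := bound 0 zero (w - w') (by simpa using sub h h')
    rw [norm_zero, mul_zero] at this
    exact sub_eq_zero.1 (norm_le_zero_iff.1 this)
  suffices H' : v ∈ H ∧ ∀ w, r v w → w ∈ clspan G from H'.2 w hw
  refine clspan_induction (p := fun v => v ∈ H ∧ ∀ w, r v w → w ∈ clspan G)
    (fun s hs => ⟨hSH hs, h s hs⟩) ⟨zero, fun w hw => ?_⟩ ?_ ?_ ?_ hv
  · have := bound 0 zero w hw
    rw [norm_zero, mul_zero] at this
    rw [norm_le_zero_iff.1 this]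
    exact zero_mem_clspan G
  · rintro x y ⟨hx, hx'⟩ ⟨hy, hy'⟩
    refine ⟨hH ▸ add_mem_clspan (mem_clspan hx) (mem_clspan hy), fun w hw => ?_⟩
    obtain ⟨a, ha⟩ := ex x hx
    obtain ⟨b, hb⟩ := ex y hy
    rw [uniq hw (add ha hb)]
    exact add_mem_clspan (hx' a ha) (hy' b hb)
  · rintro z x ⟨hx, hx'⟩
    refine ⟨hH ▸ smul_mem_clspan z (mem_clspan hx), fun w hw => ?_⟩
    obtain ⟨a, ha⟩ := ex x hx
    rw [uniq hw (smul z ha)]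
    exact smul_mem_clspan z (hx' a ha)
  · refine isClosed_of_closure_subset fun x hx => ?_
    obtain ⟨s, hs, hsx⟩ := mem_closure_iff_seq_limit.1 hx
    have hxH : x ∈ H := by
      rw [← hH]
      exact (isClosed_clspan H).mem_of_tendsto hsx
        (Eventually.of_forall fun n => mem_clspan (hs n).1)
    refine ⟨hxH, fun w hw => ?_⟩
    choose a ha using fun n => ex (s n) (hs n).1
    refine (isClosed_clspan G).mem_of_tendsto (f := a) (b := atTop) ?_
      (Eventually.of_forall fun n => (hs n).2 _ (ha n))
    refine tendsto_iff_norm_sub_tendsto_zero.2 (squeeze_zero (fun _ => norm_nonneg _)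
      (fun n => bound _ (hsub (hs n).1 hxH) _ (sub (ha n) hw)) ?_)
    simpa using (tendsto_iff_norm_sub_tendsto_zero.1 hsx).const_mul K

section TensorSpan

variable {E F E' F' : Bimod B} {t : InternalTensor E F} {t' : InternalTensor E' F'}
  {ρ σ ρ' σ' : PAut B}

lemma clspan_setOf_isHomogeneous (ρ σ : PAut B) :
    clspan {T : E →L[ℂ] F | IsHomogeneous ρ σ T} = {T | IsHomogeneous ρ σ T} :=
  Set.Subset.antisymm (fun _ hT => IsHomogeneous.of_mem_clspan (fun _ h => h) hT) (subset_clspan _)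

lemma IsTensorMap.mem_clspan_left {S : Set (E →L[ℂ] E')} {d : F →L[ℂ] F'}
    (hS : ∀ c ∈ S, IsHomogeneous ρ σ' c) (hd : IsHomogeneous ρ' σ d)
    (hσ : PAut.Compatible σ' ρ') {G : Set (t.obj →L[ℂ] t'.obj)}
    (h : ∀ c ∈ S, ∀ R, IsTensorMap t t' c d R → R ∈ clspan G) {c : E →L[ℂ] E'}
    (hc : c ∈ clspan S) {R : t.obj →L[ℂ] t'.obj} (hR : IsTensorMap t t' c d R) : R ∈ clspan G :=
  mem_clspan_of_rel (fun c R => IsTensorMap t t' c d R) (clspan_setOf_isHomogeneous ρ σ')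
    (fun _ hc => exists_isTensorMap t t' hc hd hσ) IsTensorMap.add_left
    (fun z _ _ h => h.smul_left z) ‖d‖
    (fun _ hc _ hR => (hR.norm_le hc hd hσ).trans_eq (mul_comm _ _)) hS h hc hR

lemma IsTensorMap.mem_clspan_right {S : Set (F →L[ℂ] F')} {c : E →L[ℂ] E'}
    (hS : ∀ d ∈ S, IsHomogeneous ρ' σ d) (hc : IsHomogeneous ρ σ' c)
    (hσ : PAut.Compatible σ' ρ') {G : Set (t.obj →L[ℂ] t'.obj)}
    (h : ∀ d ∈ S, ∀ R, IsTensorMap t t' c d R → R ∈ clspan G) {d : F →L[ℂ] F'}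
    (hd : d ∈ clspan S) {R : t.obj →L[ℂ] t'.obj} (hR : IsTensorMap t t' c d R) : R ∈ clspan G :=
  mem_clspan_of_rel (fun d R => IsTensorMap t t' c d R) (clspan_setOf_isHomogeneous ρ' σ)
    (fun _ hd => exists_isTensorMap t t' hc hd hσ) IsTensorMap.add_right
    (fun z _ _ h => h.smul_right z) ‖c‖ (fun _ hd _ hR => hR.norm_le hc hd hσ) hS h hd hR

end TensorSpan

section TensorBimodule

variable {E F : Bimod B} (t : InternalTensor E F) {θ τ : PAut B}

lemma ip_tmul_mem_graph_mul {ξ ξ' : E} {η η' : F} (hη : η ∈ hmg F τ) {v w : B}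
    (hv : (F.ip η η', v) ∈ τ.graph) (hw : (E.ip ξ ξ' * v, w) ∈ θ.graph) :
    (t.obj.ip (t.tmul ξ η) (t.tmul ξ' η'), w) ∈ (θ * τ).graph := by
  rw [t.ip_tmul]
  exact ⟨_, ip_lsmul_mem_graph' hη hv _, hw⟩

lemma tmul_mem_hmg {ξ : E} {η : F} (hξ : ξ ∈ hmg E θ) (hη : η ∈ hmg F τ) :
    t.tmul ξ η ∈ hmg t.obj (θ * τ) := by
  constructor
  · obtain ⟨v, hv⟩ := ip_mem_dom_left hη η
    obtain ⟨w, hw⟩ := θ.dom_ideal.mul_mem_right v (ip_mem_dom_left hξ ξ)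
    exact Bimod.mem_rspan_of_ip_mem ⟨w, ip_tmul_mem_graph_mul t hη hv hw⟩
  · rintro b c ⟨m, hm, hc⟩
    rw [t.rsmul_tmul, hmg_rsmul hη hm, ← t.rsmul_tmul_eq, hmg_rsmul hξ hc, t.lsmul_tmul]

variable {t} {Θ : Set (PAut B)}

lemma admissibleBimod_tensor (hΘ : AdmissibleSemigroup Θ) (hB : Decomposable (Bimod.self B))
    (hE : AdmissibleBimod Θ E) (hF : AdmissibleBimod Θ F) : AdmissibleBimod Θ t.obj where
  decomposable := by
    have h := t.clspan_range_of_dense (u := ((↑) : {ξ : E | ∃ θ ∈ Θ, ξ ∈ hmg E θ} → E))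
      (v := ((↑) : {ξ : F | ∃ θ ∈ Θ, ξ ∈ hmg F θ} → F))
      (by rw [Subtype.range_coe]; exact hE.decomposable)
      (by rw [Subtype.range_coe]; exact hF.decomposable)
    refine clspan_eq_univ_of_subset h ?_
    rintro _ ⟨⟨⟨ξ, θ, hθ, hξ⟩, ⟨η, τ, hτ, hη⟩⟩, rfl⟩
    exact mem_clspan ⟨θ * τ, hΘ.mul_mem hθ hτ, tmul_mem_hmg t hξ hη⟩
  l_full := by
    refine l_full_iff.2 fun θ b hb => clspan_subset_iff.2 ?_ (l_full_iff.1 hF.l_full θ hb)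
    rintro _ ⟨ρ₁, ρ₂, hρ, η, hη, η', hη', rfl⟩
    -- insert an approximate unit `z` of central elements, which are sums of inner products in `E`
    have hc : IsClosed {y : F | F.ip η y ∈ clspan {b : B | ∃ ρ₁ ρ₂, ρ₁⁻¹ * ρ₂ ≤ θ ∧
        ∃ ξ ∈ hmg t.obj ρ₁, ∃ η ∈ hmg t.obj ρ₂, b = t.obj.ip ξ η}} :=
      (isClosed_clspan _).preimage (F.ipL η).continuous
    refine hB.mem_of_lsmul_mem (E := F) (x := η') hc fun z hz => ?_
    refine map_mem_clspan ((F.ipL η) ∘L F.lm.flip η') ?_ (l_full_iff.1 hE.l_full 1 hz)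
    rintro _ ⟨θ₁, θ₂, hθ, ξ, hξ, ξ', hξ', rfl⟩
    refine mem_clspan ⟨θ₁ * ρ₁, θ₂ * ρ₂, ?_, _, tmul_mem_hmg t hξ hη, _, tmul_mem_hmg t hξ' hη',
      (t.ip_tmul _ _ _ _).symm⟩
    calc (θ₁ * ρ₁)⁻¹ * (θ₂ * ρ₂) = ρ₁⁻¹ * (θ₁⁻¹ * θ₂) * ρ₂ := by
          rw [PAut.mul_inv_rev]; simp only [mul_assoc]
      _ ≤ ρ₁⁻¹ * 1 * ρ₂ := mul_le_mul_left (mul_le_mul_right hθ _) _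
      _ ≤ θ := by rwa [mul_one]
  r_full := by
    refine r_full_iff.2 fun θ b hb => clspan_subset_iff.2 ?_ (r_full_iff.1 hE.r_full θ hb)
    rintro w ⟨θ₁, θ₂, hθ, ξ, hξ, ξ', hξ', hw⟩
    set X := {w : B | ∃ ρ₁ ρ₂, ρ₂ * ρ₁⁻¹ ≤ θ ∧
      ∃ ξ ∈ hmg t.obj ρ₁, ∃ η ∈ hmg t.obj ρ₂, (t.obj.ip ξ η, w) ∈ ρ₁.graph}
    suffices h : ∃ w ∈ clspan X, (E.ip ξ ξ', w) ∈ θ₁.graph by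
      obtain ⟨w', hw', h⟩ := h
      rwa [θ₁.map_unique hw h]
    have hcl : E.ip ξ ξ' ∈ clspan {b : B | ∃ w ∈ clspan X, (b, w) ∈ θ₁.graph} := by
      refine hB.mem_of_rsmul_mem (E := Bimod.self B) (isClosed_clspan _) fun z hz => ?_
      refine map_mem_clspan ((Bimod.self B).lm (E.ip ξ ξ')) ?_ (r_full_iff.1 hF.r_full 1 hz)
      rintro v ⟨τ₁, τ₂, hτ, η, hη, η', hη', hv⟩
      obtain ⟨w', hw'⟩ := θ₁.dom_ideal.mul_mem_right v ⟨w, hw⟩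
      refine mem_clspan ⟨w', mem_clspan ⟨θ₁ * τ₁, θ₂ * τ₂, ?_, _, tmul_mem_hmg t hξ hη, _,
        tmul_mem_hmg t hξ' hη', ip_tmul_mem_graph_mul t hη hv hw'⟩, hw'⟩
      calc θ₂ * τ₂ * (θ₁ * τ₁)⁻¹ = θ₂ * (τ₂ * τ₁⁻¹) * θ₁⁻¹ := by
            rw [PAut.mul_inv_rev]; simp only [mul_assoc]
        _ ≤ θ₂ * 1 * θ₁⁻¹ := mul_le_mul_left (mul_le_mul_right hτ _) _
        _ ≤ θ := by rwa [mul_one]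
    exact PAut.exists_mem_clspan hcl fun s hs => hs

end TensorBimodule

section FiberProduct

variable {E F : Bimod B} {t : InternalTensor E F} {C : Fam E E} {D : Fam F F}
  {ρ σ ρ' σ' : PAut B} {Θ : Set (PAut B)}

lemma mem_fiberProd {c : E →L[ℂ] E} {d : F →L[ℂ] F} {R : t.obj →L[ℂ] t.obj}
    (hσ : PAut.Compatible σ' ρ') (hc : c ∈ C ρ σ') (hd : d ∈ D ρ' σ)
    (hR : IsTensorMap t t c d R) : R ∈ fiberProd t C D ρ σ :=
  mem_clspan ⟨σ', ρ', hσ, c, hc, d, hd, hR⟩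

lemma clspan_fiberProd (ρ σ : PAut B) :
    clspan (fiberProd t C D ρ σ) = fiberProd t C D ρ σ := clspan_clspan _

/-- Fiber products of `C⋆`-families are `C⋆`-families, since `(c ⊗ d)⋆ = c⋆ ⊗ d⋆` and
`(c' ⊗ d')(c ⊗ d) = c'c ⊗ d'd`. -/
lemma Fam.IsStarAlgFam.fiberProd (hC : C.IsStarAlgFam) (hD : D.IsStarAlgFam) :
    (fiberProd t C D).IsStarAlgFam where
  homogeneous ρ σ T hT := by
    refine IsHomogeneous.of_mem_clspan ?_ hT
    rintro R ⟨σ', ρ', hσ, c, hc, d, hd, hR⟩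
    exact IsTensorMap.isHomogeneous (hC.homogeneous _ _ _ hc) (hD.homogeneous _ _ _ hd) hσ hR
  clspan_eq := clspan_fiberProd
  mono := by
    intro ρ₁ σ₁ ρ₂ σ₂ hρ hσ
    refine clspan_mono ?_
    rintro R ⟨σ', ρ', h, c, hc, d, hd, hR⟩
    exact ⟨σ', ρ', h, c, hC.mono hρ le_rfl hc, d, hD.mono le_rfl hσ hd, hR⟩
  adj_mem := by
    intro ρ σ T S hT hS
    refine IsAdjoint.mem_clspan ?_ hT hS
    rintro R ⟨σ', ρ', hσ, c, hc, d, hd, hR⟩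
    obtain ⟨c', hc', hcc'⟩ := hC.exists_adjoint hc
    obtain ⟨d', hd', hdd'⟩ := hD.exists_adjoint hd
    obtain ⟨R', hR'⟩ := exists_isTensorMap t t (hC.homogeneous _ _ _ hc')
      (hD.homogeneous _ _ _ hd') hσ.inv
    exact ⟨R', mem_fiberProd hσ.inv hc' hd' hR',
      IsTensorMap.isAdjoint (hD.homogeneous _ _ _ hd) hσ hcc' hdd' hR hR'⟩
  mul_mem := by
    intro ρ₁ σ₁ ρ₂ σ₂ T' T hT' hT
    rw [← clspan_fiberProd]
    refine comp_mem_clspan_right _ ?_ hT'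
    rintro R' ⟨σ', ρ', h', c', hc', d', hd', hR'⟩
    refine comp_mem_clspan_left _ ?_ hT
    rintro R ⟨σ, ρ, h, c, hc, d, hd, hR⟩
    exact mem_clspan (mem_fiberProd (h'.mul h) (hC.mul_mem hc' hc) (hD.mul_mem hd' hd)
      (IsTensorMap.comp hR' hR))

lemma Fam.IsStarAlgFam.clspan_one_apply (hC : C.IsStarAlgFam) (h : C.Nondegenerate) :
    clspan (Set.range fun p : C 1 1 × E => p.1.1 p.2) = Set.univ := by
  refine clspan_eq_univ_of_subset h ?_
  rintro _ ⟨ρ, σ, T, hT, ξ, rfl⟩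
  refine map_mem_clspan (ContinuousLinearMap.apply ℂ E ξ) ?_ (hC.mem_clspan_one_comp hT)
  rintro _ ⟨a, ha, rfl⟩
  exact mem_clspan ⟨(⟨a, ha⟩, T ξ), rfl⟩

lemma isTensorMap_lm (b : B) : IsTensorMap t t (E.lm b) (ContinuousLinearMap.id ℂ F) (t.obj.lm b) :=
  fun ξ η => t.lsmul_tmul ξ η b

lemma isTensorMap_rm (b : B) : IsTensorMap t t (ContinuousLinearMap.id ℂ E) (F.rm b) (t.obj.rm b) :=
  fun ξ η => t.rsmul_tmul ξ η b

lemma fiberProd_comp_opFam_mem (hC : AdmissibleFam Θ C) (hD : AdmissibleFam Θ D)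
    {T O : t.obj →L[ℂ] t.obj} (hT : T ∈ fiberProd t C D ρ σ) (hO : O ∈ opFam t.obj ρ' σ') :
    T ∘L O ∈ fiberProd t C D (ρ * ρ') (σ * σ') := by
  rw [← clspan_fiberProd]
  refine comp_mem_clspan_left _ ?_ (mem_clspan_lm_comp_rm hO)
  rintro _ ⟨a, ha, b, hb, rfl⟩
  refine comp_mem_clspan_right _ ?_ hT
  rintro R ⟨σ₁, ρ₁, h, c, hc, d, hd, hR⟩
  exact mem_clspan (mem_fiberProd h (hC.comp_lm_mem hc ha) (hD.comp_rm_mem hd hb)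
    (IsTensorMap.comp hR (IsTensorMap.comp (isTensorMap_lm a) (isTensorMap_rm b))))

/-- The fiber product of admissible families is admissible. -/
lemma fiberProd_admissible (hΘ : AdmissibleSemigroup Θ) (hB : Decomposable (Bimod.self B))
    (hC : AdmissibleFam Θ C) (hD : AdmissibleFam Θ D) : AdmissibleFam Θ (fiberProd t C D) where
  bimod := admissibleBimod_tensor hΘ hB hC.bimod hD.bimod
  isCStarFamily := (hC.isStarAlgFam.fiberProd hD.isStarAlgFam).isCStarFamily
  nondegenerate := by
    refine clspan_eq_univ_of_subset (t.clspan_range_of_dense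
      (hC.isStarAlgFam.clspan_one_apply hC.nondegenerate)
      (hD.isStarAlgFam.clspan_one_apply hD.nondegenerate)) ?_
    rintro _ ⟨⟨⟨⟨c, hc⟩, ξ⟩, ⟨⟨d, hd⟩, η⟩⟩, rfl⟩
    have h : PAut.Compatible (1 : PAut B) 1 := PAut.compatible_self 1
    obtain ⟨R, hR⟩ := exists_isTensorMap t t (hC.isStarAlgFam.homogeneous _ _ _ hc)
      (hD.isStarAlgFam.homogeneous _ _ _ hd) h
    exact mem_clspan ⟨1, 1, R, mem_fiberProd h hc hd hR, _, (hR ξ η).symm⟩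
  supported ρ σ := by
    refine Set.Subset.antisymm (clspan_subset_iff.2 ?_) ?_
    · rintro R ⟨σ', ρ', h, c, hc, d, hd, hR⟩
      have hc' := hc
      rw [hC.supported] at hc'
      refine IsTensorMap.mem_clspan_left (ρ := ρ) ?_ (hD.isStarAlgFam.homogeneous _ _ _ hd) h ?_
        hc' hR
      · rintro c ⟨ρ₁, -, σ₁, -, hρ, hσ, hc⟩
        exact (hC.isStarAlgFam.homogeneous _ _ _ hc).mono hρ hσ
      rintro c ⟨ρ₁, hρ₁, σ₁, hσ₁, hρ, hσ, hc⟩ R hR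
      rw [hD.supported] at hd
      have h1 := h.mono hσ le_rfl
      refine IsTensorMap.mem_clspan_right (σ := σ) ?_ (hC.isStarAlgFam.homogeneous _ _ _ hc) h1 ?_
        hd hR
      · rintro d ⟨ρ₂, -, σ₂, -, hρ, hσ, hd⟩
        exact (hD.isStarAlgFam.homogeneous _ _ _ hd).mono hρ hσ
      rintro d ⟨ρ₂, hρ₂, σ₂, hσ₂, hρ', hσ', hd⟩ R hR
      exact mem_clspan ⟨ρ₁, hρ₁, σ₂, hσ₂, hρ, hσ', mem_fiberProd (h1.mono le_rfl hρ') hc hd hR⟩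
    · rw [← clspan_fiberProd]
      refine clspan_mono ?_
      rintro R ⟨ρ₁, -, σ₁, -, hρ, hσ, hR⟩
      exact (hC.isStarAlgFam.fiberProd hD.isStarAlgFam).mono hρ hσ hR
  prod_opFam_le := by
    refine Fam.prod_le clspan_fiberProd (hC.isStarAlgFam.fiberProd hD.isStarAlgFam).mono ?_
    intro ρ' σ' ρ σ T O hT hO
    exact fiberProd_comp_opFam_mem hC hD hT hO
  mul_opFam ρ hρΘ σ hσΘ := by
    refine Set.Subset.antisymm ?_ (clspan_subset_iff.2 ?_)
    · refine (clspan_mono ?_).trans (clspan_fiberProd ρ σ).subset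
      rintro _ ⟨T, hT, O, hO, rfl⟩
      rw [PAut.source_eq, PAut.source_eq] at hO
      have h := fiberProd_comp_opFam_mem hC hD hT hO
      rwa [← mul_assoc, ← mul_assoc, PAut.mul_inv_mul, PAut.mul_inv_mul] at h
    · rintro R ⟨σ', ρ', h, c, hc, d, hd, hR⟩
      refine IsTensorMap.mem_clspan_left (ρ := ρ) ?_ (hD.isStarAlgFam.homogeneous _ _ _ hd) h ?_
        (hC.mem_clspan_comp_op hc) hR
      · rintro _ ⟨ρ₁, -, σ₁, -, hρ, hσ, S, hS, a, ha, b, hb, rfl⟩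
        have hb' : b ∈ hmg (Bimod.self B) (σ₁⁻¹ * σ₁)⁻¹ := by
          rwa [PAut.inv_of_le_one σ₁.inv_mul_le_one]
        have h1 := hC.comp_op_mem hS (lm_comp_rm_mem_opFam ha hb')
        rw [← mul_assoc, ← mul_assoc, PAut.mul_inv_mul, PAut.mul_inv_mul] at h1
        exact (hC.isStarAlgFam.homogeneous _ _ _ h1).mono hρ hσ
      rintro _ ⟨ρ₁, -, σ₁, -, hρ, hσ, S, hS, a, ha, b, hb, rfl⟩ R hR
      have hb' : b ∈ hmg (Bimod.self B) (σ₁⁻¹ * σ₁)⁻¹ := by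
        rwa [PAut.inv_of_le_one σ₁.inv_mul_le_one]
      have h1 := hC.comp_op_mem hS (lm_comp_rm_mem_opFam ha hb')
      rw [← mul_assoc, ← mul_assoc, PAut.mul_inv_mul, PAut.mul_inv_mul] at h1
      refine IsTensorMap.mem_clspan_right (σ := σ) ?_
        ((hC.isStarAlgFam.homogeneous _ _ _ h1).mono hρ hσ) h
        ?_ (hD.mem_clspan_comp_op hd) hR
      · rintro _ ⟨ρ₂, -, σ₂, -, hρ, hσ, S', hS', a', ha', b', hb', rfl⟩
        have hb2 : b' ∈ hmg (Bimod.self B) (σ₂⁻¹ * σ₂)⁻¹ := by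
          rwa [PAut.inv_of_le_one σ₂.inv_mul_le_one]
        have h1 := hD.comp_op_mem hS' (lm_comp_rm_mem_opFam ha' hb2)
        rw [← mul_assoc, ← mul_assoc, PAut.mul_inv_mul, PAut.mul_inv_mul] at h1
        exact (hD.isStarAlgFam.homogeneous _ _ _ h1).mono hρ hσ
      rintro _ ⟨ρ₂, -, σ₂, -, hρ', hσ', S', hS', a', ha', b', hb'', rfl⟩ R hR
      -- `S(a ξ b) ⊗ S'(a' η b') = (S(· b) ⊗ S'(a' ·)) (a (ξ ⊗ η) b')`
      have h2 := hC.comp_rm_mem hS hb'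
      have h3 := hD.comp_lm_mem hS' ha'
      rw [← mul_assoc, PAut.mul_inv_mul] at h2 h3
      have h2' := hC.isStarAlgFam.mono hρ hσ h2
      have h3' := hD.isStarAlgFam.mono hρ' hσ' h3
      obtain ⟨Q, hQ⟩ := exists_isTensorMap t t (hC.isStarAlgFam.homogeneous _ _ _ h2')
        (hD.isStarAlgFam.homogeneous _ _ _ h3') h
      refine mem_clspan ⟨Q, mem_fiberProd h h2' h3' hQ, t.obj.lm a ∘L t.obj.rm b',
        lm_comp_rm_mem_opFam ?_ ?_, ?_⟩
      · rw [PAut.source_eq]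
        exact hmg_self_mono (PAut.mul_le_mul (PAut.inv_le_inv hρ) hρ) ha
      · rw [PAut.source_eq, PAut.inv_of_le_one σ.inv_mul_le_one]
        exact hmg_self_mono (PAut.mul_le_mul (PAut.inv_le_inv hσ') hσ') hb''
      · refine hR.unique fun ξ η => ?_
        have h4 := (IsTensorMap.comp hQ
          (IsTensorMap.comp (isTensorMap_lm a) (isTensorMap_rm b'))) ξ η
        rw [h4]
        refine congrArg₂ t.tmul (congrArg S ?_) rfl
        exact (E.lsmul_rsmul a b ξ).symm

end FiberProduct

/-! ### Intertwiners and multipliers -/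

/-- `T : E → F` is a bimodule map with adjoint `S`. -/
structure IsBimodMap {E F : Bimod B} (T : E →L[ℂ] F) (S : F →L[ℂ] E) : Prop where
  map_lsmul : ∀ b ξ, T (E.lsmul b ξ) = F.lsmul b (T ξ)
  adj : IsAdjoint 1 T S

namespace IsBimodMap

variable {E F G : Bimod B} {T : E →L[ℂ] F} {S : F →L[ℂ] E} {T' : F →L[ℂ] G} {S' : G →L[ℂ] F}
  {ρ σ : PAut B}

lemma isHomogeneous (h : IsBimodMap T S) : IsHomogeneous 1 1 T := by
  refine IsHomogeneous.mk' (fun ξ => ?_) (fun a a' ha ξ => ?_) h.adj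
  · rw [PAut.inv_one]
    exact Bimod.mem_lspan_one _
  · rw [PAut.mem_one.1 ha]
    exact h.map_lsmul a ξ

lemma symm (h : IsBimodMap T S) : IsBimodMap S T where
  map_lsmul b ξ := (h.isHomogeneous.adjoint h.adj).map_lsmul b b
    (by rw [PAut.inv_one, PAut.mem_one]) ξ
  adj := by
    have := h.adj.symm
    rwa [PAut.inv_one] at this

lemma comp (h' : IsBimodMap T' S') (h : IsBimodMap T S) : IsBimodMap (T' ∘L T) (S ∘L S') where
  map_lsmul b ξ := by
    rw [ContinuousLinearMap.comp_apply, h.map_lsmul, h'.map_lsmul, ContinuousLinearMap.comp_apply]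
  adj := by
    have := h'.adj.clm_comp h.adj
    rwa [mul_one] at this

lemma id (E : Bimod B) : IsBimodMap (ContinuousLinearMap.id ℂ E) (ContinuousLinearMap.id ℂ E) where
  map_lsmul _ _ := rfl
  adj _ _ := PAut.mem_one.2 rfl

lemma mem_lspan (h : IsBimodMap T S) {x : E} (hx : x ∈ E.lspan ρ) : T x ∈ F.lspan ρ := by
  refine map_mem_clspan T ?_ hx
  rintro _ ⟨c, hc, η, rfl⟩
  rw [h.map_lsmul]
  exact Bimod.lsmul_mem_lspan hc _

end IsBimodMap

lemma BimodUnitary.isBimodMap {E F : Bimod B} (U : BimodUnitary E F) :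
    IsBimodMap (U.equiv : E →L[ℂ] F) (U.equiv.symm : F →L[ℂ] E) := ⟨U.map_lsmul, U.isAdjoint⟩

/-- The ranges of the operators `T i` span a dense subspace. -/
def JointlyDense {E F : Bimod B} {ι : Type*} (T : ι → E →L[ℂ] F) : Prop :=
  clspan (Set.range fun p : ι × E => T p.1 p.2) = Set.univ

section Conjugation

variable {E F : Bimod B} {ι : Type*} {T : ι → E →L[ℂ] F} {S : ι → F →L[ℂ] E} {ρ σ : PAut B}

/-- An operator `c` that commutes with the operators `S' T` induces `T x ↦ T c x` on `F`; the map
`T x ↦ T c⋆ x` serves as its densely defined adjoint. -/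
lemma exists_conj_aux (h : ∀ i, IsBimodMap (T i) (S i))
    (hT : JointlyDense T) {c c' : E →L[ℂ] E}
    (hc : IsAdjoint σ c c') (comm : ∀ i j, (S j ∘L T i) ∘L c = c ∘L (S j ∘L T i)) :
    ∃ R : F →L[ℂ] F, (∀ i x, R (T i x) = T i (c x)) ∧ ‖R‖ ≤ ‖c‖ := by
  have hadj : ∀ x y : ι × E, (F.ip (T y.1 (c' y.2)) (T x.1 x.2), F.ip (T y.1 y.2) (T x.1 (c x.2))) ∈
      σ.graph := fun x y => by
    have h1 := hc (S y.1 (T x.1 x.2)) y.2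
    have h2 : c (S y.1 (T x.1 x.2)) = S y.1 (T x.1 (c x.2)) :=
      (DFunLike.congr_fun (comm x.1 y.1) x.2).symm
    have h3 : ∀ z w, E.ip z (S y.1 w) = F.ip (T y.1 z) w := fun z w =>
      PAut.mem_one.1 ((h y.1).symm.adj w z)
    rwa [h2, h3, h3] at h1
  have hbound (i : ι) (k : ℕ) : ∀ x, ‖T (((fun p : ι × E => (p.1, c' p.2)) ∘
      fun p => (p.1, c p.2))^[k] (i, x)).1 (((fun p : ι × E => (p.1, c' p.2)) ∘
      fun p => (p.1, c p.2))^[k] (i, x)).2‖ ≤ ‖T i‖ * ‖x‖ * (‖c'‖ * ‖c‖) ^ k := by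
    induction k with
    | zero => exact fun x => by simpa using (T i).le_opNorm x
    | succ k ih =>
      intro x
      refine (ih (c' (c x))).trans ?_
      have h1 : ‖c' (c x)‖ ≤ ‖c'‖ * ‖c‖ * ‖x‖ := by
        rw [mul_assoc]
        exact (c'.le_opNorm _).trans (mul_le_mul_of_nonneg_left (c.le_opNorm x) (norm_nonneg _))
      calc _ ≤ ‖T i‖ * (‖c'‖ * ‖c‖ * ‖x‖) * (‖c'‖ * ‖c‖) ^ k := by gcongr
        _ = _ := by ring
  obtain ⟨R, hR, hR'⟩ := exists_extension (F := F) (G := F) (σ := σ)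
    (fun p : ι × E => T p.1 p.2) (fun p : ι × E => T p.1 p.2) hT (fun p => (p.1, c p.2))
    (fun p => (p.1, c' p.2)) hadj (r := ‖c'‖ * ‖c‖) (by positivity)
    fun x => ⟨‖T x.1‖ * ‖x.2‖, fun k => hbound x.1 k x.2⟩
  refine ⟨R, fun i x => hR (i, x), le_of_sq_le_sq ?_ (norm_nonneg _)⟩
  rwa [hc.norm_eq, ← sq] at hR'

/-- A homogeneous operator `c` on `E` that commutes with the operators `S' T`, for all members
`T, T'` of a set of bimodule maps from `E` whose ranges span a dense subspace of `F`, and with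
`S'` the adjoint of `T'`, has a unique counterpart on `F` with `T c = R T`. -/
lemma exists_conj (h : ∀ i, IsBimodMap (T i) (S i))
    (hT : JointlyDense T) {c : E →L[ℂ] E}
    (hc : IsHomogeneous ρ σ c) (comm : ∀ i j, (S j ∘L T i) ∘L c = c ∘L (S j ∘L T i)) :
    ∃ R : F →L[ℂ] F, IsHomogeneous ρ σ R ∧ ‖R‖ ≤ ‖c‖ ∧
      ∀ i, T i ∘L c = R ∘L T i ∧ c ∘L S i = S i ∘L R := by
  obtain ⟨c', hc'⟩ := hc.exists_adjoint
  -- the adjoint of `c` commutes with the same operators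
  have comm' : ∀ i j, (S j ∘L T i) ∘L c' = c' ∘L (S j ∘L T i) := fun i j => by
    have h1 := ((h i).symm.comp (h j)).adj.clm_comp hc'
    have h2 := hc'.clm_comp ((h i).symm.comp (h j)).adj
    rw [comm, one_mul] at h1
    rw [mul_one] at h2
    exact DFunLike.coe_injective (h2.unique h1)
  obtain ⟨R, hR, hRn⟩ := exists_conj_aux h hT hc' comm
  obtain ⟨R', hR', -⟩ := exists_conj_aux h hT hc'.symm comm'
  have hadj : IsAdjoint σ R R' := by
    refine isAdjoint_of_dense hT hT fun x y => ?_
    rw [hR, hR']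
    have h1 := hc' (S y.1 (T x.1 x.2)) y.2
    have h2 : c (S y.1 (T x.1 x.2)) = S y.1 (T x.1 (c x.2)) :=
      (DFunLike.congr_fun (comm x.1 y.1) x.2).symm
    have h3 : ∀ z w, E.ip z (S y.1 w) = F.ip (T y.1 z) w := fun z w =>
      PAut.mem_one.1 ((h y.1).symm.adj w z)
    rwa [h2, h3, h3] at h1
  refine ⟨R, ?_, hRn, fun i => ⟨ContinuousLinearMap.ext fun x => (hR i x).symm, ?_⟩⟩
  · refine isHomogeneous_of_dense hT hadj (fun x => ?_) fun a a' ha x => ?_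
    · rw [hR]
      exact (h x.1).mem_lspan (hc.mem_lspan _)
    · rw [hR, ← (h x.1).map_lsmul, hR, hc.map_lsmul a a' ha, (h x.1).map_lsmul]
  · have h1 := hadj.symm.clm_comp (h i).adj
    have h2 := (h i).adj.clm_comp hc'.symm
    rw [one_mul] at h2
    rw [mul_one] at h1
    have h3 : R' ∘L T i = T i ∘L c' := ContinuousLinearMap.ext fun x => hR' i x
    rw [h3] at h1
    exact DFunLike.coe_injective (h2.unique h1)

lemma clm_ext_of_range (hT : JointlyDense T)
    {G : Bimod B} {R R' : F →L[ℂ] G} (h : ∀ i, R ∘L T i = R' ∘L T i) : R = R' := by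
  refine ext_of_clspan hT ?_
  rintro _ ⟨p, rfl⟩
  exact DFunLike.congr_fun (h p.1) p.2

lemma JointlyDense.comp {G : Bimod B} {κ : Type*} {T' : κ → F →L[ℂ] G}
    (hT : JointlyDense T)
    (hT' : JointlyDense T') : JointlyDense fun i : ι × κ => T' i.2 ∘L T i.1 := by
  refine clspan_eq_univ_of_subset hT' ?_
  rintro _ ⟨⟨j, y⟩, rfl⟩
  refine map_mem_clspan (T' j) (S := Set.range fun p : ι × E => T p.1 p.2) ?_
    (hT.ge (Set.mem_univ y))
  rintro _ ⟨⟨i, x⟩, rfl⟩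
  exact mem_clspan ⟨((i, j), x), rfl⟩

end Conjugation

namespace Fam

variable {E : Bimod B} {C : Fam E E} {ρ σ ρ' σ' : PAut B} {T S : E →L[ℂ] E}

lemma IsStarAlgFam.mem_multiplier_iff (hC : C.IsStarAlgFam) : T ∈ C.multiplier ρ σ ↔
    IsHomogeneous ρ σ T ∧ (∀ {ρ' σ' c}, c ∈ C ρ' σ' → T ∘L c ∈ C (ρ * ρ') (σ * σ')) ∧
      ∀ {ρ' σ' c}, c ∈ C ρ' σ' → c ∘L T ∈ C (ρ' * ρ) (σ' * σ) := by
  refine and_congr_right fun hT => and_congr ⟨fun h ρ' σ' c hc => ?_, fun h => ?_⟩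
    ⟨fun h ρ' σ' c hc => ?_, fun h => ?_⟩
  · exact h _ _ (mem_prod (D := single ρ σ T) ⟨rfl, rfl, rfl⟩ hc le_rfl le_rfl)
  · refine prod_le hC.clspan_eq hC.mono ?_
    rintro ρ₁ σ₁ ρ₂ σ₂ T' c ⟨rfl, rfl, rfl⟩ hc
    exact h hc
  · exact h _ _ (mem_prod (C := single ρ σ T) hc ⟨rfl, rfl, rfl⟩ le_rfl le_rfl)
  · refine prod_le hC.clspan_eq hC.mono ?_
    rintro ρ₁ σ₁ ρ₂ σ₂ T' c hc ⟨rfl, rfl, rfl⟩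
    exact h hc

lemma IsStarAlgFam.le_multiplier (hC : C.IsStarAlgFam) (hT : T ∈ C ρ σ) :
    T ∈ C.multiplier ρ σ :=
  hC.mem_multiplier_iff.2 ⟨hC.homogeneous _ _ _ hT, fun hc => hC.mul_mem hT hc,
    fun hc => hC.mul_mem hc hT⟩

lemma IsStarAlgFam.multiplier_adj (hC : C.IsStarAlgFam) (hT : T ∈ C.multiplier ρ σ)
    (hS : IsAdjoint σ T S) : S ∈ C.multiplier ρ⁻¹ σ⁻¹ := by
  obtain ⟨h1, h2, h3⟩ := hC.mem_multiplier_iff.1 hT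
  refine hC.mem_multiplier_iff.2 ⟨h1.adjoint hS, fun {ρ' σ' c} hc => ?_, fun {ρ' σ' c} hc => ?_⟩
  · obtain ⟨d, hd, hcd⟩ := hC.exists_adjoint hc
    have h4 := hC.adj_mem (h3 hd) (hcd.symm.clm_comp hS)
    rwa [PAut.mul_inv_rev, PAut.mul_inv_rev, inv_inv, inv_inv] at h4
  · obtain ⟨d, hd, hcd⟩ := hC.exists_adjoint hc
    have h4 := hC.adj_mem (h2 hd) (hS.clm_comp hcd.symm)
    rwa [PAut.mul_inv_rev, PAut.mul_inv_rev, inv_inv, inv_inv] at h4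

/-- By symmetry it suffices to consider left multiplication, for `T` and for its adjoint. -/
lemma IsStarAlgFam.mem_multiplier (hC : C.IsStarAlgFam) (hT : IsHomogeneous ρ σ T)
    (hS : IsAdjoint σ T S)
    (h : ∀ {ρ' σ' c}, c ∈ C ρ' σ' → T ∘L c ∈ C (ρ * ρ') (σ * σ'))
    (h' : ∀ {ρ' σ' c}, c ∈ C ρ' σ' → S ∘L c ∈ C (ρ⁻¹ * ρ') (σ⁻¹ * σ')) :
    T ∈ C.multiplier ρ σ := by
  refine hC.mem_multiplier_iff.2 ⟨hT, h, fun {ρ' σ' c} hc => ?_⟩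
  obtain ⟨d, hd, hcd⟩ := hC.exists_adjoint hc
  have h4 := hC.adj_mem (h' hd) (hS.symm.clm_comp hcd.symm)
  rwa [PAut.mul_inv_rev, PAut.mul_inv_rev, inv_inv, inv_inv, inv_inv, inv_inv] at h4

lemma IsStarAlgFam.clspan_multiplier (hC : C.IsStarAlgFam) (ρ σ : PAut B) :
    clspan (C.multiplier ρ σ) = C.multiplier ρ σ := by
  refine Set.Subset.antisymm (fun T hT => hC.mem_multiplier_iff.2 ⟨?_, ?_, ?_⟩) (subset_clspan _)
  · exact IsHomogeneous.of_mem_clspan (fun T hT => hT.1) hT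
  · intro ρ' σ' c hc
    rw [← hC.clspan_eq]
    exact comp_mem_clspan_right _
      (fun T hT => mem_clspan ((hC.mem_multiplier_iff.1 hT).2.1 hc)) hT
  · intro ρ' σ' c hc
    rw [← hC.clspan_eq]
    exact comp_mem_clspan_left _
      (fun T hT => mem_clspan ((hC.mem_multiplier_iff.1 hT).2.2 hc)) hT

/-- An operator that commutes with a nondegenerate family commutes with its multipliers. -/
lemma IsStarAlgFam.comm_multiplier (hC : C.IsStarAlgFam) (h : C.Nondegenerate)
    {A : E →L[ℂ] E} (hA : ∀ ρ σ, ∀ c ∈ C ρ σ, A ∘L c = c ∘L A) (hT : T ∈ C.multiplier ρ σ) :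
    A ∘L T = T ∘L A := by
  refine ext_of_clspan h ?_
  rintro _ ⟨ρ', σ', c, hc, ξ, rfl⟩
  have h1 := DFunLike.congr_fun (hA _ _ _ ((hC.mem_multiplier_iff.1 hT).2.1 hc)) ξ
  have h2 := DFunLike.congr_fun (hA _ _ _ hc) ξ
  simp only [ContinuousLinearMap.comp_apply] at h1 h2 ⊢
  rw [h1, h2]

end Fam

/-! ### The category of admissible families -/

section NormalMorphisms

variable {E F : Bimod B} {C : Fam E E} {D : Fam F F} {ρ σ ρ' σ' : PAut B}

/-- `T` and its adjoint `S` intertwine the operators of `𝒞` with their images. -/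
def IntertwinesWith (φ : ∀ ρ σ, C ρ σ → D ρ σ) (T : E →L[ℂ] F) (S : F →L[ℂ] E) : Prop :=
  IsBimodMap T S ∧ ∀ ρ σ (c : C ρ σ), T ∘L c.1 = (φ ρ σ c).1 ∘L T ∧ c.1 ∘L S = S ∘L (φ ρ σ c).1

lemma mem_intertwiners {φ : ∀ ρ σ, C ρ σ → D ρ σ} {T : E →L[ℂ] F} :
    T ∈ intertwiners φ ↔ ∃ S, IntertwinesWith φ T S := by
  constructor
  · rintro ⟨h, S, hS, h'⟩
    exact ⟨S, ⟨h, fun ξ η => PAut.mem_one.2 (hS ξ η).symm⟩, h'⟩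
  · rintro ⟨S, h, h'⟩
    exact ⟨h.map_lsmul, S, fun ξ η => (PAut.mem_one.1 (h.adj ξ η)).symm, h'⟩

namespace NormalMor

lemma jointlyDense (φ : NormalMor C D) :
    JointlyDense fun i : intertwiners φ.map => i.1 := by
  rw [JointlyDense, ← φ.dense]
  congr 1
  ext y
  exact ⟨fun ⟨p, hp⟩ => ⟨p.1.1, p.1.2, p.2, hp.symm⟩, fun ⟨T, hT, ξ, h⟩ => ⟨(⟨T, hT⟩, ξ), h.symm⟩⟩

lemma exists_adjoints (φ : NormalMor C D) : ∃ S : intertwiners φ.map → F →L[ℂ] E,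
    ∀ i, IntertwinesWith φ.map i.1 (S i) :=
  ⟨fun i => (mem_intertwiners.1 i.2).choose, fun i => (mem_intertwiners.1 i.2).choose_spec⟩

lemma comp_intertwiner (φ : NormalMor C D) {T : E →L[ℂ] F} (hT : T ∈ intertwiners φ.map)
    (c : C ρ σ) : T ∘L c.1 = (φ.map ρ σ c).1 ∘L T := by
  obtain ⟨S, h⟩ := mem_intertwiners.1 hT
  exact (h.2 ρ σ c).1

/-- The image of `c` is determined by the intertwiners. -/
lemma map_eq_of_comp (φ : NormalMor C D) (c : C ρ σ) {R : F →L[ℂ] F}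
    (h : ∀ T ∈ intertwiners φ.map, T ∘L c.1 = R ∘L T) : (φ.map ρ σ c).1 = R :=
  clm_ext_of_range φ.jointlyDense fun i => by rw [← φ.comp_intertwiner i.2, h _ i.2]

/-- Two morphisms with a common jointly dense set of intertwiners agree. -/
lemma ext_of_intertwiners {φ ψ : NormalMor C D} {ι : Type*} {T : ι → E →L[ℂ] F}
    (hT : JointlyDense T)
    (h : ∀ i, T i ∈ intertwiners φ.map) (h' : ∀ i, T i ∈ intertwiners ψ.map) : φ = ψ := by
  refine NormalMor.ext (funext fun ρ => funext fun σ => funext fun c => Subtype.ext ?_)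
  refine clm_ext_of_range hT fun i => ?_
  rw [← φ.comp_intertwiner (h i), ← ψ.comp_intertwiner (h' i)]

lemma map_comp (φ : NormalMor C D) {ρ'' σ'' : PAut B} (a : C ρ σ) (c : C ρ' σ') (x : C ρ'' σ'')
    (hx : x.1 = a.1 ∘L c.1) : (φ.map _ _ x).1 = (φ.map _ _ a).1 ∘L (φ.map _ _ c).1 :=
  φ.map_eq_of_comp x fun T hT => by
    rw [hx, ← ContinuousLinearMap.comp_assoc, φ.comp_intertwiner hT,
      ContinuousLinearMap.comp_assoc, φ.comp_intertwiner hT, ContinuousLinearMap.comp_assoc]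

lemma norm_map_le (φ : NormalMor C D) (hC : C.Homogeneous) (c : C ρ σ) :
    ‖(φ.map ρ σ c).1‖ ≤ ‖c.1‖ := by
  obtain ⟨S, hS⟩ := φ.exists_adjoints
  obtain ⟨R, -, hR, h⟩ := exists_conj (fun i => (hS i).1) φ.jointlyDense (hC _ _ _ c.2)
    fun i j => by
      rw [ContinuousLinearMap.comp_assoc, ((hS i).2 _ _ c).1, ← ContinuousLinearMap.comp_assoc,
        ← ((hS j).2 _ _ c).2, ContinuousLinearMap.comp_assoc]
  rwa [φ.map_eq_of_comp c fun T hT => (h ⟨T, hT⟩).1]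

/-- Linear expressions in `φ(c)` for `c` in a closed span belong to the closed span of their
values on the generators. -/
lemma map_mem_clspan (φ : NormalMor C D) (hC : C.Homogeneous) (hC' : clspan (C ρ σ) = C ρ σ)
    {W : Type*} [NormedAddCommGroup W] [NormedSpace ℂ W] (f : (F →L[ℂ] F) →L[ℂ] W)
    {S : Set (E →L[ℂ] E)} {G : Set W} (hS : S ⊆ C ρ σ)
    (h : ∀ s (hs : s ∈ C ρ σ), s ∈ S → f (φ.map ρ σ ⟨s, hs⟩).1 ∈ clspan G) {c : C ρ σ}
    (hc : c.1 ∈ clspan S) : f (φ.map ρ σ c).1 ∈ clspan G := by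
  refine mem_clspan_of_rel (fun v w => ∃ hv : v ∈ C ρ σ, w = f (φ.map ρ σ ⟨v, hv⟩).1) hC'
    (fun v hv => ⟨_, hv, rfl⟩) ?_ ?_ ‖f‖ ?_ hS ?_ hc ⟨c.2, rfl⟩
  · rintro v v' _ _ ⟨hv, rfl⟩ ⟨hv', rfl⟩
    refine ⟨hC' ▸ add_mem_clspan (mem_clspan hv) (mem_clspan hv'), ?_⟩
    rw [← map_add, φ.map_eq_of_comp ⟨v + v', _⟩ fun T hT => ?_]
    rw [ContinuousLinearMap.comp_add, ContinuousLinearMap.add_comp,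
      ← φ.comp_intertwiner hT, ← φ.comp_intertwiner hT]
  · rintro z v _ ⟨hv, rfl⟩
    refine ⟨hC' ▸ smul_mem_clspan z (mem_clspan hv), ?_⟩
    rw [← map_smul, φ.map_eq_of_comp ⟨z • v, _⟩ fun T hT => ?_]
    rw [ContinuousLinearMap.comp_smul, ContinuousLinearMap.smul_comp, ← φ.comp_intertwiner hT]
  · rintro v hv _ ⟨hv, rfl⟩
    exact (f.le_opNorm _).trans (mul_le_mul_of_nonneg_left (φ.norm_map_le hC _) (norm_nonneg _))
  · rintro s hs _ ⟨hs', rfl⟩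
    exact h s hs' hs

end NormalMor

end NormalMorphisms

namespace AdmFam

variable {Θ : Set (PAut B)} (C : AdmFam Θ)

lemma isStarAlgFam : C.fam.IsStarAlgFam := C.admissible.isStarAlgFam

end AdmFam

namespace Mor

variable {Θ : Set (PAut B)} {C D G : AdmFam Θ} {ρ σ : PAut B}

lemma toNormalMor_injective : Function.Injective (toNormalMor : Mor C D → _) := fun φ ψ h => by
  cases φ; cases ψ; congr

lemma ext_of_intertwiners {φ ψ : Mor C D} {ι : Type*} {T : ι → C.E →L[ℂ] D.E}
    (hT : JointlyDense T)
    (h : ∀ i, T i ∈ intertwiners φ.map) (h' : ∀ i, T i ∈ intertwiners ψ.map) : φ = ψ :=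
  toNormalMor_injective (NormalMor.ext_of_intertwiners hT h h')

/-- The operators in degree `(Id, Id)` act nondegenerately on each component. -/
lemma mem_clspan_map_comp (φ : Mor C D) {d : D.E →L[ℂ] D.E} (hd : d ∈ D.fam ρ σ) :
    d ∈ clspan {R | ∃ c : C.fam 1 1, ∃ d' ∈ D.fam ρ σ, R = (φ.map 1 1 c).1 ∘L d'} := by
  rw [← φ.nondegenerate] at hd
  refine clspan_subset_iff.2 ?_ hd
  rintro _ ⟨ρ₁, ρ₂, σ₁, σ₂, hρ, hσ, T', hT', T, hT, rfl⟩
  refine comp_mem_clspan_right T ?_ hT'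
  rintro _ ⟨c, rfl⟩
  refine φ.map_mem_clspan C.isStarAlgFam.homogeneous (C.isStarAlgFam.clspan_eq _ _)
    ((ContinuousLinearMap.compL ℂ D.E D.E D.E).flip T) ?_ ?_
    (C.isStarAlgFam.mem_clspan_one_comp c.2)
  · rintro _ ⟨a, ha, rfl⟩
    have := C.isStarAlgFam.mul_mem ha c.2
    rwa [one_mul, one_mul] at this
  · rintro _ hs ⟨a, ha, rfl⟩
    refine mem_clspan ⟨⟨a, ha⟩, (φ.map _ _ c).1 ∘L T, ?_, ?_⟩
    · exact D.isStarAlgFam.mono hρ hσ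
        ((D.isStarAlgFam.mem_multiplier_iff.1 (φ.map _ _ c).2).2.1 hT)
    · rw [← ContinuousLinearMap.comp_assoc, ← φ.map_comp ⟨a, ha⟩ c ⟨_, hs⟩ rfl]
      rfl

/-- A normal morphism into the multipliers is a morphism as soon as the components of the target
are the closed spans of the products with the operators of degree `(Id, Id)`. -/
def ofNormalMor (φ : NormalMor C.fam D.fam.multiplier)
    (h : ∀ ρ σ, ∀ d ∈ D.fam ρ σ,
      d ∈ clspan {R | ∃ c : C.fam 1 1, ∃ d' ∈ D.fam ρ σ, R = (φ.map 1 1 c).1 ∘L d'}) :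
    Mor C D where
  toNormalMor := φ
  nondegenerate := by
    refine le_antisymm (Fam.prod_le D.isStarAlgFam.clspan_eq D.isStarAlgFam.mono ?_) ?_
    · intro ρ' σ' ρ σ T' T hT' hT
      rw [← D.isStarAlgFam.clspan_eq]
      refine comp_mem_clspan_right T ?_ hT'
      rintro _ ⟨c, rfl⟩
      exact mem_clspan ((D.isStarAlgFam.mem_multiplier_iff.1 (φ.map _ _ c).2).2.1 hT)
    · intro ρ σ d hd
      refine clspan_mono ?_ (h ρ σ d hd)
      rintro _ ⟨c, d', hd', rfl⟩
      exact ⟨1, ρ, 1, σ, (one_mul ρ).le, (one_mul σ).le, _, mem_clspan ⟨c, rfl⟩, d', hd', rfl⟩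

/-- The image of a multiplier `m` under the extension of `ψ`: as `m` commutes with the operators `S'
T` for intertwiners `T, T'`, it has a counterpart `R` on the target. As `R ψ(c) = ψ(m c)`, this is a
multiplier. -/
lemma exists_multiplier_map (ψ : Mor D G) {m : D.E →L[ℂ] D.E} (hm : m ∈ D.fam.multiplier ρ σ) :
    ∃ R ∈ G.fam.multiplier ρ σ, ∀ T S, IntertwinesWith ψ.map T S →
      T ∘L m = R ∘L T ∧ m ∘L S = S ∘L R := by
  obtain ⟨S, hS⟩ := ψ.exists_adjoints
  have key : ∀ {ρ σ : PAut B} {m : D.E →L[ℂ] D.E}, m ∈ D.fam.multiplier ρ σ →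
      ∃ R : G.E →L[ℂ] G.E, IsHomogeneous ρ σ R ∧
        (∀ i : intertwiners ψ.map, i.1 ∘L m = R ∘L i.1 ∧ m ∘L S i = S i ∘L R) ∧
        ∀ {ρ' σ' g}, g ∈ G.fam ρ' σ' → R ∘L g ∈ G.fam (ρ * ρ') (σ * σ') := by
    intro ρ σ m hm
    obtain ⟨R, hR, -, h⟩ := exists_conj (fun i => (hS i).1) ψ.jointlyDense hm.1 fun i j => by
      refine D.isStarAlgFam.comm_multiplier D.admissible.nondegenerate (fun ρ' σ' c hc => ?_) hm
      rw [ContinuousLinearMap.comp_assoc, ((hS i).2 _ _ ⟨c, hc⟩).1,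
        ← ContinuousLinearMap.comp_assoc, ← ((hS j).2 _ _ ⟨c, hc⟩).2,
        ContinuousLinearMap.comp_assoc]
    refine ⟨R, hR, h, fun {ρ' σ' g} hg => ?_⟩
    rw [← G.isStarAlgFam.clspan_eq]
    refine comp_mem_clspan_left R ?_ (ψ.mem_clspan_map_comp hg)
    rintro _ ⟨c, g', hg', rfl⟩
    have hmc := (D.isStarAlgFam.mem_multiplier_iff.1 hm).2.1 c.2
    rw [mul_one, mul_one] at hmc
    have e : (ψ.map ρ σ ⟨_, hmc⟩).1 = R ∘L (ψ.map 1 1 c).1 := ψ.map_eq_of_comp _ fun T hT => by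
      rw [← ContinuousLinearMap.comp_assoc, (h ⟨T, hT⟩).1, ContinuousLinearMap.comp_assoc,
        ψ.comp_intertwiner hT, ContinuousLinearMap.comp_assoc]
    rw [← ContinuousLinearMap.comp_assoc, ← e]
    exact mem_clspan ((G.isStarAlgFam.mem_multiplier_iff.1 (ψ.map ρ σ _).2).2.1 hg')
  obtain ⟨m', hmm'⟩ := hm.1.exists_adjoint
  obtain ⟨R, hR, h, hG⟩ := key hm
  obtain ⟨R', hR', h', hG'⟩ := key (D.isStarAlgFam.multiplier_adj hm hmm')
  -- the counterpart of `m⋆` is the adjoint of the counterpart of `m`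
  obtain ⟨R'', hRR⟩ := hR.exists_adjoint
  have e : R'' = R' := clm_ext_of_range ψ.jointlyDense fun i => by
    have h1 := hRR.symm.clm_comp (hS i).1.adj
    have h2 := (hS i).1.adj.clm_comp hmm'.symm
    rw [one_mul] at h2
    rw [mul_one, ← (h i).2] at h1
    rw [← (h' i).1]
    exact DFunLike.coe_injective (h1.symm.unique h2.symm)
  subst e
  refine ⟨R, G.isStarAlgFam.mem_multiplier hR hRR hG hG', fun T S' hT => ?_⟩
  have hi := h ⟨T, mem_intertwiners.2 ⟨S', hT⟩⟩
  have e : S' = S ⟨T, mem_intertwiners.2 ⟨S', hT⟩⟩ :=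
    DFunLike.coe_injective (hT.1.adj.unique (hS ⟨T, mem_intertwiners.2 ⟨S', hT⟩⟩).1.adj)
  rw [e]
  exact hi

/-- The extension of a morphism to the multipliers. -/
def extend (ψ : Mor D G) : NormalMor D.fam.multiplier G.fam.multiplier where
  map ρ σ m := ⟨(ψ.exists_multiplier_map m.2).choose, (ψ.exists_multiplier_map m.2).choose_spec.1⟩
  dense := by
    refine clspan_eq_univ_of_subset ψ.dense (Set.Subset.trans ?_ (subset_clspan _))
    rintro _ ⟨T, hT, ξ, rfl⟩
    obtain ⟨S, hS⟩ := mem_intertwiners.1 hT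
    exact ⟨T, mem_intertwiners.2 ⟨S, hS.1, fun ρ σ m =>
      (ψ.exists_multiplier_map m.2).choose_spec.2 T S hS⟩, ξ, rfl⟩

lemma extend_intertwines (ψ : Mor D G) {T : D.E →L[ℂ] G.E} {S : G.E →L[ℂ] D.E}
    (h : IntertwinesWith ψ.map T S) : IntertwinesWith ψ.extend.map T S :=
  ⟨h.1, fun _ _ m => (ψ.exists_multiplier_map m.2).choose_spec.2 T S h⟩

lemma extend_map (ψ : Mor D G) (d : D.fam ρ σ) (h : d.1 ∈ D.fam.multiplier ρ σ) :
    ψ.extend.map ρ σ ⟨d.1, h⟩ = ψ.map ρ σ d :=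
  Subtype.ext (Eq.symm (ψ.map_eq_of_comp d fun T hT => by
    obtain ⟨S, hS⟩ := mem_intertwiners.1 hT
    exact ((ψ.extend_intertwines hS).2 ρ σ ⟨d.1, h⟩).1))

lemma isExtension_extend (ψ : Mor D G) : ψ.IsExtension ψ.extend := fun _ _ d =>
  ⟨D.isStarAlgFam.le_multiplier d.2, ψ.extend_map d _⟩

/-- The identity morphism. -/
protected def id (C : AdmFam Θ) : Mor C C :=
  ofNormalMor
    { map := fun _ _ c => ⟨c.1, C.isStarAlgFam.le_multiplier c.2⟩
      dense := by
        refine Set.eq_univ_of_forall fun x => mem_clspan ⟨ContinuousLinearMap.id ℂ C.E, ?_, x, rfl⟩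
        exact mem_intertwiners.2 ⟨_, IsBimodMap.id C.E, fun _ _ _ => ⟨rfl, rfl⟩⟩ }
    fun ρ σ d hd => by
      refine clspan_mono ?_ (C.isStarAlgFam.mem_clspan_one_comp hd)
      rintro _ ⟨a, ha, rfl⟩
      exact ⟨⟨a, ha⟩, d, hd, rfl⟩

lemma id_intertwiner (C : AdmFam Θ) :
    ContinuousLinearMap.id ℂ C.E ∈ intertwiners (Mor.id C).map :=
  mem_intertwiners.2 ⟨_, IsBimodMap.id C.E, fun _ _ _ => ⟨rfl, rfl⟩⟩

lemma intertwinesWith_comp (φ : Mor C D) (ψ : Mor D G) {T : C.E →L[ℂ] D.E} {S : D.E →L[ℂ] C.E}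
    {T' : D.E →L[ℂ] G.E} {S' : G.E →L[ℂ] D.E} (h : IntertwinesWith φ.map T S)
    (h' : IntertwinesWith ψ.map T' S') :
    IntertwinesWith (fun ρ σ c => ψ.extend.map ρ σ (φ.map ρ σ c)) (T' ∘L T) (S ∘L S') := by
  refine ⟨h'.1.comp h.1, fun ρ σ c => ?_⟩
  have h2 := (ψ.extend_intertwines h').2 ρ σ (φ.map ρ σ c)
  have h1 := h.2 ρ σ c
  constructor
  · rw [ContinuousLinearMap.comp_assoc, h1.1, ← ContinuousLinearMap.comp_assoc, h2.1,
      ContinuousLinearMap.comp_assoc]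
  · rw [← ContinuousLinearMap.comp_assoc, h1.2, ContinuousLinearMap.comp_assoc, h2.2,
      ContinuousLinearMap.comp_assoc]

/-- The composition of morphisms. -/
protected def comp (φ : Mor C D) (ψ : Mor D G) : Mor C G :=
  ofNormalMor
    { map := fun ρ σ c => ψ.extend.map ρ σ (φ.map ρ σ c)
      dense := by
        refine clspan_eq_univ_of_subset (φ.jointlyDense.comp ψ.jointlyDense) ?_
        rintro _ ⟨⟨⟨T, T'⟩, ξ⟩, rfl⟩
        obtain ⟨S, hS⟩ := mem_intertwiners.1 T.2
        obtain ⟨S', hS'⟩ := mem_intertwiners.1 T'.2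
        exact mem_clspan ⟨_, mem_intertwiners.2 ⟨_, intertwinesWith_comp φ ψ hS hS'⟩, ξ, rfl⟩ }
    fun ρ σ g hg => by
      refine clspan_subset_iff.2 ?_ (ψ.mem_clspan_map_comp hg)
      rintro _ ⟨d, g', hg', rfl⟩
      refine ψ.map_mem_clspan D.isStarAlgFam.homogeneous (D.isStarAlgFam.clspan_eq _ _)
        ((ContinuousLinearMap.compL ℂ G.E G.E G.E).flip g') ?_ ?_ (φ.mem_clspan_map_comp d.2)
      · rintro _ ⟨c, d', hd', rfl⟩
        have := (D.isStarAlgFam.mem_multiplier_iff.1 (φ.map _ _ c).2).2.1 hd'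
        rwa [one_mul] at this
      · rintro _ hs ⟨c, d', hd', rfl⟩
        refine mem_clspan ⟨c, (ψ.map _ _ ⟨d', hd'⟩).1 ∘L g', ?_, ?_⟩
        · have := (G.isStarAlgFam.mem_multiplier_iff.1 (ψ.map _ _ ⟨d', hd'⟩).2).2.1 hg'
          rwa [one_mul, one_mul] at this
        · have e : (ψ.map 1 1 ⟨_, hs⟩).1 =
              (ψ.extend.map 1 1 (φ.map 1 1 c)).1 ∘L (ψ.map 1 1 ⟨d', hd'⟩).1 := by
            rw [← ψ.extend_map _ (D.isStarAlgFam.le_multiplier hs),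
              ← ψ.extend_map ⟨d', hd'⟩ (D.isStarAlgFam.le_multiplier hd')]
            exact ψ.extend.map_comp _ _ _ rfl
          rw [← ContinuousLinearMap.comp_assoc, ← e]
          rfl

lemma comp_intertwiner' (φ : Mor C D) (ψ : Mor D G) {T : C.E →L[ℂ] D.E} {T' : D.E →L[ℂ] G.E}
    (h : T ∈ intertwiners φ.map) (h' : T' ∈ intertwiners ψ.map) :
    T' ∘L T ∈ intertwiners (φ.comp ψ).map := by
  obtain ⟨S, hS⟩ := mem_intertwiners.1 h
  obtain ⟨S', hS'⟩ := mem_intertwiners.1 h'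
  exact mem_intertwiners.2 ⟨_, intertwinesWith_comp φ ψ hS hS'⟩

end Mor

/-- The category of admissible families. -/
def categoryData (Θ : Set (PAut B)) : CategoryData Θ where
  id := Mor.id
  comp := Mor.comp
  isId _ _ _ _ := rfl
  isComp φ ψ := ⟨ψ.extend, ψ.isExtension_extend, fun _ _ _ => rfl⟩
  id_comp {C D} φ := Mor.ext_of_intertwiners φ.jointlyDense
    (fun i => Mor.comp_intertwiner' _ φ (Mor.id_intertwiner C) i.2) fun i => i.2
  comp_id {C D} φ := Mor.ext_of_intertwiners φ.jointlyDense
    (fun i => Mor.comp_intertwiner' φ _ i.2 (Mor.id_intertwiner D)) fun i => i.2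
  assoc φ ψ χ := by
    have h := (φ.jointlyDense.comp ψ.jointlyDense).comp χ.jointlyDense
    refine Mor.ext_of_intertwiners h ?_ ?_
    · rintro ⟨⟨T, T'⟩, T''⟩
      exact Mor.comp_intertwiner' (φ.comp ψ) χ (Mor.comp_intertwiner' φ ψ T.2 T'.2) T''.2
    · rintro ⟨⟨T, T'⟩, T''⟩
      have h' := Mor.comp_intertwiner' φ (ψ.comp χ) T.2 (Mor.comp_intertwiner' ψ χ T'.2 T''.2)
      rwa [ContinuousLinearMap.comp_assoc] at h'

/-! ### Tensor products of morphisms -/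

section TensorIntertwiners

variable {E F E' F' : Bimod B} {t : InternalTensor E F} {t' : InternalTensor E' F'}

lemma IsBimodMap.exists_tensor (t : InternalTensor E F) (t' : InternalTensor E' F')
    {T : E →L[ℂ] E'} {S : E' →L[ℂ] E} {T' : F →L[ℂ] F'} {S' : F' →L[ℂ] F}
    (h : IsBimodMap T S) (h' : IsBimodMap T' S') :
    ∃ V W, IsTensorMap t t' T T' V ∧ IsTensorMap t' t S S' W ∧ IsBimodMap V W := by
  have hc : PAut.Compatible (1 : PAut B) 1 := PAut.compatible_self 1
  obtain ⟨V, hV⟩ := exists_isTensorMap t t' h.isHomogeneous h'.isHomogeneous hc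
  obtain ⟨W, hW⟩ := exists_isTensorMap t' t h.symm.isHomogeneous h'.symm.isHomogeneous hc
  refine ⟨V, W, hV, hW, fun b ξ => ?_, hV.isAdjoint h'.isHomogeneous hc h.adj h'.adj hW⟩
  exact (hV.isHomogeneous h.isHomogeneous h'.isHomogeneous hc).map_lsmul b b (PAut.mem_one.2 rfl) ξ

lemma JointlyDense.tensor {ι κ : Type*} {T : ι → E →L[ℂ] E'} {T' : κ → F →L[ℂ] F'}
    (h : JointlyDense T) (h' : JointlyDense T') {V : ι × κ → t.obj →L[ℂ] t'.obj}
    (hV : ∀ i, IsTensorMap t t' (T i.1) (T' i.2) (V i)) : JointlyDense V := by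
  refine clspan_eq_univ_of_subset (t'.clspan_range_of_dense h h') ?_
  rintro _ ⟨⟨⟨i, ξ⟩, ⟨j, η⟩⟩, rfl⟩
  exact mem_clspan ⟨((i, j), t.tmul ξ η), hV (i, j) ξ η⟩

lemma tensor_mem_multiplier {C : Fam E E} {D : Fam F F} (hC : C.IsStarAlgFam)
    (hD : D.IsStarAlgFam) {ρ σ ρ' σ' : PAut B} (hσ : PAut.Compatible σ' ρ') {c : E →L[ℂ] E}
    {d : F →L[ℂ] F} (hc : c ∈ C.multiplier ρ σ') (hd : d ∈ D.multiplier ρ' σ)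
    {R : t.obj →L[ℂ] t.obj} (hR : IsTensorMap t t c d R) :
    R ∈ (fiberProd t C D).multiplier ρ σ := by
  obtain ⟨h1, h2, h3⟩ := hC.mem_multiplier_iff.1 hc
  obtain ⟨h4, h5, h6⟩ := hD.mem_multiplier_iff.1 hd
  refine (hC.fiberProd hD).mem_multiplier_iff.2 ⟨hR.isHomogeneous h1 h4 hσ, ?_, ?_⟩
  · intro ρ₁ σ₁ Q hQ
    rw [← clspan_fiberProd]
    refine comp_mem_clspan_left R ?_ hQ
    rintro Q ⟨σ₁', ρ₁', h, c', hc', d', hd', hQ⟩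
    exact mem_clspan (mem_fiberProd (hσ.mul h) (h2 hc') (h5 hd') (IsTensorMap.comp hR hQ))
  · intro ρ₁ σ₁ Q hQ
    rw [← clspan_fiberProd]
    refine comp_mem_clspan_right R ?_ hQ
    rintro Q ⟨σ₁', ρ₁', h, c', hc', d', hd', hQ⟩
    exact mem_clspan (mem_fiberProd (h.mul hσ) (h3 hc') (h6 hd') (IsTensorMap.comp hQ hR))

end TensorIntertwiners

namespace Mor

variable {Θ : Set (PAut B)} {A A' C C' : AdmFam Θ} {ρ σ ρ' σ' : PAut B}
  (t : InternalTensor A.E C.E) (t' : InternalTensor A'.E C'.E)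

/-- The image of an operator of the fiber product `𝒜 ⊗ 𝒞` under `φ ⊗ ψ`. -/
lemma exists_tensor_map (φ : Mor A A') (ψ : Mor C C') {R : t.obj →L[ℂ] t.obj}
    (hR : R ∈ fiberProd t A.fam C.fam ρ σ) :
    ∃ R' ∈ (fiberProd t' A'.fam C'.fam).multiplier ρ σ, ∀ T S T' S' V W,
      IntertwinesWith φ.map T S → IntertwinesWith ψ.map T' S' → IsTensorMap t t' T T' V →
      IsTensorMap t' t S S' W → V ∘L R = R' ∘L V ∧ R ∘L W = W ∘L R' := by
  obtain ⟨S, hS⟩ := φ.exists_adjoints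
  obtain ⟨S', hS'⟩ := ψ.exists_adjoints
  choose V W hV hW hVW using fun i : intertwiners φ.map × intertwiners ψ.map =>
    IsBimodMap.exists_tensor t t' (hS i.1).1 (hS' i.2).1
  have hd : JointlyDense V := φ.jointlyDense.tensor ψ.jointlyDense hV
  have hF := A.isStarAlgFam.fiberProd (t := t) C.isStarAlgFam
  have hF' := A'.isStarAlgFam.fiberProd (t := t') C'.isStarAlgFam
  -- `fiberProd` is spanned by tensors `a ⊗ c`, and `a`, `c` commute with `S' T` for intertwiners
  have comm : ∀ R ∈ fiberProd t A.fam C.fam ρ σ, ∀ i j,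
      (W j ∘L V i) ∘L R = R ∘L (W j ∘L V i) := by
    intro R hR i j
    refine eqOn_clspan (f := ContinuousLinearMap.compL ℂ t.obj t.obj t.obj (W j ∘L V i))
      (g := (ContinuousLinearMap.compL ℂ t.obj t.obj t.obj).flip (W j ∘L V i)) ?_ hR
    rintro R ⟨σ', ρ', h, a, ha, c, hc, hR⟩
    have h1 := IsTensorMap.comp (IsTensorMap.comp (hW j) (hV i)) hR
    have h2 := IsTensorMap.comp hR (IsTensorMap.comp (hW j) (hV i))
    have e1 : (S j.1 ∘L i.1.1) ∘L a = a ∘L (S j.1 ∘L i.1.1) := by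
      rw [ContinuousLinearMap.comp_assoc, ((hS i.1).2 _ _ ⟨a, ha⟩).1,
        ← ContinuousLinearMap.comp_assoc, ← ((hS j.1).2 _ _ ⟨a, ha⟩).2,
        ContinuousLinearMap.comp_assoc]
    have e2 : (S' j.2 ∘L i.2.1) ∘L c = c ∘L (S' j.2 ∘L i.2.1) := by
      rw [ContinuousLinearMap.comp_assoc, ((hS' i.2).2 _ _ ⟨c, hc⟩).1,
        ← ContinuousLinearMap.comp_assoc, ← ((hS' j.2).2 _ _ ⟨c, hc⟩).2,
        ContinuousLinearMap.comp_assoc]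
    rw [e1, e2] at h1
    exact h1.unique h2
  have ex : ∀ R ∈ fiberProd t A.fam C.fam ρ σ, ∃ R' : t'.obj →L[ℂ] t'.obj, ‖R'‖ ≤ ‖R‖ ∧
      ∀ i, V i ∘L R = R' ∘L V i ∧ R ∘L W i = W i ∘L R' := fun R hR => by
    obtain ⟨R', -, h⟩ := exists_conj hVW hd (hF.homogeneous _ _ _ hR) (comm R hR)
    exact ⟨R', h⟩
  -- `R'` is a multiplier: on tensors, `a ⊗ c` has the counterpart `φ(a) ⊗ ψ(c)`
  obtain ⟨R', -, hR'⟩ := ex R hR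
  refine ⟨R', ?_, fun T S₁ T' S₁' V₁ W₁ hT hT' hV₁ hW₁ => ?_⟩
  · rw [← hF'.clspan_multiplier]
    refine mem_clspan_of_rel (fun R R' => ∀ i, V i ∘L R = R' ∘L V i) (clspan_fiberProd ρ σ)
      (fun R hR => ?_) ?_ ?_ 1 ?_ (subset_clspan _) ?_ hR fun i => (hR' i).1
    · obtain ⟨R', -, h⟩ := ex R hR
      exact ⟨R', fun i => (h i).1⟩
    · intro R₁ R₂ Q₁ Q₂ h1 h2 i
      rw [ContinuousLinearMap.comp_add, ContinuousLinearMap.add_comp, h1, h2]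
    · intro z R₁ Q₁ h1 i
      rw [ContinuousLinearMap.comp_smul, ContinuousLinearMap.smul_comp, h1]
    · intro R hR Q hQ
      obtain ⟨R', hn, h⟩ := ex R hR
      rwa [clm_ext_of_range (R := Q) (R' := R') hd fun i => by rw [← hQ, (h i).1], one_mul]
    · rintro R ⟨σ', ρ', h, a, ha, c, hc, hR⟩ Q hQ
      have h1 := (φ.map _ _ ⟨a, ha⟩).2
      have h2 := (ψ.map _ _ ⟨c, hc⟩).2
      obtain ⟨Q', hQ'⟩ := exists_isTensorMap t' t' h1.1 h2.1 h
      have e : Q = Q' := clm_ext_of_range hd fun i => by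
        rw [← hQ]
        have h3 := IsTensorMap.comp (hV i) hR
        have h4 := IsTensorMap.comp hQ' (hV i)
        rw [← ((hS i.1).2 _ _ ⟨a, ha⟩).1, ← ((hS' i.2).2 _ _ ⟨c, hc⟩).1] at h4
        exact h3.unique h4
      rw [e]
      exact mem_clspan (tensor_mem_multiplier A'.isStarAlgFam C'.isStarAlgFam h h1 h2 hQ')
  · set i : intertwiners φ.map × intertwiners ψ.map :=
      (⟨T, mem_intertwiners.2 ⟨_, hT⟩⟩, ⟨T', mem_intertwiners.2 ⟨_, hT'⟩⟩) with hi
    have e1 : S₁ = S i.1 := DFunLike.coe_injective (hT.1.adj.unique (hS i.1).1.adj)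
    have e2 : S₁' = S' i.2 := DFunLike.coe_injective (hT'.1.adj.unique (hS' i.2).1.adj)
    rw [e1, e2] at hW₁
    rw [hV₁.unique (hV i), hW₁.unique (hW i)]
    exact hR' i

variable {t t'} in
/-- Tensor products of intertwiners of `φ` and `ψ` intertwine `φ ⊗ ψ`. -/
lemma exists_intertwinesWith_tensor {φ : Mor A A'} {ψ : Mor C C'}
    {χ : ∀ ρ σ, fiberProd t A.fam C.fam ρ σ → (fiberProd t' A'.fam C'.fam).multiplier ρ σ}
    (hχ : ∀ ρ σ R, ∀ T S T' S' V W,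
      IntertwinesWith φ.map T S → IntertwinesWith ψ.map T' S' → IsTensorMap t t' T T' V →
      IsTensorMap t' t S S' W → V ∘L R.1 = (χ ρ σ R).1 ∘L V ∧ R.1 ∘L W = W ∘L (χ ρ σ R).1)
    {T : A.E →L[ℂ] A'.E} {T' : C.E →L[ℂ] C'.E} {V : t.obj →L[ℂ] t'.obj}
    (h : T ∈ intertwiners φ.map) (h' : T' ∈ intertwiners ψ.map) (hV : IsTensorMap t t' T T' V) :
    V ∈ intertwiners χ := by
  obtain ⟨S, hS⟩ := mem_intertwiners.1 h
  obtain ⟨S', hS'⟩ := mem_intertwiners.1 h'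
  obtain ⟨V', W, hV', hW, hVW⟩ := IsBimodMap.exists_tensor t t' hS.1 hS'.1
  rw [hV.unique hV']
  exact mem_intertwiners.2 ⟨W, hVW, fun ρ σ R => hχ ρ σ R T S T' S' V' W hS hS' hV' hW⟩

/-- Nondegeneracy of `φ ⊗ ψ`: factor `a' ⊗ c' = (φ(a) ⊗ ψ(c)) (a'' ⊗ c'')` approximately. -/
lemma mem_clspan_tensor_comp (φ : Mor A A') (ψ : Mor C C')
    {χ : ∀ ρ σ, fiberProd t A.fam C.fam ρ σ → (fiberProd t' A'.fam C'.fam).multiplier ρ σ}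
    (hχ : ∀ {ρ σ σ' ρ'}, PAut.Compatible σ' ρ' → ∀ (a : A.fam ρ σ') (c : C.fam ρ' σ)
      (R : fiberProd t A.fam C.fam ρ σ), IsTensorMap t t a.1 c.1 R.1 →
      IsTensorMap t' t' (φ.map _ _ a).1 (ψ.map _ _ c).1 (χ ρ σ R).1)
    {d : t'.obj →L[ℂ] t'.obj} (hd : d ∈ fiberProd t' A'.fam C'.fam ρ σ) :
    d ∈ clspan {R | ∃ c : fiberProd t A.fam C.fam 1 1, ∃ d' ∈ fiberProd t' A'.fam C'.fam ρ σ,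
      R = (χ 1 1 c).1 ∘L d'} := by
  have h11 : PAut.Compatible (1 : PAut B) 1 := PAut.compatible_self 1
  refine clspan_subset_iff.2 ?_ hd
  rintro R ⟨σ', ρ', h, a', ha', c', hc', hR⟩
  have ha : ∀ a ∈ {R | ∃ c : A.fam 1 1, ∃ d' ∈ A'.fam ρ σ', R = (φ.map 1 1 c).1 ∘L d'},
      a ∈ A'.fam ρ σ' := by
    rintro _ ⟨a, a', ha', rfl⟩
    have := (A'.isStarAlgFam.mem_multiplier_iff.1 (φ.map _ _ a).2).2.1 ha'
    rwa [one_mul, one_mul] at this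
  have hc : ∀ c ∈ {R | ∃ c : C.fam 1 1, ∃ d' ∈ C'.fam ρ' σ, R = (ψ.map 1 1 c).1 ∘L d'},
      c ∈ C'.fam ρ' σ := by
    rintro _ ⟨c, c', hc', rfl⟩
    have := (C'.isStarAlgFam.mem_multiplier_iff.1 (ψ.map _ _ c).2).2.1 hc'
    rwa [one_mul, one_mul] at this
  refine IsTensorMap.mem_clspan_left (fun a h => A'.isStarAlgFam.homogeneous _ _ _ (ha a h))
    (C'.isStarAlgFam.homogeneous _ _ _ hc') h ?_ (φ.mem_clspan_map_comp ha') hR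
  intro a₁ ha₁ R hR
  refine IsTensorMap.mem_clspan_right (fun c h => C'.isStarAlgFam.homogeneous _ _ _ (hc c h))
    (A'.isStarAlgFam.homogeneous _ _ _ (ha a₁ ha₁)) h ?_ (ψ.mem_clspan_map_comp hc') hR
  obtain ⟨a, a', ha', rfl⟩ := ha₁
  rintro _ ⟨c, c', hc', rfl⟩ R hR
  obtain ⟨Q, hQ⟩ := exists_isTensorMap t t (A.isStarAlgFam.homogeneous _ _ _ a.2)
    (C.isStarAlgFam.homogeneous _ _ _ c.2) h11
  obtain ⟨R', hR'⟩ := exists_isTensorMap t' t' (A'.isStarAlgFam.homogeneous _ _ _ ha')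
    (C'.isStarAlgFam.homogeneous _ _ _ hc') h
  have hQm := mem_fiberProd h11 a.2 c.2 hQ
  exact mem_clspan ⟨⟨Q, hQm⟩, R', mem_fiberProd h ha' hc' hR',
    hR.unique (IsTensorMap.comp (hχ h11 a c ⟨Q, hQm⟩ hQ) hR')⟩

end Mor

section TensorHom

variable {Θ : Set (PAut B)} {ten : ∀ E F : Bimod B, InternalTensor E F}
  (hp : FiberProdAdmissible Θ ten) {A A' C C' : AdmFam Θ}

/-- The maps of the morphism `φ ⊗ ψ`. -/
def tensorMap (φ : Mor A A') (ψ : Mor C C') (ρ σ : PAut B) (R : (prodObj hp A C).fam ρ σ) :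
    (prodObj hp A' C').fam.multiplier ρ σ :=
  ⟨(Mor.exists_tensor_map _ (ten A'.E C'.E) φ ψ R.2).choose,
    (Mor.exists_tensor_map _ (ten A'.E C'.E) φ ψ R.2).choose_spec.1⟩

lemma tensorMap_intertwiner (φ : Mor A A') (ψ : Mor C C') {T : A.E →L[ℂ] A'.E}
    {T' : C.E →L[ℂ] C'.E} {V : (ten A.E C.E).obj →L[ℂ] (ten A'.E C'.E).obj}
    (h : T ∈ intertwiners φ.map) (h' : T' ∈ intertwiners ψ.map)
    (hV : IsTensorMap (ten A.E C.E) (ten A'.E C'.E) T T' V) :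
    V ∈ intertwiners (tensorMap hp φ ψ) :=
  Mor.exists_intertwinesWith_tensor
    (fun _ _ R => (Mor.exists_tensor_map _ (ten A'.E C'.E) φ ψ R.2).choose_spec.2) h h' hV

lemma exists_jointlyDense_tensor (t : InternalTensor A.E C.E) (t' : InternalTensor A'.E C'.E)
    (φ : Mor A A') (ψ : Mor C C') :
    ∃ V : intertwiners φ.map × intertwiners ψ.map → t.obj →L[ℂ] t'.obj,
      (∀ i, IsTensorMap t t' i.1.1 i.2.1 (V i)) ∧ JointlyDense V := by
  obtain ⟨S, hS⟩ := φ.exists_adjoints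
  obtain ⟨S', hS'⟩ := ψ.exists_adjoints
  choose V W hV hW hVW using fun i : intertwiners φ.map × intertwiners ψ.map =>
    IsBimodMap.exists_tensor t t' (hS i.1).1 (hS' i.2).1
  exact ⟨V, hV, φ.jointlyDense.tensor ψ.jointlyDense hV⟩

/-- The normal morphism underlying `φ ⊗ ψ`. -/
def tensorNormalMor (φ : Mor A A') (ψ : Mor C C') :
    NormalMor (prodObj hp A C).fam (prodObj hp A' C').fam.multiplier where
  map := tensorMap hp φ ψ
  dense := by
    obtain ⟨V, hV, hd⟩ := exists_jointlyDense_tensor (ten A.E C.E) (ten A'.E C'.E) φ ψ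
    refine clspan_eq_univ_of_subset hd ?_
    rintro _ ⟨⟨i, x⟩, rfl⟩
    exact mem_clspan ⟨V i, tensorMap_intertwiner hp φ ψ i.1.2 i.2.2 (hV i), x, rfl⟩

lemma isTensorMap_tensorMap (φ : Mor A A') (ψ : Mor C C') {ρ σ ρ' σ' : PAut B}
    (h : PAut.Compatible σ' ρ') (a : A.fam ρ σ') (c : C.fam ρ' σ)
    (R : (prodObj hp A C).fam ρ σ) (hR : IsTensorMap (ten A.E C.E) (ten A.E C.E) a.1 c.1 R.1) :
    IsTensorMap (ten A'.E C'.E) (ten A'.E C'.E) (φ.map _ _ a).1 (ψ.map _ _ c).1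
      (tensorMap hp φ ψ ρ σ R).1 := by
  obtain ⟨V, hV, hd⟩ := exists_jointlyDense_tensor (ten A.E C.E) (ten A'.E C'.E) φ ψ
  obtain ⟨Q, hQ⟩ := exists_isTensorMap (ten A'.E C'.E) (ten A'.E C'.E) (φ.map _ _ a).2.1
    (ψ.map _ _ c).2.1 h
  have e : (tensorMap hp φ ψ ρ σ R).1 = Q := clm_ext_of_range hd fun i => by
    have h1 := (tensorNormalMor hp φ ψ).comp_intertwiner
      (tensorMap_intertwiner hp φ ψ i.1.2 i.2.2 (hV i)) R
    have h3 := IsTensorMap.comp (hV i) hR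
    have h4 := IsTensorMap.comp hQ (hV i)
    rw [← φ.comp_intertwiner i.1.2, ← ψ.comp_intertwiner i.2.2] at h4
    exact h1.symm.trans (h3.unique h4)
  rw [e]
  exact hQ

/-- The morphism `φ ⊗ ψ`. -/
def tensorMor (φ : Mor A A') (ψ : Mor C C') : Mor (prodObj hp A C) (prodObj hp A' C') :=
  Mor.ofNormalMor (tensorNormalMor hp φ ψ) fun _ _ _ hd =>
    Mor.mem_clspan_tensor_comp _ _ φ ψ (isTensorMap_tensorMap hp φ ψ) hd

lemma tensorMor_intertwiner (φ : Mor A A') (ψ : Mor C C') {T : A.E →L[ℂ] A'.E}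
    {T' : C.E →L[ℂ] C'.E} {V : (ten A.E C.E).obj →L[ℂ] (ten A'.E C'.E).obj}
    (h : T ∈ intertwiners φ.map) (h' : T' ∈ intertwiners ψ.map)
    (hV : IsTensorMap (ten A.E C.E) (ten A'.E C'.E) T T' V) :
    V ∈ intertwiners (tensorMor hp φ ψ).map := tensorMap_intertwiner hp φ ψ h h' hV

lemma tensorMor_spec (φ : Mor A A') (ψ : Mor C C') (ρ σ σ' ρ' : PAut B)
    (h : PAut.Compatible σ' ρ') (a : A.fam ρ σ') (c : C.fam ρ' σ) :
    ∃ R : (prodObj hp A C).fam ρ σ, (ten A.E C.E).IsTensorOp a.1 c.1 R.1 ∧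
      (ten A'.E C'.E).IsTensorOp (φ.map ρ σ' a).1 (ψ.map ρ' σ c).1
        ((tensorMor hp φ ψ).map ρ σ R).1 := by
  obtain ⟨R, hR⟩ := exists_isTensorMap (ten A.E C.E) (ten A.E C.E)
    (A.isStarAlgFam.homogeneous _ _ _ a.2) (C.isStarAlgFam.homogeneous _ _ _ c.2) h
  have hm := mem_fiberProd h a.2 c.2 hR
  exact ⟨⟨R, hm⟩, hR, isTensorMap_tensorMap hp φ ψ h a c ⟨R, hm⟩ hR⟩

end TensorHom

/-! ### Conjugation with unitaries -/

namespace BimodUnitary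

variable {E F : Bimod B} (U : BimodUnitary E F)

/-- Conjugation of operators with a unitary. -/
def conj : (E →L[ℂ] E) →L[ℂ] (F →L[ℂ] F) :=
  ContinuousLinearMap.compL ℂ F E F (U.equiv : E →L[ℂ] F) ∘L
    (ContinuousLinearMap.compL ℂ F E E).flip (U.equiv.symm : F →L[ℂ] E)

lemma conj_apply (c : E →L[ℂ] E) (x : F) : U.conj c x = U.equiv (c (U.equiv.symm x)) := rfl

lemma conj_comp (c : E →L[ℂ] E) :
    U.conj c ∘L (U.equiv : E →L[ℂ] F) = (U.equiv : E →L[ℂ] F) ∘L c :=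
  ContinuousLinearMap.ext fun x => by simp [conj_apply]

lemma symm_comp_conj (c : E →L[ℂ] E) :
    (U.equiv.symm : F →L[ℂ] E) ∘L U.conj c = c ∘L (U.equiv.symm : F →L[ℂ] E) :=
  ContinuousLinearMap.ext fun x => by simp [conj_apply]

lemma symm_conj_conj (c : E →L[ℂ] E) : U.symm.conj (U.conj c) = c :=
  ContinuousLinearMap.ext fun x => by simp [conj_apply, symm]

lemma conj_symm_conj (c : F →L[ℂ] F) : U.conj (U.symm.conj c) = c :=
  ContinuousLinearMap.ext fun x => by simp [conj_apply, symm]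

/-- The conjugate of an operator can be identified on a linearly dense family of vectors. -/
lemma conj_eq_of_dense {X : Type*} {u : X → E} (hu : clspan (Set.range u) = Set.univ)
    {c : E →L[ℂ] E} {d : F →L[ℂ] F} (h : ∀ x, U.equiv (c (u x)) = d (U.equiv (u x))) :
    U.conj c = d := by
  have e : (U.equiv : E →L[ℂ] F) ∘L c = d ∘L (U.equiv : E →L[ℂ] F) := ext_of_clspan hu (by
    rintro _ ⟨x, rfl⟩
    exact h x)
  refine ContinuousLinearMap.ext fun y => ?_
  have := congrArg (fun T : E →L[ℂ] F => T (U.equiv.symm y)) e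
  simpa [conj_apply] using this

end BimodUnitary

namespace Mor

variable {Θ : Set (PAut B)} {C D : AdmFam Θ}

/-- Conjugation with a unitary that carries `𝒞` into `𝒟` and whose inverse carries `𝒟` into `𝒞`. -/
def conj (U : BimodUnitary C.E D.E) (h : ∀ ρ σ, ∀ c ∈ C.fam ρ σ, U.conj c ∈ D.fam ρ σ)
    (h' : ∀ ρ σ, ∀ d ∈ D.fam ρ σ, U.symm.conj d ∈ C.fam ρ σ) : Mor C D :=
  ofNormalMor
    { map := fun ρ σ c => ⟨U.conj c.1, D.isStarAlgFam.le_multiplier (h ρ σ c.1 c.2)⟩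
      dense := by
        refine Set.eq_univ_of_forall fun x =>
          mem_clspan ⟨(U.equiv : C.E →L[ℂ] D.E), ?_, U.equiv.symm x, by simp⟩
        exact mem_intertwiners.2 ⟨_, U.isBimodMap, fun _ _ c =>
          ⟨(U.conj_comp c.1).symm, (U.symm_comp_conj c.1).symm⟩⟩ }
    fun ρ σ d hd => by
      refine clspan_mono ?_ (D.isStarAlgFam.mem_clspan_one_comp hd)
      rintro _ ⟨a, ha, rfl⟩
      exact ⟨⟨U.symm.conj a, h' _ _ a ha⟩, d, hd, congrArg (· ∘L d) (U.conj_symm_conj a).symm⟩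

lemma conj_intertwiner (U : BimodUnitary C.E D.E)
    (h : ∀ ρ σ, ∀ c ∈ C.fam ρ σ, U.conj c ∈ D.fam ρ σ)
    (h' : ∀ ρ σ, ∀ d ∈ D.fam ρ σ, U.symm.conj d ∈ C.fam ρ σ) :
    (U.equiv : C.E →L[ℂ] D.E) ∈ intertwiners (conj U h h').map :=
  mem_intertwiners.2 ⟨_, U.isBimodMap, fun _ _ c =>
    ⟨(U.conj_comp c.1).symm, (U.symm_comp_conj c.1).symm⟩⟩

end Mor

lemma JointlyDense.of_surjective {E F : Bimod B} {T : E →L[ℂ] F} (h : Function.Surjective T) :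
    JointlyDense fun _ : Unit => T :=
  Set.eq_univ_of_forall fun y => mem_clspan <| by
    obtain ⟨x, rfl⟩ := h y
    exact ⟨((), x), rfl⟩

section ConjIso

variable {Θ : Set (PAut B)} {C D : AdmFam Θ}

/-- Conjugation with `U⁻¹` is inverse to conjugation with `U`: their composition has the identity
operator as an intertwiner. -/
lemma Mor.conj_comp_conj_symm (U : BimodUnitary C.E D.E)
    (h : ∀ ρ σ, ∀ c ∈ C.fam ρ σ, U.conj c ∈ D.fam ρ σ)
    (h' : ∀ ρ σ, ∀ d ∈ D.fam ρ σ, U.symm.conj d ∈ C.fam ρ σ)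
    (h'' : ∀ ρ σ, ∀ c ∈ C.fam ρ σ, U.symm.symm.conj c ∈ D.fam ρ σ) :
    (Mor.conj U h h').comp (Mor.conj U.symm h' h'') = Mor.id C := by
  refine Mor.ext_of_intertwiners
    (JointlyDense.of_surjective (T := ContinuousLinearMap.id ℂ C.E) fun x => ⟨x, rfl⟩)
    (fun _ => ?_) fun _ => Mor.id_intertwiner C
  have := Mor.comp_intertwiner' _ _ (Mor.conj_intertwiner U h h')
    (Mor.conj_intertwiner U.symm h' h'')
  have e : (U.symm.equiv : D.E →L[ℂ] C.E) ∘L (U.equiv : C.E →L[ℂ] D.E) =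
      ContinuousLinearMap.id ℂ C.E :=
    ContinuousLinearMap.ext fun x => U.equiv.symm_apply_apply x
  rwa [e] at this

/-- A unitary that carries `𝒞` onto `𝒟` gives an isomorphism in the category of admissible
families. -/
def conjIso (U : BimodUnitary C.E D.E) (h : ∀ ρ σ, ∀ c ∈ C.fam ρ σ, U.conj c ∈ D.fam ρ σ)
    (h' : ∀ ρ σ, ∀ d ∈ D.fam ρ σ, U.symm.conj d ∈ C.fam ρ σ) : (categoryData Θ).Isom C D :=
  letI := (categoryData Θ).category
  { hom := Mor.conj U h h'
    inv := Mor.conj U.symm h' h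
    hom_inv_id := Mor.conj_comp_conj_symm U h h' h
    inv_hom_id := Mor.conj_comp_conj_symm U.symm h' h h' }

lemma isConj_conj (U : BimodUnitary C.E D.E)
    (h : ∀ ρ σ, ∀ c ∈ C.fam ρ σ, U.conj c ∈ D.fam ρ σ)
    (h' : ∀ ρ σ, ∀ d ∈ D.fam ρ σ, U.symm.conj d ∈ C.fam ρ σ) : (Mor.conj U h h').IsConj U := by
  refine fun ρ σ => ⟨fun c x => rfl, Set.ext fun R => ⟨?_, fun hR => ?_⟩⟩
  · rintro ⟨c, rfl⟩
    exact h ρ σ c.1 c.2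
  · exact ⟨⟨_, h' ρ σ R hR⟩, (U.conj_symm_conj R).symm⟩

end ConjIso

/-! ### The unitors -/

section Unitors

variable {Θ : Set (PAut B)} {E : Bimod B} {C : Fam E E} {ρ σ ρ' σ' : PAut B}

/-- The unitary `B ⊗ E → E`, `b ⊗ ξ ↦ b ξ`. -/
lemma exists_leftUnitor (t : InternalTensor (Bimod.self B) E) :
    ∃ U : BimodUnitary t.obj E, ∀ (b : B) ξ, U.equiv (t.tmul b ξ) = E.lsmul b ξ := by
  obtain ⟨U, hU⟩ := exists_bimodUnitary (E := t.obj) (F := E)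
    (fun p : Bimod.self B × E => t.tmul p.1 p.2) (fun p => E.lsmul p.1 p.2) t.clspan_range
    (by
      rw [← E.nondegenerate]
      congr 1
      ext x
      exact ⟨fun ⟨p, hp⟩ => ⟨p.1, p.2, hp.symm⟩, fun ⟨b, y, h⟩ => ⟨(b, y), h.symm⟩⟩)
    (fun p q => by
      rw [t.ip_tmul, E.ip_lsmul_left, ← E.lsmul_mul])
    (fun b p => ((Bimod.self B).lsmul b p.1, p.2)) (fun b p => t.lsmul_tmul _ _ _)
    fun b p => (E.lsmul_mul _ _ _).symm
  exact ⟨U, fun b ξ => hU (b, ξ)⟩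

/-- The unitary `E ⊗ B → E`, `ξ ⊗ b ↦ ξ b`. -/
lemma exists_rightUnitor (t : InternalTensor E (Bimod.self B)) :
    ∃ U : BimodUnitary t.obj E, ∀ ξ (b : B), U.equiv (t.tmul ξ b) = E.rsmul ξ b := by
  obtain ⟨U, hU⟩ := exists_bimodUnitary (E := t.obj) (F := E)
    (fun p : E × Bimod.self B => t.tmul p.1 p.2) (fun p => E.rsmul p.1 p.2) t.clspan_range
    (by
      refine Set.eq_univ_of_forall fun x => ?_
      refine clspan_mono ?_ (E.mem_rspan_one x)
      rintro _ ⟨y, b, -, rfl⟩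
      exact ⟨(y, b), rfl⟩)
    (fun p q => by
      rw [t.ip_tmul, E.ip_rsmul, E.ip_rsmul_left]
      exact mul_assoc _ _ _)
    (fun b p => (E.lsmul b p.1, p.2)) (fun b p => t.lsmul_tmul _ _ _)
    fun b p => E.lsmul_rsmul _ _ _
  exact ⟨U, fun ξ b => hU (ξ, b)⟩

/-- If `u` and `v` have the degrees `ρ` and `σ⋆`, then `θ(u d v)` has degree `(θρ)(θσ)⋆`. -/
lemma shift_mul_mem_hmg {θ : PAut B} {u v d w : B} (hu : u ∈ hmg (Bimod.self B) ρ)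
    (hv : v ∈ hmg (Bimod.self B) σ⁻¹) (hd : d ∈ hmg (Bimod.self B) (θ⁻¹ * θ))
    (hw : (u * d * v, w) ∈ θ.graph) : w ∈ hmg (Bimod.self B) (θ * ρ * (θ * σ)⁻¹) := by
  have h1 : u * d * v ∈ hmg (Bimod.self B) (ρ * (θ⁻¹ * θ) * σ⁻¹) :=
    mul_mem_hmg (mul_mem_hmg hu hd) hv
  have h2 := hmg_self_conj (θ := θ⁻¹) h1 (PAut.mem_inv.2 hw)
  refine hmg_self_mono ?_ h2
  rw [inv_inv, PAut.mul_inv_rev]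
  calc θ * (ρ * (θ⁻¹ * θ) * σ⁻¹) * θ⁻¹ ≤ θ * (ρ * 1 * σ⁻¹) * θ⁻¹ := by
        gcongr
        exact θ.inv_mul_le_one
    _ = θ * ρ * (σ⁻¹ * θ⁻¹) := by simp only [mul_one, mul_assoc]

/-- The unit family is spanned by operators `k` of the form `k b = y z` with `z = σ(v b)`, and also
`k b = z' y'` with `z' = ρ(b u)`, where `y σ(v) = ρ(u) y'` is an element of degree `ρσ⋆`. -/
lemma mem_clspan_unitFam {k : B →L[ℂ] B} (hk : k ∈ unitFam Θ ρ σ) :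
    k ∈ clspan {k : Bimod.self B →L[ℂ] Bimod.self B | IsHomogeneous ρ σ k ∧
      ∃ w ∈ hmg (Bimod.self B) (ρ * σ⁻¹),
        (∃ y v v', (v, v') ∈ σ.graph ∧ w = y * v' ∧
          ∀ b : B, ∃ z : B, (v * b, z) ∈ σ.graph ∧ k b = y * z) ∧
        ∃ y u u', (u, u') ∈ ρ.graph ∧ w = u' * y ∧
          ∀ b : B, ∃ z : B, (b * u, z) ∈ ρ.graph ∧ k b = z * y} := by
  have hk' := hk
  rw [unitFam_eq] at hk'
  refine clspan_subset_iff.2 ?_ hk'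
  rintro _ ⟨ρ₁, hρΘ, σ₁, hσΘ, θ, hθΘ, hρ, hσ, a, ha, c, hc, d, hd, rfl⟩
  refine AdmissibleSemigroup.shift_comp_mem hd (isClosed_clspan _) fun e he f hf => mem_clspan ?_
  have hu : a * e ∈ hmg (Bimod.self B) ρ₁ :=
    hmg_self_mono (mul_le_of_le_one_right' θ.inv_mul_le_one) (mul_mem_hmg ha he)
  have hv : c * f ∈ hmg (Bimod.self B) σ₁⁻¹ :=
    hmg_self_mono (mul_le_of_le_one_right' θ.inv_mul_le_one) (mul_mem_hmg hc hf)
  have hud : a * e ∈ θ.dom := θ.dom_ideal.mul_mem_left a (PAut.source_dom he)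
  have hvd : c * f ∈ θ.dom := θ.dom_ideal.mul_mem_left c (PAut.source_dom hf)
  generalize a * e = u at *
  generalize c * f = v at *
  obtain ⟨d', hd'⟩ := PAut.source_dom hd
  obtain ⟨u', hu'⟩ := hud
  obtain ⟨v', hv'⟩ := hvd
  have hcd := PAut.central_of_source hd
  refine ⟨AdmissibleSemigroup.unitFam_homogeneous _ _ _
    (mem_unitFam hρΘ hσΘ hθΘ hu hv hd hρ hσ), u' * d' * v', ?_, ⟨u' * d', v, v', ?_, rfl, ?_⟩,
    d' * v', u, u', ?_, mul_assoc _ _ _, ?_⟩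
  · refine hmg_self_mono (PAut.mul_le_mul hρ (PAut.inv_le_inv hσ)) ?_
    exact shift_mul_mem_hmg hu hv hd (θ.map_mul (θ.map_mul hu' hd') hv')
  · exact hσ (PAut.mem_mul.2 ⟨v, PAut.mem_inv.1 (hmg_self_mem_graph hv), hv'⟩)
  · intro b
    obtain ⟨z, hz⟩ : b * v ∈ θ.dom := θ.dom_ideal.mul_mem_left b ⟨v', hv'⟩
    refine ⟨z, hσ (PAut.mem_mul.2 ⟨b * v, PAut.mem_inv.1 (hmg_self_mul_mem_graph hv b), hz⟩), ?_⟩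
    refine θ.map_unique (PAut.shift_spec ⟨d', hd'⟩ (u * (b * v))) ?_
    have := θ.map_mul (θ.map_mul hu' hd') hz
    rwa [mul_assoc, hcd, ← mul_assoc] at this
  · exact hρ (PAut.mem_mul.2 ⟨u, hmg_self_mem_graph hu, hu'⟩)
  · intro b
    obtain ⟨z, hz⟩ : u * b ∈ θ.dom := θ.dom_ideal.mul_mem_right b ⟨u', hu'⟩
    refine ⟨z, hρ (PAut.mem_mul.2 ⟨u * b, hmg_self_mul_mem_graph hu b, hz⟩), ?_⟩
    refine θ.map_unique (PAut.shift_spec ⟨d', hd'⟩ (u * (b * v))) ?_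
    have := θ.map_mul hz (θ.map_mul hd' hv')
    rwa [hcd, ← mul_assoc, mul_assoc u b v] at this

/-- Under `B ⊗ E ≅ E`, an operator `k ⊗ c` with `k b = y σ(v b)` becomes `y σ(v) c`. -/
lemma leftUnitor_conj_mem (h : AdmissibleFam Θ C) {t : InternalTensor (Bimod.self B) E}
    {U : BimodUnitary t.obj E} (hU : ∀ (b : B) ξ, U.equiv (t.tmul b ξ) = E.lsmul b ξ)
    {R : t.obj →L[ℂ] t.obj} (hR : R ∈ fiberProd t (unitFam Θ) C ρ σ) : U.conj R ∈ C ρ σ := by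
  have hC := h.isStarAlgFam
  rw [← hC.clspan_eq]
  refine map_mem_clspan U.conj ?_ hR
  rintro R ⟨σ', ρ', hσ, k, hk, c, hc, hkc⟩
  have hcc := hC.homogeneous _ _ _ hc
  refine map_mem_clspan U.conj (S := {R | U.conj R ∈ C ρ σ}) (fun s hs => mem_clspan hs) ?_
  refine IsTensorMap.mem_clspan_left (fun k hk => hk.1) hcc hσ ?_ (mem_clspan_unitFam hk) hkc
  rintro k ⟨-, w, hw, ⟨y, v, v', hv, rfl, hk⟩, -⟩ R hR
  refine mem_clspan ?_
  change U.conj R ∈ C ρ σ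
  rw [U.conj_eq_of_dense (d := E.lm (y * v') ∘L c) t.clspan_range]
  · refine hC.mono ?_ le_rfl (h.lm_comp_mem hc hw)
    rw [mul_assoc]
    exact mul_le_of_le_one_right' (PAut.compatible_iff.1 hσ).2
  · rintro ⟨b, ξ⟩
    change U.equiv (R (t.tmul b ξ)) = E.lsmul (y * v') (c (U.equiv (t.tmul b ξ)))
    obtain ⟨z, hz, hkb⟩ := hk b
    rw [hR, hU, hU, hkb, E.lsmul_mul, E.lsmul_mul, ← hcc.map_lsmul_of_compatible hσ hz,
      ← hcc.map_lsmul_of_compatible hσ hv, E.lsmul_mul]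

/-- Under `E ⊗ B ≅ E`, an operator `c ⊗ k` with `k b = ρ(b u) y` becomes `c` followed by the right
multiplication with `ρ(u) y`. -/
lemma rightUnitor_conj_mem (h : AdmissibleFam Θ C) {t : InternalTensor E (Bimod.self B)}
    {U : BimodUnitary t.obj E} (hU : ∀ ξ (b : B), U.equiv (t.tmul ξ b) = E.rsmul ξ b)
    {R : t.obj →L[ℂ] t.obj} (hR : R ∈ fiberProd t C (unitFam Θ) ρ σ) : U.conj R ∈ C ρ σ := by
  have hC := h.isStarAlgFam
  rw [← hC.clspan_eq]
  refine map_mem_clspan U.conj ?_ hR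
  rintro R ⟨σ', ρ', hσ, c, hc, k, hk, hkc⟩
  have hcc := hC.homogeneous _ _ _ hc
  refine map_mem_clspan U.conj (S := {R | U.conj R ∈ C ρ σ}) (fun s hs => mem_clspan hs) ?_
  refine IsTensorMap.mem_clspan_right (fun k hk => hk.1) hcc hσ ?_ (mem_clspan_unitFam hk) hkc
  rintro k ⟨-, w, hw, -, y, u, u', hu, rfl, hk⟩ R hR
  refine mem_clspan ?_
  change U.conj R ∈ C ρ σ
  rw [U.conj_eq_of_dense (d := E.rm (u' * y) ∘L c) t.clspan_range]
  · refine hC.mono le_rfl ?_ (h.rm_comp_mem (τ := σ * ρ'⁻¹) hc ?_)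
    · rw [mul_assoc]
      exact mul_le_of_le_one_right' (PAut.compatible_iff.1 hσ.symm).2
    · rwa [PAut.mul_inv_rev, inv_inv]
  · rintro ⟨ξ, b⟩
    change U.equiv (R (t.tmul ξ b)) = E.rsmul (c (U.equiv (t.tmul ξ b))) (u' * y)
    obtain ⟨z, hz, hkb⟩ := hk b
    rw [hR, hU, hU, hkb, E.rsmul_mul, E.rsmul_mul, ← hcc.map_rsmul_of_compatible hσ.symm hz,
      ← hcc.map_rsmul_of_compatible hσ.symm hu, E.rsmul_mul]

/-- The operators `k : x ↦ ρ(u x v b)` with central `u, v, b ∈ Dom ρ` belong to the unit family. -/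
lemma exists_mem_unitFam (hΘ : AdmissibleSemigroup Θ) (hρ : ρ ∈ Θ) {u v b : B}
    (hu : u ∈ hmg (Bimod.self B) (ρ⁻¹ * ρ)) (hv : v ∈ hmg (Bimod.self B) (ρ⁻¹ * ρ))
    (hb : b ∈ hmg (Bimod.self B) (ρ⁻¹ * ρ)) :
    ∃ k : Bimod.self B →L[ℂ] Bimod.self B, k ∈ unitFam Θ ρ ρ ∧
      ∀ x : B, (b * u * v * x, k x) ∈ ρ.graph := by
  have he := hΘ.mul_mem (hΘ.inv_mem' hρ) hρ
  have hle : ρ * (ρ⁻¹ * ρ) ≤ ρ := mul_le_of_le_one_right' ρ.inv_mul_le_one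
  refine ⟨_, mem_unitFam (c := v) (d := b) he he hρ hu
    (by rwa [PAut.inv_of_le_one ρ.inv_mul_le_one]) hb hle hle, fun x => ?_⟩
  have e : b * u * v * x = u * (x * v) * b := by
    rw [← PAut.central_of_source hb, ← PAut.central_of_source hv x, mul_assoc, mul_assoc]
  rw [e]
  exact PAut.shift_spec (PAut.source_dom hb) (u * (x * v))

/-- An operator `c` is a limit of sums of operators `T b u v` with `T` of degree `(ρ, σ)` and
central `b`, `u`, `v` in `Dom ρ`. As `T (b u v x ξ) = ρ(b u v x) T ξ`, such an operator corresponds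
to `k ⊗ T` with `k x = ρ(b u v x)`. -/
lemma leftUnitor_symm_conj_mem (hΘ : AdmissibleSemigroup Θ) (h : AdmissibleFam Θ C)
    {t : InternalTensor (Bimod.self B) E} {U : BimodUnitary t.obj E}
    (hU : ∀ (b : B) ξ, U.equiv (t.tmul b ξ) = E.lsmul b ξ)
    {c : E →L[ℂ] E} (hc : c ∈ C ρ σ) : U.symm.conj c ∈ fiberProd t (unitFam Θ) C ρ σ := by
  have hC := h.isStarAlgFam
  have hF : (fiberProd t (unitFam Θ) C).IsStarAlgFam := hΘ.unitFam_isStarAlgFam.fiberProd hC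
  rw [← hF.clspan_eq]
  refine map_mem_clspan U.symm.conj ?_ (h.mem_clspan_comp_op hc)
  rintro _ ⟨ρ', hρΘ, σ', hσΘ, hρ, hσ, S, hS, b, hb, c', hc', rfl⟩
  have hS' : S ∘L E.rm c' ∈ C ρ' σ' := by
    refine hC.mono le_rfl ?_ (h.comp_rm_mem (τ := (σ'⁻¹ * σ')⁻¹) hS (by rwa [inv_inv]))
    rw [PAut.inv_of_le_one σ'.inv_mul_le_one]
    exact mul_le_of_le_one_right' σ'.inv_mul_le_one
  have e1 : S ∘L (E.lm b ∘L E.rm c') = (S ∘L E.rm c') ∘L E.lm b :=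
    ContinuousLinearMap.ext fun x => congrArg S (E.lsmul_rsmul b c' x)
  rw [e1]
  generalize S ∘L E.rm c' = T at hS'
  have hbb : ∀ {x : B}, x ∈ hmg (Bimod.self B) (ρ'⁻¹ * ρ') →
      star x * x ∈ hmg (Bimod.self B) (ρ'⁻¹ * ρ') := fun hx =>
    (centralAlg _ ρ'.inv_mul_le_one).mul_mem' ((centralAlg _ ρ'.inv_mul_le_one).star_mem' hx) hx
  have hP : IsClosed {x : B | U.symm.conj (T ∘L E.lm x) ∈
      clspan (fiberProd t (unitFam Θ) C ρ σ)} :=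
    (isClosed_clspan _).preimage
      (U.symm.conj ∘L ContinuousLinearMap.compL ℂ E E E T ∘L E.lm).continuous
  refine mem_of_mul_central_mem ρ'.inv_mul_le_one (hbb hb) hP fun u hu => ?_
  have hbu : b * u ∈ hmg (Bimod.self B) (ρ'⁻¹ * ρ') :=
    (centralAlg _ ρ'.inv_mul_le_one).mul_mem' hb hu
  refine mem_of_mul_central_mem ρ'.inv_mul_le_one (hbb hbu) hP fun v hv => ?_
  refine mem_clspan ?_
  change U.symm.conj (T ∘L E.lm (b * u * v)) ∈ fiberProd t (unitFam Θ) C ρ σ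
  obtain ⟨k, hk, hkx⟩ := exists_mem_unitFam hΘ hρΘ hu hv hb
  have hT := hC.homogeneous _ _ _ hS'
  obtain ⟨R, hR⟩ := exists_isTensorMap t t (AdmissibleSemigroup.unitFam_homogeneous _ _ _ hk) hT
    (PAut.compatible_self ρ')
  have hm := mem_fiberProd (PAut.compatible_self ρ') hk hS' hR
  have e2 : U.conj R = T ∘L E.lm (b * u * v) := U.conj_eq_of_dense t.clspan_range (by
    rintro ⟨x, ξ⟩
    change U.equiv (R (t.tmul x ξ)) = T (E.lsmul (b * u * v) (U.equiv (t.tmul x ξ)))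
    rw [hR, hU, hU, ← E.lsmul_mul]
    exact (hT.map_lsmul _ _ (hkx x) ξ).symm)
  rw [← e2, U.symm_conj_conj]
  exact hF.mono hρ hσ hm

/-- An operator `c` is a limit of sums of operators `ξ ↦ T (ξ b u v)` with `T` of degree `(ρ, σ)`
and central `b`, `u`, `v` in `Dom σ`. As `T (ξ b u v x) = (T ξ) σ(b u v x)`, such an operator
corresponds to `T ⊗ k` with `k x = σ(b u v x)`. -/
lemma rightUnitor_symm_conj_mem (hΘ : AdmissibleSemigroup Θ) (h : AdmissibleFam Θ C)
    {t : InternalTensor E (Bimod.self B)} {U : BimodUnitary t.obj E}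
    (hU : ∀ ξ (b : B), U.equiv (t.tmul ξ b) = E.rsmul ξ b)
    {c : E →L[ℂ] E} (hc : c ∈ C ρ σ) : U.symm.conj c ∈ fiberProd t C (unitFam Θ) ρ σ := by
  have hC := h.isStarAlgFam
  have hF : (fiberProd t C (unitFam Θ)).IsStarAlgFam := hC.fiberProd hΘ.unitFam_isStarAlgFam
  rw [← hF.clspan_eq]
  refine map_mem_clspan U.symm.conj ?_ (h.mem_clspan_comp_op hc)
  rintro _ ⟨ρ', hρΘ, σ', hσΘ, hρ, hσ, S, hS, c', hc', b, hb, rfl⟩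
  have hS' : S ∘L E.lm c' ∈ C ρ' σ' :=
    hC.mono (mul_le_of_le_one_right' ρ'.inv_mul_le_one) le_rfl (h.comp_lm_mem hS hc')
  change U.symm.conj ((S ∘L E.lm c') ∘L E.rm b) ∈ _
  generalize S ∘L E.lm c' = T at hS'
  have hbb : ∀ {x : B}, x ∈ hmg (Bimod.self B) (σ'⁻¹ * σ') →
      star x * x ∈ hmg (Bimod.self B) (σ'⁻¹ * σ') := fun hx =>
    (centralAlg _ σ'.inv_mul_le_one).mul_mem' ((centralAlg _ σ'.inv_mul_le_one).star_mem' hx) hx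
  have hP : IsClosed {x : B | U.symm.conj (T ∘L E.rm x) ∈
      clspan (fiberProd t C (unitFam Θ) ρ σ)} :=
    (isClosed_clspan _).preimage
      (U.symm.conj ∘L ContinuousLinearMap.compL ℂ E E E T ∘L E.rm).continuous
  refine mem_of_mul_central_mem σ'.inv_mul_le_one (hbb hb) hP fun u hu => ?_
  have hbu : b * u ∈ hmg (Bimod.self B) (σ'⁻¹ * σ') :=
    (centralAlg _ σ'.inv_mul_le_one).mul_mem' hb hu
  refine mem_of_mul_central_mem σ'.inv_mul_le_one (hbb hbu) hP fun v hv => ?_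
  refine mem_clspan ?_
  change U.symm.conj (T ∘L E.rm (b * u * v)) ∈ fiberProd t C (unitFam Θ) ρ σ
  obtain ⟨k, hk, hkx⟩ := exists_mem_unitFam hΘ hσΘ hu hv hb
  have hT := hC.homogeneous _ _ _ hS'
  obtain ⟨R, hR⟩ := exists_isTensorMap t t hT (AdmissibleSemigroup.unitFam_homogeneous _ _ _ hk)
    (PAut.compatible_self σ')
  have hm := mem_fiberProd (PAut.compatible_self σ') hS' hk hR
  have hbuv : b * u * v ∈ hmg (Bimod.self B) (σ'⁻¹ * σ') :=
    (centralAlg _ σ'.inv_mul_le_one).mul_mem' hbu hv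
  have e2 : U.conj R = T ∘L E.rm (b * u * v) := U.conj_eq_of_dense t.clspan_range (by
    rintro ⟨ξ, x⟩
    change U.equiv (R (t.tmul ξ x)) = T (E.rsmul (U.equiv (t.tmul ξ x)) (b * u * v))
    rw [hR, hU, hU, ← E.rsmul_mul, ← PAut.central_of_source hbuv]
    exact (hT.map_rsmul (hkx x) ξ).symm)
  rw [← e2, U.symm_conj_conj]
  exact hF.mono hρ hσ hm

end Unitors

/-! ### The associator -/

section Associator

variable {E F G : Bimod B} {A : Fam E E} {C : Fam F F} {D : Fam G G} {ρ σ : PAut B}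
  {t : InternalTensor E F} {s : InternalTensor t.obj G}
  {t' : InternalTensor F G} {s' : InternalTensor E t'.obj}

lemma clspan_range_id (E : Bimod B) : clspan (Set.range fun x : E => x) = Set.univ :=
  Set.eq_univ_of_forall fun x => mem_clspan ⟨x, rfl⟩

lemma clspan_range_assoc (t : InternalTensor E F) (s : InternalTensor t.obj G) :
    clspan (Set.range fun p : (E × F) × G => s.tmul (t.tmul p.1.1 p.1.2) p.2) = Set.univ :=
  s.clspan_range_of_dense (u := fun p : E × F => t.tmul p.1 p.2) (v := fun ζ : G => ζ)
    t.clspan_range (clspan_range_id G)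

/-- The unitary `(E ⊗ F) ⊗ G → E ⊗ (F ⊗ G)`. -/
lemma exists_associator (t : InternalTensor E F) (s : InternalTensor t.obj G)
    (t' : InternalTensor F G) (s' : InternalTensor E t'.obj) :
    ∃ U : BimodUnitary s.obj s'.obj,
      ∀ ξ η ζ, U.equiv (s.tmul (t.tmul ξ η) ζ) = s'.tmul ξ (t'.tmul η ζ) := by
  obtain ⟨U, hU⟩ := exists_bimodUnitary (E := s.obj) (F := s'.obj)
    (fun p : (E × F) × G => s.tmul (t.tmul p.1.1 p.1.2) p.2)
    (fun p => s'.tmul p.1.1 (t'.tmul p.1.2 p.2))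
    (clspan_range_assoc t s)
    (by
      refine clspan_eq_univ_of_subset (s'.clspan_range_of_dense (u := fun ξ : E => ξ)
        (v := fun q : F × G => t'.tmul q.1 q.2) (clspan_range_id E) t'.clspan_range) ?_
      rintro _ ⟨⟨ξ, η, ζ⟩, rfl⟩
      exact mem_clspan ⟨((ξ, η), ζ), rfl⟩)
    (fun p q => by
      rw [s.ip_tmul, s'.ip_tmul, t.ip_tmul, t'.lsmul_tmul, t'.ip_tmul])
    (fun b p => ((E.lsmul b p.1.1, p.1.2), p.2))
    (fun b p => by rw [s.lsmul_tmul, t.lsmul_tmul]) fun b p => s'.lsmul_tmul _ _ _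
  exact ⟨U, fun ξ η ζ => hU ((ξ, η), ζ)⟩

variable {U : BimodUnitary s.obj s'.obj}

/-- Under the associator, `(a ⊗ c) ⊗ d` becomes `a ⊗ (c ⊗ d)`. -/
lemma associator_conj_tensor (hU : ∀ ξ η ζ, U.equiv (s.tmul (t.tmul ξ η) ζ) =
      s'.tmul ξ (t'.tmul η ζ)) {a : E →L[ℂ] E} {c : F →L[ℂ] F} {d : G →L[ℂ] G}
    {P : t.obj →L[ℂ] t.obj} {R : s.obj →L[ℂ] s.obj} {Q : t'.obj →L[ℂ] t'.obj}
    {V : s'.obj →L[ℂ] s'.obj} (hP : IsTensorMap t t a c P) (hR : IsTensorMap s s P d R)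
    (hQ : IsTensorMap t' t' c d Q) (hV : IsTensorMap s' s' a Q V) : U.conj R = V :=
  U.conj_eq_of_dense (clspan_range_assoc t s) (by
    rintro ⟨⟨ξ, η⟩, ζ⟩
    change U.equiv (R (s.tmul (t.tmul ξ η) ζ)) = V (U.equiv (s.tmul (t.tmul ξ η) ζ))
    rw [hR, hP, hU, hU, hV, hQ])

lemma associator_conj_mem (hA : A.IsStarAlgFam) (hC : C.IsStarAlgFam) (hD : D.IsStarAlgFam)
    (hU : ∀ ξ η ζ, U.equiv (s.tmul (t.tmul ξ η) ζ) = s'.tmul ξ (t'.tmul η ζ))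
    {R : s.obj →L[ℂ] s.obj} (hR : R ∈ fiberProd s (fiberProd t A C) D ρ σ) :
    U.conj R ∈ fiberProd s' A (fiberProd t' C D) ρ σ := by
  rw [← clspan_fiberProd]
  refine map_mem_clspan U.conj ?_ hR
  rintro R ⟨σ₁, ρ₁, h₁, P, hP, d, hd, hPd⟩
  have hdd := hD.homogeneous _ _ _ hd
  refine map_mem_clspan U.conj (S := {R | U.conj R ∈ fiberProd s' A (fiberProd t' C D) ρ σ})
    (fun s hs => mem_clspan hs) ?_
  have hom : ∀ P ∈ {P | ∃ σ' ρ', PAut.Compatible σ' ρ' ∧ ∃ a ∈ A ρ σ', ∃ c ∈ C ρ' σ₁,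
      t.IsTensorOp a c P}, IsHomogeneous ρ σ₁ P := by
    rintro P ⟨σ', ρ', h', a, ha, c, hc, hP⟩
    exact IsTensorMap.isHomogeneous (hA.homogeneous _ _ _ ha) (hC.homogeneous _ _ _ hc) h' hP
  refine IsTensorMap.mem_clspan_left hom hdd h₁ ?_ hP hPd
  rintro P ⟨σ', ρ', h', a, ha, c, hc, hP⟩ R hR
  refine mem_clspan ?_
  obtain ⟨Q, hQ⟩ := exists_isTensorMap t' t' (hC.homogeneous _ _ _ hc) hdd h₁
  have hQm := mem_fiberProd h₁ hc hd hQ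
  obtain ⟨V, hV⟩ := exists_isTensorMap s' s' (hA.homogeneous _ _ _ ha)
    ((hC.fiberProd hD).homogeneous _ _ _ hQm) h'
  change U.conj R ∈ fiberProd s' A (fiberProd t' C D) ρ σ
  rw [associator_conj_tensor hU hP hR hQ hV]
  exact mem_fiberProd h' ha hQm hV

lemma associator_symm_conj_mem (hA : A.IsStarAlgFam) (hC : C.IsStarAlgFam) (hD : D.IsStarAlgFam)
    (hU : ∀ ξ η ζ, U.equiv (s.tmul (t.tmul ξ η) ζ) = s'.tmul ξ (t'.tmul η ζ))
    {V : s'.obj →L[ℂ] s'.obj} (hV : V ∈ fiberProd s' A (fiberProd t' C D) ρ σ) :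
    U.symm.conj V ∈ fiberProd s (fiberProd t A C) D ρ σ := by
  rw [← clspan_fiberProd]
  refine map_mem_clspan U.symm.conj ?_ hV
  rintro V ⟨σ₁, ρ₁, h₁, a, ha, Q, hQ, haQ⟩
  have haa := hA.homogeneous _ _ _ ha
  refine map_mem_clspan U.symm.conj
    (S := {V | U.symm.conj V ∈ fiberProd s (fiberProd t A C) D ρ σ})
    (fun s hs => mem_clspan hs) ?_
  have hom : ∀ Q ∈ {Q | ∃ σ' ρ', PAut.Compatible σ' ρ' ∧ ∃ c ∈ C ρ₁ σ', ∃ d ∈ D ρ' σ,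
      t'.IsTensorOp c d Q}, IsHomogeneous ρ₁ σ Q := by
    rintro Q ⟨σ', ρ', h', c, hc, d, hd, hQ⟩
    exact IsTensorMap.isHomogeneous (hC.homogeneous _ _ _ hc) (hD.homogeneous _ _ _ hd) h' hQ
  refine IsTensorMap.mem_clspan_right hom haa h₁ ?_ hQ haQ
  rintro Q ⟨σ', ρ', h', c, hc, d, hd, hQ⟩ V hV
  refine mem_clspan ?_
  obtain ⟨P, hP⟩ := exists_isTensorMap t t haa (hC.homogeneous _ _ _ hc) h₁
  have hPm := mem_fiberProd h₁ ha hc hP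
  obtain ⟨R, hR⟩ := exists_isTensorMap s s ((hA.fiberProd hC).homogeneous _ _ _ hPm)
    (hD.homogeneous _ _ _ hd) h'
  change U.symm.conj V ∈ fiberProd s (fiberProd t A C) D ρ σ
  rw [← associator_conj_tensor hU hP hR hQ hV, U.symm_conj_conj]
  exact mem_fiberProd h' hPm hd hR

end Associator

/-! ### Positivity of Gram matrices -/

section Gram

lemma exists_sum_star_mul_self {ι : Type*} (s : Finset ι) (b : ι → B) :
    ∃ c, ∑ i ∈ s, star (b i) * b i = star c * c := by
  let _ := CStarAlgebra.spectralOrder B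
  have := CStarAlgebra.spectralOrderedRing B
  exact CStarAlgebra.nonneg_iff_eq_star_mul_self.1
    (Finset.sum_nonneg fun i _ => star_mul_self_nonneg (b i))

/-- If `M` is self-adjoint and not positive, then `-N M N = N³ = R⋆R` for a self-adjoint element `N`
(the negative part of `M`) and some `R ≠ 0`. -/
lemma exists_of_isSelfAdjoint {A : Type*} [NonUnitalCStarAlgebra A] {M : A} (hM : star M = M) :
    ∃ N R : A, star N = N ∧ N * M * N + star R * R = 0 ∧ (R = 0 → ∃ P, M = star P * P) := by
  let _ := CStarAlgebra.spectralOrder A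
  have := CStarAlgebra.spectralOrderedRing A
  have hM : IsSelfAdjoint M := hM
  obtain ⟨Q, hQ⟩ := CStarAlgebra.nonneg_iff_eq_star_mul_self.1 (CFC.negPart_nonneg M)
  have hNM : M⁻ * M = - (M⁻ * M⁻) := by
    conv_lhs => rw [← CFC.posPart_sub_negPart M hM]
    rw [mul_sub, CFC.posPart_sub_negPart M hM, CFC.negPart_mul_posPart, zero_sub]
  have hNsa : star M⁻ = M⁻ := (IsSelfAdjoint.of_nonneg (CFC.negPart_nonneg M)).star_eq
  refine ⟨M⁻, Q * M⁻, hNsa, ?_, fun h => ?_⟩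
  · have e : star (Q * M⁻) * (Q * M⁻) = M⁻ * M⁻ * M⁻ := by
      rw [star_mul, hNsa, mul_assoc, ← mul_assoc (star Q), ← hQ, mul_assoc]
    rw [e, hNM, neg_mul, neg_add_cancel]
  · have h3 : M⁻ = 0 := by
      refine (CStarRing.star_mul_self_eq_zero_iff _).1 ?_
      rw [hNsa]
      nth_rw 1 [hQ]
      rw [mul_assoc, h, mul_zero]
    exact CStarAlgebra.nonneg_iff_eq_star_mul_self.1 ((CFC.negPart_eq_zero_iff M hM).1 h3)

lemma Bimod.ip_sum_right (E : Bimod B) {ι : Type*} (s : Finset ι) (x : E) (y : ι → E) :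
    E.ip x (∑ i ∈ s, y i) = ∑ i ∈ s, E.ip x (y i) := map_sum (E.ipL x) y s

lemma Bimod.ip_sum_left (E : Bimod B) {ι : Type*} (s : Finset ι) (x : ι → E) (y : E) :
    E.ip (∑ i ∈ s, x i) y = ∑ i ∈ s, E.ip (x i) y := map_sum (E.ipL.flip y) x s

/-- The Gram matrix `M` of a finite family in a Hilbert module has the form `P⋆P`: for self-adjoint
`N`, the diagonal entries of `N M N` are positive. -/
lemma exists_gram_eq {E : Bimod B} {ι : Type*} [Fintype ι] (ξ : ι → E) :
    ∃ P : ι → ι → B, ∀ i j, E.ip (ξ i) (ξ j) = ∑ k, star (P k i) * P k j := by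
  classical
  let _ := CStarAlgebra.spectralOrder B
  have := CStarAlgebra.spectralOrderedRing B
  let M : CStarMatrix ι ι B := CStarMatrix.ofMatrix fun i j => E.ip (ξ i) (ξ j)
  have hM : star M = M := by
    refine CStarMatrix.ext fun i j => ?_
    rw [CStarMatrix.star_apply]
    exact E.star_ip _ _
  -- compare the diagonal entries of `N M N + R⋆R = 0`
  obtain ⟨N, R, hN, h1, h2⟩ := exists_of_isSelfAdjoint hM
  have hR : R = 0 := by
    refine CStarMatrix.ext fun k i => ?_
    have h3 := CStarMatrix.ext_iff.2 h1 i i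
    rw [CStarMatrix.add_apply, CStarMatrix.mul_apply, CStarMatrix.mul_apply,
      CStarMatrix.zero_apply] at h3
    have hNs (i j : ι) : N i j = star (N j i) := by
      rw [← CStarMatrix.star_apply, hN]
    have e : ∑ j, (N * M) i j * N j i =
        E.ip (∑ j, E.rsmul (ξ j) (N j i)) (∑ j, E.rsmul (ξ j) (N j i)) := by
      rw [E.ip_sum_right]
      refine Finset.sum_congr rfl fun j _ => ?_
      rw [E.ip_rsmul, E.ip_sum_left, CStarMatrix.mul_apply]
      refine congrArg (· * N j i) (Finset.sum_congr rfl fun l _ => ?_)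
      rw [E.ip_rsmul_left, hNs i l]
      rfl
    rw [e] at h3
    obtain ⟨b, hb⟩ := E.ip_self_pos (∑ j, E.rsmul (ξ j) (N j i))
    rw [hb] at h3
    have h4 : ∑ j, star R i j * R j i = ∑ j, star (R j i) * R j i := rfl
    rw [h4] at h3
    have h5 : (0 : B) ≤ ∑ j, star (R j i) * R j i :=
      Finset.sum_nonneg fun j _ => star_mul_self_nonneg _
    have h6 : ∑ j, star (R j i) * R j i = 0 :=
      ((add_eq_zero_iff_of_nonneg (star_mul_self_nonneg b) h5).1 h3).2
    exact (CStarRing.star_mul_self_eq_zero_iff _).1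
      ((Finset.sum_eq_zero_iff_of_nonneg fun j _ => star_mul_self_nonneg _).1 h6 k
        (Finset.mem_univ k))
  obtain ⟨P, hP⟩ := h2 hR
  refine ⟨fun k i => P k i, fun i j => ?_⟩
  have := CStarMatrix.ext_iff.2 hP i j
  rw [CStarMatrix.mul_apply] at this
  exact this

end Gram

/-! ### Completions of semi-inner product modules -/

/-- A complex vector space with a `B`-valued semi-inner product and actions of `B`, whose separated
completion is a right `C⋆`-bimodule. -/
structure PreBimod (B : Type u) [NonUnitalCStarAlgebra B] (V : Type u) [AddCommGroup V]
    [Module ℂ V] where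
  ip : V →ₗ⋆[ℂ] V →ₗ[ℂ] B
  rsmul : B → V →ₗ[ℂ] V
  lsmul : B → V →ₗ[ℂ] V
  star_ip : ∀ x y, star (ip x y) = ip y x
  ip_self_pos : ∀ x, ∃ b, ip x x = star b * b
  ip_rsmul : ∀ x y b, ip x (rsmul b y) = ip x y * b
  ip_lsmul : ∀ b x y, ip x (lsmul b y) = ip (lsmul (star b) x) y
  lsmul_add : ∀ b c x, lsmul (b + c) x = lsmul b x + lsmul c x
  lsmul_smul : ∀ (w : ℂ) b x, lsmul (w • b) x = w • lsmul b x
  lsmul_mul : ∀ b c x, lsmul (b * c) x = lsmul b (lsmul c x)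
  bound : ∀ x, ∃ C, ∀ b, √‖ip (lsmul b x) (lsmul b x)‖ ≤ C * ‖b‖
  full : clspan {b | ∃ x y, b = ip x y} = Set.univ
  nondegenerate : ∀ x, ∀ ε > 0, ∃ b, √‖ip (x - lsmul b x) (x - lsmul b x)‖ < ε

namespace PreBimod

variable {V : Type u} [AddCommGroup V] [Module ℂ V] (P : PreBimod B V)

lemma ip_rsmul_left (x y : V) (b : B) : P.ip (P.rsmul b x) y = star b * P.ip x y := by
  rw [← P.star_ip, P.ip_rsmul, star_mul, P.star_ip]

/-- The Cauchy–Schwarz inequality. Since the inner product may be degenerate, `‖⟨y|y⟩‖` is first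
replaced by positive upper bounds `N`. -/
lemma norm_ip_sq_le (x y : V) : ‖P.ip y x‖ ^ 2 ≤ ‖P.ip y y‖ * ‖P.ip x x‖ := by
  let _ := CStarAlgebra.spectralOrder B
  have := CStarAlgebra.spectralOrderedRing B
  have pos : ∀ z : V, 0 ≤ P.ip z z := fun z => by
    obtain ⟨b, hb⟩ := P.ip_self_pos z
    rw [hb]
    exact star_mul_self_nonneg b
  set b := P.ip y x with hb
  have hb' : P.ip x y = star b := by rw [hb, P.star_ip]
  have key : ∀ N : ℝ, ‖P.ip y y‖ ≤ N → 0 < N → ‖b‖ ^ 2 ≤ N * ‖P.ip x x‖ := by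
    intro N hN hN0
    set t : ℝ := N⁻¹ with ht
    -- expand `0 ≤ ⟨x - y t b | x - y t b⟩` with `t = N⁻¹`
    have h0 := pos (x - (t : ℂ) • P.rsmul b y)
    have h1 : P.ip (x - (t : ℂ) • P.rsmul b y) (x - (t : ℂ) • P.rsmul b y)
        = P.ip x x - (2 * t) • (star b * b) + (t * t) • (star b * P.ip y y * b) := by
      simp only [map_sub, map_smul, LinearMap.sub_apply, LinearMap.smul_apply, map_smulₛₗ,
        P.ip_rsmul, ip_rsmul_left, hb', ← hb, Complex.conj_ofReal]
      simp only [Complex.coe_smul, ← smul_smul, two_mul, add_smul, mul_assoc, smul_sub]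
      abel
    have h2 : star b * P.ip y y * b ≤ N • (star b * b) :=
      (CStarAlgebra.star_left_conjugate_le_norm_smul (IsSelfAdjoint.of_nonneg (pos y))).trans
        (smul_le_smul_of_nonneg_right hN (star_mul_self_nonneg b))
    have ht0 : 0 ≤ t := by positivity
    have h3 : (t * t) • (star b * P.ip y y * b) ≤ t • (star b * b) := by
      refine (smul_le_smul_of_nonneg_left h2 (mul_nonneg ht0 ht0)).trans_eq ?_
      rw [smul_smul, ht]
      congr 1
      field_simp
    have h4 : t • (star b * b) ≤ P.ip x x := by
      rw [h1] at h0
      have h5 : 0 ≤ P.ip x x - (2 * t) • (star b * b) + t • (star b * b) :=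
        h0.trans (add_le_add_right h3 _)
      rw [two_mul, add_smul] at h5
      rw [← sub_nonneg]
      convert h5 using 1
      abel
    have h5 := CStarAlgebra.norm_le_norm_of_nonneg_of_le
      (smul_nonneg ht0 (star_mul_self_nonneg b)) h4
    rw [norm_smul, Real.norm_of_nonneg ht0, CStarRing.norm_star_mul_self, ← sq, ht] at h5
    rwa [inv_mul_le_iff₀ hN0] at h5
  refine ge_of_tendsto (x := 𝓝[>] (0 : ℝ)) (f := fun e => (‖P.ip y y‖ + e) * ‖P.ip x x‖) ?_ ?_
  · have : Continuous fun e : ℝ => (‖P.ip y y‖ + e) * ‖P.ip x x‖ := by fun_prop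
    have h := this.tendsto 0
    simp only [add_zero] at h
    exact h.mono_left nhdsWithin_le_nhds
  · filter_upwards [self_mem_nhdsWithin] with e he
    have he : 0 < e := he
    exact key _ (by linarith) (by positivity)

/-- The seminorm `‖⟨x|x⟩‖^(1/2)`. -/
def seminorm (x : V) : ℝ := √‖P.ip x x‖

lemma seminorm_nonneg (x : V) : 0 ≤ P.seminorm x := Real.sqrt_nonneg _

lemma seminorm_sq (x : V) : P.seminorm x ^ 2 = ‖P.ip x x‖ := Real.sq_sqrt (norm_nonneg _)

lemma norm_ip_le (x y : V) : ‖P.ip y x‖ ≤ P.seminorm y * P.seminorm x := by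
  refine abs_le_of_sq_le_sq' ?_ (mul_nonneg (P.seminorm_nonneg _) (P.seminorm_nonneg _)) |>.2
  rw [mul_pow, seminorm_sq, seminorm_sq]
  exact P.norm_ip_sq_le x y

lemma seminorm_smul (c : ℂ) (x : V) : P.seminorm (c • x) = ‖c‖ * P.seminorm x := by
  have : P.ip (c • x) (c • x) = (star c * c) • P.ip x x := by
    rw [map_smul, map_smulₛₗ, LinearMap.smul_apply, smul_smul, mul_comm]
    rfl
  rw [seminorm, this, norm_smul, CStarRing.norm_star_mul_self, ← sq, Real.sqrt_mul (by positivity),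
    Real.sqrt_sq (norm_nonneg c), seminorm]

lemma seminorm_add_le (x y : V) : P.seminorm (x + y) ≤ P.seminorm x + P.seminorm y := by
  refine abs_le_of_sq_le_sq' ?_ (add_nonneg (P.seminorm_nonneg x) (P.seminorm_nonneg y)) |>.2
  have : P.ip (x + y) (x + y) = P.ip x x + P.ip x y + (P.ip y x + P.ip y y) := by
    simp only [map_add, LinearMap.add_apply]
    abel
  rw [seminorm_sq, this]
  have h1 := norm_add_le (P.ip x x + P.ip x y) (P.ip y x + P.ip y y)
  have h2 := norm_add_le (P.ip x x) (P.ip x y)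
  have h3 := norm_add_le (P.ip y x) (P.ip y y)
  have h4 := P.norm_ip_le x y
  have h5 := P.norm_ip_le y x
  have h6 := P.seminorm_sq x
  have h7 := P.seminorm_sq y
  nlinarith

lemma seminorm_rsmul_le (b : B) (x : V) : P.seminorm (P.rsmul b x) ≤ ‖b‖ * P.seminorm x := by
  refine abs_le_of_sq_le_sq' ?_ (mul_nonneg (norm_nonneg b) (P.seminorm_nonneg x)) |>.2
  rw [seminorm_sq, P.ip_rsmul, ip_rsmul_left, mul_pow, seminorm_sq, sq ‖b‖]
  calc ‖star b * P.ip x x * b‖ ≤ ‖star b‖ * ‖P.ip x x‖ * ‖b‖ := norm_mul₃_le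
    _ = ‖b‖ * ‖b‖ * ‖P.ip x x‖ := by rw [norm_star]; ring

/-- The left action is contractive, since `‖(b⋆b)ᵏ x‖` grows at most like `‖b⋆b‖ᵏ`. -/
lemma seminorm_lsmul_le (b : B) (x : V) : P.seminorm (P.lsmul b x) ≤ ‖b‖ * P.seminorm x := by
  set c := star b * b with hc
  have hcs : star c = c := by rw [hc, star_mul, star_star]
  have hip : ∀ k : ℕ, ∀ y z, P.ip ((P.lsmul c)^[k] y) z = P.ip y ((P.lsmul c)^[k] z) := by
    intro k
    induction k with
    | zero => exact fun _ _ => rfl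
    | succ k ih =>
      intro y z
      rw [Function.iterate_succ_apply, ih, Function.iterate_succ_apply', P.ip_lsmul, hcs]
  obtain ⟨C, hC⟩ := P.bound x
  have hC0 : ∀ d, P.seminorm (P.lsmul d x) ≤ C * ‖d‖ := hC
  have hb : ∀ k, ∃ d : B, ‖d‖ ≤ ‖c‖ ^ (k + 1) ∧ (P.lsmul c)^[k + 1] x = P.lsmul d x := by
    intro k
    induction k with
    | zero => exact ⟨c, by simp, rfl⟩
    | succ k ih =>
      obtain ⟨d, hd, h⟩ := ih
      refine ⟨c * d, ?_, ?_⟩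
      · rw [pow_succ']
        exact (norm_mul_le _ _).trans (mul_le_mul_of_nonneg_left hd (norm_nonneg c))
      · rw [Function.iterate_succ_apply', h]
        exact (P.lsmul_mul c d x).symm
  have h2 := le_mul_of_sq_le (a := fun k => P.seminorm ((P.lsmul c)^[k] x)) (r := ‖c‖)
    (C := max C (P.seminorm x)) (fun k => P.seminorm_nonneg _) (fun k => by
      rw [seminorm_sq, hip, ← Function.iterate_add_apply, ← two_mul]
      exact (P.norm_ip_le _ _).trans_eq (mul_comm _ _)) (norm_nonneg c) (fun k => by
    cases k with
    | zero => simp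
    | succ k =>
      obtain ⟨d, hd, h⟩ := hb k
      rw [h]
      refine (hC0 d).trans ?_
      refine mul_le_mul (le_max_left _ _) hd (norm_nonneg _) ?_
      exact (P.seminorm_nonneg x).trans (le_max_right _ _))
  refine abs_le_of_sq_le_sq' ?_ (mul_nonneg (norm_nonneg b) (P.seminorm_nonneg x)) |>.2
  have h3 : P.ip (P.lsmul b x) (P.lsmul b x) = P.ip x (P.lsmul c x) := by
    rw [hc, P.lsmul_mul, P.ip_lsmul (star b), star_star]
  rw [seminorm_sq, h3, mul_pow, sq (P.seminorm x), sq ‖b‖, ← CStarRing.norm_star_mul_self, ← hc]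
  refine (P.norm_ip_le _ _).trans ?_
  refine (mul_le_mul_of_nonneg_left h2 (P.seminorm_nonneg x)).trans_eq ?_
  change P.seminorm x * (‖c‖ * P.seminorm x) = _
  ring

/-- The underlying vector space, equipped with the seminorm. -/
def Space (_ : PreBimod B V) : Type u := V

instance : AddCommGroup P.Space := inferInstanceAs (AddCommGroup V)

instance : Module ℂ P.Space := inferInstanceAs (Module ℂ V)

instance : Norm P.Space := ⟨P.seminorm⟩

instance : SeminormedAddCommGroup P.Space := SeminormedAddCommGroup.ofCore (𝕜 := ℂ)
  ⟨P.seminorm_nonneg, P.seminorm_smul, P.seminorm_add_le⟩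

instance : NormedSpace ℂ P.Space :=
  { (inferInstance : Module ℂ P.Space) with norm_smul_le := fun c x => (P.seminorm_smul c x).le }

/-- The semi-inner product as a bounded sesquilinear map. -/
def ipC : P.Space →L⋆[ℂ] P.Space →L[ℂ] B :=
  LinearMap.mkContinuous₂ (E := P.Space) (F := P.Space) P.ip 1
    fun x y => by
      rw [one_mul]
      exact P.norm_ip_le y x

/-- The right action as a bounded operator. -/
def rsmulC (b : B) : P.Space →L[ℂ] P.Space :=
  LinearMap.mkContinuous (E := P.Space) (F := P.Space) (P.rsmul b) ‖b‖ (P.seminorm_rsmul_le b)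

/-- The left action as a bounded operator. -/
def lsmulC (b : B) : P.Space →L[ℂ] P.Space :=
  LinearMap.mkContinuous (E := P.Space) (F := P.Space) (P.lsmul b) ‖b‖ (P.seminorm_lsmul_le b)

/-- The completion. -/
abbrev Completion : Type u := UniformSpace.Completion P.Space

/-- The canonical map into the completion, on the seminormed space. -/
def coeC : P.Space →L[ℂ] P.Completion := UniformSpace.Completion.toComplL

/-- The canonical map into the completion. -/
def coe : V →ₗ[ℂ] P.Completion := (P.coeC : P.Space →ₗ[ℂ] P.Completion)

lemma denseRange_coe : DenseRange P.coe :=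
  UniformSpace.Completion.denseRange_coe (α := P.Space)

lemma extend_coe {W : Type*} [AddCommGroup W] [UniformSpace W] [IsUniformAddGroup W] [T0Space W]
    [CompleteSpace W] [Module ℂ W] [ContinuousConstSMul ℂ W] {τ : ℂ →+* ℂ} (f : P.Space →SL[τ] W)
    (x : P.Space) : f.extend P.coeC (P.coe x) = f x :=
  ContinuousLinearMap.extend_eq f P.denseRange_coe
    (UniformSpace.Completion.isUniformInducing_coe _) x

lemma norm_coe (x : V) : ‖P.coe x‖ = P.seminorm x :=
  UniformSpace.Completion.norm_coe (E := P.Space) x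

/-- The inner product of the completion. -/
def ipHat : P.Completion →L⋆[ℂ] P.Completion →L[ℂ] B :=
  (((P.ipC.extend P.coeC).flip).extend P.coeC).flip

lemma ipHat_coe (x y : V) : P.ipHat (P.coe x) (P.coe y) = P.ip x y :=
  (congrArg (fun f : P.Completion →L⋆[ℂ] B => f (P.coe x)) (P.extend_coe _ y)).trans
    (congrArg (fun f : P.Space →L[ℂ] B => f y) (P.extend_coe P.ipC x))

/-- The right action on the completion. -/
def rsmulHat (b : B) : P.Completion →L[ℂ] P.Completion := (P.coeC ∘L P.rsmulC b).extend P.coeC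

lemma rsmulHat_coe (b : B) (x : V) : P.rsmulHat b (P.coe x) = P.coe (P.rsmul b x) :=
  P.extend_coe _ x

/-- The left action on the completion. -/
def lsmulHat (b : B) : P.Completion →L[ℂ] P.Completion := (P.coeC ∘L P.lsmulC b).extend P.coeC

lemma lsmulHat_coe (b : B) (x : V) : P.lsmulHat b (P.coe x) = P.coe (P.lsmul b x) :=
  P.extend_coe _ x

lemma ext_coe {W : Type*} [TopologicalSpace W] [T2Space W] {f g : P.Completion → W}
    (hf : Continuous f) (hg : Continuous g) (h : ∀ x : V, f (P.coe x) = g (P.coe x)) (x) :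
    f x = g x :=
  congrFun (P.denseRange_coe.equalizer hf hg (funext h)) x

lemma ext_coe₂ {W : Type*} [TopologicalSpace W] [T2Space W]
    {f g : P.Completion → P.Completion → W}
    (hf : Continuous fun p : P.Completion × P.Completion => f p.1 p.2)
    (hg : Continuous fun p : P.Completion × P.Completion => g p.1 p.2)
    (h : ∀ x y : V, f (P.coe x) (P.coe y) = g (P.coe x) (P.coe y)) (x y) : f x y = g x y :=
  congrFun ((P.denseRange_coe.prodMap P.denseRange_coe).equalizer hf hg
    (funext fun p : V × V => h p.1 p.2)) (x, y)

lemma continuous_ipHat : Continuous fun p : P.Completion × P.Completion => P.ipHat p.1 p.2 :=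
  isBoundedBilinearMap_apply.continuous.comp (P.ipHat.continuous.prodMap continuous_id)

lemma ipHat_self_pos (x : P.Completion) : ∃ b, P.ipHat x x = star b * b := by
  let _ := CStarAlgebra.spectralOrder B
  have := CStarAlgebra.spectralOrderedRing B
  refine CStarAlgebra.nonneg_iff_eq_star_mul_self.1 ?_
  refine P.denseRange_coe.induction_on (p := fun x => 0 ≤ P.ipHat x x) x ?_ fun x => ?_
  · exact CStarAlgebra.isClosed_nonneg.preimage
      (P.continuous_ipHat.comp (continuous_id.prodMk continuous_id))
  · obtain ⟨b, hb⟩ := P.ip_self_pos x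
    rw [ipHat_coe, hb]
    exact star_mul_self_nonneg b

lemma lsmulHat_add (b c : B) : P.lsmulHat (b + c) = P.lsmulHat b + P.lsmulHat c := by
  refine ContinuousLinearMap.ext (P.ext_coe (P.lsmulHat _).continuous
    (P.lsmulHat b + P.lsmulHat c).continuous fun x => ?_)
  rw [add_apply, lsmulHat_coe, lsmulHat_coe, lsmulHat_coe, P.lsmul_add, map_add]

lemma lsmulHat_smul (w : ℂ) (b : B) : P.lsmulHat (w • b) = w • P.lsmulHat b := by
  refine ContinuousLinearMap.ext (P.ext_coe (P.lsmulHat _).continuous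
    (w • P.lsmulHat b).continuous fun x => ?_)
  rw [smul_apply, lsmulHat_coe, lsmulHat_coe, P.lsmul_smul, map_smul]

lemma lsmulHat_mul (b c : B) : P.lsmulHat (b * c) = P.lsmulHat b ∘L P.lsmulHat c := by
  refine ContinuousLinearMap.ext (P.ext_coe (P.lsmulHat _).continuous
    (P.lsmulHat b ∘L P.lsmulHat c).continuous fun x => ?_)
  rw [ContinuousLinearMap.comp_apply, lsmulHat_coe, lsmulHat_coe, lsmulHat_coe, P.lsmul_mul]

lemma clspan_lsmulHat : clspan {x | ∃ b y, x = P.lsmulHat b y} = Set.univ := by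
  refine Set.eq_univ_of_forall fun x => ?_
  refine P.denseRange_coe.induction_on x (isClosed_clspan _) fun x => ?_
  refine closure_minimal (subset_refl _) (isClosed_clspan _)
    (Metric.mem_closure_iff.2 fun ε hε => ?_)
  obtain ⟨b, hb⟩ := P.nondegenerate x ε hε
  refine ⟨_, mem_clspan ⟨b, P.coe x, rfl⟩, ?_⟩
  rw [lsmulHat_coe, dist_eq_norm, ← map_sub, norm_coe]
  exact hb

/-- The right `C⋆`-bimodule obtained by completion. -/
def bimod : Bimod B where
  carrier := P.Completion
  ip x y := P.ipHat x y
  rsmul x b := P.rsmulHat b x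
  lsmul b x := P.lsmulHat b x
  ip_add_right x y z := map_add (P.ipHat x) y z
  ip_smul_right w x y := map_smul (P.ipHat x) w y
  star_ip := by
    refine P.ext_coe₂ P.continuous_ipHat.star (P.continuous_ipHat.comp continuous_swap)
      fun x y => ?_
    rw [ipHat_coe, ipHat_coe, P.star_ip]
  ip_self_pos := P.ipHat_self_pos
  norm_sq := by
    refine P.ext_coe (continuous_norm.pow 2) (P.continuous_ipHat.comp
      (continuous_id.prodMk continuous_id)).norm fun x => ?_
    change ‖P.coe x‖ ^ 2 = ‖P.ipHat (P.coe x) (P.coe x)‖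
    rw [norm_coe, ipHat_coe, seminorm_sq]
  ip_rsmul x y b := by
    revert x y
    refine P.ext_coe₂ ?_ ?_ fun x y => ?_
    · exact P.continuous_ipHat.comp
        (continuous_fst.prodMk ((P.rsmulHat b).continuous.comp continuous_snd))
    · exact P.continuous_ipHat.mul continuous_const
    · rw [rsmulHat_coe, ipHat_coe, ipHat_coe, P.ip_rsmul]
  full := by
    refine clspan_eq_univ_of_subset P.full ?_
    rintro _ ⟨x, y, rfl⟩
    exact mem_clspan ⟨P.coe x, P.coe y, (P.ipHat_coe x y).symm⟩
  lsmul_add b c x := by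
    rw [P.lsmulHat_add]
    rfl
  lsmul_smul w b x := by
    rw [P.lsmulHat_smul]
    rfl
  lsmul_mul b c x := by
    rw [P.lsmulHat_mul]
    rfl
  ip_lsmul b := by
    refine P.ext_coe₂ ?_ ?_ fun x y => ?_
    · exact P.continuous_ipHat.comp
        (continuous_fst.prodMk ((P.lsmulHat b).continuous.comp continuous_snd))
    · exact P.continuous_ipHat.comp
        (((P.lsmulHat (star b)).continuous.comp continuous_fst).prodMk continuous_snd)
    · rw [lsmulHat_coe, lsmulHat_coe, ipHat_coe, ipHat_coe, P.ip_lsmul]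
  nondegenerate := P.clspan_lsmulHat

end PreBimod

/-! ### Existence of internal tensor products -/

section InternalTensorExistence

open scoped TensorProduct

variable (E F : Bimod B)

/-- The semi-inner product `⟨ξ ⊗ η|ξ' ⊗ η'⟩ = ⟨η|⟨ξ|ξ'⟩η'⟩` on the algebraic tensor product. -/
def tensorIp : E ⊗[ℂ] F →ₗ⋆[ℂ] E ⊗[ℂ] F →ₗ[ℂ] B :=
  TensorProduct.lift (LinearMap.mk₂'ₛₗ (starRingEnd ℂ) (starRingEnd ℂ)
    (fun ξ η => TensorProduct.lift (LinearMap.mk₂ ℂ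
      (fun ξ' η' => F.ipL η (F.lm (E.ipL ξ ξ') η')) (by simp) (by simp) (by simp) (by simp)))
    (fun ξ ξ' η => TensorProduct.ext' fun _ _ => by simp)
    (fun w ξ η => TensorProduct.ext' fun _ _ => by simp)
    (fun ξ η η' => TensorProduct.ext' fun _ _ => by simp)
    (fun w ξ η => TensorProduct.ext' fun _ _ => by simp))

variable {E F}

lemma tensorIp_tmul (ξ ξ' : E) (η η' : F) :
    tensorIp E F (ξ ⊗ₜ η) (ξ' ⊗ₜ η') = F.ip η (F.lsmul (E.ip ξ ξ') η') := rfl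

lemma star_tensorIp (x y : E ⊗[ℂ] F) : star (tensorIp E F x y) = tensorIp E F y x := by
  induction x with
  | zero => simp
  | add x x' hx hx' => simp only [map_add, LinearMap.add_apply, star_add, hx, hx']
  | tmul ξ η =>
    induction y with
    | zero => simp
    | add y y' hy hy' => simp only [map_add, LinearMap.add_apply, star_add, hy, hy']
    | tmul ξ' η' =>
      rw [tensorIp_tmul, tensorIp_tmul, F.star_ip, F.ip_lsmul, E.star_ip]

/-- The semi-inner product is positive, by the factorization of the Gram matrix of the first
tensor factors. -/
lemma tensorIp_self_pos (x : E ⊗[ℂ] F) : ∃ b, tensorIp E F x x = star b * b := by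
  classical
  obtain ⟨S, rfl⟩ := TensorProduct.exists_finset x
  obtain ⟨P, hP⟩ := exists_gram_eq fun i : S => i.1.1
  have e : tensorIp E F (∑ i ∈ S, i.1 ⊗ₜ[ℂ] i.2) (∑ i ∈ S, i.1 ⊗ₜ[ℂ] i.2) =
      ∑ k : S, F.ip (∑ i : S, F.lsmul (P k i) i.1.2) (∑ j : S, F.lsmul (P k j) j.1.2) := by
    rw [← Finset.sum_coe_sort]
    simp only [map_sum, LinearMap.sum_apply, tensorIp_tmul, F.ip_sum_left, F.ip_sum_right]
    rw [Finset.sum_comm]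
    refine (Finset.sum_congr rfl fun i _ => Finset.sum_congr rfl fun j _ => ?_).trans
      ((Finset.sum_congr rfl fun i _ => Finset.sum_comm).trans Finset.sum_comm)
    rw [hP, ← F.lm_apply, map_sum, sum_apply, F.ip_sum_right]
    refine Finset.sum_congr rfl fun k _ => ?_
    rw [F.lm_apply, F.lsmul_mul, F.ip_lsmul, star_star]
  rw [e]
  choose b hb using fun k : S => F.ip_self_pos (∑ i : S, F.lsmul (P k i) i.1.2)
  simp only [hb]
  exact exists_sum_star_mul_self _ b

/-- The projective estimate for the seminorm of the algebraic tensor product. -/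
lemma norm_tensorIp_sum_le {ι : Type*} (S : Finset ι) (ξ : ι → E) (η : ι → F) :
    √‖tensorIp E F (∑ i ∈ S, ξ i ⊗ₜ η i) (∑ i ∈ S, ξ i ⊗ₜ η i)‖ ≤ ∑ i ∈ S, ‖ξ i‖ * ‖η i‖ := by
  refine Real.sqrt_le_iff.2 ⟨Finset.sum_nonneg fun i _ => by positivity, ?_⟩
  rw [sq, Finset.sum_mul_sum]
  simp only [map_sum, LinearMap.sum_apply]
  refine (norm_sum_le _ _).trans ?_
  rw [Finset.sum_comm]
  refine Finset.sum_le_sum fun i _ => (norm_sum_le _ _).trans (Finset.sum_le_sum fun j _ => ?_)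
  rw [tensorIp_tmul]
  calc ‖F.ip (η j) (F.lsmul (E.ip (ξ j) (ξ i)) (η i))‖
      ≤ ‖η j‖ * ‖F.lsmul (E.ip (ξ j) (ξ i)) (η i)‖ := F.norm_ip_le _ _
    _ ≤ ‖η j‖ * (‖ξ j‖ * ‖ξ i‖ * ‖η i‖) := by
        gcongr
        exact (F.norm_lsmul_le _ _).trans (by gcongr; exact E.norm_ip_le _ _)
    _ = ‖ξ j‖ * ‖η j‖ * (‖ξ i‖ * ‖η i‖) := by ring

lemma lsmul_tensor_sum (b : B) {ι : Type*} (S : Finset ι) (ξ : ι → E) (η : ι → F) :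
    (E.lm b : E →ₗ[ℂ] E).rTensor F (∑ i ∈ S, ξ i ⊗ₜ η i) = ∑ i ∈ S, E.lsmul b (ξ i) ⊗ₜ η i := by
  rw [map_sum]
  rfl

variable (E F) in
/-- The algebraic tensor product with the semi-inner product and the actions of `B`. -/
def tensorPreBimod : PreBimod B (E ⊗[ℂ] F) where
  ip := tensorIp E F
  rsmul b := (F.rm b : F →ₗ[ℂ] F).lTensor E
  lsmul b := (E.lm b : E →ₗ[ℂ] E).rTensor F
  star_ip := star_tensorIp
  ip_self_pos := tensorIp_self_pos
  ip_rsmul x y b := by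
    induction x with
    | zero => simp
    | add x x' hx hx' => simp only [map_add, LinearMap.add_apply, hx, hx', add_mul]
    | tmul ξ η =>
      induction y with
      | zero => simp
      | add y y' hy hy' => simp only [map_add, hy, hy', add_mul]
      | tmul ξ' η' =>
        change F.ip η (F.lsmul (E.ip ξ ξ') (F.rsmul η' b)) =
          F.ip η (F.lsmul (E.ip ξ ξ') η') * b
        rw [F.lsmul_rsmul, F.ip_rsmul]
  ip_lsmul b x y := by
    induction x with
    | zero => simp
    | add x x' hx hx' => simp only [map_add, LinearMap.add_apply, hx, hx']
    | tmul ξ η =>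
      induction y with
      | zero => simp
      | add y y' hy hy' => simp only [map_add, hy, hy']
      | tmul ξ' η' =>
        change F.ip η (F.lsmul (E.ip ξ (E.lsmul b ξ')) η') =
          F.ip η (F.lsmul (E.ip (E.lsmul (star b) ξ) ξ') η')
        rw [E.ip_lsmul]
  lsmul_add b c x := by
    rw [map_add, ContinuousLinearMap.toLinearMap_add, LinearMap.rTensor_add, LinearMap.add_apply]
  lsmul_smul w b x := by
    rw [map_smul, ContinuousLinearMap.toLinearMap_smul, LinearMap.rTensor_smul,
      LinearMap.smul_apply]
  lsmul_mul b c x := by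
    rw [← LinearMap.rTensor_comp_apply]
    congr 2
    exact LinearMap.ext fun ξ => E.lsmul_mul b c ξ
  bound x := by
    obtain ⟨S, rfl⟩ := TensorProduct.exists_finset x
    refine ⟨∑ i ∈ S, ‖i.1‖ * ‖i.2‖, fun b => ?_⟩
    rw [lsmul_tensor_sum, Finset.sum_mul]
    refine (norm_tensorIp_sum_le S _ _).trans (Finset.sum_le_sum fun i _ => ?_)
    calc ‖E.lsmul b i.1‖ * ‖i.2‖ ≤ ‖b‖ * ‖i.1‖ * ‖i.2‖ := by
          gcongr
          exact E.norm_lsmul_le _ _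
      _ = ‖i.1‖ * ‖i.2‖ * ‖b‖ := by ring
  full := by
    refine clspan_eq_univ_of_subset F.full ?_
    rintro _ ⟨η, η', rfl⟩
    refine map_mem_clspan (F.ipL η) ?_
      (F.nondegenerate.symm ▸ trivial : η' ∈ clspan {x | ∃ b y, x = F.lsmul b y})
    rintro _ ⟨b, y, rfl⟩
    refine map_mem_clspan (F.ipL η ∘L F.lm.flip y) ?_
      (E.full.symm ▸ trivial : b ∈ clspan {b | ∃ x y, b = E.ip x y})
    rintro _ ⟨ξ, ξ', rfl⟩
    exact mem_clspan ⟨ξ ⊗ₜ η, ξ' ⊗ₜ y, rfl⟩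
  nondegenerate x ε hε := by
    obtain ⟨S, rfl⟩ := TensorProduct.exists_finset x
    obtain ⟨l, hl, hl1, hl2⟩ := PAut.exists_approximateUnit (1 : PAut B)
    have h1 : Tendsto (fun b => ∑ i ∈ S, ‖i.1 - E.lsmul b i.1‖ * ‖i.2‖) l (𝓝 0) := by
      have h0 : ∀ i ∈ S, Tendsto (fun b => ‖i.1 - E.lsmul b i.1‖ * ‖i.2‖) l (𝓝 0) := fun i _ => by
        have := tendsto_iff_norm_sub_tendsto_zero.1
          (Bimod.tendsto_lsmul_of_mem_lspan hl1 hl2 (E.mem_lspan_one i.1))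
        simpa only [norm_sub_rev, zero_mul] using this.mul_const ‖i.2‖
      simpa using tendsto_finsetSum S h0
    obtain ⟨b, hb⟩ := (h1.eventually (gt_mem_nhds hε)).exists
    refine ⟨b, lt_of_le_of_lt ?_ hb⟩
    have e : ∑ i ∈ S, i.1 ⊗ₜ[ℂ] i.2 - ∑ i ∈ S, E.lsmul b i.1 ⊗ₜ[ℂ] i.2 =
        ∑ i ∈ S, (i.1 - E.lsmul b i.1) ⊗ₜ[ℂ] i.2 := by
      simp only [TensorProduct.sub_tmul, Finset.sum_sub_distrib]
    rw [lsmul_tensor_sum, e]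
    exact norm_tensorIp_sum_le S _ _

/-- Internal tensor products exist. -/
lemma nonempty_internalTensor (E F : Bimod B) : Nonempty (InternalTensor E F) :=
  let P := tensorPreBimod E F
  ⟨{ obj := P.bimod
     tmul := fun ξ η => P.coe (ξ ⊗ₜ η)
     ip_tmul := fun ξ η ξ' η' => P.ipHat_coe _ _
     rsmul_tmul := fun ξ η b => P.rsmulHat_coe _ _
     lsmul_tmul := fun ξ η b => P.lsmulHat_coe _ _
     dense := by
      refine Set.eq_univ_of_forall fun x => ?_
      refine P.denseRange_coe.induction_on x (isClosed_clspan _) fun x => ?_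
      obtain ⟨S, rfl⟩ := TensorProduct.exists_finset x
      rw [map_sum]
      refine (Submodule.span ℂ _).topologicalClosure.sum_mem fun i _ => ?_
      exact mem_clspan ⟨i.1, i.2, rfl⟩ }⟩

end InternalTensorExistence

/-! ### The monoidal structure -/

/-- The continuous linear map underlying a unitary bimodule isomorphism. -/
abbrev BimodUnitary.toCLM {E F : Bimod B} (U : BimodUnitary E F) : E →L[ℂ] F := U.equiv

lemma BimodUnitary.jointlyDense {E F : Bimod B} (U : BimodUnitary E F) :
    JointlyDense fun _ : Unit => U.toCLM :=
  JointlyDense.of_surjective fun y => ⟨_, U.equiv.apply_symm_apply y⟩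

section Monoidal

variable {Θ : Set (PAut B)} {ten : ∀ E F : Bimod B, InternalTensor E F}
  (hp : FiberProdAdmissible Θ ten) (hu : AdmissibleFam Θ (unitFam Θ))
  (hΘ : AdmissibleSemigroup Θ)

/-- The unitary `(E ⊗ F) ⊗ G → E ⊗ (F ⊗ G)`. -/
def associatorU (ten : ∀ E F : Bimod B, InternalTensor E F) (E F G : Bimod B) :
    BimodUnitary (ten (ten E F).obj G).obj (ten E (ten F G).obj).obj :=
  (exists_associator (ten E F) (ten (ten E F).obj G) (ten F G) (ten E (ten F G).obj)).choose

lemma associatorU_tmul (E F G : Bimod B) (ξ : E) (η : F) (ζ : G) :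
    (associatorU ten E F G).equiv ((ten _ G).tmul ((ten E F).tmul ξ η) ζ) =
      (ten E _).tmul ξ ((ten F G).tmul η ζ) :=
  (exists_associator (ten E F) (ten (ten E F).obj G) (ten F G)
    (ten E (ten F G).obj)).choose_spec ξ η ζ

/-- The unitary `B ⊗ E → E`. -/
def leftUnitorU (ten : ∀ E F : Bimod B, InternalTensor E F) (E : Bimod B) :
    BimodUnitary (ten (Bimod.self B) E).obj E := (exists_leftUnitor _).choose

lemma leftUnitorU_tmul (E : Bimod B) (b : B) (ξ : E) :
    (leftUnitorU ten E).equiv ((ten (Bimod.self B) E).tmul b ξ) = E.lsmul b ξ :=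
  (exists_leftUnitor (ten (Bimod.self B) E)).choose_spec b ξ

/-- The unitary `E ⊗ B → E`. -/
def rightUnitorU (ten : ∀ E F : Bimod B, InternalTensor E F) (E : Bimod B) :
    BimodUnitary (ten E (Bimod.self B)).obj E := (exists_rightUnitor _).choose

lemma rightUnitorU_tmul (E : Bimod B) (ξ : E) (b : B) :
    (rightUnitorU ten E).equiv ((ten E (Bimod.self B)).tmul ξ b) = E.rsmul ξ b :=
  (exists_rightUnitor (ten E (Bimod.self B))).choose_spec ξ b

lemma associatorU_conj_mem (A C D : AdmFam Θ) (ρ σ : PAut B) (c)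
    (h : c ∈ (prodObj hp (prodObj hp A C) D).fam ρ σ) :
    (associatorU ten A.E C.E D.E).conj c ∈ (prodObj hp A (prodObj hp C D)).fam ρ σ :=
  associator_conj_mem A.isStarAlgFam C.isStarAlgFam D.isStarAlgFam (associatorU_tmul _ _ _) h

lemma associatorU_symm_conj_mem (A C D : AdmFam Θ) (ρ σ : PAut B) (c)
    (h : c ∈ (prodObj hp A (prodObj hp C D)).fam ρ σ) :
    (associatorU ten A.E C.E D.E).symm.conj c ∈ (prodObj hp (prodObj hp A C) D).fam ρ σ :=
  associator_symm_conj_mem A.isStarAlgFam C.isStarAlgFam D.isStarAlgFam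
    (associatorU_tmul _ _ _) h

/-- The associator `(𝒜 ⊗ 𝒞) ⊗ 𝒟 → 𝒜 ⊗ (𝒞 ⊗ 𝒟)`. -/
def associatorIso (A C D : AdmFam Θ) :
    (categoryData Θ).Isom (prodObj hp (prodObj hp A C) D) (prodObj hp A (prodObj hp C D)) :=
  conjIso (C := prodObj hp (prodObj hp A C) D) (D := prodObj hp A (prodObj hp C D))
    (associatorU ten A.E C.E D.E) (associatorU_conj_mem hp A C D)
    (associatorU_symm_conj_mem hp A C D)

lemma associatorIso_isConj (A C D : AdmFam Θ) :
    (CategoryData.Isom.mor (associatorIso hp A C D)).IsConj (associatorU ten A.E C.E D.E) :=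
  isConj_conj (C := prodObj hp (prodObj hp A C) D) (D := prodObj hp A (prodObj hp C D)) _
    (associatorU_conj_mem hp A C D) (associatorU_symm_conj_mem hp A C D)

lemma associatorIso_intertwiner (A C D : AdmFam Θ) :
    (associatorU ten A.E C.E D.E).toCLM ∈
      intertwiners (CategoryData.Isom.mor (associatorIso hp A C D)).map :=
  Mor.conj_intertwiner (C := prodObj hp (prodObj hp A C) D) (D := prodObj hp A (prodObj hp C D)) _
    (associatorU_conj_mem hp A C D) (associatorU_symm_conj_mem hp A C D)

lemma leftUnitorU_conj_mem (C : AdmFam Θ) (ρ σ : PAut B) (c)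
    (h : c ∈ (prodObj hp (unitObj Θ hu) C).fam ρ σ) :
    (leftUnitorU ten C.E).conj c ∈ C.fam ρ σ :=
  leftUnitor_conj_mem C.admissible (leftUnitorU_tmul _) h

lemma leftUnitorU_symm_conj_mem (hΘ : AdmissibleSemigroup Θ) (C : AdmFam Θ) (ρ σ : PAut B) (c)
    (h : c ∈ C.fam ρ σ) :
    (leftUnitorU ten C.E).symm.conj c ∈ (prodObj hp (unitObj Θ hu) C).fam ρ σ :=
  leftUnitor_symm_conj_mem hΘ C.admissible (leftUnitorU_tmul _) h

/-- The isomorphism `𝒦(B;Θ) ⊗ 𝒞 → 𝒞`. -/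
def leftUnitorIso (C : AdmFam Θ) :
    (categoryData Θ).Isom (prodObj hp (unitObj Θ hu) C) C :=
  conjIso (C := prodObj hp (unitObj Θ hu) C) (D := C)
    (leftUnitorU ten C.E) (leftUnitorU_conj_mem hp hu C) (leftUnitorU_symm_conj_mem hp hu hΘ C)

lemma leftUnitorIso_isConj (C : AdmFam Θ) :
    (CategoryData.Isom.mor (leftUnitorIso hp hu hΘ C)).IsConj (leftUnitorU ten C.E) :=
  isConj_conj (C := prodObj hp (unitObj Θ hu) C) (D := C) _
    (leftUnitorU_conj_mem hp hu C) (leftUnitorU_symm_conj_mem hp hu hΘ C)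

lemma leftUnitorIso_intertwiner (C : AdmFam Θ) :
    (leftUnitorU ten C.E).toCLM ∈
      intertwiners (CategoryData.Isom.mor (leftUnitorIso hp hu hΘ C)).map :=
  Mor.conj_intertwiner (C := prodObj hp (unitObj Θ hu) C) (D := C) _
    (leftUnitorU_conj_mem hp hu C) (leftUnitorU_symm_conj_mem hp hu hΘ C)

lemma rightUnitorU_conj_mem (C : AdmFam Θ) (ρ σ : PAut B) (c)
    (h : c ∈ (prodObj hp C (unitObj Θ hu)).fam ρ σ) :
    (rightUnitorU ten C.E).conj c ∈ C.fam ρ σ :=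
  rightUnitor_conj_mem C.admissible (rightUnitorU_tmul _) h

lemma rightUnitorU_symm_conj_mem (hΘ : AdmissibleSemigroup Θ) (C : AdmFam Θ) (ρ σ : PAut B) (c)
    (h : c ∈ C.fam ρ σ) :
    (rightUnitorU ten C.E).symm.conj c ∈ (prodObj hp C (unitObj Θ hu)).fam ρ σ :=
  rightUnitor_symm_conj_mem hΘ C.admissible (rightUnitorU_tmul _) h

/-- The isomorphism `𝒞 ⊗ 𝒦(B;Θ) → 𝒞`. -/
def rightUnitorIso (C : AdmFam Θ) :
    (categoryData Θ).Isom (prodObj hp C (unitObj Θ hu)) C :=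
  conjIso (C := prodObj hp C (unitObj Θ hu)) (D := C)
    (rightUnitorU ten C.E) (rightUnitorU_conj_mem hp hu C) (rightUnitorU_symm_conj_mem hp hu hΘ C)

lemma rightUnitorIso_isConj (C : AdmFam Θ) :
    (CategoryData.Isom.mor (rightUnitorIso hp hu hΘ C)).IsConj (rightUnitorU ten C.E) :=
  isConj_conj (C := prodObj hp C (unitObj Θ hu)) (D := C) _
    (rightUnitorU_conj_mem hp hu C) (rightUnitorU_symm_conj_mem hp hu hΘ C)

lemma rightUnitorIso_intertwiner (C : AdmFam Θ) :
    (rightUnitorU ten C.E).toCLM ∈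
      intertwiners (CategoryData.Isom.mor (rightUnitorIso hp hu hΘ C)).map :=
  Mor.conj_intertwiner (C := prodObj hp C (unitObj Θ hu)) (D := C) _
    (rightUnitorU_conj_mem hp hu C) (rightUnitorU_symm_conj_mem hp hu hΘ C)

/-- The tensor product of families with its associators and unitors. -/
def monoidalData : MonoidalData (categoryData Θ) ten hu hp where
  tensorHom := tensorMor hp
  tensorHom_spec := tensorMor_spec hp
  associator := associatorIso hp
  associator_spec A C D :=
    ⟨associatorU ten A.E C.E D.E, associatorU_tmul _ _ _, associatorIso_isConj hp A C D⟩
  leftUnitor := leftUnitorIso hp hu hΘ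
  leftUnitor_spec C :=
    ⟨leftUnitorU ten C.E, leftUnitorU_tmul _, leftUnitorIso_isConj hp hu hΘ C⟩
  rightUnitor := rightUnitorIso hp hu hΘ
  rightUnitor_spec C :=
    ⟨rightUnitorU ten C.E, rightUnitorU_tmul _, rightUnitorIso_isConj hp hu hΘ C⟩

/-! ### The axioms of a monoidal category -/

/-- Intertwiners of two morphisms have a tensor product. -/
lemma exists_tensor_of_intertwiners {A A' C C' : AdmFam Θ} (t : InternalTensor A.E C.E)
    (t' : InternalTensor A'.E C'.E) {φ : Mor A A'} {ψ : Mor C C'} {T : A.E →L[ℂ] A'.E}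
    {T' : C.E →L[ℂ] C'.E} (h : T ∈ intertwiners φ.map) (h' : T' ∈ intertwiners ψ.map) :
    ∃ V, IsTensorMap t t' T T' V := by
  obtain ⟨S, hS⟩ := mem_intertwiners.1 h
  obtain ⟨S', hS'⟩ := mem_intertwiners.1 h'
  obtain ⟨V, W, hV, -, -⟩ := IsBimodMap.exists_tensor t t' hS.1 hS'.1
  exact ⟨V, hV⟩

lemma jointlyDense_id (E : Bimod B) :
    JointlyDense fun _ : Unit => ContinuousLinearMap.id ℂ E :=
  JointlyDense.of_surjective fun x => ⟨x, rfl⟩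

/-- The identity operator intertwines both morphisms. -/
lemma tensorMor_id (A C : AdmFam Θ) :
    tensorMor hp (Mor.id A) (Mor.id C) = Mor.id (prodObj hp A C) :=
  Mor.ext_of_intertwiners (jointlyDense_id (prodObj hp A C).E)
    (fun _ => tensorMor_intertwiner hp _ _ (Mor.id_intertwiner A) (Mor.id_intertwiner C)
      fun _ _ => rfl) fun _ => Mor.id_intertwiner _

/-- Both morphisms are determined by the intertwiners `T'T ⊗ S'S = (T' ⊗ S')(T ⊗ S)`. -/
lemma tensorMor_comp {A A' A'' C C' C'' : AdmFam Θ} (φ : Mor A A') (ψ : Mor C C')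
    (φ' : Mor A' A'') (ψ' : Mor C' C'') :
    (tensorMor hp φ ψ).comp (tensorMor hp φ' ψ') = tensorMor hp (φ.comp φ') (ψ.comp ψ') := by
  obtain ⟨V, hV, hd⟩ := exists_jointlyDense_tensor (ten A.E C.E) (ten A'.E C'.E) φ ψ
  obtain ⟨V', hV', hd'⟩ := exists_jointlyDense_tensor (ten A'.E C'.E) (ten A''.E C''.E) φ' ψ'
  exact Mor.ext_of_intertwiners (C := prodObj hp A C) (D := prodObj hp A'' C'') (hd.comp hd')
    (fun i => Mor.comp_intertwiner' (C := prodObj hp A C) (D := prodObj hp A' C') _ _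
      (tensorMor_intertwiner hp φ ψ i.1.1.2 i.1.2.2 (hV i.1))
      (tensorMor_intertwiner hp φ' ψ' i.2.1.2 i.2.2.2 (hV' i.2)))
    fun i => tensorMor_intertwiner hp _ _ (Mor.comp_intertwiner' φ φ' i.1.1.2 i.2.1.2)
      (Mor.comp_intertwiner' ψ ψ' i.1.2.2 i.2.2.2) (IsTensorMap.comp (hV' i.2) (hV i.1))

/-- Naturality of the associators, since `U ((T ⊗ T') ⊗ T'') = (T ⊗ (T' ⊗ T'')) U`. -/
lemma associator_naturality {A A' C C' D D' : AdmFam Θ} (φ : Mor A A') (ψ : Mor C C')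
    (χ : Mor D D') :
    (tensorMor hp (tensorMor hp φ ψ) χ).comp (CategoryData.Isom.mor (associatorIso hp A' C' D')) =
      (CategoryData.Isom.mor (associatorIso hp A C D)).comp
        (tensorMor hp φ (tensorMor hp ψ χ)) := by
  obtain ⟨V, hV, hd⟩ := exists_jointlyDense_tensor (ten A.E C.E) (ten A'.E C'.E) φ ψ
  have hV1 := fun i => tensorMor_intertwiner hp φ ψ i.1.2 i.2.2 (hV i)
  choose W hW using fun i : (intertwiners φ.map × intertwiners ψ.map) × intertwiners χ.map =>
    exists_tensor_of_intertwiners (A := prodObj hp A C) (A' := prodObj hp A' C')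
      (ten (ten A.E C.E).obj D.E) (ten (ten A'.E C'.E).obj D'.E) (hV1 i.1) i.2.2
  have hW1 := fun i => tensorMor_intertwiner hp (tensorMor hp φ ψ) χ (hV1 i.1) i.2.2 (hW i)
  have hWd : JointlyDense W := JointlyDense.tensor hd χ.jointlyDense hW
  refine Mor.ext_of_intertwiners (C := prodObj hp (prodObj hp A C) D)
    (D := prodObj hp A' (prodObj hp C' D')) (hWd.comp (associatorU ten A'.E C'.E D'.E).jointlyDense)
    (fun i => Mor.comp_intertwiner' _ _ (hW1 i.1) (associatorIso_intertwiner hp A' C' D'))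
    fun i => ?_
  obtain ⟨X, hX⟩ := exists_tensor_of_intertwiners (ten C.E D.E) (ten C'.E D'.E)
    i.1.1.2.2 i.1.2.2
  have hX1 := tensorMor_intertwiner hp ψ χ i.1.1.2.2 i.1.2.2 hX
  obtain ⟨Y, hY⟩ := exists_tensor_of_intertwiners (C := prodObj hp C D) (C' := prodObj hp C' D')
    (ten A.E (ten C.E D.E).obj) (ten A'.E (ten C'.E D'.E).obj) i.1.1.1.2 hX1
  have hY1 := tensorMor_intertwiner hp φ (tensorMor hp ψ χ) i.1.1.1.2 hX1 hY
  have e : (associatorU ten A'.E C'.E D'.E).toCLM ∘L W i.1 =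
      Y ∘L (associatorU ten A.E C.E D.E).toCLM :=
    ext_of_clspan (clspan_range_assoc (ten A.E C.E) (ten (ten A.E C.E).obj D.E)) (by
      rintro _ ⟨⟨⟨ξ, η⟩, ζ⟩, rfl⟩
      change (associatorU ten A'.E C'.E D'.E).equiv (W i.1
          ((ten _ _).tmul ((ten _ _).tmul ξ η) ζ)) =
        Y ((associatorU ten A.E C.E D.E).equiv ((ten _ _).tmul ((ten _ _).tmul ξ η) ζ))
      rw [hW, hV, associatorU_tmul, associatorU_tmul, hY, hX])
  rw [e]
  exact Mor.comp_intertwiner' _ _ (associatorIso_intertwiner hp A C D) hY1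

end Monoidal

section Coherence

variable {Θ : Set (PAut B)} {ten : ∀ E F : Bimod B, InternalTensor E F}
  (hp : FiberProdAdmissible Θ ten) (hu : AdmissibleFam Θ (unitFam Θ))
  (hΘ : AdmissibleSemigroup Θ)

/-- Naturality of the left unitors, since intertwiners commute with the left action of `B`. -/
lemma leftUnitor_naturality {C D : AdmFam Θ} (φ : Mor C D) :
    (tensorMor hp (Mor.id (unitObj Θ hu)) φ).comp
        (CategoryData.Isom.mor (leftUnitorIso hp hu hΘ D)) =
      (CategoryData.Isom.mor (leftUnitorIso hp hu hΘ C)).comp φ := by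
  choose V hV using fun i : Unit × intertwiners φ.map =>
    exists_tensor_of_intertwiners (A := unitObj Θ hu) (A' := unitObj Θ hu)
      (ten (Bimod.self B) C.E) (ten (Bimod.self B) D.E) (Mor.id_intertwiner (unitObj Θ hu)) i.2.2
  have hd : JointlyDense V :=
    JointlyDense.tensor (jointlyDense_id (Bimod.self B)) φ.jointlyDense hV
  refine Mor.ext_of_intertwiners (C := prodObj hp (unitObj Θ hu) C) (D := D)
    (hd.comp (leftUnitorU ten D.E).jointlyDense)
    (fun i => Mor.comp_intertwiner' (C := prodObj hp (unitObj Θ hu) C)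
      (D := prodObj hp (unitObj Θ hu) D) _ _
      (tensorMor_intertwiner hp (Mor.id (unitObj Θ hu)) φ (Mor.id_intertwiner (unitObj Θ hu))
        i.1.2.2 (hV i.1))
      (leftUnitorIso_intertwiner hp hu hΘ D)) fun i => ?_
  have e : (leftUnitorU ten D.E).toCLM ∘L V i.1 = i.1.2.1 ∘L (leftUnitorU ten C.E).toCLM :=
    ext_of_clspan (ten (Bimod.self B) C.E).clspan_range (by
      rintro _ ⟨⟨b, ξ⟩, rfl⟩
      change (leftUnitorU ten D.E).equiv (V i.1 ((ten (Bimod.self B) C.E).tmul b ξ)) =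
        i.1.2.1 ((leftUnitorU ten C.E).equiv ((ten (Bimod.self B) C.E).tmul b ξ))
      rw [hV, leftUnitorU_tmul]
      obtain ⟨S, hS⟩ := mem_intertwiners.1 i.1.2.2
      exact (hS.1.map_lsmul b ξ).symm.trans (congrArg i.1.2.1 (leftUnitorU_tmul C.E b ξ).symm))
  rw [e]
  exact Mor.comp_intertwiner' (C := prodObj hp (unitObj Θ hu) C) (D := C) _ _
    (leftUnitorIso_intertwiner hp hu hΘ C) i.1.2.2

/-- Naturality of the right unitors, since intertwiners commute with the right action of `B`. -/
lemma rightUnitor_naturality {C D : AdmFam Θ} (φ : Mor C D) :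
    (tensorMor hp φ (Mor.id (unitObj Θ hu))).comp
        (CategoryData.Isom.mor (rightUnitorIso hp hu hΘ D)) =
      (CategoryData.Isom.mor (rightUnitorIso hp hu hΘ C)).comp φ := by
  choose V hV using fun i : intertwiners φ.map × Unit =>
    exists_tensor_of_intertwiners (C := unitObj Θ hu) (C' := unitObj Θ hu)
      (ten C.E (Bimod.self B)) (ten D.E (Bimod.self B)) i.1.2 (Mor.id_intertwiner (unitObj Θ hu))
  have hd : JointlyDense V :=
    JointlyDense.tensor φ.jointlyDense (jointlyDense_id (Bimod.self B)) hV
  refine Mor.ext_of_intertwiners (C := prodObj hp C (unitObj Θ hu)) (D := D)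
    (hd.comp (rightUnitorU ten D.E).jointlyDense)
    (fun i => Mor.comp_intertwiner' (C := prodObj hp C (unitObj Θ hu))
      (D := prodObj hp D (unitObj Θ hu)) _ _
      (tensorMor_intertwiner hp φ (Mor.id (unitObj Θ hu)) i.1.1.2
        (Mor.id_intertwiner (unitObj Θ hu)) (hV i.1))
      (rightUnitorIso_intertwiner hp hu hΘ D)) fun i => ?_
  have e : (rightUnitorU ten D.E).toCLM ∘L V i.1 = i.1.1.1 ∘L (rightUnitorU ten C.E).toCLM :=
    ext_of_clspan (ten C.E (Bimod.self B)).clspan_range (by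
      rintro _ ⟨⟨ξ, b⟩, rfl⟩
      change (rightUnitorU ten D.E).equiv (V i.1 ((ten C.E (Bimod.self B)).tmul ξ b)) =
        i.1.1.1 ((rightUnitorU ten C.E).equiv ((ten C.E (Bimod.self B)).tmul ξ b))
      rw [hV, rightUnitorU_tmul]
      obtain ⟨S, hS⟩ := mem_intertwiners.1 i.1.1.2
      exact (hS.1.isHomogeneous.map_rsmul (PAut.mem_one.2 rfl) ξ).symm.trans
        (congrArg i.1.1.1 (rightUnitorU_tmul C.E ξ b).symm))
  rw [e]
  exact Mor.comp_intertwiner' (C := prodObj hp C (unitObj Θ hu)) (D := C) _ _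
    (rightUnitorIso_intertwiner hp hu hΘ C) i.1.1.2

/-- The triangle identity, since `ξ b ⊗ η = ξ ⊗ b η`. -/
lemma triangle (C D : AdmFam Θ) :
    (CategoryData.Isom.mor (associatorIso hp C (unitObj Θ hu) D)).comp
        (tensorMor hp (Mor.id C) (CategoryData.Isom.mor (leftUnitorIso hp hu hΘ D))) =
      tensorMor hp (CategoryData.Isom.mor (rightUnitorIso hp hu hΘ C)) (Mor.id D) := by
  obtain ⟨V, hV⟩ := exists_tensor_of_intertwiners (A := prodObj hp C (unitObj Θ hu))
    (ten (ten C.E (Bimod.self B)).obj D.E) (ten C.E D.E) (rightUnitorIso_intertwiner hp hu hΘ C)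
    (Mor.id_intertwiner D)
  obtain ⟨W, hW⟩ := exists_tensor_of_intertwiners (C := prodObj hp (unitObj Θ hu) D)
    (ten C.E (ten (Bimod.self B) D.E).obj) (ten C.E D.E) (Mor.id_intertwiner C)
    (leftUnitorIso_intertwiner hp hu hΘ D)
  have hd : JointlyDense fun _ : Unit × Unit => V :=
    JointlyDense.tensor (rightUnitorU ten C.E).jointlyDense (jointlyDense_id D.E) fun _ => hV
  have e : V = W ∘L (associatorU ten C.E (Bimod.self B) D.E).toCLM :=
    ext_of_clspan (clspan_range_assoc (ten C.E (Bimod.self B))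
      (ten (ten C.E (Bimod.self B)).obj D.E)) (by
      rintro _ ⟨⟨⟨ξ, b⟩, η⟩, rfl⟩
      change V ((ten _ _).tmul ((ten C.E (Bimod.self B)).tmul ξ b) η) =
        W ((associatorU ten C.E (Bimod.self B) D.E).equiv
          ((ten _ _).tmul ((ten C.E (Bimod.self B)).tmul ξ b) η))
      rw [hV, associatorU_tmul, hW]
      change (ten C.E D.E).tmul ((rightUnitorU ten C.E).equiv _) η =
        (ten C.E D.E).tmul ξ ((leftUnitorU ten D.E).equiv _)
      rw [rightUnitorU_tmul, leftUnitorU_tmul]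
      exact (ten C.E D.E).rsmul_tmul_eq ξ b η)
  refine Mor.ext_of_intertwiners (C := prodObj hp (prodObj hp C (unitObj Θ hu)) D)
    (D := prodObj hp C D) hd (fun _ => ?_) fun _ =>
      tensorMor_intertwiner hp _ _ (rightUnitorIso_intertwiner hp hu hΘ C)
        (Mor.id_intertwiner D) hV
  rw [e]
  exact Mor.comp_intertwiner' _ _ (associatorIso_intertwiner hp C (unitObj Θ hu) D)
    (tensorMor_intertwiner hp _ _ (Mor.id_intertwiner C) (leftUnitorIso_intertwiner hp hu hΘ D) hW)

/-- The pentagon identity, checked on elementary tensors. -/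
lemma pentagon (A C D G : AdmFam Θ) :
    (tensorMor hp (CategoryData.Isom.mor (associatorIso hp A C D)) (Mor.id G)).comp
        ((CategoryData.Isom.mor (associatorIso hp A (prodObj hp C D) G)).comp
          (tensorMor hp (Mor.id A) (CategoryData.Isom.mor (associatorIso hp C D G)))) =
      (CategoryData.Isom.mor (associatorIso hp (prodObj hp A C) D G)).comp
        (CategoryData.Isom.mor (associatorIso hp A C (prodObj hp D G))) := by
  obtain ⟨V, hV⟩ := exists_tensor_of_intertwiners (A := prodObj hp (prodObj hp A C) D)
    (A' := prodObj hp A (prodObj hp C D))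
    (ten (ten (ten A.E C.E).obj D.E).obj G.E) (ten (ten A.E (ten C.E D.E).obj).obj G.E)
    (associatorIso_intertwiner hp A C D) (Mor.id_intertwiner G)
  obtain ⟨W, hW⟩ := exists_tensor_of_intertwiners (C := prodObj hp (prodObj hp C D) G)
    (C' := prodObj hp C (prodObj hp D G))
    (ten A.E (ten (ten C.E D.E).obj G.E).obj) (ten A.E (ten C.E (ten D.E G.E).obj).obj)
    (Mor.id_intertwiner A) (associatorIso_intertwiner hp C D G)
  have e : (associatorU ten A.E C.E (ten D.E G.E).obj).toCLM ∘L
      (associatorU ten (ten A.E C.E).obj D.E G.E).toCLM =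
      (W ∘L (associatorU ten A.E (ten C.E D.E).obj G.E).toCLM) ∘L V :=
    ext_of_clspan ((ten (ten (ten A.E C.E).obj D.E).obj G.E).clspan_range_of_dense
      (clspan_range_assoc (ten A.E C.E) (ten (ten A.E C.E).obj D.E)) (clspan_range_id G.E)) (by
      rintro _ ⟨⟨⟨⟨ξ, η⟩, ζ⟩, ω⟩, rfl⟩
      change (associatorU ten _ _ _).equiv ((associatorU ten (ten A.E C.E).obj D.E G.E).equiv
          ((ten _ _).tmul ((ten _ _).tmul ((ten _ _).tmul ξ η) ζ) ω)) =
        W ((associatorU ten A.E (ten C.E D.E).obj G.E).equiv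
          (V ((ten _ _).tmul ((ten _ _).tmul ((ten _ _).tmul ξ η) ζ) ω)))
      rw [associatorU_tmul, associatorU_tmul, hV]
      change _ = W ((associatorU ten A.E (ten C.E D.E).obj G.E).equiv
        ((ten _ _).tmul ((associatorU ten A.E C.E D.E).equiv _) ω))
      rw [associatorU_tmul, associatorU_tmul, hW]
      change _ = (ten _ _).tmul ξ ((associatorU ten C.E D.E G.E).equiv _)
      rw [associatorU_tmul])
  refine Mor.ext_of_intertwiners (C := prodObj hp (prodObj hp (prodObj hp A C) D) G)
    (D := prodObj hp A (prodObj hp C (prodObj hp D G)))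
    ((associatorU ten (ten A.E C.E).obj D.E G.E).jointlyDense.comp
      (associatorU ten A.E C.E (ten D.E G.E).obj).jointlyDense) (fun _ => ?_) fun _ =>
        Mor.comp_intertwiner' _ _ (associatorIso_intertwiner hp (prodObj hp A C) D G)
          (associatorIso_intertwiner hp A C (prodObj hp D G))
  rw [e]
  exact Mor.comp_intertwiner' _ _
    (tensorMor_intertwiner hp _ _ (associatorIso_intertwiner hp A C D) (Mor.id_intertwiner G) hV)
    (Mor.comp_intertwiner' _ _ (associatorIso_intertwiner hp A (prodObj hp C D) G)
      (tensorMor_intertwiner hp _ _ (Mor.id_intertwiner A)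
        (associatorIso_intertwiner hp C D G) hW))

/-- The monoidal category of `Θ`-admissible `C⋆`-families. -/
abbrev monoidalCategory :
    letI := (categoryData Θ).category
    MonoidalCategory (AdmFam Θ) :=
  letI := (categoryData Θ).category
  letI := (monoidalData hp hu hΘ).toStruct
  MonoidalCategory.ofTensorHom
    (id_tensorHom_id := fun A C => tensorMor_id hp A C)
    (id_tensorHom := fun _ _ _ _ => rfl)
    (tensorHom_id := fun _ _ => rfl)
    (tensorHom_comp_tensorHom := fun φ ψ φ' ψ' => tensorMor_comp hp φ ψ φ' ψ')
    (associator_naturality := fun φ ψ χ => associator_naturality hp φ ψ χ)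
    (leftUnitor_naturality := fun φ => leftUnitor_naturality hp hu hΘ φ)
    (rightUnitor_naturality := fun φ => rightUnitor_naturality hp hu hΘ φ)
    (pentagon := fun A C D G => pentagon hp A C D G)
    (triangle := fun C D => triangle hp hu hΘ C D)

end Coherence

end CStarFamily

end

theorem mainTheorem4 {B : Type u} [NonUnitalCStarAlgebra B] (Θ : Set (CStarFamily.PAut B))
    (hΘ : CStarFamily.AdmissibleSemigroup Θ)
    (hB : CStarFamily.Decomposable (CStarFamily.Bimod.self B)) :
    (∀ E F : CStarFamily.Bimod B, Nonempty (CStarFamily.InternalTensor E F)) ∧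
    ∃ K : CStarFamily.CategoryData Θ,
      ∃ hu : CStarFamily.AdmissibleFam Θ (CStarFamily.unitFam Θ),
        ∀ ten : (∀ E F : CStarFamily.Bimod B, CStarFamily.InternalTensor E F),
          ∃ hp : CStarFamily.FiberProdAdmissible Θ ten,
            ∃ S : CStarFamily.MonoidalData K ten hu hp,
              letI := K.category
              ∃ M : MonoidalCategory (CStarFamily.AdmFam Θ),
                M.toMonoidalCategoryStruct = S.toStruct :=
  ⟨CStarFamily.nonempty_internalTensor, CStarFamily.categoryData Θ, hΘ.unitFam_admissible hB,
    fun _ => ⟨fun C D => CStarFamily.fiberProd_admissible hΘ hB C.admissible D.admissible,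
      CStarFamily.monoidalData _ _ hΘ, CStarFamily.monoidalCategory _ _ hΘ, rfl⟩⟩
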